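/- Let $B$ be a Noetherian scheme, $\pi\colon C\to B$ a smooth proper morphism with geometrically integral fibres of dimension $1$, and $D\subset C$ a relative effective Cartier divisor over $B$ with geometrically reduced fibres. Let $\tilde A\to A$ be a surjective homomorphism of local Artin rings whose kernel $I$ satisfies $I^2=0$, so that $I$ is an $A$-module. Let $\operatorname{Spec}\tilde A\to B$ be a morphism, let $\tilde t\in\tilde A$, and let $t\in A$ be its image. Write $C_{\tilde A}, D_{\tilde A}$ and $C_A, D_A$ for the base changes to $\operatorname{Spec}\tilde A$ and $\operatorname{Spec}A$, and $\omega(D)$ for the sheaf of relative differentials of these curves with at most simple poles along the divisor. A logarithmic $t$-connection $(F,\nabla)$ on $C_A$ is a vector bundle $F$ with an $A$-linear map of sheaves $\nabla\colon F\to F\otimes\omega(D)$ such that $\nabla(fs)=f\nabla s+t\,s\otimes df$; similarly for $\tilde t$ on $C_{\tilde A}$. A lift of $x_A=(F,\nabla)$ to $\tilde A$ is a logarithmic $\tilde t$-connection on $C_{\tilde A}$ whose pull-back to $C_A$ is isomorphic to $x_A$. Let $x_A=(F,\nabla)$ be a logarithmic $t$-connection on $C_A$, with $F$ of rank $n$.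 Let $\varphi\colon\mathcal{E}nd(F)\to\mathcal{E}nd(F)\otimes\omega(D)$ be the commutator $\theta\mapsto\nabla\theta-(\theta\otimes 1)\nabla$ and let $$Q_{x_A}=\operatorname{coker}\bigl(H^1(\varphi)\colon H^1(\mathcal{E}nd(F))\to H^1(\mathcal{E}nd(F)\otimes\omega(D))\bigr).$$ There exist a rank $n$ vector bundle $\tilde F$ on $C_{\tilde A}$ lifting $F$, a finite affine open cover $(U_i)$ of $C_{\tilde A}$ that trivializes $F$, and logarithmic $\tilde t$-connections $\tilde\nabla_i$ on $\tilde F|_{U_i}$ lifting $\nabla|_{U_i}$. For all such choices, the cocycle $(\tilde\nabla_i-\tilde\nabla_j)_{i,j}$ defines a class in $H^1(\mathcal{E}nd(F)\otimes\omega(D)\otimes_A I)\cong H^1(\mathcal{E}nd(F)\otimes\omega(D))\otimes_A I$, and its image $$\mathrm{ob}_{x_A}\in Q_{x_A}\otimes_A I$$ is independent of the choices. A lift of $x_A$ to $\tilde A$ exists if and only if $\mathrm{ob}_{x_A}=0$. In particular, a lift exists if $Q_{x_A}=0$. -/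

import Mathlib

open CategoryTheory Limits AlgebraicGeometry TopologicalSpace Opposite
open scoped TensorProduct

universe u

noncomputable section

namespace LogConn

/-- The semilinear map `Ω[R₁/A₁] → Ω[R₂/A₂]`, `r • d s ↦ ψ r • d (ψ s)`, of Kähler differentials
attached to a commutative square of rings. -/
def kaehlerMap {A₁ A₂ R₁ R₂ : Type u} [CommRing A₁] [CommRing A₂] [CommRing R₁] [CommRing R₂]
    [Algebra A₁ R₁] [Algebra A₂ R₂] (φ : A₁ →+* A₂) (ψ : R₁ →+* R₂)
    (h : ∀ a, ψ (algebraMap A₁ R₁ a) = algebraMap A₂ R₂ (φ a)) :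
    Ω[R₁⁄A₁] →ₛₗ[ψ] Ω[R₂⁄A₂] :=
  letI := φ.toAlgebra
  letI := ψ.toAlgebra
  letI := ((algebraMap A₂ R₂).comp φ).toAlgebra
  haveI : IsScalarTower A₁ A₂ R₂ := .of_algebraMap_eq fun _ => rfl
  haveI : IsScalarTower A₁ R₁ R₂ := .of_algebraMap_eq fun a => (h a).symm
  { toFun := KaehlerDifferential.map A₁ A₂ R₁ R₂
    map_add' := map_add _
    map_smul' := fun r x => by
      rw [map_smul]
      exact algebra_compatible_smul R₂ r _ }

/-- A scheme over `Spec A` with an ideal sheaf (that of the polar divisor). -/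
structure PolarScheme (A : Type u) [CommRing A] where
  X : Scheme.{u}
  str : X ⟶ Spec (.of A)
  D : X.IdealSheafData

section
variable {A : Type u} [CommRing A] (C : PolarScheme A)

theorem le_preimage_top (U : C.X.Opens) : U ≤ C.str ⁻¹ᵁ ⊤ := le_top

instance algSec (U : C.X.Opens) : Algebra A Γ(C.X, U) :=
  ((Scheme.ΓSpecIso (.of A)).inv ≫ C.str.appLE ⊤ U (le_preimage_top C U)).hom.toAlgebra

instance modSec (F : C.X.Modules) (U : C.X.Opens) : Module A Γ(F, U) :=
  Module.compHom _ (algebraMap A Γ(C.X, U))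

instance towerSec (F : C.X.Modules) (U : C.X.Opens) : IsScalarTower A Γ(C.X, U) Γ(F, U) :=
  ⟨fun a r m => by
    rw [Algebra.smul_def, mul_smul]; rfl⟩

/-- Restriction of functions. -/
abbrev resO {V U : C.X.Opens} (h : V ≤ U) : Γ(C.X, U) →+* Γ(C.X, V) :=
  (C.X.presheaf.map (homOfLE h).op).hom

theorem resO_algebraMap {V U : C.X.Opens} (h : V ≤ U) (a : A) :
    resO C h (algebraMap A Γ(C.X, U) a) = algebraMap A Γ(C.X, V) a := by
  change (((Scheme.ΓSpecIso (.of A)).inv ≫ C.str.appLE ⊤ U (le_preimage_top C U)) ≫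
    C.X.presheaf.map (homOfLE h).op).hom a = _
  rw [Category.assoc, Scheme.Hom.appLE_map]
  rfl

/-- Restriction of sections of a sheaf of modules, semilinear over restriction of functions. -/
def resM (F : C.X.Modules) {V U : C.X.Opens} (h : V ≤ U) : Γ(F, U) →ₛₗ[resO C h] Γ(F, V) where
  toFun := F.presheaf.map (homOfLE h).op
  map_add' := map_add _
  map_smul' r x := Scheme.Modules.map_smul F (homOfLE h) r x

/-- Restriction of sections of the ideal of the polar divisor. -/
def resD {V U : C.X.affineOpens} (h : V ≤ U) : C.D.ideal U →ₛₗ[resO C h] C.D.ideal V where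
  toFun a := ⟨resO C h a.1, C.D.ideal_le_comap_ideal h a.2⟩
  map_add' _ _ := Subtype.ext (map_add _ _ _)
  map_smul' _ _ := Subtype.ext (map_mul _ _ _)
end

section Cech

universe v w

variable {A : Type u} [CommRing A] {X : TopCat.{u}}

/-- The restriction maps of a presheaf of `A`-modules. -/
abbrev resE (E : (Opens X)ᵒᵖ ⥤ ModuleCat.{u} A) {V U : Opens X} (h : V ≤ U) :
    E.obj (op U) →ₗ[A] E.obj (op V) :=
  (E.map (homOfLE h).op).hom

theorem resE_resE (E : (Opens X)ᵒᵖ ⥤ ModuleCat.{u} A) {W V U : Opens X} (h : V ≤ U) (h' : W ≤ V)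
    (s : E.obj (op U)) : resE E h' (resE E h s) = resE E (h'.trans h) s := by
  change (E.map (homOfLE h).op ≫ E.map (homOfLE h').op).hom s = _
  rw [← E.map_comp]
  rfl

/-- The Čech differential `C⁰ → C¹`. -/
def cechD0 {ι : Type v} (U : ι → Opens X) (E : (Opens X)ᵒᵖ ⥤ ModuleCat.{u} A) :
    (∀ i, E.obj (op (U i))) →ₗ[A] ∀ i j, E.obj (op (U i ⊓ U j)) where
  toFun s i j := resE E inf_le_left (s i) - resE E inf_le_right (s j)
  map_add' s s' := by
    funext i j
    simp only [Pi.add_apply, map_add]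
    abel
  map_smul' a s := by
    funext i j
    simp only [Pi.smul_apply, map_smul, RingHom.id_apply, smul_sub]

/-- The Čech differential `C¹ → C²`. -/
def cechD1 {ι : Type v} (U : ι → Opens X) (E : (Opens X)ᵒᵖ ⥤ ModuleCat.{u} A) :
    (∀ i j, E.obj (op (U i ⊓ U j))) →ₗ[A] ∀ i j k, E.obj (op (U i ⊓ U j ⊓ U k)) where
  toFun c i j k :=
    resE E inf_le_left (c i j)
      + resE E (le_inf (inf_le_left.trans inf_le_right) inf_le_right) (c j k)
      - resE E (le_inf (inf_le_left.trans inf_le_left) inf_le_right) (c i k)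
  map_add' s s' := by
    funext i j k
    simp only [Pi.add_apply, map_add]
    abel
  map_smul' a s := by
    funext i j k
    simp only [Pi.smul_apply, map_smul, RingHom.id_apply, smul_sub, smul_add]

/-- Čech `1`-cocycles of a family of open sets. -/
abbrev CechZ1 {ι : Type v} (U : ι → Opens X) (E : (Opens X)ᵒᵖ ⥤ ModuleCat.{u} A) :
    Submodule A (∀ i j, E.obj (op (U i ⊓ U j))) :=
  LinearMap.ker (cechD1 U E)

/-- Čech `H¹` of a family of open sets: cocycles modulo coboundaries. -/
def CechH1 {ι : Type v} (U : ι → Opens X) (E : (Opens X)ᵒᵖ ⥤ ModuleCat.{u} A) : Type (max u v) :=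
  CechZ1 U E ⧸ (LinearMap.range (cechD0 U E)).submoduleOf (CechZ1 U E)

instance {ι : Type v} (U : ι → Opens X) (E : (Opens X)ᵒᵖ ⥤ ModuleCat.{u} A) :
    AddCommGroup (CechH1 U E) :=
  inferInstanceAs (AddCommGroup
    (CechZ1 U E ⧸ (LinearMap.range (cechD0 U E)).submoduleOf (CechZ1 U E)))

instance {ι : Type v} (U : ι → Opens X) (E : (Opens X)ᵒᵖ ⥤ ModuleCat.{u} A) :
    Module A (CechH1 U E) :=
  inferInstanceAs (Module A
    (CechZ1 U E ⧸ (LinearMap.range (cechD0 U E)).submoduleOf (CechZ1 U E)))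

/-- The class of a cocycle. -/
def CechZ1.toCechH1 {ι : Type v} (U : ι → Opens X) (E : (Opens X)ᵒᵖ ⥤ ModuleCat.{u} A) :
    CechZ1 U E →ₗ[A] CechH1 U E :=
  ((LinearMap.range (cechD0 U E)).submoduleOf (CechZ1 U E)).mkQ

/-- Pull-back of cocycles along a refinement `V k ≤ U (σ k)`. -/
def CechZ1.refine {ι : Type v} {κ : Type w} {U : ι → Opens X} {V : κ → Opens X} (σ : κ → ι)
    (h : ∀ k, V k ≤ U (σ k)) (E : (Opens X)ᵒᵖ ⥤ ModuleCat.{u} A) :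
    CechZ1 U E →ₗ[A] CechZ1 V E where
  toFun c := ⟨fun k l => resE E (inf_le_inf (h k) (h l)) (c.1 (σ k) (σ l)), by
    rw [LinearMap.mem_ker]
    funext k l m
    have := congrArg (resE E (inf_le_inf (inf_le_inf (h k) (h l)) (h m)))
      (congrFun (congrFun (congrFun (LinearMap.mem_ker.1 c.2) (σ k)) (σ l)) (σ m))
    simpa only [cechD1, LinearMap.coe_mk, AddHom.coe_mk, map_add, map_sub, resE_resE, Pi.zero_apply,
      map_zero] using this⟩
  map_add' c c' := by
    ext k l
    simp
  map_smul' a c := by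
    ext k l
    simp

/-- Pull-back on Čech `H¹` along a refinement `V k ≤ U (σ k)`. -/
def CechH1.refine {ι : Type v} {κ : Type w} {U : ι → Opens X} {V : κ → Opens X} (σ : κ → ι)
    (h : ∀ k, V k ≤ U (σ k)) (E : (Opens X)ᵒᵖ ⥤ ModuleCat.{u} A) :
    CechH1 U E →ₗ[A] CechH1 V E :=
  Submodule.mapQ _ _ (CechZ1.refine σ h E) (by
    rintro ⟨_, hc⟩ ⟨s, rfl⟩
    refine ⟨fun k => resE E (h k) (s (σ k)), ?_⟩
    funext k l
    simp [cechD0, CechZ1.refine, resE_resE, - ModuleCat.hom_comp])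

/-- Open covers of `X` indexed by the points of `X`, the set attached to `x` being a
neighbourhood of `x`. They are cofinal among all open covers, and a refinement of two of them
can be taken along the identity of `X`. -/
structure PointedCover (X : TopCat.{u}) where
  U : X → Opens X
  mem : ∀ x, x ∈ U x

/-- `𝒰 ≤ 𝒱` if `𝒱` refines `𝒰`. -/
instance : Preorder (PointedCover X) where
  le 𝒰 𝒱 := ∀ x, 𝒱.U x ≤ 𝒰.U x
  le_refl _ _ := le_rfl
  le_trans _ _ _ h h' x := (h' x).trans (h x)

/-- The transition maps between the Čech groups of covers indexed by points. -/
def PointedCover.trans (E : (Opens X)ᵒᵖ ⥤ ModuleCat.{u} A) (𝒰 𝒱 : PointedCover X) (h : 𝒰 ≤ 𝒱) :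
    CechH1 𝒰.U E →ₗ[A] CechH1 𝒱.U E :=
  CechH1.refine id h E

open scoped Classical in
/-- The first cohomology `H¹(X, E)` of a sheaf `E` of `A`-modules: the colimit of the Čech groups
over all open covers of `X`. In degree one this is the sheaf cohomology of any abelian sheaf on any
topological space. -/
def H1 (E : (Opens X)ᵒᵖ ⥤ ModuleCat.{u} A) : Type u :=
  Module.DirectLimit (fun 𝒰 : PointedCover X => CechH1 𝒰.U E) (PointedCover.trans E)

open scoped Classical in
instance (E : (Opens X)ᵒᵖ ⥤ ModuleCat.{u} A) : AddCommGroup (H1 E) :=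
  Module.DirectLimit.addCommGroup (fun 𝒰 : PointedCover X => CechH1 𝒰.U E) (PointedCover.trans E)

open scoped Classical in
instance (E : (Opens X)ᵒᵖ ⥤ ModuleCat.{u} A) : Module A (H1 E) :=
  Module.DirectLimit.module (fun 𝒰 : PointedCover X => CechH1 𝒰.U E) (PointedCover.trans E)

open scoped Classical in
/-- The canonical map from the Čech group of a cover indexed by points to `H¹`. -/
def PointedCover.toH1 (E : (Opens X)ᵒᵖ ⥤ ModuleCat.{u} A) (𝒰 : PointedCover X) :
    CechH1 𝒰.U E →ₗ[A] H1 E :=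
  Module.DirectLimit.of A (PointedCover X) (fun 𝒰 : PointedCover X => CechH1 𝒰.U E)
    (PointedCover.trans E) 𝒰

/-- The map from Čech `H¹` of an open cover to `H¹`. -/
def CechH1.toH1 {ι : Type v} {U : ι → Opens X} (hU : ∀ x : X, ∃ i, x ∈ U i)
    (E : (Opens X)ᵒᵖ ⥤ ModuleCat.{u} A) : CechH1 U E →ₗ[A] H1 E :=
  PointedCover.toH1 E ⟨fun x => U (hU x).choose, fun x => (hU x).choose_spec⟩ ∘ₗ
    CechH1.refine (fun x : X => (hU x).choose) (fun _ => le_rfl) E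

variable {E E' : (Opens X)ᵒᵖ ⥤ ModuleCat.{u} A}

/-- Functoriality of cocycles. -/
def CechZ1.map (f : E ⟶ E') {ι : Type v} (U : ι → Opens X) : CechZ1 U E →ₗ[A] CechZ1 U E' where
  toFun c := ⟨fun i j => (f.app _).hom (c.1 i j), by
    rw [LinearMap.mem_ker]
    funext i j k
    have := congrArg (f.app (op (U i ⊓ U j ⊓ U k))).hom
      (congrFun (congrFun (congrFun (LinearMap.mem_ker.1 c.2) i) j) k)
    simpa only [cechD1, LinearMap.coe_mk, AddHom.coe_mk, map_add, map_sub, Pi.zero_apply,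
      map_zero, resE, NatTrans.naturality_apply] using this⟩
  map_add' c c' := by
    ext i j
    simp
  map_smul' a c := by
    ext i j
    simp

/-- Functoriality of Čech `H¹`. -/
def CechH1.map (f : E ⟶ E') {ι : Type v} (U : ι → Opens X) : CechH1 U E →ₗ[A] CechH1 U E' :=
  Submodule.mapQ _ _ (CechZ1.map f U) (by
    rintro ⟨_, hc⟩ ⟨s, rfl⟩
    refine ⟨fun k => (f.app _).hom (s k), ?_⟩
    funext k l
    simp [cechD0, CechZ1.map, resE, NatTrans.naturality_apply])

theorem PointedCover.map_trans (f : E ⟶ E') (𝒰 𝒱 : PointedCover X) (h : 𝒰 ≤ 𝒱) :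
    CechH1.map f 𝒱.U ∘ₗ PointedCover.trans E 𝒰 𝒱 h =
      PointedCover.trans E' 𝒰 𝒱 h ∘ₗ CechH1.map f 𝒰.U := by
  refine LinearMap.ext fun x => ?_
  obtain ⟨c, rfl⟩ := Submodule.mkQ_surjective _ x
  refine congrArg (CechZ1.toCechH1 𝒱.U E') (?_ :
    CechZ1.map f 𝒱.U (CechZ1.refine id h E c) = CechZ1.refine id h E' (CechZ1.map f 𝒰.U c))
  ext i j
  simp [CechZ1.map, CechZ1.refine, resE, NatTrans.naturality_apply]

open scoped Classical in
/-- Functoriality of `H¹`. -/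
def H1.map (f : E ⟶ E') : H1 E →ₗ[A] H1 E' :=
  Module.DirectLimit.map (G := fun 𝒰 : PointedCover X => CechH1 𝒰.U E)
    (G' := fun 𝒰 : PointedCover X => CechH1 𝒰.U E')
    (f := PointedCover.trans E) (f' := PointedCover.trans E')
    (fun 𝒰 : PointedCover X => CechH1.map f 𝒰.U) (PointedCover.map_trans f)

open scoped Classical in
theorem H1.exists_rep (x : H1 E) :
    ∃ (𝒰 : PointedCover X) (c : CechZ1 𝒰.U E), x = 𝒰.toH1 E (CechZ1.toCechH1 𝒰.U E c) := by
  have : Nonempty (PointedCover X) := ⟨⟨fun _ => ⊤, fun _ => trivial⟩⟩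
  have : IsDirectedOrder (PointedCover X) :=
    ⟨fun 𝒰 𝒱 => ⟨⟨fun x => 𝒰.U x ⊓ 𝒱.U x, fun x => ⟨𝒰.mem x, 𝒱.mem x⟩⟩,
      fun _ => inf_le_left, fun _ => inf_le_right⟩⟩
  obtain ⟨𝒰, y, hy⟩ := Module.DirectLimit.exists_of (R := A)
    (G := fun 𝒰 : PointedCover X => CechH1 𝒰.U E) (f := PointedCover.trans E) x
  obtain ⟨c, rfl⟩ := Submodule.mkQ_surjective _ y
  exact ⟨𝒰, c, hy.symm⟩

open scoped Classical in
theorem H1.map_toH1 (f : E ⟶ E') (𝒰 : PointedCover X) (c : CechZ1 𝒰.U E) :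
    H1.map f (𝒰.toH1 E (CechZ1.toCechH1 𝒰.U E c)) =
      𝒰.toH1 E' (CechZ1.toCechH1 𝒰.U E' (CechZ1.map f 𝒰.U c)) :=
  Module.DirectLimit.map_apply_of (f := PointedCover.trans E) (f' := PointedCover.trans E')
    (fun 𝒰 : PointedCover X => CechH1.map f 𝒰.U) (PointedCover.map_trans f) _

end Cech

section Sheaves

variable {A : Type u} [CommRing A] {C : PolarScheme A}

variable (C) in
/-- A family of `𝒪(V)`-modules for `V` affine open, with restriction maps. -/
structure AffModule where
  obj : C.X.affineOpens → Type u
  [grp : ∀ V : C.X.affineOpens, AddCommGroup (obj V)]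
  [modO : ∀ V : C.X.affineOpens, Module Γ(C.X, V.1) (obj V)]
  [modA : ∀ V : C.X.affineOpens, Module A (obj V)]
  [tower : ∀ V : C.X.affineOpens, IsScalarTower A Γ(C.X, V.1) (obj V)]
  res : ∀ {V' V : C.X.affineOpens}, V' ≤ V → obj V →ₗ[A] obj V'

attribute [instance] AffModule.grp AffModule.modO AffModule.modA AffModule.tower

/-- A semilinear map over restriction of functions is `A`-linear. -/
def toLinA {V' V : C.X.Opens} (h : V' ≤ V) {M N : Type u} [AddCommGroup M] [AddCommGroup N]
    [Module Γ(C.X, V) M] [Module Γ(C.X, V') N] [Module A M] [Module A N]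
    [IsScalarTower A Γ(C.X, V) M] [IsScalarTower A Γ(C.X, V') N]
    (f : M →ₛₗ[resO C h] N) : M →ₗ[A] N where
  toFun := f
  map_add' := map_add f
  map_smul' a m := by
    rw [← algebraMap_smul Γ(C.X, V) a m, f.map_smulₛₗ, resO_algebraMap, algebraMap_smul]
    rfl

/-- `F ⊗ Ω_{X/A}`, with value `F(V) ⊗ Ω_{𝒪(V)/A}` on an affine open `V`. -/
def tensorOmega (F : C.X.Modules) : AffModule C where
  obj V := Γ(F, V.1) ⊗[Γ(C.X, V.1)] Ω[Γ(C.X, V.1)⁄A]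
  res h := toLinA h (TensorProduct.map (resM C F h)
    (kaehlerMap (RingHom.id A) (resO C h) (resO_algebraMap C h)))

/-- The section `s ⊗ w` of `F ⊗ Ω` over an affine open. -/
def omegaTmul {F : C.X.Modules} {V : C.X.affineOpens} (s : Γ(F, V.1)) (w : Ω[Γ(C.X, V.1)⁄A]) :
    (tensorOmega F).obj V :=
  (s ⊗ₜ w : Γ(F, V.1) ⊗[Γ(C.X, V.1)] Ω[Γ(C.X, V.1)⁄A])

/-- The endomorphism `θ ⊗ 1` of `(F ⊗ Ω)(V)`. -/
def actOmega {F : C.X.Modules} {V : C.X.affineOpens} (θ : Γ(F, V.1) →ₗ[Γ(C.X, V.1)] Γ(F, V.1)) :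
    (tensorOmega F).obj V →ₗ[Γ(C.X, V.1)] (tensorOmega F).obj V :=
  LinearMap.rTensor Ω[Γ(C.X, V.1)⁄A] θ

/-- `N ⊗_A M` for an `A`-module `M`. -/
def AffModule.tensor (N : AffModule C) (M : Type u) [AddCommGroup M] [Module A M] :
    AffModule C where
  obj V := N.obj V ⊗[A] M
  res h := LinearMap.rTensor M (N.res h)

/-- The map `x ↦ x ⊗ m`, `N(V) → N(V) ⊗_A M`. -/
def AffModule.tmul (N : AffModule C) {M : Type u} [AddCommGroup M] [Module A M] (m : M)
    (V : C.X.affineOpens) : N.obj V →ₗ[Γ(C.X, V.1)] (N.tensor M).obj V where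
  toFun x := (x ⊗ₜ m : N.obj V ⊗[A] M)
  map_add' x y := TensorProduct.add_tmul x y m
  map_smul' _ _ := rfl

/-- The presheaf `ℰnd(F)` of `A`-modules: a section over `W` is a compatible family of
`𝒪(V)`-linear endomorphisms of `F(V)`, `V ⊆ W` affine open. -/
def endSections (F : C.X.Modules) (W : C.X.Opens) :
    Submodule A (∀ V : {V : C.X.affineOpens // V.1 ≤ W}, Γ(F, V.1.1) →ₗ[Γ(C.X, V.1.1)] Γ(F, V.1.1))
    where
  carrier := {θ | ∀ (V V' : {V : C.X.affineOpens // V.1 ≤ W}) (h : V'.1 ≤ V.1) (s : Γ(F, V.1.1)),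
    θ V' (resM C F h s) = resM C F h (θ V s)}
  zero_mem' V V' h s := by simp
  add_mem' hθ hη V V' h s := by simp [hθ V V' h s, hη V V' h s]
  smul_mem' a θ hθ V V' h s := by
    have := (toLinA h (resM C F h)).map_smul a (θ V s)
    simp only [Pi.smul_apply, LinearMap.smul_apply, hθ V V' h s]
    exact this.symm

/-- The presheaf `ℰnd(F)` of `A`-modules. -/
def endPresheaf (F : C.X.Modules) : (C.X.Opens)ᵒᵖ ⥤ ModuleCat.{u} A where
  obj W := ModuleCat.of A (endSections F W.unop)
  map i := ModuleCat.ofHom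
    { toFun θ := ⟨fun V => θ.1 ⟨V.1, V.2.trans i.unop.le⟩, fun V V' h s =>
        θ.2 ⟨V.1, V.2.trans i.unop.le⟩ ⟨V'.1, V'.2.trans i.unop.le⟩ h s⟩
      map_add' _ _ := rfl
      map_smul' _ _ := rfl }
  map_id _ := rfl
  map_comp _ _ := rfl

/-- Sections over `W` of `ℋom(F, N(D))`, where `N(D) = ℋom(𝒪(-D), N)`: compatible families of
`𝒪(V)`-linear maps `F(V) → Hom(𝒪(-D)(V), N(V))`, `V ⊆ W` affine open. -/
def homPolarSections (F : C.X.Modules) (N : AffModule C) (W : C.X.Opens) :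
    Submodule A (∀ V : {V : C.X.affineOpens // V.1 ≤ W},
      Γ(F, V.1.1) →ₗ[Γ(C.X, V.1.1)] (C.D.ideal V.1 →ₗ[Γ(C.X, V.1.1)] N.obj V.1)) where
  carrier := {θ | ∀ (V V' : {V : C.X.affineOpens // V.1 ≤ W}) (h : V'.1 ≤ V.1) (s : Γ(F, V.1.1))
    (a : C.D.ideal V.1), θ V' (resM C F h s) (resD C h a) = N.res h (θ V s a)}
  zero_mem' V V' h s a := by simp
  add_mem' hθ hη V V' h s a := by simp [hθ V V' h s a, hη V V' h s a]
  smul_mem' r θ hθ V V' h s a := by simp [hθ V V' h s a]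

/-- The presheaf `ℋom(F, N(D))` of `A`-modules. -/
def homPolar (F : C.X.Modules) (N : AffModule C) : (C.X.Opens)ᵒᵖ ⥤ ModuleCat.{u} A where
  obj W := ModuleCat.of A (homPolarSections F N W.unop)
  map i := ModuleCat.ofHom
    { toFun θ := ⟨fun V => θ.1 ⟨V.1, V.2.trans i.unop.le⟩, fun V V' h s a =>
        θ.2 ⟨V.1, V.2.trans i.unop.le⟩ ⟨V'.1, V'.2.trans i.unop.le⟩ h s a⟩
      map_add' _ _ := rfl
      map_smul' _ _ := rfl }
  map_id _ := rfl
  map_comp _ _ := rfl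

/-- `ℰnd(F) ⊗ ω(D) = ℋom(F, (F ⊗ Ω)(D))`, for `F` locally free. -/
abbrev endOmega (F : C.X.Modules) : (C.X.Opens)ᵒᵖ ⥤ ModuleCat.{u} A :=
  homPolar F (tensorOmega F)

/-- `ℰnd(F) ⊗ ω(D) ⊗_A M`, for `F` locally free. -/
abbrev endOmegaTensor (F : C.X.Modules) (M : Type u) [AddCommGroup M] [Module A M] :
    (C.X.Opens)ᵒᵖ ⥤ ModuleCat.{u} A :=
  homPolar F ((tensorOmega F).tensor M)

/-- A logarithmic `t`-connection `∇ : F → F ⊗ ω(D)` over the open set `W`, where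
`F ⊗ ω(D) = (F ⊗ Ω)(D) = ℋom(𝒪(-D), F ⊗ Ω)`: `nabla V s a` stands for `a · ∇ s`. -/
structure TConnection (t : A) (F : C.X.Modules) (W : C.X.Opens) where
  nabla : ∀ V : {V : C.X.affineOpens // V.1 ≤ W},
    Γ(F, V.1.1) →ₗ[A] (C.D.ideal V.1 →ₗ[Γ(C.X, V.1.1)] (tensorOmega F).obj V.1)
  leibniz : ∀ V (f : Γ(C.X, V.1.1)) (s : Γ(F, V.1.1)) (a : C.D.ideal V.1),
    nabla V (f • s) a = f • nabla V s a + t • (a.1 • omegaTmul s (KaehlerDifferential.D A _ f))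
  compat : ∀ (V V' : {V : C.X.affineOpens // V.1 ≤ W}) (h : V'.1 ≤ V.1) (s : Γ(F, V.1.1))
    (a : C.D.ideal V.1),
    nabla V' (resM C F h s) (resD C h a) = (tensorOmega F).res h (nabla V s a)

end Sheaves

section Obstruction

variable {A : Type u} [CommRing A] {C : PolarScheme A} {t : A} {F : C.X.Modules}

theorem actOmega_res {V V' : C.X.affineOpens} (h : V' ≤ V)
    (θ : Γ(F, V.1) →ₗ[Γ(C.X, V.1)] Γ(F, V.1)) (θ' : Γ(F, V'.1) →ₗ[Γ(C.X, V'.1)] Γ(F, V'.1))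
    (hθ : ∀ s, θ' (resM C F h s) = resM C F h (θ s)) (x : (tensorOmega F).obj V) :
    actOmega θ' ((tensorOmega F).res h x) = (tensorOmega F).res h (actOmega θ x) := by
  refine TensorProduct.induction_on (motive := fun x : Γ(F, V.1) ⊗[Γ(C.X, V.1)] Ω[Γ(C.X, V.1)⁄A] =>
    actOmega θ' ((tensorOmega F).res h x) = (tensorOmega F).res h (actOmega θ x)) x ?_ ?_ ?_
  · exact ((congrArg _ (map_zero ((tensorOmega F).res h))).trans (map_zero _)).trans
      ((congrArg _ (map_zero (actOmega θ))).trans (map_zero _)).symm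
  · intro s w
    change omegaTmul (θ' (resM C F h s)) _ = omegaTmul (resM C F h (θ s)) _
    rw [hθ]
    rfl
  · intro x y hx hy
    refine ((congrArg _ (map_add ((tensorOmega F).res h) x y)).trans (map_add _ _ _)).trans ?_
    refine Eq.trans ?_ ((congrArg _ (map_add (actOmega θ) x y)).trans (map_add _ _ _)).symm
    exact congrArg₂ (· + ·) hx hy

theorem actOmega_add {V : C.X.affineOpens} (θ θ' : Γ(F, V.1) →ₗ[Γ(C.X, V.1)] Γ(F, V.1)) :
    actOmega (θ + θ') = actOmega θ + actOmega θ' :=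
  LinearMap.rTensor_add _ θ θ'

theorem actOmega_smul {V : C.X.affineOpens} (r : A) (θ : Γ(F, V.1) →ₗ[Γ(C.X, V.1)] Γ(F, V.1)) :
    actOmega (r • θ) = r • actOmega θ := by
  have : r • θ = algebraMap A Γ(C.X, V.1) r • θ := by
    ext s
    exact (algebraMap_smul Γ(C.X, V.1) r (θ s)).symm
  rw [this]
  refine (LinearMap.rTensor_smul _ (algebraMap A Γ(C.X, V.1) r) θ).trans ?_
  refine LinearMap.ext fun x => ?_
  exact algebraMap_smul Γ(C.X, V.1) r (actOmega θ x)

theorem actOmega_smul_smul_tmul {V : C.X.affineOpens} (θ : Γ(F, V.1) →ₗ[Γ(C.X, V.1)] Γ(F, V.1))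
    (r : A) (a : Γ(C.X, V.1)) (s : Γ(F, V.1)) (w : Ω[Γ(C.X, V.1)⁄A]) :
    actOmega θ (r • (a • omegaTmul s w)) = r • (a • omegaTmul (θ s) w) := by
  rw [← algebraMap_smul Γ(C.X, V.1) r, ← algebraMap_smul Γ(C.X, V.1) r, map_smul, map_smul]
  rfl

/-- The commutator `∇ ∘ θ - (θ ⊗ 1) ∘ ∇` on an affine open set. -/
def TConnection.commutatorAt (nab : TConnection t F ⊤) (V : C.X.affineOpens)
    (θ : Γ(F, V.1) →ₗ[Γ(C.X, V.1)] Γ(F, V.1)) :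
    Γ(F, V.1) →ₗ[Γ(C.X, V.1)] (C.D.ideal V →ₗ[Γ(C.X, V.1)] (tensorOmega F).obj V) where
  toFun s := nab.nabla ⟨V, le_top⟩ (θ s) - actOmega θ ∘ₗ nab.nabla ⟨V, le_top⟩ s
  map_add' s s' := by
    rw [map_add, map_add, map_add, LinearMap.comp_add]
    abel
  map_smul' f s := by
    refine LinearMap.ext fun a => ?_
    have h1 := nab.leibniz ⟨V, le_top⟩ f (θ s) a
    have h2 := (congrArg (actOmega θ) (nab.leibniz ⟨V, le_top⟩ f s a)).trans
      ((map_add (actOmega θ) _ _).trans (congrArg₂ (· + ·) ((actOmega θ).map_smul f _)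
        (actOmega_smul_smul_tmul θ t a.1 s _)))
    rw [map_smul θ]
    refine (congrArg₂ (· - ·) h1 h2).trans ?_
    refine (add_sub_add_right_eq_sub _ _ _).trans (smul_sub _ _ _).symm

theorem TConnection.commutatorAt_add (nab : TConnection t F ⊤) (V : C.X.affineOpens)
    (θ θ' : Γ(F, V.1) →ₗ[Γ(C.X, V.1)] Γ(F, V.1)) :
    nab.commutatorAt V (θ + θ') = nab.commutatorAt V θ + nab.commutatorAt V θ' := by
  refine LinearMap.ext fun s => ?_
  change nab.nabla ⟨V, le_top⟩ (θ s + θ' s) - actOmega (θ + θ') ∘ₗ nab.nabla ⟨V, le_top⟩ s =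
    (nab.nabla ⟨V, le_top⟩ (θ s) - actOmega θ ∘ₗ nab.nabla ⟨V, le_top⟩ s) +
    (nab.nabla ⟨V, le_top⟩ (θ' s) - actOmega θ' ∘ₗ nab.nabla ⟨V, le_top⟩ s)
  rw [map_add, actOmega_add, LinearMap.add_comp]
  abel

theorem TConnection.commutatorAt_smul (nab : TConnection t F ⊤) (V : C.X.affineOpens)
    (r : A) (θ : Γ(F, V.1) →ₗ[Γ(C.X, V.1)] Γ(F, V.1)) :
    nab.commutatorAt V (r • θ) = r • nab.commutatorAt V θ := by
  refine LinearMap.ext fun s => ?_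
  change nab.nabla ⟨V, le_top⟩ (r • θ s) - actOmega (r • θ) ∘ₗ nab.nabla ⟨V, le_top⟩ s =
    r • (nab.nabla ⟨V, le_top⟩ (θ s) - actOmega θ ∘ₗ nab.nabla ⟨V, le_top⟩ s)
  rw [map_smul, actOmega_smul, LinearMap.smul_comp, smul_sub]

theorem TConnection.commutatorAt_res (nab : TConnection t F ⊤) {V V' : C.X.affineOpens}
    (h : V' ≤ V) (θ : Γ(F, V.1) →ₗ[Γ(C.X, V.1)] Γ(F, V.1))
    (θ' : Γ(F, V'.1) →ₗ[Γ(C.X, V'.1)] Γ(F, V'.1))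
    (hθ : ∀ s, θ' (resM C F h s) = resM C F h (θ s)) (s : Γ(F, V.1)) (a : C.D.ideal V) :
    nab.commutatorAt V' θ' (resM C F h s) (resD C h a) =
      (tensorOmega F).res h (nab.commutatorAt V θ s a) := by
  have h1 := nab.compat ⟨V, le_top⟩ ⟨V', le_top⟩ h (θ s) a
  have h2 := congrArg (actOmega θ') (nab.compat ⟨V, le_top⟩ ⟨V', le_top⟩ h s a)
  rw [actOmega_res h θ θ' hθ] at h2
  rw [← hθ] at h1
  exact (congrArg₂ (· - ·) h1 h2).trans (map_sub ((tensorOmega F).res h) _ _).symm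

/-- The commutator `θ ↦ ∇ ∘ θ - (θ ⊗ 1) ∘ ∇` with a `t`-connection, on sections over `W`. -/
def TConnection.commutatorSections (nab : TConnection t F ⊤) (W : C.X.Opens) :
    endSections F W →ₗ[A] homPolarSections F (tensorOmega F) W where
  toFun θ := ⟨fun V => nab.commutatorAt V.1 (θ.1 V), fun V V' h s a =>
    nab.commutatorAt_res h (θ.1 V) (θ.1 V') (θ.2 V V' h) s a⟩
  map_add' θ θ' := Subtype.ext (funext fun V => nab.commutatorAt_add V.1 (θ.1 V) (θ'.1 V))
  map_smul' r θ := Subtype.ext (funext fun V => nab.commutatorAt_smul V.1 r (θ.1 V))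

/-- The morphism of sheaves of `A`-modules `φ : ℰnd(F) → ℰnd(F) ⊗ ω(D)`, `θ ↦ [∇, θ]`. -/
def TConnection.commutator (nab : TConnection t F ⊤) : endPresheaf F ⟶ endOmega F where
  app W := ModuleCat.ofHom (nab.commutatorSections W.unop)
  naturality _ _ _ := rfl

/-- The module of obstructions: the cokernel of `H¹(φ) : H¹(ℰnd F) → H¹(ℰnd F ⊗ ω(D))`. -/
abbrev TConnection.ObsModule (nab : TConnection t F ⊤) : Type u :=
  H1 (endOmega F) ⧸ LinearMap.range (H1.map nab.commutator)

variable {M : Type u} [AddCommGroup M] [Module A M]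

/-- `θ ↦ θ ⊗ m` on sections over `W`. -/
def tensorRightSections (F : C.X.Modules) (m : M) (W : C.X.Opens) :
    homPolarSections F (tensorOmega F) W →ₗ[A] homPolarSections F ((tensorOmega F).tensor M) W where
  toFun θ := ⟨fun V => (θ.1 V).compr₂ ((tensorOmega F).tmul m V.1), fun V V' h s a =>
    congrArg ((tensorOmega F).tmul m V'.1) (θ.2 V V' h s a)⟩
  map_add' θ θ' := Subtype.ext (funext fun V => LinearMap.ext fun s => LinearMap.ext fun a =>
    map_add ((tensorOmega F).tmul m V.1) (θ.1 V s a) (θ'.1 V s a))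
  map_smul' r θ := Subtype.ext (funext fun V => LinearMap.ext fun s => LinearMap.ext fun a =>
    (TensorProduct.smul_tmul' r (θ.1 V s a) m).symm)

theorem tensorRightSections_add (F : C.X.Modules) (m m' : M) (W : C.X.Opens)
    (θ : homPolarSections F (tensorOmega F) W) :
    tensorRightSections F (m + m') W θ =
      tensorRightSections F m W θ + tensorRightSections F m' W θ :=
  Subtype.ext (funext fun V => LinearMap.ext fun s => LinearMap.ext fun a =>
    TensorProduct.tmul_add (θ.1 V s a) m m')

theorem tensorRightSections_smul (F : C.X.Modules) (r : A) (m : M) (W : C.X.Opens)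
    (θ : homPolarSections F (tensorOmega F) W) :
    tensorRightSections F (r • m) W θ = r • tensorRightSections F m W θ :=
  Subtype.ext (funext fun V => LinearMap.ext fun s => LinearMap.ext fun a =>
    TensorProduct.tmul_smul r (θ.1 V s a) m)

/-- The morphism `θ ↦ θ ⊗ m` from `ℰnd(F) ⊗ ω(D)` to `ℰnd(F) ⊗ ω(D) ⊗_A M`. -/
def tensorRight (F : C.X.Modules) (m : M) : endOmega F ⟶ endOmegaTensor F M where
  app W := ModuleCat.ofHom (tensorRightSections F m W.unop)
  naturality _ _ _ := rfl

/-- The natural map `H¹(ℰnd(F) ⊗ ω(D)) ⊗_A M → H¹(ℰnd(F) ⊗ ω(D) ⊗_A M)`. -/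
def H1.tensorComparison (F : C.X.Modules) (M : Type u) [AddCommGroup M] [Module A M] :
    H1 (endOmega F) ⊗[A] M →ₗ[A] H1 (endOmegaTensor F M) :=
  TensorProduct.lift (LinearMap.mk₂ A (fun x m => H1.map (tensorRight F m) x)
    (fun x y m => map_add _ _ _)
    (fun r x m => map_smul _ _ _)
    (fun x m m' => by
      obtain ⟨𝒰, c, rfl⟩ := H1.exists_rep x
      simp only [H1.map_toH1]
      rw [← map_add, ← map_add]
      exact congrArg _ (congrArg _ (Subtype.ext (funext fun i => funext fun j =>
        tensorRightSections_add F m m' _ (c.1 i j)))))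
    (fun r x m => by
      obtain ⟨𝒰, c, rfl⟩ := H1.exists_rep x
      simp only [H1.map_toH1]
      rw [← map_smul, ← map_smul]
      exact congrArg _ (congrArg _ (Subtype.ext (funext fun i => funext fun j =>
        tensorRightSections_smul F r m _ (c.1 i j))))))

end Obstruction

section Lifts

variable {A A' : Type u} [CommRing A] [CommRing A'] [Algebra A' A]

/-- A morphism from a scheme over `Spec A` to a scheme over `Spec A'` over `Spec A → Spec A'`, such
that the polar divisor is the inverse image of the polar divisor. -/
structure PolarScheme.Hom (C : PolarScheme A) (C' : PolarScheme A') where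
  f : C.X ⟶ C'.X
  w : f ≫ C'.str = C.str ≫ Spec.map (CommRingCat.ofHom (algebraMap A' A))
  D : C.D = C'.D.comap f

variable {C : PolarScheme A} {C' : PolarScheme A'} (g : C.Hom C')

namespace PolarScheme.Hom

/-- Pull-back of functions. -/
abbrev mapO {V' : C'.X.Opens} {V : C.X.Opens} (e : V ≤ g.f ⁻¹ᵁ V') :
    Γ(C'.X, V') →+* Γ(C.X, V) :=
  (g.f.appLE V' V e).hom

theorem mapO_algebraMap {V' : C'.X.Opens} {V : C.X.Opens} (e : V ≤ g.f ⁻¹ᵁ V') (a : A') :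
    g.mapO e (algebraMap A' Γ(C'.X, V') a) = algebraMap A Γ(C.X, V) (algebraMap A' A a) := by
  change (((Scheme.ΓSpecIso (.of A')).inv ≫ C'.str.appLE ⊤ V' (le_preimage_top C' V')) ≫
    g.f.appLE V' V e).hom a = (CommRingCat.ofHom (algebraMap A' A) ≫
      ((Scheme.ΓSpecIso (.of A)).inv ≫ C.str.appLE ⊤ V (le_preimage_top C V))).hom a
  refine congrArg (fun φ : CommRingCat.of A' ⟶ Γ(C.X, V) => φ.hom a) ?_
  rw [Category.assoc, Scheme.Hom.appLE_comp_appLE]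
  simp only [g.w]
  rw [Scheme.Hom.comp_appLE, ← Category.assoc, ← Category.assoc]
  congr 1
  exact (Scheme.ΓSpecIso_inv_naturality _).symm

theorem mapO_mem {V' : C'.X.affineOpens} {V : C.X.affineOpens} (e : V.1 ≤ g.f ⁻¹ᵁ V'.1)
    {a : Γ(C'.X, V'.1)} (ha : a ∈ C'.D.ideal V') : g.mapO e a ∈ C.D.ideal V := by
  have h1 : C'.D ≤ (C.D.subschemeι ≫ g.f).ker := by
    rw [g.D]
    exact Scheme.IdealSheafData.le_map_comap _ _
  have h2 : ((C.D.subschemeι ≫ g.f).app V'.1).hom a = 0 :=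
    RingHom.mem_ker.1 (Scheme.Hom.ideal_ker_le _ _ (h1 V' ha))
  rw [← Scheme.IdealSheafData.ker_subschemeι_app, RingHom.mem_ker]
  have h3 : g.f.appLE V'.1 V.1 e ≫ C.D.subschemeι.app V.1 = (C.D.subschemeι ≫ g.f).appLE V'.1
      (C.D.subschemeι ⁻¹ᵁ V.1) (C.D.subschemeι.preimage_mono e) := by
    rw [Scheme.Hom.app_eq_appLE, Scheme.Hom.appLE_comp_appLE]
  refine (congrArg (fun φ => φ.hom a) h3).trans ?_
  exact (congrArg (C.D.subscheme.presheaf.map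
    (homOfLE (C.D.subschemeι.preimage_mono e)).op).hom h2).trans (RingHom.map_zero _)

/-- Pull-back of sections of the ideal of the polar divisor. -/
def mapD {V' : C'.X.affineOpens} {V : C.X.affineOpens} (e : V.1 ≤ g.f ⁻¹ᵁ V'.1) :
    C'.D.ideal V' →ₛₗ[g.mapO e] C.D.ideal V where
  toFun a := ⟨g.mapO e a.1, g.mapO_mem e a.2⟩
  map_add' _ _ := Subtype.ext (map_add _ _ _)
  map_smul' _ _ := Subtype.ext (map_mul _ _ _)

/-- The pull-back of sections along a morphism `F' → f_* F`. -/
def mapM {F' : C'.X.Modules} {F : C.X.Modules}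
    (α : F' ⟶ (Scheme.Modules.pushforward g.f).obj F)
    {V' : C'.X.Opens} {V : C.X.Opens} (e : V ≤ g.f ⁻¹ᵁ V') : Γ(F', V') →ₛₗ[g.mapO e] Γ(F, V) where
  toFun s := resM C F e (α.app V' s)
  map_add' s s' := (congrArg (resM C F e) (map_add (α.app V').hom s s')).trans (map_add _ _ _)
  map_smul' r s := by
    have h1 : α.app V' (r • s) = (g.f.app V').hom r • (show Γ(F, g.f ⁻¹ᵁ V') from α.app V' s) :=
      Scheme.Modules.Hom.app_smul α r s
    rw [h1]
    exact (resM C F e).map_smulₛₗ _ _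

/-- The pull-back of sections of `F' ⊗ Ω` along a morphism `F' → f_* F`. -/
def mapOmega {F' : C'.X.Modules} {F : C.X.Modules}
    (α : F' ⟶ (Scheme.Modules.pushforward g.f).obj F)
    {V' : C'.X.affineOpens} {V : C.X.affineOpens} (e : V.1 ≤ g.f ⁻¹ᵁ V'.1) :
    (tensorOmega F').obj V' →ₛₗ[algebraMap A' A] (tensorOmega F).obj V where
  toFun := TensorProduct.map (g.mapM α e)
    (kaehlerMap (algebraMap A' A) (g.mapO e) (g.mapO_algebraMap e))
  map_add' := map_add _
  map_smul' r x := by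
    have h1 : r • x = algebraMap A' Γ(C'.X, V'.1) r • x := (algebraMap_smul Γ(C'.X, V'.1) r x).symm
    rw [h1]
    refine ((TensorProduct.map (g.mapM α e) (kaehlerMap (algebraMap A' A) (g.mapO e)
      (g.mapO_algebraMap e))).map_smulₛₗ _ _).trans ?_
    rw [mapO_algebraMap]
    exact algebraMap_smul Γ(C.X, V.1) (algebraMap A' A r) _

end PolarScheme.Hom

/-- `b : Fin n → F(U)` is a frame: it induces an isomorphism `𝒪ⁿ → F` over `U`. -/
def IsFrame {X : Scheme.{u}} (F : X.Modules) {n : ℕ} {U : X.Opens} (b : Fin n → Γ(F, U)) : Prop :=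
  ∀ (V : X.Opens) (h : V ≤ U), Function.Bijective
    fun a : Fin n → Γ(X, V) => ∑ i, a i • F.presheaf.map (homOfLE h).op (b i)

/-- A vector bundle of rank `n`: a sheaf of modules locally isomorphic to `𝒪ⁿ`. -/
def IsVectorBundle {X : Scheme.{u}} (n : ℕ) (F : X.Modules) : Prop :=
  ∀ x : X, ∃ (U : X.Opens) (_ : x ∈ U) (b : Fin n → Γ(F, U)), IsFrame F b

/-- A vector bundle with an isomorphism of its pull-back with `F`. -/
structure BundleLift (n : ℕ) (F : C.X.Modules) where
  bundle : C'.X.Modules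
  isVectorBundle : IsVectorBundle n bundle
  iso : (Scheme.Modules.pullback g.f).obj bundle ≅ F

variable {g} {n : ℕ} {F : C.X.Modules}

/-- The morphism `F' → f_* F` adjoint to the isomorphism `f^* F' ≅ F`. -/
def BundleLift.toPush (L : BundleLift g n F) :
    L.bundle ⟶ (Scheme.Modules.pushforward g.f).obj F :=
  (Scheme.Modules.pullbackPushforwardAdjunction g.f).homEquiv _ _ L.iso.hom

/-- The pull-back to `F` of the connection `∇'`, defined over `W'`, is `∇`:
`∇ (f^* s) = f^* (∇' s)` for all local sections `s`. -/
def BundleLift.IsConnectionLift (L : BundleLift g n F) {t : A} {t' : A'} {W' : C'.X.Opens}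
    (nab' : TConnection t' L.bundle W') (nab : TConnection t F ⊤) : Prop :=
  ∀ (V' : {V' : C'.X.affineOpens // V'.1 ≤ W'}) (V : C.X.affineOpens)
    (e : V.1 ≤ g.f ⁻¹ᵁ V'.1.1) (s : Γ(L.bundle, V'.1.1)) (a : C'.D.ideal V'.1),
    nab.nabla ⟨V, le_top⟩ (g.mapM L.toPush e s) (g.mapD e a) =
      g.mapOmega L.toPush e (nab'.nabla V' s a)

variable (g n) in
/-- `(F, ∇)` is isomorphic to the pull-back of a `t'`-connection. -/
def TConnection.HasLift {t : A} (nab : TConnection t F ⊤) (t' : A') : Prop :=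
  ∃ (L : BundleLift g n F) (nab' : TConnection t' L.bundle ⊤), L.IsConnectionLift nab' nab

variable (A A') in
/-- The kernel of `A' → A`, as an `A`-module (when it has square zero). -/
abbrev KerModule : Type u := A ⊗[A'] RingHom.ker (algebraMap A' A)

/-- The multiplication `N ⊗ I → N`, `x ⊗ i ↦ i • x`, for an `A'`-module `N`. -/
def mulKer (N : Type u) [AddCommGroup N] [Module A' N] :
    N ⊗[A'] RingHom.ker (algebraMap A' A) →ₗ[A'] N :=
  TensorProduct.lift (LinearMap.mk₂ A' (fun x i => i.1 • x)
    (fun _ _ _ => smul_add _ _ _) (fun _ _ _ => smul_comm _ _ _)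
    (fun _ _ _ => add_smul _ _ _) (fun _ _ _ => mul_smul _ _ _))

/-- `i ↦ 1 ⊗ i`. -/
def toKerModule : RingHom.ker (algebraMap A' A) →ₛₗ[algebraMap A' A] KerModule A A' where
  toFun i := 1 ⊗ₜ i
  map_add' := TensorProduct.tmul_add 1
  map_smul' r i := by
    rw [TensorProduct.tmul_smul, algebraMap_smul]

/-- The choices in the construction of the obstruction class: a lift of the vector bundle, a finite
affine open cover trivializing `F`, and local lifts of the connection. (The morphism `f` being a
homeomorphism, the cover is given upstairs.) -/
structure ObstructionData (g : C.Hom C') (n : ℕ) {t : A} (nab : TConnection t F ⊤) (t' : A') where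
  lift : BundleLift g n F
  m : ℕ
  cover : Fin m → C'.X.affineOpens
  covers : ∀ x : C.X, ∃ i, x ∈ g.f ⁻¹ᵁ (cover i).1
  trivial : ∀ i, ∃ b : Fin n → Γ(F, g.f ⁻¹ᵁ (cover i).1), IsFrame F b
  conn : ∀ i, TConnection t' lift.bundle (cover i).1
  isConnectionLift : ∀ i, lift.IsConnectionLift (conn i) nab

namespace ObstructionData

variable {t : A} {nab : TConnection t F ⊤} {t' : A'}

/-- The cocycle `c` with values in `ℰnd(F) ⊗ ω(D) ⊗_A I` is `(∇'ᵢ - ∇'ⱼ)ᵢⱼ`, under the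
identification of `I · (F' ⊗ ω'(D'))` with `F ⊗ ω(D) ⊗_A I`: for local sections `s` of `F'` and `a`
of `𝒪(-D')`, one has `a · (∇'ᵢ - ∇'ⱼ) s = ∑ iₖ xₖ` and `f^*a · c (f^*s) = ∑ f^*xₖ ⊗ iₖ` with `xₖ` in
`F' ⊗ Ω` and `iₖ` in `I`. -/
def IsDifferenceCocycle (d : ObstructionData g n nab t')
    (c : CechZ1 (fun i => g.f ⁻¹ᵁ (d.cover i).1) (endOmegaTensor F (KerModule A A'))) : Prop :=
  ∀ (i j : Fin d.m) (V' : C'.X.affineOpens) (hi : V'.1 ≤ (d.cover i).1) (hj : V'.1 ≤ (d.cover j).1)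
    (V : C.X.affineOpens) (e : V.1 ≤ g.f ⁻¹ᵁ V'.1) (s : Γ(d.lift.bundle, V'.1))
    (a : C'.D.ideal V'),
    ∃ w : (tensorOmega d.lift.bundle).obj V' ⊗[A'] RingHom.ker (algebraMap A' A),
      (d.conn i).nabla ⟨V', hi⟩ s a - (d.conn j).nabla ⟨V', hj⟩ s a = mulKer _ w ∧
      (c.1 i j).1 ⟨V, le_inf (e.trans (g.f.preimage_mono hi)) (e.trans (g.f.preimage_mono hj))⟩
        (g.mapM d.lift.toPush e s) (g.mapD e a) =
      (TensorProduct.map (g.mapOmega d.lift.toPush e) toKerModule w :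
        (tensorOmega F).obj V ⊗[A] KerModule A A')

/-- `ob` is the image in `Q ⊗_A I` of the class of the cocycle `(∇'ᵢ - ∇'ⱼ)ᵢⱼ` in
`H¹(ℰnd(F) ⊗ ω(D) ⊗_A I) ≅ H¹(ℰnd(F) ⊗ ω(D)) ⊗_A I`. -/
def Represents (d : ObstructionData g n nab t') (ob : nab.ObsModule ⊗[A] KerModule A A') : Prop :=
  ∃ c : CechZ1 (fun i => g.f ⁻¹ᵁ (d.cover i).1) (endOmegaTensor F (KerModule A A')),
    d.IsDifferenceCocycle c ∧
    ∃ z : H1 (endOmega F) ⊗[A] KerModule A A',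
      H1.tensorComparison F (KerModule A A') z =
        CechH1.toH1 d.covers _ (CechZ1.toCechH1 _ _ c) ∧
      LinearMap.rTensor (KerModule A A') (LinearMap.range (H1.map nab.commutator)).mkQ z = ob

end ObstructionData

end Lifts

section BaseChange

variable {B C : Scheme.{u}} (π : C ⟶ B) (D : C.IdealSheafData)

/-- The base change `C ×_B Spec A`, with the inverse image of the closed subscheme `D`. -/
def baseChange {A : Type u} [CommRing A] (b : Spec (.of A) ⟶ B) : PolarScheme A where
  X := pullback π b
  str := pullback.snd π b
  D := D.comap (pullback.fst π b)

/-- The morphism `C ×_B Spec A → C ×_B Spec A'`. -/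
def baseChangeHom {A A' : Type u} [CommRing A] [CommRing A'] [Algebra A' A]
    (b : Spec (.of A') ⟶ B) :
    (baseChange π D (Spec.map (CommRingCat.ofHom (algebraMap A' A)) ≫ b)).Hom (baseChange π D b)
    where
  f := pullback.lift (pullback.fst π _)
    (pullback.snd π _ ≫ Spec.map (CommRingCat.ofHom (algebraMap A' A)))
    (pullback.condition.trans (Category.assoc _ _ _).symm)
  w := pullback.lift_snd _ _ _
  D := by
    refine Eq.trans ?_ (Scheme.IdealSheafData.comap_comp D _ (pullback.fst π b))
    exact congrArg D.comap (pullback.lift_fst _ _ _).symm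

/-- A relative effective Cartier divisor on `C/B`: a closed subscheme flat over `B` whose ideal is
locally generated by a nonzerodivisor. -/
structure IsRelativeCartier : Prop where
  flat : Flat (D.subschemeι ≫ π)
  cartier : ∀ x : C, ∃ (U : C.affineOpens) (_ : x ∈ U.1), ∃ f ∈ nonZeroDivisors Γ(C, U.1),
    D.ideal U = Ideal.span {f}

end BaseChange

end LogConn

end

/-!
# Obstructions to lifting logarithmic connections on a curve

Local lifts of `∇` on a lift `L` of `F` differ by sections of `ℰnd(L) ⊗ ω(D)` which vanish modulo
`I`. By flatness such a section is the same thing as a section of `ℰnd(F) ⊗ ω(D) ⊗ I`. The relation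
`KerRel`, and `SectionRel` for sections, express this correspondence `∑ iₖ xₖ ↔ ∑ x̄ₖ ⊗ iₖ` without
choosing an isomorphism; it is functional in the direction needed (`KerRel.unique`,
`IsThickening.sectionRel_unique`) and everything vanishing modulo `I` is in its domain
(`IsThickening.exists_sectionRel`). Hence the differences of the local lifts form a Čech cocycle.

Geometry enters through two properties of the base change of the curve only: it is a thickening
(`IsThickening`, proved in `isThickening_baseChangeHom`), and topologically a curve, in that proper
closed subsets are finite (`IsCurveLike`, proved in `isCurveLike_baseChange`). On such a space, the
special covers (`PointedCover.IsSpecial`), consisting of a dense open set `U η` and of neighbourhoods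
of the finitely many remaining points which meet each other within `U η` only, are cofinal. They have
no relevant triple overlaps, so that a cocycle is an arbitrary family of sections over the overlaps
with `U η`. Three facts result:

* `H¹(ℰnd(F) ⊗ ω(D)) ⊗ I → H¹(ℰnd(F) ⊗ ω(D) ⊗ I)` is bijective (`tensorComparison_bijective`), since
  the corresponding maps of sections over small affine open sets are;
* bundles lift, by lifting transition matrices one by one (`IsThickening.nonempty_bundleLift`);
* a lift of `F` can be modified by arbitrary sections `u` of `ℰnd(F) ⊗ I` over the overlaps
  (`IsThickening.exists_modification`).

The main computation is `IsThickening.sectionRel_change`. Let `L₁` and `L₂` be lifts of `F`, with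
identifications over the members of a special cover which differ by `u` on the overlaps, and let
local lifts of `∇` on `L₁` and on `L₂` differ by `e` along these identifications. Then the
difference cocycles `c₁` and `c₂` are related by `c₂ = c₁ - e_η + e_z - [∇, u]`. So the class of `c₁`
modulo the image of `H¹(φ) ⊗ 1` does not depend on the choices (`IsThickening.represents_unique`). A
global lift has zero difference cocycle (`IsThickening.exists_represents_zero`). Conversely, if the
class of `c₁` vanishes, then `c₁ = e_η - e_z + [∇, u]` on some special cover, and modifying the
bundle by `u` and the local connections by `e` makes the latter agree on the overlaps
(`IsThickening.hasLift_of_represents_zero`).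
-/

noncomputable section

namespace LogConn

/-! ### Sections, frames and morphisms given on frames -/

section Sections

variable {X : Scheme.{u}}

/-- Restriction of functions on a scheme. -/
abbrev rs {V U : X.Opens} (h : V ≤ U) : Γ(X, U) →+* Γ(X, V) :=
  (X.presheaf.map (homOfLE h).op).hom

theorem rs_rs {U V W : X.Opens} (h : V ≤ U) (h' : W ≤ V) (a : Γ(X, U)) :
    rs h' (rs h a) = rs (h'.trans h) a := by
  change (X.presheaf.map _ ≫ X.presheaf.map _).hom a = _
  rw [← X.presheaf.map_comp]
  rfl

theorem rs_self {U : X.Opens} (h : U ≤ U) (a : Γ(X, U)) : rs h a = a := by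
  change (X.presheaf.map (𝟙 (op U))).hom a = a
  rw [X.presheaf.map_id]
  rfl

theorem rs_bijective_of_eq {U V : X.Opens} (h : V ≤ U) (h' : U ≤ V) :
    Function.Bijective (rs h) :=
  Function.bijective_iff_has_inverse.2 ⟨rs h', fun a => by rw [rs_rs, rs_self],
    fun a => by rw [rs_rs, rs_self]⟩

/-- Restriction of sections of a sheaf of modules. -/
def rF (F : X.Modules) {V U : X.Opens} (h : V ≤ U) : Γ(F, U) →+ Γ(F, V) :=
  (F.presheaf.map (homOfLE h).op).hom

theorem rF_rF (F : X.Modules) {U V W : X.Opens} (h : V ≤ U) (h' : W ≤ V) (a : Γ(F, U)) :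
    rF F h' (rF F h a) = rF F (h'.trans h) a := by
  change (F.presheaf.map _ ≫ F.presheaf.map _).hom a = _
  rw [← F.presheaf.map_comp]
  rfl

theorem rF_self (F : X.Modules) {U : X.Opens} (h : U ≤ U) (a : Γ(F, U)) : rF F h a = a := by
  change (F.presheaf.map (𝟙 (op U))).hom a = a
  rw [F.presheaf.map_id]
  rfl

theorem rF_smul (F : X.Modules) {U V : X.Opens} (h : V ≤ U) (r : Γ(X, U)) (a : Γ(F, U)) :
    rF F h (r • a) = rs h r • rF F h a :=
  Scheme.Modules.map_smul F (homOfLE h) r a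

theorem app_rF {F G : X.Modules} (φ : F ⟶ G) {U V : X.Opens} (h : V ≤ U) (a : Γ(F, U)) :
    φ.app V (rF F h a) = rF G h (φ.app U a) :=
  ConcreteCategory.congr_hom (φ.mapPresheaf.naturality (homOfLE h).op) a

/-- A family of sections over the members of an open cover glues. -/
theorem exists_section (F : X.Modules) {ι : Type*} {V : X.Opens} (U : ι → X.Opens)
    (hU : ∀ i, U i ≤ V) (hV : ∀ x ∈ V, ∃ i, x ∈ U i) (s : ∀ i, Γ(F, U i))
    (hs : ∀ i j, rF F (inf_le_left : U i ⊓ U j ≤ _) (s i) = rF F inf_le_right (s j)) :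
    ∃ t : Γ(F, V), ∀ i, rF F (hU i) t = s i := by
  obtain ⟨t, ht, -⟩ := TopCat.Sheaf.existsUnique_gluing' (C := Ab) ⟨F.presheaf, F.isSheaf⟩ U V
    (fun i => homOfLE (hU i)) (fun x hx => by simpa using hV x hx) s (fun i j => hs i j)
  exact ⟨t, ht⟩

theorem section_ext (F : X.Modules) {ι : Type*} {V : X.Opens} (U : ι → X.Opens)
    (hU : ∀ i, U i ≤ V) (hV : ∀ x ∈ V, ∃ i, x ∈ U i) {s t : Γ(F, V)}
    (hs : ∀ i, rF F (hU i) s = rF F (hU i) t) : s = t :=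
  TopCat.Sheaf.eq_of_locally_eq' (C := Ab) ⟨F.presheaf, F.isSheaf⟩ U V
    (fun i => homOfLE (hU i)) (fun x hx => by simpa using hV x hx) s t hs

theorem exists_fun {ι : Type*} {V : X.Opens} (U : ι → X.Opens)
    (hU : ∀ i, U i ≤ V) (hV : ∀ x ∈ V, ∃ i, x ∈ U i) (s : ∀ i, Γ(X, U i))
    (hs : ∀ i j, rs (inf_le_left : U i ⊓ U j ≤ _) (s i) = rs inf_le_right (s j)) :
    ∃ t : Γ(X, V), ∀ i, rs (hU i) t = s i := by
  obtain ⟨t, ht, -⟩ := TopCat.Sheaf.existsUnique_gluing' X.sheaf U V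
    (fun i => homOfLE (hU i)) (fun x hx => by simpa using hV x hx) s (fun i j => hs i j)
  exact ⟨t, ht⟩

theorem fun_ext {ι : Type*} {V : X.Opens} (U : ι → X.Opens)
    (hU : ∀ i, U i ≤ V) (hV : ∀ x ∈ V, ∃ i, x ∈ U i) {s t : Γ(X, V)}
    (hs : ∀ i, rs (hU i) s = rs (hU i) t) : s = t :=
  TopCat.Sheaf.eq_of_locally_eq' X.sheaf U V
    (fun i => homOfLE (hU i)) (fun x hx => by simpa using hV x hx) s t hs

/-- A morphism of sheaves of modules, from its action on sections. -/
def mkHom {F G : X.Modules} (φ : ∀ V : X.Opens, Γ(F, V) →ₗ[Γ(X, V)] Γ(G, V))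
    (hφ : ∀ (V U : X.Opens) (h : V ≤ U) (s : Γ(F, U)), φ V (rF F h s) = rF G h (φ U s)) :
    F ⟶ G :=
  ⟨PresheafOfModules.homMk (M₁ := F.val) (M₂ := G.val)
    { app := fun V => AddCommGrpCat.ofHom (φ V.unop).toAddMonoidHom
      naturality := fun U V i => by
        ext s
        exact hφ V.unop U.unop i.unop.le s }
    (fun V r s => (φ V.unop).map_smul r s)⟩

end Sections

section Frames

variable {X : Scheme.{u}} {F G : X.Modules} {n : ℕ} {U : X.Opens}

/-- The basis of `F(V)` given by a frame over `U ⊇ V`. -/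
def IsFrame.basis {b : Fin n → Γ(F, U)} (hb : IsFrame F b) {V : X.Opens} (h : V ≤ U) :
    Module.Basis (Fin n) Γ(X, V) Γ(F, V) :=
  .ofEquivFun (LinearEquiv.symm (LinearEquiv.ofBijective
    (Fintype.linearCombination Γ(X, V) fun k => rF F h (b k)) (hb V h)))

@[simp]
theorem IsFrame.basis_apply {b : Fin n → Γ(F, U)} (hb : IsFrame F b) {V : X.Opens} (h : V ≤ U)
    (k : Fin n) : hb.basis h k = rF F h (b k) := by
  classical
  rw [IsFrame.basis, Module.Basis.coe_ofEquivFun]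
  exact (Fintype.linearCombination_apply_single _ _ k (1 : Γ(X, V))).trans (one_smul _ _)

theorem isFrame_iff {b : Fin n → Γ(F, U)} : IsFrame F b ↔
    ∀ (V : X.Opens) (h : V ≤ U), Function.Bijective
      fun a : Fin n → Γ(X, V) => ∑ i, a i • rF F h (b i) := Iff.rfl

theorem IsFrame.restrict {b : Fin n → Γ(F, U)} (hb : IsFrame F b) {V : X.Opens} (h : V ≤ U) :
    IsFrame F fun k => rF F h (b k) := by
  rw [isFrame_iff] at *
  intro W h'
  simpa only [rF_rF] using hb W (h'.trans h)

theorem IsFrame.rF_repr {b : Fin n → Γ(F, U)} (hb : IsFrame F b) {V W : X.Opens} (h : V ≤ U)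
    (h' : W ≤ V) (s : Γ(F, V)) (k : Fin n) :
    (hb.basis (h'.trans h)).repr (rF F h' s) k = rs h' ((hb.basis h).repr s k) := by
  conv_lhs => rw [← (hb.basis h).sum_repr s]
  rw [map_sum]
  simp_rw [rF_smul, IsFrame.basis_apply, rF_rF, ← IsFrame.basis_apply hb]
  exact congrFun ((hb.basis (h'.trans h)).repr_sum_self _) k

/-- A change of frame by an invertible matrix. -/
theorem IsFrame.change {b : Fin n → Γ(F, U)} (hb : IsFrame F b)
    {M : Matrix (Fin n) (Fin n) Γ(X, U)} (hM : IsUnit M) :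
    IsFrame F fun k => ∑ l, M l k • b l := by
  rw [isFrame_iff]
  intro V h
  classical
  have hM' : IsUnit (M.map (rs h)) := hM.map (rs h).mapMatrix
  have h1 : (fun a : Fin n → Γ(X, V) => ∑ k, a k • rF F h (∑ l, M l k • b l)) =
      (fun a : Fin n → Γ(X, V) => ∑ k, a k • rF F h (b k)) ∘ (M.map (rs h)).mulVec := by
    funext a
    simp only [map_sum, rF_smul, Finset.smul_sum, Function.comp, Matrix.mulVec, dotProduct,
      Finset.sum_smul, smul_smul, Matrix.map_apply]
    rw [Finset.sum_comm]
    simp_rw [mul_comm]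
  rw [h1]
  obtain ⟨⟨M', N, hMN, hNM⟩, rfl⟩ := hM'
  exact ((isFrame_iff.1 hb) V h).comp (Function.bijective_iff_has_inverse.2 ⟨N.mulVec,
    fun v => by simp [hNM], fun v => by simp [hMN]⟩)

/-- Two frames differ by an invertible matrix. -/
theorem IsFrame.exists_matrix {b c : Fin n → Γ(F, U)} (hb : IsFrame F b) (hc : IsFrame F c) :
    ∃ M : Matrix (Fin n) (Fin n) Γ(X, U), IsUnit M ∧ ∀ k, c k = ∑ l, M l k • b l := by
  classical
  let β := hb.basis le_rfl
  let γ := hc.basis le_rfl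
  have hβ : ∀ k, β k = b k := fun k => (hb.basis_apply le_rfl k).trans (rF_self F _ _)
  have hγ : ∀ k, γ k = c k := fun k => (hc.basis_apply le_rfl k).trans (rF_self F _ _)
  refine ⟨β.toMatrix γ, ?_, fun k => ?_⟩
  · exact IsUnit.of_mul_eq_one (γ.toMatrix β) (β.toMatrix_mul_toMatrix_flip γ)
  · have := β.sum_toMatrix_smul_self γ k
    simp only [hβ, hγ] at this
    exact this.symm

/-- Morphisms out of a sheaf with frames on the members of a cover. -/
theorem exists_hom_of_frames {ι : Type*} (U : ι → X.Opens) (hU : ∀ x : X, ∃ i, x ∈ U i)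
    (b : ∀ i, Fin n → Γ(F, U i)) (hb : ∀ i, IsFrame F (b i)) (c : ∀ i, Fin n → Γ(G, U i))
    (hc : ∀ i j (M : Matrix (Fin n) (Fin n) Γ(X, U i ⊓ U j)),
      (∀ k, rF F inf_le_right (b j k) = ∑ l, M l k • rF F inf_le_left (b i l)) →
      ∀ k, rF G inf_le_right (c j k) = ∑ l, M l k • rF G inf_le_left (c i l)) :
    ∃ β : F ⟶ G, ∀ i k, β.app (U i) (b i k) = c i k := by
  classical
  -- the morphism over an open set contained in a member of the cover
  let ψ : ∀ (i : ι) (V : X.Opens) (_ : V ≤ U i), Γ(F, V) →ₗ[Γ(X, V)] Γ(G, V) := fun i V h =>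
    ((hb i).basis h).constr Γ(X, V) fun k => rF G h (c i k)
  have ψb : ∀ i V h k, ψ i V h (rF F h (b i k)) = rF G h (c i k) := fun i V h k => by
    rw [← IsFrame.basis_apply (hb i), Module.Basis.constr_basis]
  have ψres : ∀ i V W (h : V ≤ U i) (h' : W ≤ V) s,
      rF G h' (ψ i V h s) = ψ i W (h'.trans h) (rF F h' s) := by
    intro i V W h h' s
    rw [← ((hb i).basis h).sum_repr s]
    simp only [map_sum, map_smul, rF_smul, IsFrame.basis_apply, ψb, rF_rF]
  have ψij : ∀ i j V (hi : V ≤ U i) (hj : V ≤ U j) s, ψ i V hi s = ψ j V hj s := by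
    intro i j V hi hj s
    obtain ⟨M, -, hM⟩ := ((hb i).restrict (inf_le_left : U i ⊓ U j ≤ U i)).exists_matrix
      ((hb j).restrict inf_le_right)
    have hM' := hc i j M hM
    have e : V ≤ U i ⊓ U j := le_inf hi hj
    rw [← ((hb j).basis hj).sum_repr s]
    simp only [map_sum, map_smul, IsFrame.basis_apply, ψb]
    refine Finset.sum_congr rfl fun k _ => congrArg _ ?_
    have h1 := congrArg (rF F e) (hM k)
    have h2 := congrArg (rF G e) (hM' k)
    simp only [map_sum, rF_smul, rF_rF] at h1 h2
    rw [h1, h2]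
    simp only [map_sum, map_smul, ψb]
  have key : ∀ (V : X.Opens) (s : Γ(F, V)), ∃ t : Γ(G, V), ∀ i,
      rF G inf_le_left t = ψ i (V ⊓ U i) inf_le_right (rF F inf_le_left s) := by
    intro V s
    refine exists_section G (fun i => V ⊓ U i) (fun i => inf_le_left)
      (fun x hx => (hU x).imp fun i hi => ⟨hx, hi⟩) _ fun i j => ?_
    rw [ψres, ψres, ψij i j _ _ (inf_le_right.trans inf_le_right), rF_rF, rF_rF]
  choose φ hφ using key
  have hext : ∀ (V : X.Opens) (s : Γ(F, V)) (t : Γ(G, V)), (∀ i,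
      rF G inf_le_left t = ψ i (V ⊓ U i) inf_le_right (rF F inf_le_left s)) → φ V s = t := by
    intro V s t ht
    refine section_ext G (fun i => V ⊓ U i) (fun i => inf_le_left)
      (fun x hx => (hU x).imp fun i hi => ⟨hx, hi⟩) fun i => ?_
    rw [hφ, ht]
  refine ⟨mkHom (fun V => ⟨⟨φ V, fun s s' => ?_⟩, fun r s => ?_⟩) fun V W h s => ?_, fun i k => ?_⟩
  · exact hext _ _ _ fun i => by simp only [map_add, hφ]
  · refine hext _ _ _ fun i => ?_
    simp only [rF_smul, map_smul, RingHom.id_apply]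
    rw [hφ]
  · refine hext _ _ _ fun i => ?_
    have := congrArg (rF G (inf_le_inf_right _ h)) (hφ W s i)
    rw [rF_rF, ψres, rF_rF] at this
    change rF G _ (rF G h (φ W s)) = _
    rw [rF_rF, this, rF_rF]
  · refine hext _ _ _ fun j => ?_
    rw [← ψij i j _ inf_le_left inf_le_right, ψb]

/-- A morphism which carries frames to frames is an isomorphism. -/
theorem isIso_of_frames {ι : Type*} (U : ι → X.Opens) (hU : ∀ x : X, ∃ i, x ∈ U i)
    (b : ∀ i, Fin n → Γ(F, U i)) (hb : ∀ i, IsFrame F (b i)) (β : F ⟶ G)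
    (hc : ∀ i, IsFrame G fun k => β.app (U i) (b i k)) : IsIso β := by
  have bij : ∀ (i : ι) (V : X.Opens) (h : V ≤ U i), Function.Bijective (β.app V) := by
    intro i V h
    have h1 := isFrame_iff.1 (hb i) V h
    have h2 := isFrame_iff.1 (hc i) V h
    have h3 : (fun a : Fin n → Γ(X, V) => ∑ k, a k • rF G h (β.app (U i) (b i k))) =
        β.app V ∘ fun a : Fin n → Γ(X, V) => ∑ k, a k • rF F h (b i k) := by
      funext a
      simp only [Function.comp, map_sum, Scheme.Modules.Hom.app_smul, app_rF]
    rw [h3] at h2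
    exact (Function.Bijective.of_comp_iff _ h1).1 h2
  have inj : ∀ V : X.Opens, Function.Injective (β.app V) := by
    intro V s t hst
    refine section_ext F (fun i => V ⊓ U i) (fun i => inf_le_left)
      (fun x hx => (hU x).imp fun i hi => ⟨hx, hi⟩) fun i => ?_
    apply (bij i _ inf_le_right).1
    rw [app_rF, app_rF, hst]
  rw [Scheme.Modules.Hom.isIso_iff_isIso_app]
  intro V
  rw [ConcreteCategory.isIso_iff_bijective]
  refine ⟨inj V, fun t => ?_⟩
  choose s hs using fun i => (bij i (V ⊓ U i) inf_le_right).2 (rF G inf_le_left t)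
  obtain ⟨s', hs'⟩ := exists_section F (fun i => V ⊓ U i) (fun i => inf_le_left)
    (fun x hx => (hU x).imp fun i hi => ⟨hx, hi⟩) s fun i j => inj _ (by
      rw [app_rF, app_rF, hs, hs, rF_rF, rF_rF])
  refine ⟨s', section_ext G (fun i => V ⊓ U i) (fun i => inf_le_left)
      (fun x hx => (hU x).imp fun i hi => ⟨hx, hi⟩) fun i => ?_⟩
  rw [← app_rF, hs', hs]

end Frames

/-! ### Bundles glued along transition matrices -/

section Gluing

open Matrix

/-- Restriction of vectors of functions. -/
def rsV {X : Scheme.{u}} {n : ℕ} {V U : X.Opens} (h : V ≤ U) (v : Fin n → Γ(X, U)) :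
    Fin n → Γ(X, V) := fun k => rs h (v k)

section

variable {X : Scheme.{u}} {n : ℕ} {V U W : X.Opens}

theorem rsV_mulVec (h : V ≤ U) (M : Matrix (Fin n) (Fin n) Γ(X, U)) (v : Fin n → Γ(X, U)) :
    rsV h (M *ᵥ v) = M.map (rs h) *ᵥ rsV h v :=
  funext fun k => RingHom.map_mulVec (rs h) M v k

theorem rsV_rsV (h : V ≤ U) (h' : W ≤ V) (v : Fin n → Γ(X, U)) :
    rsV h' (rsV h v) = rsV (h'.trans h) v := funext fun _ => rs_rs _ _ _

theorem rsV_self (h : V ≤ V) (v : Fin n → Γ(X, V)) : rsV h v = v := funext fun _ => rs_self _ _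

theorem rsV_add (h : V ≤ U) (v w : Fin n → Γ(X, U)) : rsV h (v + w) = rsV h v + rsV h w :=
  funext fun _ => map_add _ _ _

theorem rsV_smul (h : V ≤ U) (r : Γ(X, U)) (v : Fin n → Γ(X, U)) :
    rsV h (r • v) = rs h r • rsV h v := funext fun _ => map_mul _ _ _

theorem rsV_zero (h : V ≤ U) : rsV h (0 : Fin n → Γ(X, U)) = 0 := funext fun _ => map_zero _

theorem map_rs_map_rs (h : V ≤ U) (h' : W ≤ V) (M : Matrix (Fin n) (Fin n) Γ(X, U)) :
    (M.map (rs h)).map (rs h') = M.map (rs (h'.trans h)) :=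
  Matrix.ext fun _ _ => rs_rs _ _ _

theorem rsV_injective (h : V ≤ U) (h' : U ≤ V) :
    Function.Injective (rsV h : (Fin n → Γ(X, U)) → _) := fun _ _ hvw =>
  funext fun k => (rs_bijective_of_eq h h').1 (congrFun hvw k)

/-- A family of natural coordinates defines a frame. -/
theorem exists_frame_of_coord {F : X.Modules}
    (ε : ∀ (V : X.Opens) (_ : V ≤ U), Γ(F, V) →ₗ[Γ(X, V)] Fin n → Γ(X, V))
    (hε : ∀ V h, Function.Bijective (ε V h))
    (nat : ∀ (V W : X.Opens) (h : V ≤ U) (h' : W ≤ V) (s : Γ(F, V)),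
      ε W (h'.trans h) (rF F h' s) = rsV h' (ε V h s)) :
    ∃ b : Fin n → Γ(F, U), IsFrame F b ∧ ∀ k, ε U le_rfl (b k) = Pi.single k 1 := by
  classical
  choose b hb using fun k : Fin n => (hε U le_rfl).2 (Pi.single k 1)
  refine ⟨b, isFrame_iff.2 fun V h => ?_, hb⟩
  have h1 : ε V h ∘ (fun a : Fin n → Γ(X, V) => ∑ i, a i • rF F h (b i)) = id := by
    funext a
    have h2 : ∀ k, ε V h (rF F h (b k)) = Pi.single k 1 := fun k => by
      refine (nat U V le_rfl h (b k)).trans ?_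
      rw [hb]
      funext l
      simp only [rsV, Pi.single_apply]
      split_ifs
      · exact map_one _
      · exact map_zero _
    simp only [Function.comp, map_sum, map_smul, h2, id]
    funext l
    simp [Pi.single_apply]
  refine (Function.Bijective.of_comp_iff' (hε V h) _).1 ?_
  rw [h1]
  exact Function.bijective_id

end

/-- Data gluing the trivial bundles of rank `n` over `W₀` and over the members `W i` of a family of
open sets along matrices over `W₀ ⊓ W i`. -/
structure GluingData (X : Scheme.{u}) (n : ℕ) (ι : Type u) where
  W0 : X.Opens
  W : ι → X.Opens
  G : ∀ i, Matrix (Fin n) (Fin n) Γ(X, W0 ⊓ W i)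

namespace GluingData

variable {X : Scheme.{u}} {n : ℕ} {ι : Type u} (Δ : GluingData X n ι)

/-- The restriction of functions to an intersection, as a module structure. -/
abbrev moduleInf (V U : X.Opens) : Module Γ(X, V) Γ(X, V ⊓ U) :=
  Module.compHom _ (rs (inf_le_left : V ⊓ U ≤ V))

attribute [local instance] moduleInf

theorem smul_fun {V U : X.Opens} (r : Γ(X, V)) (v : Fin n → Γ(X, V ⊓ U)) :
    r • v = (rs inf_le_left r : Γ(X, V ⊓ U)) • v := rfl

theorem le₀ (V : X.Opens) (i : ι) : V ⊓ (Δ.W0 ⊓ Δ.W i) ≤ V ⊓ Δ.W0 :=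
  inf_le_inf_left _ inf_le_left

theorem le₁ (V : X.Opens) (i : ι) : V ⊓ (Δ.W0 ⊓ Δ.W i) ≤ V ⊓ Δ.W i :=
  inf_le_inf_left _ inf_le_right

/-- Sections over `V`: pairs `(s₀, (sᵢ))` with `s₀ = Gᵢ sᵢ`. -/
def sections (V : X.Opens) :
    Submodule Γ(X, V) ((Fin n → Γ(X, V ⊓ Δ.W0)) × (∀ i, Fin n → Γ(X, V ⊓ Δ.W i))) where
  carrier := {p | ∀ i, rsV (Δ.le₀ V i) p.1 =
    (Δ.G i).map (rs (inf_le_right : V ⊓ (Δ.W0 ⊓ Δ.W i) ≤ _)) *ᵥ rsV (Δ.le₁ V i) (p.2 i)}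
  zero_mem' i := by
    simp only [Prod.fst_zero, Prod.snd_zero, Pi.zero_apply, rsV_zero, mulVec_zero]
  add_mem' {p q} hp hq i := by
    simp only [Prod.fst_add, Prod.snd_add, Pi.add_apply, rsV_add, mulVec_add, hp i, hq i]
  smul_mem' r p hp i := by
    simp only [Prod.smul_fst, Prod.smul_snd, Pi.smul_apply, smul_fun, rsV_smul, mulVec_smul, hp i,
      rs_rs]

/-- Restriction of sections. -/
def res {V V' : X.Opens} (h : V' ≤ V) : Δ.sections V →+ Δ.sections V' where
  toFun p := ⟨(rsV (inf_le_inf_right _ h) p.1.1, fun i => rsV (inf_le_inf_right _ h) (p.1.2 i)),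
    fun i => by
      have := congrArg (rsV (inf_le_inf_right _ h : V' ⊓ (Δ.W0 ⊓ Δ.W i) ≤ V ⊓ (Δ.W0 ⊓ Δ.W i)))
        (p.2 i)
      simpa only [rsV_mulVec, rsV_rsV, map_rs_map_rs] using this⟩
  map_zero' := Subtype.ext (Prod.ext (rsV_zero _) (funext fun _ => rsV_zero _))
  map_add' _ _ := Subtype.ext (Prod.ext (rsV_add _ _ _) (funext fun _ => rsV_add _ _ _))

/-- The underlying presheaf of abelian groups of the glued sheaf. -/
def presheaf : TopCat.Presheaf Ab X where
  obj V := AddCommGrpCat.of (Δ.sections V.unop)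
  map i := AddCommGrpCat.ofHom (Δ.res i.unop.le)
  map_id V := AddCommGrpCat.hom_ext (AddMonoidHom.ext fun p =>
    Subtype.ext (Prod.ext (rsV_self _ _) (funext fun i => rsV_self _ (p.1.2 i))))
  map_comp i j := AddCommGrpCat.hom_ext (AddMonoidHom.ext fun p =>
    Subtype.ext (Prod.ext (rsV_rsV _ _ _).symm (funext fun i => (rsV_rsV _ _ (p.1.2 i)).symm)))

instance (V : (X.Opens)ᵒᵖ) : Module (X.ringCatSheaf.obj.obj V) (Δ.presheaf.obj V) :=
  inferInstanceAs (Module Γ(X, V.unop) (Δ.sections V.unop))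

theorem exists_vec {κ : Type*} {V : X.Opens} (U : κ → X.Opens)
    (hU : ∀ i, U i ≤ V) (hV : ∀ x ∈ V, ∃ i, x ∈ U i) (s : ∀ i, Fin n → Γ(X, U i))
    (hs : ∀ i j (W : X.Opens) (hi : W ≤ U i) (hj : W ≤ U j), rsV hi (s i) = rsV hj (s j)) :
    ∃ t : Fin n → Γ(X, V), ∀ i, rsV (hU i) t = s i := by
  choose t ht using fun k => exists_fun U hU hV (fun i => s i k)
    fun i j => congrFun (hs i j _ inf_le_left inf_le_right) k
  exact ⟨t, fun i => funext fun k => ht k i⟩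

theorem vec_ext {κ : Type*} {V : X.Opens} (U : κ → X.Opens)
    (hU : ∀ i, U i ≤ V) (hV : ∀ x ∈ V, ∃ i, x ∈ U i) {s t : Fin n → Γ(X, V)}
    (hs : ∀ i, rsV (hU i) s = rsV (hU i) t) : s = t :=
  funext fun k => fun_ext U hU hV fun i => congrFun (hs i) k

/-- The sheaf of modules glued from the trivial bundles. -/
def sheaf : X.Modules where
  val := .ofPresheaf Δ.presheaf (fun X Y f r m =>
    Subtype.ext (Prod.ext (by
      refine (rsV_smul _ _ _).trans ?_
      refine (congrArg (· • _) (rs_rs _ _ _)).trans ?_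
      exact (congrArg (· • _) (rs_rs _ _ _)).symm) (funext fun i => by
      refine (rsV_smul _ _ _).trans ?_
      refine (congrArg (· • _) (rs_rs _ _ _)).trans ?_
      exact (congrArg (· • _) (rs_rs _ _ _)).symm)))
  isSheaf := by
    change TopCat.Presheaf.IsSheaf Δ.presheaf
    refine (TopCat.Presheaf.isSheaf_iff_isSheaf_comp (forget AddCommGrpCat) _).2 ?_
    rw [TopCat.Presheaf.isSheaf_iff_isSheafUniqueGluing_types]
    intro κ U (sf : ∀ i, Δ.sections (U i)) hsf
    have hsf' : ∀ i j, Δ.res (inf_le_left : U i ⊓ U j ≤ _) (sf i) = Δ.res inf_le_right (sf j) :=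
      fun i j => hsf i j
    have hcov : ∀ (T : X.Opens), ∀ x ∈ iSup U ⊓ T, ∃ i, x ∈ U i ⊓ T := fun T x hx => by
      obtain ⟨i, hi⟩ := Opens.mem_iSup.1 hx.1
      exact ⟨i, hi, hx.2⟩
    have hle : ∀ (T : X.Opens) i, U i ⊓ T ≤ iSup U ⊓ T := fun T i =>
      inf_le_inf_right _ (le_iSup U i)
    have c0 : ∀ i j (W : X.Opens) (hi : W ≤ U i ⊓ Δ.W0) (hj : W ≤ U j ⊓ Δ.W0),
        rsV hi (sf i).1.1 = rsV hj (sf j).1.1 := fun i j W hi hj => by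
      have := congrArg (rsV (le_inf (le_inf (hi.trans inf_le_left) (hj.trans inf_le_left))
        (hi.trans inf_le_right))) (congrArg (fun p => p.1.1) (hsf' i j))
      simpa only [res, AddMonoidHom.coe_mk, ZeroHom.coe_mk, rsV_rsV] using this
    have c1 : ∀ l i j (W : X.Opens) (hi : W ≤ U i ⊓ Δ.W l) (hj : W ≤ U j ⊓ Δ.W l),
        rsV hi ((sf i).1.2 l) = rsV hj ((sf j).1.2 l) := fun l i j W hi hj => by
      have := congrArg (rsV (le_inf (le_inf (hi.trans inf_le_left) (hj.trans inf_le_left))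
        (hi.trans inf_le_right))) (congrFun (congrArg (fun p => p.1.2) (hsf' i j)) l)
      simpa only [res, AddMonoidHom.coe_mk, ZeroHom.coe_mk, rsV_rsV] using this
    obtain ⟨t0, ht0⟩ := exists_vec (fun i => U i ⊓ Δ.W0) (hle _) (hcov _)
      (fun i => (sf i).1.1) c0
    choose t1 ht1 using fun l => exists_vec (fun i => U i ⊓ Δ.W l) (hle _) (hcov _)
      (fun i => (sf i).1.2 l) (c1 l)
    refine ⟨(⟨(t0, t1), fun l => ?_⟩ : Δ.sections (iSup U)), fun i => ?_, fun t ht => ?_⟩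
    · refine vec_ext (fun i => U i ⊓ (Δ.W0 ⊓ Δ.W l)) (hle _) (hcov _) fun i => ?_
      have h1 := (sf i).2 l
      rw [← ht0, ← ht1] at h1
      simpa only [rsV_mulVec, rsV_rsV, map_rs_map_rs] using h1
    · exact Subtype.ext (Prod.ext (ht0 i) (funext fun l => ht1 l i))
    · have ht' : ∀ i, Δ.res (le_iSup U i) (show Δ.sections (iSup U) from t) = sf i := fun i => ht i
      refine Subtype.ext (Prod.ext ?_ (funext fun l => ?_))
      · refine vec_ext (fun i => U i ⊓ Δ.W0) (hle _) (hcov _) fun i => ?_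
        rw [ht0, ← ht' i]
        rfl
      · refine vec_ext (fun i => U i ⊓ Δ.W l) (hle _) (hcov _) fun i => ?_
        rw [ht1, ← ht' i]
        rfl

/-- The coordinates over open subsets of `W₀`. -/
def coord₀ (V : X.Opens) (h : V ≤ Δ.W0) : Γ(Δ.sheaf, V) →ₗ[Γ(X, V)] Fin n → Γ(X, V) where
  toFun p := rsV (le_inf le_rfl h) (show Δ.sections V from p).1.1
  map_add' _ _ := rsV_add _ _ _
  map_smul' _ _ := (rsV_smul _ _ _).trans (congrArg (· • _) ((rs_rs _ _ _).trans (rs_self _ _)))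

/-- The coordinates over open subsets of `W i`. -/
def coord₁ (i : ι) (V : X.Opens) (h : V ≤ Δ.W i) :
    Γ(Δ.sheaf, V) →ₗ[Γ(X, V)] Fin n → Γ(X, V) where
  toFun p := rsV (le_inf le_rfl h) ((show Δ.sections V from p).1.2 i)
  map_add' _ _ := rsV_add _ _ _
  map_smul' _ _ := (rsV_smul _ _ _).trans (congrArg (· • _) ((rs_rs _ _ _).trans (rs_self _ _)))

theorem coord₀_res (V V' : X.Opens) (h : V ≤ Δ.W0) (h' : V' ≤ V) (s : Γ(Δ.sheaf, V)) :
    Δ.coord₀ V' (h'.trans h) (rF _ h' s) = rsV h' (Δ.coord₀ V h s) :=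
  (rsV_rsV _ _ _).trans (rsV_rsV _ _ _).symm

theorem coord₁_res (i : ι) (V V' : X.Opens) (h : V ≤ Δ.W i) (h' : V' ≤ V) (s : Γ(Δ.sheaf, V)) :
    Δ.coord₁ i V' (h'.trans h) (rF _ h' s) = rsV h' (Δ.coord₁ i V h s) :=
  (rsV_rsV _ _ _).trans (rsV_rsV _ _ _).symm

theorem coord₀_eq (i : ι) (V : X.Opens) (h : V ≤ Δ.W0) (h' : V ≤ Δ.W i) (s : Γ(Δ.sheaf, V)) :
    Δ.coord₀ V h s = (Δ.G i).map (rs (le_inf h h')) *ᵥ Δ.coord₁ i V h' s := by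
  have := congrArg (rsV (le_inf le_rfl (le_inf h h'))) ((show Δ.sections V from s).2 i)
  rw [rsV_mulVec, rsV_rsV, rsV_rsV, map_rs_map_rs] at this
  exact this

variable (hG : ∀ i, IsUnit (Δ.G i))

section

include hG

/-- The inverse of the gluing matrix. -/
def inv (i : ι) : Matrix (Fin n) (Fin n) Γ(X, Δ.W0 ⊓ Δ.W i) := ((hG i).unit⁻¹ : _)

theorem G_mul_inv (i : ι) : Δ.G i * Δ.inv hG i = 1 := (hG i).mul_val_inv

theorem inv_mul_G (i : ι) : Δ.inv hG i * Δ.G i = 1 := (hG i).val_inv_mul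

theorem mulVec_inv {i : ι} {V : X.Opens} (h : V ≤ Δ.W0 ⊓ Δ.W i) (v : Fin n → Γ(X, V)) :
    (Δ.G i).map (rs h) *ᵥ (Δ.inv hG i).map (rs h) *ᵥ v = v := by
  classical
  have := congrArg (rs h).mapMatrix (Δ.G_mul_inv hG i)
  rw [map_mul, map_one] at this
  rw [mulVec_mulVec]
  exact (congrArg (· *ᵥ v) this).trans (one_mulVec _)

theorem inv_mulVec {i : ι} {V : X.Opens} (h : V ≤ Δ.W0 ⊓ Δ.W i) (v : Fin n → Γ(X, V)) :
    (Δ.inv hG i).map (rs h) *ᵥ (Δ.G i).map (rs h) *ᵥ v = v := by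
  classical
  have := congrArg (rs h).mapMatrix (Δ.inv_mul_G hG i)
  rw [map_mul, map_one] at this
  rw [mulVec_mulVec]
  exact (congrArg (· *ᵥ v) this).trans (one_mulVec _)

theorem coord₀_bijective (V : X.Opens) (h : V ≤ Δ.W0) : Function.Bijective (Δ.coord₀ V h) := by
  constructor
  · refine (injective_iff_map_eq_zero _).2 fun (p : Δ.sections V) hp => ?_
    have h0 : p.1.1 = 0 := rsV_injective (le_inf le_rfl h) inf_le_left (hp.trans (rsV_zero _).symm)
    refine Subtype.ext (Prod.ext h0 (funext fun i => ?_))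
    have h1 := p.2 i
    rw [h0, rsV_zero] at h1
    have h2 := congrArg ((Δ.inv hG i).map (rs inf_le_right) *ᵥ ·) h1
    simp only [inv_mulVec, mulVec_zero] at h2
    exact rsV_injective (Δ.le₁ V i) (le_inf inf_le_left (le_inf (inf_le_left.trans h) inf_le_right))
      (h2.symm.trans (rsV_zero _).symm)
  · intro v
    have hi : ∀ i, V ⊓ Δ.W i ≤ Δ.W0 ⊓ Δ.W i := fun i => inf_le_inf_right _ h
    refine ⟨(⟨(rsV inf_le_left v, fun i => (Δ.inv hG i).map (rs (hi i)) *ᵥ rsV inf_le_left v),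
      fun i => ?_⟩ : Δ.sections V), (rsV_rsV _ _ _).trans (rsV_self _ _)⟩
    simp only [rsV_mulVec, rsV_rsV, map_rs_map_rs, mulVec_inv]

theorem coord₁_bijective (hW : ∀ i j, i ≠ j → Δ.W i ⊓ Δ.W j ≤ Δ.W0) (j : ι)
    (V : X.Opens) (h : V ≤ Δ.W j) : Function.Bijective (Δ.coord₁ j V h) := by
  classical
  constructor
  · refine (injective_iff_map_eq_zero _).2 fun (p : Δ.sections V) hp => ?_
    have hj : p.1.2 j = 0 := rsV_injective (le_inf le_rfl h) inf_le_left
      (hp.trans (rsV_zero _).symm)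
    have h0 : p.1.1 = 0 := by
      have h1 := p.2 j
      rw [hj, rsV_zero, mulVec_zero] at h1
      exact rsV_injective (Δ.le₀ V j) (le_inf inf_le_left
        (le_inf inf_le_right (inf_le_left.trans h))) (h1.trans (rsV_zero _).symm)
    refine Subtype.ext (Prod.ext h0 (funext fun i => ?_))
    by_cases hij : i = j
    · subst hij
      exact hj
    · have h1 := p.2 i
      rw [h0, rsV_zero] at h1
      have h2 := congrArg ((Δ.inv hG i).map (rs inf_le_right) *ᵥ ·) h1
      simp only [inv_mulVec, mulVec_zero] at h2
      exact rsV_injective (Δ.le₁ V i) (le_inf inf_le_left (le_inf ((le_inf inf_le_right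
        (inf_le_left.trans h)).trans (hW i j hij)) inf_le_right))
        (h2.symm.trans (rsV_zero _).symm)
  · intro v
    have h0 : V ⊓ Δ.W0 ≤ Δ.W0 ⊓ Δ.W j := le_inf inf_le_right (inf_le_left.trans h)
    have hi : ∀ i, i ≠ j → V ⊓ Δ.W i ≤ Δ.W0 ⊓ Δ.W i := fun i hij =>
      le_inf ((le_inf inf_le_right (inf_le_left.trans h)).trans (hW i j hij)) inf_le_right
    have hi' : ∀ i, i ≠ j → V ⊓ Δ.W i ≤ Δ.W0 ⊓ Δ.W j := fun i hij =>
      le_inf ((hi i hij).trans inf_le_left) (inf_le_left.trans h)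
    refine ⟨(⟨((Δ.G j).map (rs h0) *ᵥ rsV inf_le_left v, fun i => if hij : i = j then
      rsV inf_le_left v else (Δ.inv hG i).map (rs (hi i hij)) *ᵥ (Δ.G j).map (rs (hi' i hij)) *ᵥ
        rsV inf_le_left v), fun i => ?_⟩ : Δ.sections V), ?_⟩
    · by_cases hij : i = j
      · subst hij
        simp only [rsV_mulVec, rsV_rsV, map_rs_map_rs, dif_pos]
      · simp only [hij, dif_neg, not_false_iff, rsV_mulVec, rsV_rsV, map_rs_map_rs, mulVec_inv]
    · change rsV _ (dite _ _ _) = v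
      rw [dif_pos rfl, rsV_rsV, rsV_self]

/-- The frames of the glued bundle. -/
theorem exists_frames (hW : ∀ i j, i ≠ j → Δ.W i ⊓ Δ.W j ≤ Δ.W0) :
    ∃ (b₀ : Fin n → Γ(Δ.sheaf, Δ.W0)) (b : ∀ i, Fin n → Γ(Δ.sheaf, Δ.W i)), IsFrame _ b₀ ∧
      (∀ i, IsFrame _ (b i)) ∧ ∀ i k, rF _ inf_le_right (b i k) =
        ∑ l, Δ.G i l k • rF _ (inf_le_left : Δ.W0 ⊓ Δ.W i ≤ _) (b₀ l) := by
  classical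
  obtain ⟨b₀, hb₀, e₀⟩ := exists_frame_of_coord Δ.coord₀ (Δ.coord₀_bijective hG) Δ.coord₀_res
  choose b hb e using fun i => exists_frame_of_coord (Δ.coord₁ i)
    (Δ.coord₁_bijective hG hW i) (Δ.coord₁_res i)
  refine ⟨b₀, b, hb₀, hb, fun i k => (Δ.coord₀_bijective hG _ inf_le_left).1 ?_⟩
  have r0 : ∀ l, Δ.coord₀ (Δ.W0 ⊓ Δ.W i) inf_le_left (rF _ inf_le_left (b₀ l)) =
      Pi.single l 1 := fun l => by
    refine (Δ.coord₀_res Δ.W0 _ le_rfl inf_le_left (b₀ l)).trans ?_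
    rw [e₀]
    funext m
    simp only [rsV, Pi.single_apply]
    split_ifs
    · exact map_one _
    · exact map_zero _
  have r1 : ∀ l, Δ.coord₁ i (Δ.W0 ⊓ Δ.W i) inf_le_right (rF _ inf_le_right (b i l)) =
      Pi.single l 1 := fun l => by
    refine (Δ.coord₁_res i (Δ.W i) _ le_rfl inf_le_right (b i l)).trans ?_
    rw [e]
    funext m
    simp only [rsV, Pi.single_apply]
    split_ifs
    · exact map_one _
    · exact map_zero _
  rw [Δ.coord₀_eq i _ inf_le_left inf_le_right, r1]
  simp only [map_sum, map_smul, r0]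
  funext m
  simp [Pi.single_apply, rs_self, Finset.sum_apply]

end

end GluingData

end Gluing

/-! ### Frames of a pull-back, and lifts given by a map to the direct image -/

section Pull

variable {X Y : Scheme.{u}} (f : X ⟶ Y) {L : Y.Modules} {F : X.Modules}

/-- Pull-back of sections along a morphism `L → f_* F`. -/
def pull (α : L ⟶ (Scheme.Modules.pushforward f).obj F) {V' : Y.Opens} {V : X.Opens}
    (e : V ≤ f ⁻¹ᵁ V') : Γ(L, V') →+ Γ(F, V) :=
  (rF F e).comp (α.app V').hom

variable (α : L ⟶ (Scheme.Modules.pushforward f).obj F)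

theorem appLE_rs {V' U' : Y.Opens} {V U : X.Opens} (e : U ≤ f ⁻¹ᵁ U') (e' : V ≤ f ⁻¹ᵁ V')
    (h' : V' ≤ U') (h : V ≤ U) (r : Γ(Y, U')) :
    f.appLE V' V e' (rs h' r) = rs h (f.appLE U' U e r) := by
  have h1 : Y.presheaf.map (homOfLE h').op ≫ f.appLE V' V e' =
      f.appLE U' U e ≫ X.presheaf.map (homOfLE h).op := by
    rw [Scheme.Hom.map_appLE, Scheme.Hom.appLE_map]
  exact congrArg (fun φ => φ.hom r) h1

theorem pull_smul {V' : Y.Opens} {V : X.Opens} (e : V ≤ f ⁻¹ᵁ V') (r : Γ(Y, V')) (s : Γ(L, V')) :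
    pull f α e (r • s) = f.appLE V' V e r • pull f α e s := by
  have h1 : α.app V' (r • s) = (f.app V').hom r • (show Γ(F, f ⁻¹ᵁ V') from α.app V' s) :=
    Scheme.Modules.Hom.app_smul α r s
  exact (congrArg (rF F e) h1).trans (rF_smul F e _ _)

theorem pull_rF {V' U' : Y.Opens} {V U : X.Opens} (e : U ≤ f ⁻¹ᵁ U') (e' : V ≤ f ⁻¹ᵁ V')
    (h' : V' ≤ U') (h : V ≤ U) (s : Γ(L, U')) :
    pull f α e' (rF L h' s) = rF F h (pull f α e s) := by
  change rF F e' (α.app V' (rF L h' s)) = rF F h (rF F e (α.app U' s))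
  rw [app_rF]
  exact (rF_rF F (f.preimage_mono h') e' _).trans (rF_rF F e h _).symm

theorem pull_app {V' : Y.Opens} (s : Γ(L, V')) :
    pull f α (le_refl (f ⁻¹ᵁ V')) s = α.app V' s := rF_self F _ _

/-- The extension `j_* 𝒪ⁿ` of the trivial bundle on an open set. -/
abbrev trivialExt (X : Scheme.{u}) (n : ℕ) (U : X.Opens) : GluingData X n PEmpty.{u + 1} :=
  ⟨U, PEmpty.elim, fun i => i.elim⟩

/-- The section of `j_* 𝒪ⁿ` with given components. -/
def trivialExt.mk {n : ℕ} {U V : X.Opens} (v : Fin n → Γ(X, V ⊓ U)) :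
    Γ((trivialExt X n U).sheaf, V) :=
  (⟨(v, fun i => i.elim), fun i => i.elim⟩ : (trivialExt X n U).sections V)

/-- The components of a section of `j_* 𝒪ⁿ`. -/
def trivialExt.vec {n : ℕ} {U V : X.Opens} (s : Γ((trivialExt X n U).sheaf, V)) :
    Fin n → Γ(X, V ⊓ U) :=
  (show (trivialExt X n U).sections V from s).1.1

theorem trivialExt.vec_mk {n : ℕ} {U V : X.Opens} (v : Fin n → Γ(X, V ⊓ U)) :
    trivialExt.vec (trivialExt.mk v) = v := rfl

theorem trivialExt.ext {n : ℕ} {U V : X.Opens} {s t : Γ((trivialExt X n U).sheaf, V)}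
    (h : trivialExt.vec s = trivialExt.vec t) : s = t :=
  Subtype.ext (Prod.ext h (funext fun i => i.elim))

theorem trivialExt.vec_add {n : ℕ} {U V : X.Opens} (s t : Γ((trivialExt X n U).sheaf, V))
    (k : Fin n) : trivialExt.vec (s + t) k = trivialExt.vec s k + trivialExt.vec t k := rfl

theorem trivialExt.vec_smul {n : ℕ} {U V : X.Opens} (r : Γ(X, V))
    (s : Γ((trivialExt X n U).sheaf, V)) (k : Fin n) :
    trivialExt.vec (r • s) k = rs inf_le_left r * trivialExt.vec s k := rfl

theorem trivialExt.vec_rF {n : ℕ} {U V W : X.Opens} (h : W ≤ V)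
    (s : Γ((trivialExt X n U).sheaf, V)) (k : Fin n) :
    trivialExt.vec (rF _ h s) k = rs (inf_le_inf_right _ h) (trivialExt.vec s k) := rfl

/-- The coordinates with respect to a frame over `U'`, as a morphism to `f_* j_* 𝒪ⁿ`. -/
def coordHom {n : ℕ} {U' : Y.Opens} {b : Fin n → Γ(L, U')} (hb : IsFrame L b) :
    L ⟶ (Scheme.Modules.pushforward f).obj (trivialExt X n (f ⁻¹ᵁ U')).sheaf :=
  have h0 : ∀ T : Y.Opens, f ⁻¹ᵁ T ⊓ f ⁻¹ᵁ U' ≤ f ⁻¹ᵁ (T ⊓ U') := fun T => le_rfl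
  mkHom
    (fun T =>
      { toFun := fun s => (trivialExt.mk fun k => f.appLE (T ⊓ U') (f ⁻¹ᵁ T ⊓ f ⁻¹ᵁ U') (h0 T)
          ((hb.basis inf_le_right).repr (rF L inf_le_left s) k) :
            Γ((trivialExt X n (f ⁻¹ᵁ U')).sheaf, f ⁻¹ᵁ T))
        map_add' := fun s t => trivialExt.ext (funext fun k => by
          refine Eq.trans ?_ (trivialExt.vec_add _ _ k).symm
          simp only [map_add, Finsupp.add_apply, trivialExt.vec_mk])
        map_smul' := fun r s => trivialExt.ext (funext fun k => by
          refine Eq.trans ?_ (trivialExt.vec_smul ((f.app T).hom r) _ k).symm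
          simp only [rF_smul, map_smul, Finsupp.smul_apply, smul_eq_mul, map_mul,
            trivialExt.vec_mk]
          refine congrArg (· * _) ?_
          refine (appLE_rs f (le_refl (f ⁻¹ᵁ T)) _ _ inf_le_left r).trans ?_
          rw [Scheme.Hom.app_eq_appLE]) })
    (fun V T h s => trivialExt.ext (funext fun k => by
      refine Eq.trans ?_ (trivialExt.vec_rF (f.preimage_mono h) _ k).symm
      change f.appLE (V ⊓ U') (f ⁻¹ᵁ V ⊓ f ⁻¹ᵁ U') (h0 V)
        ((hb.basis inf_le_right).repr (rF L inf_le_left (rF L h s)) k) =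
        rs _ (f.appLE (T ⊓ U') (f ⁻¹ᵁ T ⊓ f ⁻¹ᵁ U') (h0 T)
          ((hb.basis inf_le_right).repr (rF L inf_le_left s) k))
      rw [← appLE_rs f (h0 T) (h0 V) (inf_le_inf_right _ h) _, ← IsFrame.rF_repr, rF_rF, rF_rF]))

theorem vec_coordHom {n : ℕ} {U' : Y.Opens} {b : Fin n → Γ(L, U')} (hb : IsFrame L b)
    (h0 : ∀ T : Y.Opens, f ⁻¹ᵁ T ⊓ f ⁻¹ᵁ U' ≤ f ⁻¹ᵁ (T ⊓ U')) (T : Y.Opens) (s : Γ(L, T))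
    (k : Fin n) :
    trivialExt.vec (show Γ((trivialExt X n (f ⁻¹ᵁ U')).sheaf, f ⁻¹ᵁ T) from
      (coordHom f hb).app T s) k = f.appLE (T ⊓ U') (f ⁻¹ᵁ T ⊓ f ⁻¹ᵁ U') (h0 T)
          ((hb.basis inf_le_right).repr (rF L inf_le_left s) k) := rfl

/-- The extension `j_* j^* F` of the restriction of a sheaf of modules to an open set. -/
abbrev extendRes (F : X.Modules) (U : X.Opens) : X.Modules :=
  (Scheme.Modules.pushforward U.ι).obj (F.restrict U.ι)

theorem image_preimage_ι_le (U V : X.Opens) : U.ι ''ᵁ (U.ι ⁻¹ᵁ V) ≤ V ⊓ U :=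
  le_inf (U.ι.image_preimage_le V) (by
    rintro _ ⟨x, -, rfl⟩
    exact x.2)

theorem extendRes_smul {U V : X.Opens} (r : Γ(X, V)) (s : Γ(F, U.ι ''ᵁ (U.ι ⁻¹ᵁ V))) :
    (r • (show Γ(extendRes F U, V) from s) : Γ(extendRes F U, V)) =
      (rs (U.ι.image_preimage_le V) r • s : Γ(F, U.ι ''ᵁ (U.ι ⁻¹ᵁ V))) := by
  change ((U.ι.appIso (U.ι ⁻¹ᵁ V)).inv (U.ι.app V r)) • s = _
  refine congrArg (· • s) ?_
  exact congrArg (fun φ => φ.hom r) (U.ι.app_appIso_inv V)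

/-- The linear combination of sections over `U` with coefficients in `j_* 𝒪ⁿ`. -/
def comb {n : ℕ} {U : X.Opens} (c : Fin n → Γ(F, U)) {V W : X.Opens} (h : W ≤ V ⊓ U)
    (v : Γ((trivialExt X n U).sheaf, V)) : Γ(F, W) :=
  ∑ k, rs h (trivialExt.vec v k) • rF F (h.trans inf_le_right) (c k)

theorem comb_add {n : ℕ} {U : X.Opens} (c : Fin n → Γ(F, U)) {V W : X.Opens} (h : W ≤ V ⊓ U)
    (v w : Γ((trivialExt X n U).sheaf, V)) : comb c h (v + w) = comb c h v + comb c h w := by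
  simp only [comb, trivialExt.vec_add, map_add, add_smul, Finset.sum_add_distrib]

theorem comb_smul {n : ℕ} {U : X.Opens} (c : Fin n → Γ(F, U)) {V W : X.Opens} (h : W ≤ V ⊓ U)
    (r : Γ(X, V)) (v : Γ((trivialExt X n U).sheaf, V)) :
    comb c h (r • v) = rs (h.trans inf_le_left) r • comb c h v := by
  simp only [comb, trivialExt.vec_smul, map_mul, Finset.smul_sum, smul_smul, rs_rs]

theorem comb_rF {n : ℕ} {U : X.Opens} (c : Fin n → Γ(F, U)) {V W V' W' : X.Opens} (h : W ≤ V ⊓ U)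
    (h' : W' ≤ V' ⊓ U) (e : V' ≤ V) (e' : W' ≤ W) (v : Γ((trivialExt X n U).sheaf, V)) :
    comb c h' (rF _ e v) = rF F e' (comb c h v) := by
  simp only [comb, trivialExt.vec_rF, map_sum, rF_smul, rs_rs, rF_rF]

/-- The morphism `j_* 𝒪ⁿ → j_* j^* F` defined by sections over `U`. -/
def combHom {n : ℕ} {U : X.Opens} (c : Fin n → Γ(F, U)) :
    (trivialExt X n U).sheaf ⟶ extendRes F U :=
  mkHom
    (fun V =>
      { toFun := fun v => (comb c (image_preimage_ι_le U V) v : Γ(F, U.ι ''ᵁ (U.ι ⁻¹ᵁ V)))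
        map_add' := fun v w => comb_add c _ v w
        map_smul' := fun r v => (comb_smul c (image_preimage_ι_le U V) r v).trans
          (extendRes_smul r (comb c (image_preimage_ι_le U V) v)).symm })
    (fun V T h v => comb_rF c (image_preimage_ι_le U T) (image_preimage_ι_le U V) h
      (show U.ι ''ᵁ (U.ι ⁻¹ᵁ V) ≤ U.ι ''ᵁ (U.ι ⁻¹ᵁ T) from
          U.ι.image_mono (U.ι.preimage_mono h)) v)

set_option maxHeartbeats 1000000 in
theorem frame_pullback {n : ℕ} {U' : Y.Opens} {b : Fin n → Γ(L, U')} (hb : IsFrame L b) :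
    IsFrame ((Scheme.Modules.pullback f).obj L) fun k =>
      pull f ((Scheme.Modules.pullbackPushforwardAdjunction f).unit.app L)
        (le_refl (f ⁻¹ᵁ U')) (b k) := by
  classical
  set adj := Scheme.Modules.pullbackPushforwardAdjunction f with hadj
  set P := (Scheme.Modules.pullback f).obj L with hP
  let η : L ⟶ (Scheme.Modules.pushforward f).obj P := adj.unit.app L
  let U := f ⁻¹ᵁ U'
  let c : Fin n → Γ(P, U) := fun k => pull f η (le_refl (f ⁻¹ᵁ U')) (b k)
  let p : P ⟶ (trivialExt X n U).sheaf := (adj.homEquiv _ _).symm (coordHom f hb)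
  have hp : η ≫ (Scheme.Modules.pushforward f).map p = coordHom f hb := by
    rw [← Adjunction.homEquiv_unit]
    exact Equiv.apply_symm_apply _ _
  let ρ : P ⟶ extendRes P U := (Scheme.Modules.restrictAdjunction U.ι).unit.app P
  have h00 : ∀ T : Y.Opens, f ⁻¹ᵁ T ⊓ f ⁻¹ᵁ U' ≤ f ⁻¹ᵁ (T ⊓ U') := fun T => le_rfl
  have hp' : ∀ (T : Y.Opens) (s : Γ(L, T)) (k : Fin n),
      trivialExt.vec (p.app (f ⁻¹ᵁ T) (η.app T s)) k =
        f.appLE (T ⊓ U') (f ⁻¹ᵁ T ⊓ f ⁻¹ᵁ U') (h00 T)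
          ((hb.basis inf_le_right).repr (rF L inf_le_left s) k) := by
    intro T s k
    rw [← vec_coordHom f hb h00, ← hp]
    rfl
  have hρ : p ≫ combHom c = ρ := by
    apply (adj.homEquiv _ _).injective
    rw [Adjunction.homEquiv_unit, Adjunction.homEquiv_unit, Functor.map_comp, ← Category.assoc]
    refine (congrArg (· ≫ _) hp).trans ?_
    ext T s
    have h0 : U.ι ''ᵁ (U.ι ⁻¹ᵁ (f ⁻¹ᵁ T)) ≤ f ⁻¹ᵁ (T ⊓ U') := image_preimage_ι_le U (f ⁻¹ᵁ T)
    have h1 : rF L inf_le_left s = ∑ k, (hb.basis (inf_le_right : T ⊓ U' ≤ U')).repr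
        (rF L inf_le_left s) k • rF L inf_le_right (b k) := by
      conv_lhs => rw [← (hb.basis inf_le_right).sum_repr (rF L inf_le_left s)]
      simp only [IsFrame.basis_apply]
    have h2 := congrArg (pull f η h0) h1
    rw [map_sum] at h2
    have h3 : pull f η h0 (rF L inf_le_left s) = rF P (U.ι.image_preimage_le (f ⁻¹ᵁ T))
        (pull f η le_rfl s) := pull_rF f η _ _ _ _ _
    rw [pull_app] at h3
    change comb c (image_preimage_ι_le U (f ⁻¹ᵁ T)) (show Γ((trivialExt X n U).sheaf, f ⁻¹ᵁ T)
      from (coordHom f hb).app T s) = rF P (U.ι.image_preimage_le (f ⁻¹ᵁ T)) (η.app T s)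
    refine Eq.trans (Finset.sum_congr rfl fun k _ => ?_) (h2.symm.trans h3)
    rw [pull_smul, pull_rF f η (le_refl (f ⁻¹ᵁ U')) _ _
      ((image_preimage_ι_le U (f ⁻¹ᵁ T)).trans inf_le_right)]
    refine congrArg (· • rF P _ (c k)) ?_
    rw [vec_coordHom f hb h00, ← appLE_rs f (h00 T) h0 le_rfl, rs_self]
  have hpc : ∀ k, p.app (f ⁻¹ᵁ U') (c k) = trivialExt.mk (Pi.single k 1) := by
    intro k
    refine trivialExt.ext (funext fun l => ?_)
    have h1 : c k = η.app U' (b k) := pull_app f η (b k)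
    rw [h1, hp', trivialExt.vec_mk, ← IsFrame.basis_apply hb, Module.Basis.repr_self,
      Finsupp.single_apply, Pi.single_apply]
    rcases eq_or_ne k l with rfl | hkl
    · rw [if_pos rfl, if_pos rfl]
      exact map_one _
    · rw [if_neg hkl, if_neg hkl.symm]
      exact map_zero _
  rw [isFrame_iff]
  intro V h
  have hVU : V ≤ U.ι ''ᵁ (U.ι ⁻¹ᵁ V) := fun x hx => ⟨⟨x, h hx⟩, hx, rfl⟩
  have key : ∀ x : Γ(P, V), rF P hVU (comb c (image_preimage_ι_le U V) (p.app V x)) = x := by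
    intro x
    have h1 : comb c (image_preimage_ι_le U V) (p.app V x) =
        rF P (U.ι.image_preimage_le V) x :=
      congrArg (fun q : P ⟶ extendRes P U => q.app V x) hρ
    rw [h1, rF_rF, rF_self]
  have hcomp : ∀ a : Fin n → Γ(X, V), trivialExt.vec (p.app V (∑ k, a k • rF P h (c k))) =
      fun l => rs inf_le_left (a l) := by
    intro a
    funext l
    have h1 : p.app V (∑ k, a k • rF P h (c k)) =
        trivialExt.mk fun l => rs inf_le_left (a l) := by
      simp only [map_sum, Scheme.Modules.Hom.app_smul, app_rF, hpc]
      refine trivialExt.ext ?_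
      have h2 : ∀ v : Fin n → Γ((trivialExt X n U).sheaf, V), trivialExt.vec (∑ k, v k) =
          ∑ k, trivialExt.vec (v k) := fun v => map_sum (AddMonoidHom.mk' (trivialExt.vec
            (U := U) (V := V)) fun s t => rfl) v _
      rw [h2]
      funext l
      rw [Finset.sum_apply, Finset.sum_eq_single l]
      · rw [trivialExt.vec_smul, trivialExt.vec_rF]
        rw [trivialExt.vec_mk, Pi.single_eq_same, map_one, mul_one, trivialExt.vec_mk]
      · intro k _ hk
        rw [trivialExt.vec_smul, trivialExt.vec_rF, trivialExt.vec_mk,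
          Pi.single_eq_of_ne hk.symm, map_zero, mul_zero]
      · simp
    rw [h1, trivialExt.vec_mk]
  constructor
  · intro a a' h1
    funext l
    have h2 := congrFun ((hcomp a).symm.trans ((congrArg (fun x => trivialExt.vec (p.app V x))
      h1).trans (hcomp a'))) l
    exact (rs_bijective_of_eq (inf_le_left : V ⊓ U ≤ V) (le_inf le_rfl h)).1 h2
  · intro x
    refine ⟨fun k => rs (le_inf le_rfl h) (trivialExt.vec (p.app V x) k), ?_⟩
    conv_rhs => rw [← key x]
    simp only [comb, map_sum, rF_smul, rs_rs, rF_rF]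
    rfl

end Pull

section BundleLift

theorem IsFrame.map_isIso {X : Scheme.{u}} {F G : X.Modules} {n : ℕ} {U : X.Opens}
    {b : Fin n → Γ(F, U)} (hb : IsFrame F b) (φ : F ⟶ G) [IsIso φ] :
    IsFrame G fun k => φ.app U (b k) := by
  rw [isFrame_iff] at *
  intro V h
  have h1 : (fun a : Fin n → Γ(X, V) => ∑ k, a k • rF G h (φ.app U (b k))) =
      φ.app V ∘ fun a : Fin n → Γ(X, V) => ∑ k, a k • rF F h (b k) := by
    funext a
    simp only [Function.comp, map_sum, Scheme.Modules.Hom.app_smul, app_rF]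
  rw [h1]
  refine Function.Bijective.comp ?_ (hb V h)
  exact (ConcreteCategory.isIso_iff_bijective _).1
    (Scheme.Modules.Hom.isIso_iff_isIso_app.1 (inferInstanceAs (IsIso φ)) V)

variable {A A' : Type u} [CommRing A] [CommRing A'] [Algebra A' A]
variable {C : PolarScheme A} {C' : PolarScheme A'} {g : C.Hom C'} {n : ℕ} {F : C.X.Modules}

/-- The pull-back along a lift of a bundle carries frames to frames. -/
theorem BundleLift.isFrame (L : BundleLift g n F) {U' : C'.X.Opens}
    {b : Fin n → Γ(L.bundle, U')} (hb : IsFrame L.bundle b) :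
    IsFrame F fun k => pull g.f L.toPush (le_refl (g.f ⁻¹ᵁ U')) (b k) := by
  have h1 := (frame_pullback g.f hb).map_isIso L.iso.hom
  refine (iff_of_eq (congrArg _ (funext fun k => ?_))).1 h1
  rw [pull_app, pull_app, BundleLift.toPush, Adjunction.homEquiv_unit]
  rfl

/-- A morphism `L → f_* F` carrying frames to frames exhibits `L` as a lift of `F`. -/
def BundleLift.ofHom (L : C'.X.Modules) (hL : IsVectorBundle n L)
    (α : L ⟶ (Scheme.Modules.pushforward g.f).obj F)
    (hα : ∀ x : C.X, ∃ (U' : C'.X.Opens) (_ : x ∈ g.f ⁻¹ᵁ U') (b : Fin n → Γ(L, U')),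
      IsFrame L b ∧ IsFrame F fun k => pull g.f α (le_refl (g.f ⁻¹ᵁ U')) (b k)) :
    BundleLift g n F where
  bundle := L
  isVectorBundle := hL
  iso := by
    refine @asIso _ _ _ _ (((Scheme.Modules.pullbackPushforwardAdjunction g.f).homEquiv _ _).symm α)
      ?_
    choose U' hU' b hb hb' using hα
    refine isIso_of_frames (fun x => g.f ⁻¹ᵁ (U' x)) (fun x => ⟨x, hU' x⟩) _
      (fun x => frame_pullback g.f (hb x)) _ fun x => ?_
    refine (iff_of_eq (congrArg _ (funext fun k => ?_))).1 (hb' x)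
    rw [pull_app, pull_app]
    conv_lhs => rw [← Equiv.apply_symm_apply
      ((Scheme.Modules.pullbackPushforwardAdjunction g.f).homEquiv _ _) α]
    rw [Adjunction.homEquiv_unit]
    rfl

theorem BundleLift.ofHom_toPush (L : C'.X.Modules) (hL : IsVectorBundle n L)
    (α : L ⟶ (Scheme.Modules.pushforward g.f).obj F)
    (hα : ∀ x : C.X, ∃ (U' : C'.X.Opens) (_ : x ∈ g.f ⁻¹ᵁ U') (b : Fin n → Γ(L, U')),
      IsFrame L b ∧ IsFrame F fun k => pull g.f α (le_refl (g.f ⁻¹ᵁ U')) (b k)) :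
    (BundleLift.ofHom L hL α hα).toPush = α := by
  rw [BundleLift.toPush]
  exact Equiv.apply_symm_apply _ _

end BundleLift

/-! ### Thickenings and pushouts of rings of sections -/

section Definitions

variable {A : Type u} [CommRing A]

/-- A section `φ` of `𝒪(-D)` over an affine open `U` which freely generates `𝒪(-D)` over every
affine open contained in `U`. -/
def IsGen (C : PolarScheme A) {U : C.X.affineOpens} (φ : C.D.ideal U) : Prop :=
  ∀ (V : C.X.affineOpens) (h : V ≤ U), Function.Bijective fun r : Γ(C.X, V.1) => r • resD C h φ

variable {A' : Type u} [CommRing A'] [Algebra A' A]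

/-- The properties of the thickening `C ⊆ C'` of a curve over `A`, along a square zero extension
`A' → A`, on which the theory of lifts of connections depends. -/
structure IsThickening {C : PolarScheme A} {C' : PolarScheme A'} (g : C.Hom C') : Prop where
  surj : Function.Surjective (algebraMap A' A)
  sq : RingHom.ker (algebraMap A' A) ^ 2 = ⊥
  homeo : IsHomeomorph g.f
  affine : IsAffineHom g.f
  app_surj : ∀ V' : C'.X.affineOpens, Function.Surjective (g.f.app V'.1).hom
  ker_app : ∀ V' : C'.X.affineOpens, RingHom.ker (g.f.app V'.1).hom =
    (RingHom.ker (algebraMap A' A)).map (algebraMap A' Γ(C'.X, V'.1))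
  flat : ∀ V' : C'.X.affineOpens, Module.Flat A' Γ(C'.X, V'.1)
  flat_kaehler : ∀ V' : C'.X.affineOpens, Module.Flat Γ(C'.X, V'.1) Ω[Γ(C'.X, V'.1)⁄A']
  inf : ∀ U' V' : C'.X.affineOpens, IsAffineOpen (U'.1 ⊓ V'.1)
  gen : ∀ x : C'.X, ∃ (U' : C'.X.affineOpens) (_ : x ∈ U'.1) (φ : C'.D.ideal U'), IsGen C' φ ∧
    IsGen C (U := ⟨g.f ⁻¹ᵁ U'.1, U'.2.preimage g.f⟩) (g.mapD le_rfl φ)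

/-- The topological properties of an irreducible curve: there is a generic point, every other point
is closed, and the complement of a neighbourhood of the generic point is finite. -/
def IsCurveLike (X : Type u) [TopologicalSpace X] : Prop :=
  ∃ η : X, (∀ U : Set X, IsOpen U → U.Nonempty → η ∈ U) ∧
    (∀ U : Set X, IsOpen U → η ∈ U → Uᶜ.Finite) ∧ ∀ x : X, x ≠ η → IsClosed {x}

end Definitions

section Pushouts

theorem ker_of_isPushout {R S R' S' : CommRingCat.{u}} {a : R ⟶ S} {p : R ⟶ R'} {p' : S ⟶ S'}
    {a' : R' ⟶ S'} (h : IsPushout a p p' a') (hp : Function.Surjective p.hom) :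
    RingHom.ker p'.hom = (RingHom.ker p.hom).map a.hom := by
  apply le_antisymm
  · set J := (RingHom.ker p.hom).map a.hom
    let q : S →+* S ⧸ J := Ideal.Quotient.mk J
    let c : R' →+* S ⧸ J := RingHom.liftOfSurjective p.hom hp ⟨q.comp a.hom, fun x hx =>
      Ideal.Quotient.eq_zero_iff_mem.2 (Ideal.mem_map_of_mem _ hx)⟩
    have hc : c.comp p.hom = q.comp a.hom := RingHom.liftOfSurjective_comp ..
    let d : S' ⟶ CommRingCat.of (S ⧸ J) := h.desc (CommRingCat.ofHom q) (CommRingCat.ofHom c)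
      (CommRingCat.hom_ext hc.symm)
    have hd : p' ≫ d = CommRingCat.ofHom q := h.inl_desc _ _ _
    intro x hx
    have h1 : d.hom (p'.hom x) = q x := congrArg (fun φ => φ.hom x) hd
    rw [RingHom.mem_ker.1 hx, map_zero] at h1
    exact Ideal.Quotient.eq_zero_iff_mem.1 h1.symm
  · rw [Ideal.map_le_iff_le_comap]
    intro x hx
    have h1 : p'.hom (a.hom x) = a'.hom (p.hom x) := congrArg (fun φ => φ.hom x) h.w
    rw [Ideal.mem_comap, RingHom.mem_ker, h1, RingHom.mem_ker.1 hx, map_zero]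

/-- A nonzerodivisor `f` of `S` with `S / f` flat over `R` remains a nonzerodivisor after base
change. -/
theorem nonZeroDivisors_of_isPushout {R S R' S' : CommRingCat.{u}} {a : R ⟶ S} {p : R ⟶ R'}
    {p' : S ⟶ S'} {a' : R' ⟶ S'} (h : IsPushout a p p' a') {f : S} (hf : f ∈ nonZeroDivisors S)
    {T : CommRingCat.{u}} (q : S ⟶ T) (hq : Function.Surjective q.hom)
    (hqf : RingHom.ker q.hom = Ideal.span {f}) (hflat : (a ≫ q).hom.Flat) :
    p'.hom f ∈ nonZeroDivisors S' := by
  letI := a.hom.toAlgebra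
  letI := p.hom.toAlgebra
  letI := p'.hom.toAlgebra
  letI := a'.hom.toAlgebra
  letI := (a ≫ p').hom.toAlgebra
  letI := (a ≫ q).hom.toAlgebra
  letI := q.hom.toAlgebra
  haveI : IsScalarTower R S S' := .of_algebraMap_eq fun _ => rfl
  haveI : IsScalarTower R S T := .of_algebraMap_eq fun _ => rfl
  haveI : IsScalarTower R R' S' := .of_algebraMap_eq fun r => congrArg (fun φ => φ.hom r) h.w
  have h' : Algebra.IsPushout R S R' S' := CommRingCat.isPushout_iff_isPushout.1 h
  have hpo : IsBaseChange R' (IsScalarTower.toAlgHom R S S').toLinearMap := h'.symm.out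
  haveI : Module.Flat R T := hflat
  let m : S →ₗ[R] S := LinearMap.mulLeft R f
  have h1 : Function.Injective m := fun x y hxy => by
    refine (mul_cancel_left_mem_nonZeroDivisors hf).1 hxy
  have h2 : Function.Injective (m.lTensor R') := by
    refine LinearMap.lTensor_injective_of_exact_of_flat
      (IsScalarTower.toAlgHom R S T).toLinearMap hq m h1 ?_ R'
    intro x
    change q.hom x = 0 ↔ _
    rw [← RingHom.mem_ker, hqf, Ideal.mem_span_singleton]
    exact ⟨fun ⟨y, hy⟩ => ⟨y, hy.symm⟩, fun ⟨y, hy⟩ => ⟨y, hy.symm⟩⟩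
  let e := hpo.equiv
  have h3 : ∀ x, e (m.lTensor R' x) = p'.hom f * e x := by
    intro x
    induction x using TensorProduct.induction_on with
    | zero => simp
    | tmul r s =>
      simp only [LinearMap.lTensor_tmul, e, IsBaseChange.equiv_tmul]
      change r • (p'.hom (f * s)) = p'.hom f * (r • p'.hom s)
      rw [map_mul, mul_smul_comm]
    | add x y hx hy => simp only [map_add, hx, hy, mul_add]
  rw [mem_nonZeroDivisors_iff_left]
  intro x hx
  obtain ⟨y, rfl⟩ := e.surjective x
  rw [← h3, e.map_eq_zero_iff] at hx
  rw [h2 (hx.trans (map_zero _).symm), map_zero]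

end Pushouts

section SchemeLemmas

/-- The square of sections over preimages of affine opens, attached to a cartesian square. -/
theorem isPushout_sections {X Y S T : Scheme.{u}} {f : T ⟶ S} {g : Y ⟶ X} {iX : X ⟶ S} {iY : Y ⟶ T}
    (H : IsPullback g iY iX f) {US : S.Opens} {UT : T.Opens} {UX : X.Opens}
    (hUST : UT ≤ f ⁻¹ᵁ US) (hUSX : UX ≤ iX ⁻¹ᵁ US) (hUS : IsAffineOpen US) (hUT : IsAffineOpen UT)
    (hUX : IsAffineOpen UX) {UY : Y.Opens} (hUY : UY = g ⁻¹ᵁ UX ⊓ iY ⁻¹ᵁ UT) :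
    IsPushout (iX.appLE US UX hUSX) (f.appLE US UT hUST)
      (g.appLE UX UY (hUY.trans_le inf_le_left)) (iY.appLE UT UY (hUY.trans_le inf_le_right)) :=
  (isIso_pushoutSection_iff H hUST hUSX hUY).1
    (isIso_pushoutSection_of_isAffineOpen H hUST hUSX hUY hUS hUT hUX)

theorem isAffineOpen_of_isPullback {X Y S T : Scheme.{u}} {f : T ⟶ S} {g : Y ⟶ X} {iX : X ⟶ S}
    {iY : Y ⟶ T} (H : IsPullback g iY iX f) {US : S.Opens} {UT : T.Opens} {UX : X.Opens}
    (hUST : UT ≤ f ⁻¹ᵁ US) (hUSX : UX ≤ iX ⁻¹ᵁ US) (hUS : IsAffineOpen US) (hUT : IsAffineOpen UT)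
    (hUX : IsAffineOpen UX) {UY : Y.Opens} (hUY : UY = g ⁻¹ᵁ UX ⊓ iY ⁻¹ᵁ UT) :
    IsAffineOpen UY := by
  have : IsAffine _ := hUS
  have : IsAffine _ := hUT
  have : IsAffine _ := hUX
  exact .of_isIso (Scheme.Hom.isPullback_resLE H hUST hUSX hUY).isoPullback.hom

/-- The ideal of the inverse image of a closed subscheme. -/
theorem ideal_comap {X Y : Scheme.{u}} (D : Y.IdealSheafData) (f : X ⟶ Y) (U : Y.affineOpens)
    (V : X.affineOpens) (e : V.1 ≤ f ⁻¹ᵁ U.1) :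
    (D.comap f).ideal V = (D.ideal U).map (f.appLE U.1 V.1 e).hom := by
  have H := (IsPullback.of_hasPullback f D.subschemeι)
  have h1 := isPushout_sections H.flip (US := U.1) (UT := V.1) (UX := D.subschemeι ⁻¹ᵁ U.1)
    e le_rfl U.2 V.2 (U.2.preimage _) rfl
  have h2 := ker_of_isPushout h1.flip (by
    rw [← Scheme.Hom.app_eq_appLE]; exact D.subschemeι.app_surjective U.1 U.2)
  rw [← Scheme.Hom.app_eq_appLE, Scheme.IdealSheafData.ker_subschemeι_app] at h2
  rw [← h2, Scheme.IdealSheafData.comap, Scheme.Hom.ker_apply, Scheme.Hom.app_eq_appLE]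
  have h3 : (pullback.fst f D.subschemeι) ⁻¹ᵁ V.1 ≤
      (pullback.snd f D.subschemeι) ⁻¹ᵁ (D.subschemeι ⁻¹ᵁ U.1) ⊓
      (pullback.fst f D.subschemeι) ⁻¹ᵁ V.1 := by
    refine le_inf ?_ le_rfl
    rw [← Scheme.Hom.comp_preimage, ← pullback.condition, Scheme.Hom.comp_preimage]
    exact Scheme.Hom.preimage_mono _ e
  ext x
  rw [RingHom.mem_ker, RingHom.mem_ker]
  have h4 := appLE_rs (pullback.fst f D.subschemeι) (le_refl (pullback.fst f D.subschemeι ⁻¹ᵁ V.1))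
    (inf_le_right : (pullback.snd f D.subschemeι) ⁻¹ᵁ (D.subschemeι ⁻¹ᵁ U.1) ⊓
      (pullback.fst f D.subschemeι) ⁻¹ᵁ V.1 ≤ _) le_rfl inf_le_right x
  rw [rs_self] at h4
  change _ ↔ (pullback.fst f D.subschemeι).appLE V.1 _ _ x = 0
  rw [h4]
  exact ⟨fun h => (congrArg _ h).trans (map_zero _),
    fun h => (rs_bijective_of_eq inf_le_right h3).1 (h.trans (map_zero _).symm)⟩

/-- Restriction to a smaller affine open preserves nonzerodivisors. -/
theorem rs_mem_nonZeroDivisors {X : Scheme.{u}} {U V : X.affineOpens} (h : V ≤ U) {f : Γ(X, U.1)}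
    (hf : f ∈ nonZeroDivisors Γ(X, U.1)) : rs h f ∈ nonZeroDivisors Γ(X, V.1) := by
  have h1 : (rs (show V.1 ≤ U.1 from h)).Flat := by
    have := (Flat.flat_appLE (𝟙 X) U.2 V.2 h)
    have h2 : (𝟙 X : X ⟶ X).appLE U.1 V.1 h = X.presheaf.map (homOfLE h).op := by
      simp [Scheme.Hom.appLE]
      exact Category.id_comp _
    rwa [h2] at this
  algebraize [rs (show V.1 ≤ U.1 from h)]
  rw [mem_nonZeroDivisors_iff_left]
  intro x hx
  have h2 : Function.Injective (LinearMap.mulLeft Γ(X, U.1) f) := fun x y hxy => by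
    refine (mul_cancel_left_mem_nonZeroDivisors hf).1 hxy
  have h3 := Module.Flat.lTensor_preserves_injective_linearMap (M := Γ(X, V.1)) _ h2
  have h4 := @h3 (x ⊗ₜ 1) 0 (by
    rw [LinearMap.lTensor_tmul, map_zero, LinearMap.mulLeft_apply, mul_one]
    have : f = f • (1 : Γ(X, U.1)) := by rw [smul_eq_mul, mul_one]
    rw [this, TensorProduct.tmul_smul, TensorProduct.smul_tmul', Algebra.smul_def]
    change (rs h f * x) ⊗ₜ _ = _
    rw [hx, TensorProduct.zero_tmul])
  have h5 := congrArg (TensorProduct.rid Γ(X, U.1) Γ(X, V.1)) h4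
  simpa using h5

/-- A nonzerodivisor which generates the ideal of the divisor is a free generator. -/
theorem isGen_of_span {A : Type u} [CommRing A] (C : PolarScheme A) {U : C.X.affineOpens}
    {f : Γ(C.X, U.1)} (hf : f ∈ nonZeroDivisors Γ(C.X, U.1)) (hD : C.D.ideal U = Ideal.span {f})
    (φ : C.D.ideal U) (hφ : φ.1 = f) : IsGen C φ := by
  intro V h
  constructor
  · intro r r' hr
    have h1 : r * rs h φ.1 = r' * rs h φ.1 := congrArg Subtype.val hr
    rw [hφ] at h1
    exact (mul_cancel_right_mem_nonZeroDivisors (rs_mem_nonZeroDivisors h hf)).1 h1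
  · intro y
    have h1 : C.D.ideal V = Ideal.span {rs h f} := by
      rw [← C.D.map_ideal h, hD, Ideal.map_span, Set.image_singleton]
      rfl
    obtain ⟨r, hr⟩ := Ideal.mem_span_singleton'.1 (h1.le y.2)
    refine ⟨r, Subtype.ext ?_⟩
    change r * rs h φ.1 = y.1
    rw [hφ]
    exact hr

end SchemeLemmas

/-! ### The base change along a square zero extension is a thickening -/

section BaseChange

theorem isOpen_eq_top_of_isLocalRing {R : CommRingCat.{u}} [IsLocalRing R] [Subsingleton (Spec R)]
    (U : (Spec R).Opens) (x : Spec R) (hx : x ∈ U) : U = ⊤ := by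
  ext y
  simp [Subsingleton.elim y x, hx]

instance {R : Type u} [CommRing R] [IsLocalRing R] [IsArtinianRing R] :
    Subsingleton (Spec (.of R)) :=
  inferInstanceAs (Subsingleton (PrimeSpectrum R))

variable {B C : Scheme.{u}} (π : C ⟶ B) (D : C.IdealSheafData)

/-- The projection `C ×_B Spec A → C`. -/
def baseChangeFst {A : Type u} [CommRing A] (b : Spec (.of A) ⟶ B) : (baseChange π D b).X ⟶ C :=
  pullback.fst π b

theorem isPullback_baseChange {A : Type u} [CommRing A] (b : Spec (.of A) ⟶ B) :
    IsPullback (baseChangeFst π D b) (baseChange π D b).str π b :=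
  IsPullback.of_hasPullback π b

theorem baseChangeHom_fst {A A' : Type u} [CommRing A] [CommRing A'] [Algebra A' A]
    (b : Spec (.of A') ⟶ B) :
    (baseChangeHom (A := A) π D b).f ≫ baseChangeFst π D b = baseChangeFst π D _ :=
  pullback.lift_fst _ _ _

/-- The base change of a relative effective Cartier divisor is locally generated by the pull-back
of a local equation, which remains a nonzerodivisor. -/
theorem IsRelativeCartier.exists_generator (hD : IsRelativeCartier π D) (W : B.affineOpens) (x : C)
    (hx : π x ∈ W.1) :
    ∃ (U : C.affineOpens) (_ : x ∈ U.1) (f : Γ(C, U.1)), 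
      ∀ {A : Type u} [CommRing A] (b : Spec (.of A) ⟶ B) (_ : b ⁻¹ᵁ W.1 = ⊤)
        (V : (baseChange π D b).X.affineOpens) (e : V.1 ≤ baseChangeFst π D b ⁻¹ᵁ U.1),
      (baseChangeFst π D b).appLE U.1 V.1 e f ∈ nonZeroDivisors _ ∧
      (baseChange π D b).D.ideal V = Ideal.span {((baseChangeFst π D b).appLE U.1 V.1 e).hom f} := by
  obtain ⟨U₀, hxU₀, f₀, hf₀, hD₀⟩ := hD.cartier x
  obtain ⟨_, ⟨U, hU, rfl⟩, hxU, hUle⟩ := C.isBasis_affineOpens.exists_subset_of_mem_open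
    (show x ∈ ((U₀.1 ⊓ π ⁻¹ᵁ W.1 : C.Opens) : Set C) from ⟨hxU₀, hx⟩) (U₀.1 ⊓ π ⁻¹ᵁ W.1).2
  have hU₀ : U ≤ U₀.1 := fun y hy => (hUle hy).1
  have hW : U ≤ π ⁻¹ᵁ W.1 := fun y hy => (hUle hy).2
  have hf : rs hU₀ f₀ ∈ nonZeroDivisors Γ(C, U) :=
    rs_mem_nonZeroDivisors (U := U₀) (V := ⟨U, hU⟩) hU₀ hf₀
  have hDU : D.ideal ⟨U, hU⟩ = Ideal.span {rs hU₀ f₀} := by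
    rw [← D.map_ideal (U := ⟨U, hU⟩) (V := U₀) hU₀, hD₀, Ideal.map_span, Set.image_singleton]
    rfl
  refine ⟨⟨U, hU⟩, hxU, rs hU₀ f₀, fun {A} _ b hb V e => ⟨?_, ?_⟩⟩
  · have h1 := isPushout_sections (isPullback_baseChange π D b) (US := W.1) (UT := ⊤) (UX := U)
      hb.ge hW W.2 (isAffineOpen_top _) hU rfl
    have h2 := nonZeroDivisors_of_isPushout h1 hf (D.subschemeι.app U)
      (D.subschemeι.app_surjective U hU) (by rw [← hDU, ← D.ker_subschemeι_app ⟨U, hU⟩]) (by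
        rw [Scheme.Hom.app_eq_appLE, Scheme.Hom.appLE_comp_appLE]
        have := hD.flat
        exact Flat.flat_appLE _ W.2 (hU.preimage _) _)
    have hV : V.1 ≤ baseChangeFst π D b ⁻¹ᵁ U ⊓ (baseChange π D b).str ⁻¹ᵁ ⊤ := fun y hy => ⟨e hy, trivial⟩
    have hAff : IsAffineOpen (baseChangeFst π D b ⁻¹ᵁ U ⊓ (baseChange π D b).str ⁻¹ᵁ ⊤) :=
      isAffineOpen_of_isPullback (isPullback_baseChange π D b) (US := W.1) (UT := ⊤) (UX := U)
        hb.ge hW W.2 (isAffineOpen_top _) hU rfl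
    have h3 := rs_mem_nonZeroDivisors (U := ⟨_, hAff⟩) (V := V) hV h2
    rwa [← appLE_rs (baseChangeFst π D b) inf_le_left e le_rfl hV, rs_self] at h3
  · have h1 := ideal_comap D (baseChangeFst π D b) ⟨U, hU⟩ V e
    rw [hDU, Ideal.map_span, Set.image_singleton] at h1
    exact h1

end BaseChange

section Thickening

variable {A A' : Type u} [CommRing A] [CommRing A'] [Algebra A' A]
  {B C : Scheme.{u}} (π : C ⟶ B) (D : C.IdealSheafData) (b : Spec (.of A') ⟶ B)

theorem isPullback_baseChangeHom :
    IsPullback (baseChangeHom (A := A) π D b).f (baseChange π D _).str (baseChange π D b).str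
      (Spec.map (CommRingCat.ofHom (algebraMap A' A))) := by
  refine IsPullback.of_right (h₁₂ := baseChangeFst π D b) (h₂₂ := b) (v₁₃ := π) ?_
    (pullback.lift_snd _ _ _) (isPullback_baseChange π D b)
  rw [baseChangeHom_fst]
  exact isPullback_baseChange π D _

theorem flat_algebraMap {A : Type u} [CommRing A] (b : Spec (.of A) ⟶ B) [Flat π]
    (V : (baseChange π D b).X.affineOpens) : Module.Flat A Γ((baseChange π D b).X, V.1) := by
  have h1 : ((baseChange π D b).str.appLE ⊤ V.1 (le_preimage_top _ _)).hom.Flat :=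
    Flat.flat_appLE (pullback.snd π b) (isAffineOpen_top _) V.2 _
  have h2 : ((Scheme.ΓSpecIso (.of A)).inv).hom.Flat := 
    RingHom.Flat.of_bijective ((Scheme.ΓSpecIso (.of A)).symm.commRingCatIsoToRingEquiv.bijective)
  exact h2.comp h1

theorem flat_kaehler {A : Type u} [CommRing A] (b : Spec (.of A) ⟶ B) [Smooth π]
    (V : (baseChange π D b).X.affineOpens) :
    Module.Flat Γ((baseChange π D b).X, V.1) Ω[Γ((baseChange π D b).X, V.1)⁄A] := by
  have h1 : ((baseChange π D b).str.appLE ⊤ V.1 (le_preimage_top _ _)).hom.Smooth :=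
    Smooth.smooth_appLE (pullback.snd π b) (isAffineOpen_top _) V.2 _
  have h2 : ((Scheme.ΓSpecIso (.of A)).inv).hom.Smooth :=
    RingHom.Smooth.of_bijective
      ((Scheme.ΓSpecIso (.of A)).symm.commRingCatIsoToRingEquiv.bijective)
  have h3 : Algebra.Smooth A Γ((baseChange π D b).X, V.1) := h2.comp h1
  infer_instance

/-- The base change of the curve along a square zero extension of local Artin rings is a thickening
in the sense of `IsThickening`. -/
theorem isThickening_baseChangeHom [IsLocalRing A'] [IsArtinianRing A'] [IsLocalRing A]
    [IsArtinianRing A] (hsurj : Function.Surjective (algebraMap A' A))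
    (hsq : RingHom.ker (algebraMap A' A) ^ 2 = ⊥) [Smooth π] [IsSeparated π]
    (hD : IsRelativeCartier π D) : IsThickening (baseChangeHom (A := A) π D b) := by
  have H := isPullback_baseChangeHom (A := A) π D b
  have hφ : IsClosedImmersion (Spec.map (CommRingCat.ofHom (algebraMap A' A))) :=
    IsClosedImmersion.spec_of_surjective _ hsurj
  have hφ' : Surjective (Spec.map (CommRingCat.ofHom (algebraMap A' A))) :=
    ⟨fun x => ⟨IsLocalRing.closedPoint A, Subsingleton.elim _ _⟩⟩
  have hf : IsClosedImmersion (baseChangeHom (A := A) π D b).f :=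
    MorphismProperty.of_isPullback H.flip hφ
  have hf' : Surjective (baseChangeHom (A := A) π D b).f :=
    MorphismProperty.of_isPullback (P := @Surjective) H.flip hφ'
  have hmapO : ∀ (U : C.Opens) (V' : (baseChange π D b).X.Opens)
      (e : V' ≤ baseChangeFst π D b ⁻¹ᵁ U)
      (e' : (baseChangeHom (A := A) π D b).f ⁻¹ᵁ V' ≤ baseChangeFst π D _ ⁻¹ᵁ U) (f : Γ(C, U)),
      (baseChangeHom (A := A) π D b).mapO (le_refl (_ ⁻¹ᵁ V'))
        ((baseChangeFst π D b).appLE U V' e f) = (baseChangeFst π D _).appLE U _ e' f := by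
    intro U V' e e' f
    have h1 := baseChangeHom_fst (A := A) π D b
    have h2 : (baseChangeFst π D b).appLE U V' e ≫
        (baseChangeHom (A := A) π D b).f.appLE V' _ le_rfl = (baseChangeFst π D _).appLE U _ e' := by
      refine (Scheme.Hom.appLE_comp_appLE ..).trans ?_
      simp only [h1]
    exact congrArg (fun φ => φ.hom f) h2
  -- the kernel on sections comes from the pushout of rings, affine intersections from separatedness,
  -- and the local generators of `𝒪(-D)` from those on the original curve
  refine ⟨hsurj, hsq, isHomeomorph_iff_isEmbedding_surjective.2
    ⟨Scheme.Hom.isEmbedding _, hf'.1⟩, inferInstance, fun V' => Scheme.Hom.app_surjective _ _ V'.2,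
    fun V' => ?_, flat_algebraMap π D b, flat_kaehler π D b, fun U' V' => ?_, fun x => ?_⟩
  · have h1 := isPushout_sections H (US := ⊤) (UT := ⊤) (UX := V'.1)
      (UY := (baseChangeHom (A := A) π D b).f ⁻¹ᵁ V'.1) le_top le_top
      (isAffineOpen_top _) (isAffineOpen_top _) V'.2 (inf_top_eq _).symm
    have h0 : ∀ x, (Spec.map (CommRingCat.ofHom (algebraMap A' A))).appLE ⊤ ⊤ le_top
        ((Scheme.ΓSpecIso (.of A')).inv.hom x) = (Scheme.ΓSpecIso (.of A)).inv.hom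
        (algebraMap A' A x) := by
      intro x
      have := Scheme.ΓSpecIso_inv_naturality (CommRingCat.ofHom (algebraMap A' A))
      rw [Scheme.Hom.appTop, Scheme.Hom.app_eq_appLE] at this
      exact (congrArg (fun φ => φ.hom x) this).symm
    have hinj := ((Scheme.ΓSpecIso (.of A)).symm.commRingCatIsoToRingEquiv.bijective).1
    have hsurj' := ((Scheme.ΓSpecIso (.of A')).symm.commRingCatIsoToRingEquiv.bijective).2
    have hsurj'' := ((Scheme.ΓSpecIso (.of A)).symm.commRingCatIsoToRingEquiv.bijective).2
    have h2 := ker_of_isPushout h1 (fun y => by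
      obtain ⟨y, rfl⟩ := hsurj'' y
      obtain ⟨y, rfl⟩ := hsurj y
      exact ⟨_, h0 y⟩)
    rw [Scheme.Hom.app_eq_appLE]
    refine h2.trans ?_
    apply le_antisymm
    · rw [Ideal.map_le_iff_le_comap]
      intro x hx
      obtain ⟨x, rfl⟩ := hsurj' x
      have h3 := (h0 x).symm.trans (RingHom.mem_ker.1 hx)
      exact Ideal.mem_map_of_mem (algebraMap A' Γ((baseChange π D b).X, V'.1))
        (RingHom.mem_ker.2 (hinj (h3.trans (map_zero _).symm)))
    · rw [Ideal.map_le_iff_le_comap]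
      intro x hx
      refine Ideal.mem_map_of_mem ((baseChange π D b).str.appLE ⊤ V'.1 _).hom
        (x := (Scheme.ΓSpecIso (.of A')).inv.hom x) ?_
      rw [RingHom.mem_ker]
      refine (h0 x).trans ?_
      rw [RingHom.mem_ker.1 hx, map_zero]
  · have h1 : IsSeparated (pullback.snd π b) := inferInstance
    have h2 : IsAffineHom (pullback.diagonal (pullback.snd π b)) := inferInstance
    exact isAffineHom_diagonal_iff.1 h2 ⊤ (isAffineOpen_top _) U'.1 le_top V'.1 le_top U'.2 V'.2
  · obtain ⟨_, ⟨W, hW, rfl⟩, hxW, -⟩ := B.isBasis_affineOpens.exists_subset_of_mem_open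
      (show π (baseChangeFst π D b x) ∈ ((⊤ : B.Opens) : Set B) from trivial) (⊤ : B.Opens).2
    obtain ⟨U, hxU, f, hfU⟩ := hD.exists_generator π D ⟨W, hW⟩ (baseChangeFst π D b x) hxW
    have hbW : b ⁻¹ᵁ W = ⊤ := by
      refine isOpen_eq_top_of_isLocalRing (R := .of A') _ ((baseChange π D b).str x) ?_
      have : π (baseChangeFst π D b x) = b ((baseChange π D b).str x) := by
        rw [← Scheme.Hom.comp_apply, (isPullback_baseChange π D b).w, Scheme.Hom.comp_apply]
      rw [this] at hxW
      exact hxW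
    have hbW' : (Spec.map (CommRingCat.ofHom (algebraMap A' A)) ≫ b) ⁻¹ᵁ W = ⊤ := by
      rw [Scheme.Hom.comp_preimage, hbW]
      rfl
    obtain ⟨_, ⟨V', hV', rfl⟩, hxV', hV'U⟩ :=
      (baseChange π D b).X.isBasis_affineOpens.exists_subset_of_mem_open
        (show x ∈ ((baseChangeFst π D b ⁻¹ᵁ U.1 : (baseChange π D b).X.Opens) : Set _) from hxU)
        (baseChangeFst π D b ⁻¹ᵁ U.1).2
    obtain ⟨h1, h2⟩ := hfU b hbW ⟨V', hV'⟩ hV'U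
    refine ⟨⟨V', hV'⟩, hxV', ⟨_, h2.ge (Ideal.mem_span_singleton_self _)⟩,
      isGen_of_span _ h1 h2 _ rfl, ?_⟩
    have e' : (baseChangeHom (A := A) π D b).f ⁻¹ᵁ V' ≤ baseChangeFst π D _ ⁻¹ᵁ U.1 := by
      rw [← baseChangeHom_fst, Scheme.Hom.comp_preimage]
      exact Scheme.Hom.preimage_mono _ hV'U
    obtain ⟨h3, h4⟩ := hfU (A := A) _ hbW'
      ⟨(baseChangeHom (A := A) π D b).f ⁻¹ᵁ V', hV'.preimage _⟩ e'
    exact isGen_of_span _ h3 h4 _ (hmapO U.1 V' hV'U e' f)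

end Thickening

/-! ### The topology of a smooth curve over an Artinian ring -/

section CurveTopology

/-- A ring standard smooth of relative dimension one over an Artinian ring has dimension at most
one, being quasi-finite over a polynomial ring in one variable. -/
theorem not_lt_lt_of_isStandardSmooth {R S : Type u} [CommRing R] [CommRing S] [IsArtinianRing R]
    (f : R →+* S) (hf : RingHom.IsStandardSmoothOfRelativeDimension 1 f)
    (p q r : PrimeSpectrum S) (hpq : p < q) (hqr : q < r) : False := by
  obtain ⟨g, -, hg⟩ := hf.exists_etale_mvPolynomial
  algebraize [g]
  have : Algebra.QuasiFinite (MvPolynomial (Fin 1) R) S := inferInstance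
  have key : ∀ p q : PrimeSpectrum S, p < q → PrimeSpectrum.comap g p < PrimeSpectrum.comap g q := by
    intro p q hpq
    refine lt_of_le_of_ne (Ideal.comap_mono hpq.le) fun h => hpq.ne (PrimeSpectrum.ext ?_)
    -- primes of a quasi-finite extension are incomparable within a fibre
    exact Algebra.QuasiFinite.eq_of_le_of_under_eq (R := MvPolynomial (Fin 1) R) p.asIdeal q.asIdeal
      hpq.le (congrArg PrimeSpectrum.asIdeal h)
  have h1 : ringKrullDim (MvPolynomial (Fin 1) R) ≤ 1 := by
    rw [MvPolynomial.ringKrullDim_of_isNoetherianRing]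
    have : ringKrullDim R ≤ 0 := by
      exact_mod_cast (Ring.krullDimLE_iff (n := 0)).1 inferInstance
    calc ringKrullDim R + (Nat.card (Fin 1) : ℕ) ≤ 0 + (Nat.card (Fin 1) : ℕ) := by gcongr
      _ = 1 := by simp
  let s : LTSeries (PrimeSpectrum (MvPolynomial (Fin 1) R)) :=
    { length := 2
      toFun := ![PrimeSpectrum.comap g p, PrimeSpectrum.comap g q, PrimeSpectrum.comap g r]
      step := fun i => by
        fin_cases i
        · exact key p q hpq
        · exact key q r hqr }
  have h2 : ((2 : ℕ) : WithBot ℕ∞) ≤ ringKrullDim (MvPolynomial (Fin 1) R) :=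
    Order.LTSeries.length_le_krullDim s
  have h3 := h2.trans h1
  norm_cast at h3

theorem isCurveLike_of_specializes {X : Type u} [TopologicalSpace X] [NoetherianSpace X]
    [IrreducibleSpace X] [QuasiSober X] [T0Space X]
    (h : ∀ x y z : X, x ⤳ y → y ⤳ z → x = y ∨ y = z) : IsCurveLike X := by
  have hcl : ∀ x : X, x ≠ genericPoint X → IsClosed {x} := by
    intro x hx
    rw [← closure_subset_iff_isClosed]
    intro y hy
    exact ((h _ x y (genericPoint_specializes x) (specializes_iff_mem_closure.2 hy)).resolve_left
      hx.symm).symm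
  refine ⟨genericPoint X, fun U hU hne => ?_, fun U hU hη => ?_, hcl⟩
  · obtain ⟨x, hx⟩ := hne
    exact (genericPoint_specializes x).mem_open hU hx
  · obtain ⟨S, hSf, hSc, hSi, hS⟩ :=
      NoetherianSpace.exists_finite_set_isClosed_irreducible hU.isClosed_compl
    rw [hS]
    refine hSf.sUnion fun t ht => ?_
    obtain ⟨z, hz⟩ := QuasiSober.sober (hSi t ht) (hSc t ht)
    have hzt : z ∈ t := hz.mem
    have hz' : z ≠ genericPoint X := by
      rintro rfl
      have : genericPoint X ∈ Uᶜ := by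
        rw [hS]
        exact ⟨t, ht, hzt⟩
      exact this hη
    have : t = {z} := by
      rw [← hz.def, (hcl z hz').closure_eq]
    rw [this]
    exact Set.finite_singleton z

theorem isCurveLike_of_smooth {A : Type u} [CommRing A] [IsLocalRing A] [IsArtinianRing A]
    {X : Scheme.{u}} (f : X ⟶ Spec (.of A)) [SmoothOfRelativeDimension 1 f]
    [QuasiCompact f] [GeometricallyIrreducible f] : IsCurveLike X := by
  have : Nonempty (Spec (.of A)) := ⟨IsLocalRing.closedPoint A⟩
  have h1 : IrreducibleSpace X := GeometricallyIrreducible.irreducibleSpace_of_subsingleton f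
  have h2 : Smooth f := SmoothOfRelativeDimension.smooth 1 f
  have h3 : IsLocallyNoetherian X := LocallyOfFiniteType.isLocallyNoetherian f
  have h4 : CompactSpace X := QuasiCompact.compactSpace_of_compactSpace f
  have h5 : IsNoetherian X := {}
  refine isCurveLike_of_specializes fun x y z hxy hyz => ?_
  obtain ⟨U, hU, V, hV, hzV, e, hf⟩ :=
    SmoothOfRelativeDimension.exists_isStandardSmoothOfRelativeDimension (n := 1) (f := f) z
  -- the spectrum of a local Artin ring is a point, so that an affine neighbourhood of `z` contains
  -- the whole chain of specializations and is standard smooth over the base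
  have hUtop : U = ⊤ := isOpen_eq_top_of_isLocalRing (R := .of A) U (f z) (e hzV)
  subst hUtop
  have : IsArtinianRing Γ(Spec (.of A), ⊤) :=
    ((Scheme.ΓSpecIso (.of A)).symm.commRingCatIsoToRingEquiv).surjective.isArtinianRing
  have hyV : y ∈ V := hyz.mem_open V.2 hzV
  have hxV : x ∈ V := hxy.mem_open V.2 hyV
  rw [← SetLike.mem_coe, ← hV.range_fromSpec] at hxV hyV hzV
  obtain ⟨p, rfl⟩ := hxV
  obtain ⟨q, rfl⟩ := hyV
  obtain ⟨r, rfl⟩ := hzV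
  have hind := hV.fromSpec.isOpenEmbedding.isInducing
  rw [hind.specializes_iff] at hxy hyz
  by_contra! hne
  refine not_lt_lt_of_isStandardSmooth _ hf p q r
    (lt_of_le_of_ne ((PrimeSpectrum.le_iff_specializes _ _).2 hxy) fun h => hne.1 (by rw [h]))
    (lt_of_le_of_ne ((PrimeSpectrum.le_iff_specializes _ _).2 hyz) fun h => hne.2 (by rw [h]))

theorem isCurveLike_baseChange {A : Type u} [CommRing A] [IsLocalRing A] [IsArtinianRing A]
    {B C : Scheme.{u}} (π : C ⟶ B) (D : C.IdealSheafData) (b : Spec (.of A) ⟶ B)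
    [SmoothOfRelativeDimension 1 π] [QuasiCompact π] [GeometricallyIntegral π] :
    IsCurveLike (baseChange π D b).X := by
  have : SmoothOfRelativeDimension 1 (pullback.snd π b) :=
    (smoothOfRelativeDimension_isStableUnderBaseChange 1).of_isPullback
      (IsPullback.of_hasPullback π b) inferInstance
  have h := isCurveLike_of_smooth (X := pullback π b) (pullback.snd π b)
  exact h

end CurveTopology

/-! ### Localization of tensor products and of differentials -/

section Away

/-- A semilinear map over `ψ : R → S` which exhibits its target as the localization of its source
away from `g`, when `ψ` is the localization away from `g`. -/
def IsAwayMap {R S : Type*} [CommRing R] [CommRing S] {ψ : R →+* S} (g : R) {M N : Type*}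
    [AddCommGroup M] [AddCommGroup N] [Module R M] [Module S N] (f : M →ₛₗ[ψ] N) : Prop :=
  (∀ x, f x = 0 → ∃ k : ℕ, g ^ k • x = 0) ∧ ∀ y, ∃ (k : ℕ) (x : M), f x = ψ g ^ k • y

variable {R S : Type u} [CommRing R] [CommRing S] [Algebra R S] {g : R}

theorem isAwayMap_of_isLocalizedModule {M N : Type u} [AddCommGroup M] [AddCommGroup N]
    [Module R M] [Module R N] [Module S N] [IsScalarTower R S N] (f : M →ₛₗ[algebraMap R S] N)
    (f' : M →ₗ[R] N) (hf : ∀ x, f x = f' x) [IsLocalizedModule (Submonoid.powers g) f'] :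
    IsAwayMap g f := by
  refine ⟨fun x hx => ?_, fun y => ?_⟩
  · rw [hf] at hx
    obtain ⟨⟨_, k, rfl⟩, hk⟩ := (IsLocalizedModule.eq_zero_iff (Submonoid.powers g) f').1 hx
    exact ⟨k, hk⟩
  · obtain ⟨⟨x, ⟨_, k, rfl⟩⟩, hk⟩ := IsLocalizedModule.surj (Submonoid.powers g) f' y
    refine ⟨k, x, ?_⟩
    rw [hf, ← hk, ← map_pow, algebraMap_smul]
    rfl

theorem IsAwayMap.isLocalizedModule [IsLocalization.Away g S] {M N : Type u} [AddCommGroup M]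
    [AddCommGroup N] [Module R M] [Module R N] [Module S N] [IsScalarTower R S N]
    {f : M →ₛₗ[algebraMap R S] N} (h : IsAwayMap g f) (f' : M →ₗ[R] N) (hf : ∀ x, f x = f' x) :
    IsLocalizedModule (Submonoid.powers g) f' where
  map_units := by
    rintro ⟨_, k, rfl⟩
    have h0 : IsUnit (algebraMap R S (g ^ k)) := by
      rw [map_pow]; exact (IsLocalization.Away.algebraMap_isUnit g).pow k
    have h1 := h0.map (algebraMap S (Module.End S N))
    rw [Module.End.isUnit_iff] at h1 ⊢
    convert h1 using 1
    funext x
    exact (algebraMap_smul S (g ^ k) x).symm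
  surj y := by
    obtain ⟨k, x, hx⟩ := h.2 y
    refine ⟨⟨x, ⟨_, k, rfl⟩⟩, ?_⟩
    rw [← hf, hx, ← map_pow, algebraMap_smul]
    rfl
  exists_of_eq := by
    intro x x' hx
    obtain ⟨k, hk⟩ := h.1 (x - x') (by rw [map_sub, hf, hf, hx, sub_self])
    refine ⟨⟨_, k, rfl⟩, ?_⟩
    rw [smul_sub, sub_eq_zero] at hk
    exact hk

/-- Localization commutes with tensor products. -/
theorem IsAwayMap.tensor {R S : Type u} [CommRing R] [CommRing S] {ψ : R →+* S} {g : R}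
    (hψ : letI := ψ.toAlgebra; IsLocalization.Away g S) {M N M' N' : Type u} [AddCommGroup M]
    [AddCommGroup N] [Module R M] [Module S N] [AddCommGroup M'] [AddCommGroup N'] [Module R M']
    [Module S N'] {f : M →ₛₗ[ψ] N} {f' : M' →ₛₗ[ψ] N'} (h : IsAwayMap g f) (h' : IsAwayMap g f') :
    IsAwayMap g (TensorProduct.map f f') := by
  letI := ψ.toAlgebra
  letI : Module R N := Module.compHom _ ψ
  letI : Module R N' := Module.compHom _ ψ
  haveI : IsScalarTower R S N := ⟨fun a b c => by rw [Algebra.smul_def, mul_smul]; rfl⟩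
  haveI : IsScalarTower R S N' := ⟨fun a b c => by rw [Algebra.smul_def, mul_smul]; rfl⟩
  let l : M →ₗ[R] N := { toFun := f, map_add' := map_add f, map_smul' := fun r x => f.map_smulₛₗ r x }
  let l' : M' →ₗ[R] N' :=
    { toFun := f', map_add' := map_add f', map_smul' := fun r x => f'.map_smulₛₗ r x }
  haveI := h.isLocalizedModule l fun _ => rfl
  haveI := h'.isLocalizedModule l' fun _ => rfl
  haveI := IsLocalization.tensorProduct_compatibleSMul (Submonoid.powers g) S N N'
  let e : N ⊗[S] N' ≃ₗ[R] N ⊗[R] N' :=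
    (IsLocalization.moduleTensorEquiv (Submonoid.powers g) S N N').restrictScalars R
  haveI := IsLocalizedModule.of_linearEquiv (Submonoid.powers g) (TensorProduct.map l l') e.symm
  refine isAwayMap_of_isLocalizedModule (S := S) _ (e.symm.toLinearMap ∘ₗ TensorProduct.map l l')
    fun x => ?_
  induction x using TensorProduct.induction_on with
  | zero => rw [map_zero, map_zero]
  | tmul x y => rfl
  | add x y hx hy => rw [map_add, map_add, hx, hy]

/-- Localization commutes with extension of scalars along a tensor product over a base ring. -/
theorem IsAwayMap.rTensor {A R S : Type u} [CommRing A] [CommRing R] [CommRing S] [Algebra A R]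
    [Algebra A S] {ψ : R →+* S} (hψA : ∀ a, ψ (algebraMap A R a) = algebraMap A S a) {g : R}
    (hψ : letI := ψ.toAlgebra; IsLocalization.Away g S) {M N P : Type u} [AddCommGroup M]
    [AddCommGroup N] [Module R M] [Module S N] [Module A M] [Module A N] [IsScalarTower A R M]
    [IsScalarTower A S N] [AddCommGroup P] [Module A P] {f : M →ₛₗ[ψ] N} (h : IsAwayMap g f)
    (f' : M →ₗ[A] N) (hf : ∀ x, f x = f' x) (F : M ⊗[A] P →ₛₗ[ψ] N ⊗[A] P)
    (hF : ∀ x, F x = f'.rTensor P x) : IsAwayMap g F := by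
  letI := ψ.toAlgebra
  haveI : IsScalarTower A R S := .of_algebraMap_eq fun a => (hψA a).symm
  letI : Module R N := Module.compHom _ ψ
  haveI : IsScalarTower R S N := ⟨fun a b c => by rw [Algebra.smul_def, mul_smul]; rfl⟩
  haveI : IsScalarTower A R N := ⟨fun a b c => by
    rw [Algebra.smul_def, mul_smul, ← algebraMap_smul S a, ← hψA]; rfl⟩
  let l : M →ₗ[R] N := { toFun := f, map_add' := map_add f, map_smul' := fun r x => f.map_smulₛₗ r x }
  haveI := h.isLocalizedModule l fun _ => rfl
  haveI : IsScalarTower R S (N ⊗[A] P) := ⟨fun a b c => by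
    induction c using TensorProduct.induction_on with
    | zero => simp
    | tmul x y => rw [TensorProduct.smul_tmul', TensorProduct.smul_tmul', TensorProduct.smul_tmul',
        smul_assoc]
    | add x y hx hy => rw [smul_add, smul_add, smul_add, hx, hy]⟩
  refine isAwayMap_of_isLocalizedModule (S := S) F
    (TensorProduct.AlgebraTensorModule.rTensor A P l) fun x => ?_
  rw [hF]
  induction x using TensorProduct.induction_on with
  | zero => rw [map_zero, map_zero]
  | tmul x y => 
    rw [LinearMap.rTensor_tmul, ← hf]
    rfl
  | add x y hx hy => rw [map_add, map_add, hx, hy]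

theorem kaehlerMap_D {A₁ A₂ R₁ R₂ : Type u} [CommRing A₁] [CommRing A₂] [CommRing R₁] [CommRing R₂]
    [Algebra A₁ R₁] [Algebra A₂ R₂] (φ : A₁ →+* A₂) (ψ : R₁ →+* R₂)
    (h : ∀ a, ψ (algebraMap A₁ R₁ a) = algebraMap A₂ R₂ (φ a)) (r : R₁) :
    kaehlerMap φ ψ h (KaehlerDifferential.D A₁ R₁ r) = KaehlerDifferential.D A₂ R₂ (ψ r) := by
  letI := φ.toAlgebra
  letI := ψ.toAlgebra
  letI := ((algebraMap A₂ R₂).comp φ).toAlgebra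
  haveI : IsScalarTower A₁ A₂ R₂ := .of_algebraMap_eq fun _ => rfl
  haveI : IsScalarTower A₁ R₁ R₂ := .of_algebraMap_eq fun a => (h a).symm
  exact KaehlerDifferential.map_D A₁ A₂ R₁ R₂ r

/-- Semilinear maps out of a module of differentials are determined by their values on exact
differentials. -/
theorem kaehler_hom_ext {A R S N : Type*} [CommRing A] [CommRing R] [CommRing S] [Algebra A R]
    [AddCommGroup N] [Module S N] {ψ : R →+* S} {f f' : Ω[R⁄A] →ₛₗ[ψ] N}
    (h : ∀ r, f (KaehlerDifferential.D A R r) = f' (KaehlerDifferential.D A R r)) : f = f' := by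
  refine LinearMap.ext fun x => ?_
  have hx : x ∈ Submodule.span R (Set.range (KaehlerDifferential.D A R)) := by
    rw [KaehlerDifferential.span_range_derivation]; trivial
  induction hx using Submodule.span_induction with
  | mem x hx => obtain ⟨r, rfl⟩ := hx; exact h r
  | zero => rw [map_zero, map_zero]
  | add x y _ _ hx hy => rw [map_add, map_add, hx, hy]
  | smul r x _ hx => rw [f.map_smulₛₗ, f'.map_smulₛₗ, hx]

theorem isAwayMap_kaehlerMap {A R S : Type u} [CommRing A] [CommRing R] [CommRing S] [Algebra A R]
    [Algebra A S] {ψ : R →+* S} (hψA : ∀ a, ψ (algebraMap A R a) = algebraMap A S a) {g : R}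
    (hψ : letI := ψ.toAlgebra; IsLocalization.Away g S) :
    IsAwayMap g (kaehlerMap (RingHom.id A) ψ hψA) := by
  letI := ψ.toAlgebra
  haveI : IsScalarTower A R S := .of_algebraMap_eq fun a => (hψA a).symm
  let l : Ω[R⁄A] →ₛₗ[ψ] Ω[S⁄A] :=
    { toFun := KaehlerDifferential.map A A R S
      map_add' := map_add _
      map_smul' := fun r x => by
        rw [map_smul]
        exact (algebraMap_smul S r _).symm }
  have hl : kaehlerMap (RingHom.id A) ψ hψA = l := kaehler_hom_ext fun r => by
    rw [kaehlerMap_D]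
    exact (KaehlerDifferential.map_D A A R S r).symm
  rw [hl]
  haveI := KaehlerDifferential.isLocalizedModule_map A R S (Submonoid.powers g)
  exact isAwayMap_of_isLocalizedModule (S := S) (f := l) (KaehlerDifferential.map A A R S)
    fun _ => rfl

end Away

/-! ### Gluing for quasi-coherent families of modules on affine open sets -/

section AffModules

variable {A : Type u} [CommRing A] {C : PolarScheme A}

/-- The conditions on a family of modules over the affine open sets, with restriction maps, for it
to come from a quasi-coherent sheaf: restriction is functorial and semilinear, and restriction to a
basic open set is a localization. -/
structure AffModule.IsQCoh (N : AffModule C) : Prop where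
  res_smul : ∀ {V' V : C.X.affineOpens} (h : V' ≤ V) (r : Γ(C.X, V.1)) (x : N.obj V),
    N.res h (r • x) = resO C h r • N.res h x
  res_self : ∀ {V : C.X.affineOpens} (h : V ≤ V) (x : N.obj V), N.res h x = x
  res_res : ∀ {V V' V'' : C.X.affineOpens} (h : V' ≤ V) (h' : V'' ≤ V') (x : N.obj V),
    N.res h' (N.res h x) = N.res (h'.trans h) x
  eq_zero : ∀ {V : C.X.affineOpens} (f : Γ(C.X, V.1)) (x : N.obj V),
    N.res (C.X.affineBasicOpen_le f) x = 0 → ∃ k : ℕ, f ^ k • x = 0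
  extend : ∀ {V : C.X.affineOpens} (f : Γ(C.X, V.1)) (y : N.obj (C.X.affineBasicOpen f)),
    ∃ (k : ℕ) (x : N.obj V), N.res (C.X.affineBasicOpen_le f) x =
      resO C (C.X.affineBasicOpen_le f) f ^ k • y

theorem exists_partition {R : Type*} [CommRing R] {t : Finset R}
    (ht : Ideal.span (t : Set R) = ⊤) (k : ℕ) : ∃ h : R → R, ∑ f ∈ t, h f * f ^ k = 1 := by
  classical
  have h1 : (1 : R) ∈ Ideal.span ((fun x => x ^ k) '' (t : Set R)) := by
    rw [Ideal.span_pow_eq_top _ ht k]; trivial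
  obtain ⟨c, hc⟩ := (Submodule.mem_span_image_finset_iff_exists_fun R).1 h1
  refine ⟨fun f => if h : f ∈ t then c ⟨f, h⟩ else 0, ?_⟩
  rw [← Finset.sum_attach, ← hc]
  exact Finset.sum_congr rfl fun f _ => by simp

/-- A family of affine open sets is a cover basis of an affine open set if it is closed under
passage to smaller affine open sets and covers; a finite number of basic open sets then suffices to
cover. -/
theorem exists_finset_basicOpen {X : Scheme.{u}} (V : X.affineOpens) {𝔅 : Set X.affineOpens}
    (hdown : ∀ T₁ T₂ : X.affineOpens, T₁ ≤ T₂ → T₂ ∈ 𝔅 → T₁ ∈ 𝔅)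
    (hcov : ∀ x ∈ V.1, ∃ T ∈ 𝔅, x ∈ T.1) :
    ∃ t : Finset Γ(X, V.1), Ideal.span (t : Set Γ(X, V.1)) = ⊤ ∧
      ∀ f ∈ t, X.affineBasicOpen f ∈ 𝔅 := by
  have h1 : Ideal.span {f : Γ(X, V.1) | X.affineBasicOpen f ∈ 𝔅} = ⊤ := by
    rw [← V.2.self_le_iSup_basicOpen_iff]
    intro x hx
    obtain ⟨T, hT, hxT⟩ := hcov x hx
    obtain ⟨f, hf, hxf⟩ := V.2.exists_basicOpen_le (V := T.1) ⟨x, hxT⟩ hx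
    rw [Opens.mem_iSup]
    exact ⟨⟨f, hdown _ T hf hT⟩, hxf⟩
  obtain ⟨t, ht, ht'⟩ := (Ideal.span_eq_top_iff_finite _).1 h1
  exact ⟨t, ht', fun f hf => ht hf⟩

namespace AffModule.IsQCoh

variable {N : AffModule C} (hN : N.IsQCoh)

include hN

theorem cancel {V : C.X.affineOpens} (f : Γ(C.X, V.1)) (k : ℕ)
    {x y : N.obj (C.X.affineBasicOpen f)}
    (h : resO C (C.X.affineBasicOpen_le f) f ^ k • x = resO C (C.X.affineBasicOpen_le f) f ^ k • y) :
    x = y := by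
  have hu : IsUnit (resO C (C.X.affineBasicOpen_le f) f) :=
    C.X.toRingedSpace.isUnit_res_basicOpen f
  exact (hu.pow k).smul_left_cancel.1 h

theorem ext_basic {V : C.X.affineOpens} {t : Finset Γ(C.X, V.1)}
    (ht : Ideal.span (t : Set Γ(C.X, V.1)) = ⊤) {x : N.obj V}
    (h : ∀ f ∈ t, N.res (C.X.affineBasicOpen_le f) x = 0) : x = 0 := by
  choose! k hk using fun f hf => hN.eq_zero f x (h f hf)
  obtain ⟨c, hc⟩ := exists_partition ht (t.sup k)
  rw [← one_smul Γ(C.X, V.1) x, ← hc, Finset.sum_smul]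
  refine Finset.sum_eq_zero fun f hf => ?_
  rw [← Nat.sub_add_cancel (Finset.le_sup (f := k) hf), pow_add, mul_smul, mul_smul, hk f hf,
    smul_zero, smul_zero]

/-- Sections are determined by their restrictions to a cover. -/
theorem ext {V : C.X.affineOpens} {𝔅 : Set C.X.affineOpens}
    (hdown : ∀ T₁ T₂ : C.X.affineOpens, T₁ ≤ T₂ → T₂ ∈ 𝔅 → T₁ ∈ 𝔅)
    (hcov : ∀ x ∈ V.1, ∃ T ∈ 𝔅, x ∈ T.1) {x y : N.obj V}
    (h : ∀ (T : C.X.affineOpens) (_ : T ∈ 𝔅) (hT : T ≤ V), N.res hT x = N.res hT y) : x = y := by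
  obtain ⟨t, ht, hf⟩ := exists_finset_basicOpen V hdown hcov
  refine sub_eq_zero.1 (hN.ext_basic ht fun f hft => ?_)
  rw [map_sub, h _ (hf f hft), sub_self]

/-- Sections over the members of a cover glue. -/
theorem glue {V : C.X.affineOpens} {𝔅 : Set C.X.affineOpens}
    (hdown : ∀ T₁ T₂ : C.X.affineOpens, T₁ ≤ T₂ → T₂ ∈ 𝔅 → T₁ ∈ 𝔅)
    (hcov : ∀ x ∈ V.1, ∃ T ∈ 𝔅, x ∈ T.1)
    (y : ∀ T : C.X.affineOpens, T ∈ 𝔅 → T ≤ V → N.obj T)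
    (hy : ∀ (T₁ T₂ : C.X.affineOpens) (h : T₁ ≤ T₂) (m₁ : T₁ ∈ 𝔅) (m₂ : T₂ ∈ 𝔅) (l₁ : T₁ ≤ V)
      (l₂ : T₂ ≤ V), N.res h (y T₂ m₂ l₂) = y T₁ m₁ l₁) :
    ∃ x : N.obj V, ∀ T m (l : T ≤ V), N.res l x = y T m l := by
  classical
  obtain ⟨t, ht, hf⟩ := exists_finset_basicOpen V hdown hcov
  have hle : ∀ f : Γ(C.X, V.1), C.X.affineBasicOpen f ≤ V := fun f => C.X.affineBasicOpen_le f
  choose! k x hx using fun f (hft : f ∈ t) => hN.extend f (y _ (hf f hft) (hle f))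
  -- a common exponent
  obtain ⟨K, x₁, h1⟩ : ∃ (K : ℕ) (x₁ : Γ(C.X, V.1) → N.obj V), ∀ f (hft : f ∈ t),
      N.res (hle f) (x₁ f) = resO C (hle f) f ^ K • y _ (hf f hft) (hle f) := by
    refine ⟨t.sup k, fun f => f ^ (t.sup k - k f) • x f, fun f hft => ?_⟩
    rw [hN.res_smul, hx f hft, map_pow, smul_smul, ← pow_add,
      Nat.sub_add_cancel (Finset.le_sup (f := k) hft)]
  have h2 : ∀ p : Γ(C.X, V.1) × Γ(C.X, V.1), p ∈ t ×ˢ t → ∃ m : ℕ,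
      (p.1 * p.2) ^ m • (p.2 ^ K • x₁ p.1 - p.1 ^ K • x₁ p.2) = 0 := by
    rintro ⟨f, g⟩ hp
    obtain ⟨hft, hgt⟩ := Finset.mem_product.1 hp
    refine hN.eq_zero (f * g) _ ?_
    have lf : C.X.affineBasicOpen (f * g) ≤ C.X.affineBasicOpen f := by
      change C.X.basicOpen (f * g) ≤ C.X.basicOpen f
      rw [Scheme.basicOpen_mul]; exact inf_le_left
    have lg : C.X.affineBasicOpen (f * g) ≤ C.X.affineBasicOpen g := by
      change C.X.basicOpen (f * g) ≤ C.X.basicOpen g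
      rw [Scheme.basicOpen_mul]; exact inf_le_right
    have mm := hdown _ _ lf (hf f hft)
    have e1 : N.res (hle (f * g)) (x₁ f) = resO C (hle (f * g)) f ^ K • y _ mm (hle _) := by
      rw [← hN.res_res (hle f) lf, h1 f hft, hN.res_smul, hy _ _ lf mm (hf f hft) (hle _), map_pow]
      congr 2
      exact rs_rs _ _ _
    have e2 : N.res (hle (f * g)) (x₁ g) = resO C (hle (f * g)) g ^ K • y _ mm (hle _) := by
      rw [← hN.res_res (hle g) lg, h1 g hgt, hN.res_smul, hy _ _ lg mm (hf g hgt) (hle _), map_pow]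
      congr 2
      exact rs_rs _ _ _
    change N.res (hle (f * g)) (g ^ K • x₁ f - f ^ K • x₁ g) = 0
    rw [map_sub, hN.res_smul, hN.res_smul, e1, e2, map_pow, map_pow, smul_smul, smul_smul,
      mul_comm (resO C (hle (f * g)) g ^ K),
      sub_self]
  choose! m hm using h2
  obtain ⟨M, hM⟩ : ∃ M : ℕ, ∀ p ∈ t ×ˢ t, m p ≤ M := ⟨_, fun p hp => Finset.le_sup (f := m) hp⟩
  -- now the numerators agree on overlaps
  have h3 : ∀ f ∈ t, ∀ g ∈ t, g ^ (K + M) • (f ^ M • x₁ f) = f ^ (K + M) • (g ^ M • x₁ g) := by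
    intro f hft g hgt
    have hp : (f, g) ∈ t ×ˢ t := Finset.mem_product.2 ⟨hft, hgt⟩
    have h4 : (f * g) ^ M • (g ^ K • x₁ f - f ^ K • x₁ g) = 0 := by
      rw [← Nat.sub_add_cancel (hM _ hp), pow_add, mul_smul, hm (f, g) hp,
        smul_zero]
    rw [smul_sub, sub_eq_zero, smul_smul, smul_smul] at h4
    rw [smul_smul, smul_smul]
    convert h4 using 2 <;> ring
  obtain ⟨c, hc⟩ := exists_partition ht (K + M)
  have h5 : ∀ f (hft : f ∈ t), N.res (hle f) (∑ g ∈ t, c g • (g ^ M • x₁ g)) =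
      y _ (hf f hft) (hle f) := by
    intro f hft
    refine hN.cancel f (K + M) ?_
    have h6 : f ^ (K + M) • ∑ g ∈ t, c g • (g ^ M • x₁ g) = f ^ M • x₁ f := by
      rw [Finset.smul_sum]
      calc _ = ∑ g ∈ t, (c g * g ^ (K + M)) • (f ^ M • x₁ f) := Finset.sum_congr rfl fun g hg => by
            rw [smul_comm, ← h3 f hft g hg, smul_smul]
        _ = _ := by rw [← Finset.sum_smul, hc, one_smul]
    have h7 := congrArg (N.res (hle f)) h6
    rw [hN.res_smul, hN.res_smul, h1 f hft, map_pow, map_pow, smul_smul, ← pow_add, add_comm M K]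
      at h7
    exact h7
  refine ⟨∑ g ∈ t, c g • (g ^ M • x₁ g), fun T mT l => ?_⟩
  refine hN.ext (𝔅 := {S | ∃ f ∈ t, S ≤ C.X.affineBasicOpen f})
    (fun T₁ T₂ h ⟨f, hft, hT⟩ => ⟨f, hft, h.trans hT⟩) (fun p hp => ?_) fun S hS hST => ?_
  · have := (V.2.self_le_iSup_basicOpen_iff (s := (t : Set Γ(C.X, V.1)))).2 ht (l hp)
    obtain ⟨⟨f, hft⟩, hpf⟩ := Opens.mem_iSup.1 this
    exact ⟨C.X.affineBasicOpen f, ⟨f, hft, le_rfl⟩, hpf⟩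
  · obtain ⟨f, hft, hSf⟩ := hS
    rw [hN.res_res, ← hN.res_res (hle f) hSf, h5 f hft, hy S _ hSf (hdown _ _ hST mT) (hf f hft)
      (hST.trans l) (hle f), hy S T hST (hdown _ _ hST mT) mT (hST.trans l) l]

end AffModule.IsQCoh

end AffModules

/-! ### The family `F ⊗ Ω` is quasi-coherent -/

section BundleQCoh

variable {X : Scheme.{u}} {F : X.Modules} {n : ℕ}

theorem IsFrame.exists_pow_smul_eq_zero {U : X.Opens} {b : Fin n → Γ(F, U)} (hb : IsFrame F b)
    {T O : X.Opens} (hT : IsAffineOpen T) (hTU : T ≤ U) (g : Γ(X, T)) (hO : O = X.basicOpen g)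
    (hOT : O ≤ T) {s : Γ(F, T)} (hs : rF F hOT s = 0) : ∃ k : ℕ, g ^ k • s = 0 := by
  letI := (rs hOT).toAlgebra
  haveI : IsLocalization.Away g Γ(X, O) := hT.isLocalization_of_eq_basicOpen g (homOfLE hOT) hO
  have h1 : ∀ j, ∃ k : ℕ, g ^ k * (hb.basis hTU).repr s j = 0 := fun j => by
    have h2 := hb.rF_repr hTU hOT s j
    rw [hs, map_zero] at h2
    obtain ⟨⟨_, k, rfl⟩, hk⟩ := (IsLocalization.map_eq_zero_iff (Submonoid.powers g) Γ(X, O) _).1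
      h2.symm
    exact ⟨k, hk⟩
  choose k hk using h1
  refine ⟨Finset.univ.sup k, (hb.basis hTU).repr.injective (Finsupp.ext fun j => ?_)⟩
  rw [map_smul, map_zero, Finsupp.smul_apply, smul_eq_mul,
    ← Nat.sub_add_cancel (Finset.le_sup (f := k) (Finset.mem_univ j)), pow_add, mul_assoc, hk,
    mul_zero]
  rfl

theorem IsFrame.exists_extension {U : X.Opens} {b : Fin n → Γ(F, U)} (hb : IsFrame F b)
    {T O : X.Opens} (hT : IsAffineOpen T) (hTU : T ≤ U) (g : Γ(X, T)) (hO : O = X.basicOpen g)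
    (hOT : O ≤ T) (y : Γ(F, O)) : ∃ (k : ℕ) (s : Γ(F, T)), rF F hOT s = rs hOT g ^ k • y := by
  letI := (rs hOT).toAlgebra
  haveI : IsLocalization.Away g Γ(X, O) := hT.isLocalization_of_eq_basicOpen g (homOfLE hOT) hO
  have h1 : ∀ j, ∃ (k : ℕ) (r : Γ(X, T)), rs hOT r =
      rs hOT g ^ k * (hb.basis (hOT.trans hTU)).repr y j := fun j => by
    obtain ⟨⟨r, ⟨_, k, rfl⟩⟩, hk⟩ := IsLocalization.surj (Submonoid.powers g)
      ((hb.basis (hOT.trans hTU)).repr y j)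
    refine ⟨k, r, ?_⟩
    rw [← map_pow, mul_comm]
    exact hk.symm
  choose k r hr using h1
  refine ⟨Finset.univ.sup k, ∑ j, (g ^ (Finset.univ.sup k - k j) * r j) • hb.basis hTU j, ?_⟩
  conv_rhs => rw [← (hb.basis (hOT.trans hTU)).sum_repr y]
  rw [map_sum, Finset.smul_sum]
  refine Finset.sum_congr rfl fun j _ => ?_
  rw [rF_smul, map_mul, hr, hb.basis_apply, hb.basis_apply, rF_rF, smul_smul, ← mul_assoc, map_pow,
    ← pow_add, Nat.sub_add_cancel (Finset.le_sup (f := k) (Finset.mem_univ j))]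

theorem IsVectorBundle.exists_cover (hF : IsVectorBundle n F) (V : X.affineOpens) :
    ∃ t : Finset Γ(X, V.1), Ideal.span (t : Set Γ(X, V.1)) = ⊤ ∧
      ∀ f ∈ t, ∃ b : Fin n → Γ(F, X.basicOpen f), IsFrame F b := by
  refine exists_finset_basicOpen V
    (𝔅 := {T : X.affineOpens | ∃ b : Fin n → Γ(F, T.1), IsFrame F b}) ?_ ?_
  · rintro T₁ T₂ h ⟨b, hb⟩
    exact ⟨_, hb.restrict h⟩
  · intro x _
    obtain ⟨U, hxU, b, hb⟩ := hF x
    obtain ⟨_, ⟨T, hT, rfl⟩, hxT, hTU⟩ := X.isBasis_affineOpens.exists_subset_of_mem_open hxU U.2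
    exact ⟨⟨T, hT⟩, ⟨_, hb.restrict hTU⟩, hxT⟩

theorem mem_of_span_eq_top {V : X.affineOpens} {t : Finset Γ(X, V.1)}
    (ht : Ideal.span (t : Set Γ(X, V.1)) = ⊤) {x : X} (hx : x ∈ V.1) :
    ∃ f : t, x ∈ X.basicOpen f.1 := by
  have := (V.2.self_le_iSup_basicOpen_iff (s := (t : Set Γ(X, V.1)))).2 ht hx
  obtain ⟨⟨f, hft⟩, hpf⟩ := Opens.mem_iSup.1 this
  exact ⟨⟨f, hft⟩, hpf⟩

theorem IsVectorBundle.exists_pow_smul_eq_zero (hF : IsVectorBundle n F) {V : X.affineOpens}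
    (g : Γ(X, V.1)) (s : Γ(F, V.1)) (hs : rF F (X.basicOpen_le g) s = 0) :
    ∃ k : ℕ, g ^ k • s = 0 := by
  obtain ⟨t, ht, hb⟩ := hF.exists_cover V
  have h1 : ∀ f ∈ t, ∃ k : ℕ, rF F (X.basicOpen_le f) (g ^ k • s) = 0 := fun f hf => by
    obtain ⟨b, hb⟩ := hb f hf
    obtain ⟨k, hk⟩ := hb.exists_pow_smul_eq_zero (V.2.basicOpen f) le_rfl
      (rs (X.basicOpen_le f) g) (X.basicOpen_res g (homOfLE (X.basicOpen_le f)).op).symm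
      inf_le_left (s := rF F (X.basicOpen_le f) s) (by
        rw [rF_rF, ← rF_rF F (X.basicOpen_le g) (inf_le_right), hs, map_zero])
    exact ⟨k, by rw [rF_smul, map_pow, hk]⟩
  choose! k hk using h1
  refine ⟨t.sup k, section_ext F (fun f : t => X.basicOpen f.1) (fun f => X.basicOpen_le f.1)
    (fun x hx => mem_of_span_eq_top ht hx) fun f => ?_⟩
  rw [← Nat.sub_add_cancel (Finset.le_sup (f := k) f.2), pow_add, mul_smul, rF_smul, hk _ f.2,
    smul_zero, map_zero]

theorem IsVectorBundle.exists_extension (hF : IsVectorBundle n F) {V : X.affineOpens}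
    (g : Γ(X, V.1)) (y : Γ(F, X.basicOpen g)) :
    ∃ (k : ℕ) (s : Γ(F, V.1)), rF F (X.basicOpen_le g) s = rs (X.basicOpen_le g) g ^ k • y := by
  obtain ⟨t, ht, hb⟩ := hF.exists_cover V
  have hV : ∀ f : Γ(X, V.1), X.basicOpen f ⊓ X.basicOpen g ≤ V.1 := fun f =>
    inf_le_left.trans (X.basicOpen_le f)
  have hl : ∀ f : Γ(X, V.1), X.basicOpen f ⊓ X.basicOpen g ≤ X.basicOpen f := fun f => inf_le_left
  have hr : ∀ f : Γ(X, V.1), X.basicOpen f ⊓ X.basicOpen g ≤ X.basicOpen g := fun f => inf_le_right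
  have h1 : ∀ f ∈ t, ∃ (k : ℕ) (x : Γ(F, X.basicOpen f)),
      rF F (hl f) x = rs (hV f) g ^ k • rF F (hr f) y := fun f hf => by
    obtain ⟨b, hb⟩ := hb f hf
    obtain ⟨k, x, hx⟩ := hb.exists_extension (V.2.basicOpen f) le_rfl
      (rs (X.basicOpen_le f) g) (X.basicOpen_res g (homOfLE (X.basicOpen_le f)).op).symm
      (hl f) (rF F (hr f) y)
    rw [rs_rs] at hx
    exact ⟨k, x, hx⟩
  choose! k x hx using h1
  obtain ⟨K, x₁, h1⟩ : ∃ (K : ℕ) (x₁ : ∀ f : t, Γ(F, X.basicOpen f.1)), ∀ f : t,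
      rF F (hl f.1) (x₁ f) = rs (hV f.1) g ^ K • rF F (hr f.1) y := by
    refine ⟨t.sup k, fun f => rs (X.basicOpen_le f.1) g ^ (t.sup k - k f.1) • x f.1, fun f => ?_⟩
    rw [rF_smul, hx _ f.2, map_pow, rs_rs, smul_smul, ← pow_add,
      Nat.sub_add_cancel (Finset.le_sup (f := k) f.2)]
  have hV' : ∀ f f' : Γ(X, V.1), X.basicOpen f ⊓ X.basicOpen f' ≤ V.1 := fun f f' =>
    inf_le_left.trans (X.basicOpen_le f)
  have h2 : ∀ p : t × t, ∃ m : ℕ, rs (hV' p.1.1 p.2.1) g ^ m •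
      (rF F (inf_le_left : X.basicOpen p.1.1 ⊓ X.basicOpen p.2.1 ≤ X.basicOpen p.1.1) (x₁ p.1) -
        rF F (inf_le_right : X.basicOpen p.1.1 ⊓ X.basicOpen p.2.1 ≤ X.basicOpen p.2.1)
          (x₁ p.2)) = 0 := by
    rintro ⟨f, f'⟩
    obtain ⟨b, hb⟩ := hb f.1 f.2
    have haff : IsAffineOpen (X.basicOpen f.1 ⊓ X.basicOpen f'.1) := by
      rw [← Scheme.basicOpen_mul]
      exact V.2.basicOpen _
    refine hb.exists_pow_smul_eq_zero haff inf_le_left (rs (hV' f.1 f'.1) g)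
      (X.basicOpen_res g (homOfLE (hV' f.1 f'.1)).op).symm inf_le_left ?_
    have e1 := congrArg (rF F (le_inf (inf_le_left.trans inf_le_left) inf_le_right :
      X.basicOpen f.1 ⊓ X.basicOpen f'.1 ⊓ X.basicOpen g ≤ _)) (h1 f)
    have e2 := congrArg (rF F (le_inf (inf_le_left.trans inf_le_right) inf_le_right :
      X.basicOpen f.1 ⊓ X.basicOpen f'.1 ⊓ X.basicOpen g ≤ _)) (h1 f')
    rw [rF_rF, rF_smul, rF_rF, map_pow, rs_rs] at e1 e2
    rw [map_sub, rF_rF, rF_rF, e1, e2, sub_self]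
  choose m hm using h2
  obtain ⟨M, hM⟩ : ∃ M : ℕ, ∀ p, m p ≤ M :=
    ⟨Finset.univ.sup m, fun p => Finset.le_sup (Finset.mem_univ p)⟩
  obtain ⟨s, hs⟩ := exists_section F (fun f : t => X.basicOpen f.1) (fun f => X.basicOpen_le f.1)
    (fun x hx => mem_of_span_eq_top ht hx) (fun f => rs (X.basicOpen_le f.1) g ^ M • x₁ f)
    (fun f f' => by
      rw [rF_smul, rF_smul, map_pow, map_pow, rs_rs, rs_rs, ← sub_eq_zero, ← smul_sub,
        ← Nat.sub_add_cancel (hM (f, f')), pow_add, mul_smul]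
      refine (congrArg _ (hm (f, f'))).trans (smul_zero _))
  refine ⟨M + K, s, section_ext F (fun f : t => X.basicOpen f.1 ⊓ X.basicOpen g)
    (fun f => hr f.1) (fun x hx => ?_) fun f => ?_⟩
  · obtain ⟨f, hf⟩ := mem_of_span_eq_top ht (X.basicOpen_le g hx)
    exact ⟨f, hf, hx⟩
  · have e := congrArg (rF F (hl f.1)) (hs f)
    rw [rF_rF, rF_smul, h1, map_pow, rs_rs, smul_smul, ← pow_add] at e
    rw [rF_rF, rF_smul, map_pow, rs_rs, e]

end BundleQCoh

section KaehlerMaps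

@[elab_as_elim]
theorem kaehler_induction {A R : Type*} [CommRing A] [CommRing R] [Algebra A R] {p : Ω[R⁄A] → Prop}
    (x : Ω[R⁄A]) (zero : p 0) (D : ∀ r, p (KaehlerDifferential.D A R r))
    (smul : ∀ (r : R) x, p x → p (r • x)) (add : ∀ x y, p x → p y → p (x + y)) : p x := by
  have hx : x ∈ Submodule.span R (Set.range (KaehlerDifferential.D A R)) := by
    rw [KaehlerDifferential.span_range_derivation]; trivial
  induction hx using Submodule.span_induction with
  | mem x hx => obtain ⟨r, rfl⟩ := hx; exact D r
  | zero => exact zero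
  | add x y _ _ hx hy => exact add x y hx hy
  | smul r x _ hx => exact smul r x hx

theorem kaehlerMap_smul {A₁ A₂ R₁ R₂ : Type u} [CommRing A₁] [CommRing A₂] [CommRing R₁]
    [CommRing R₂] [Algebra A₁ R₁] [Algebra A₂ R₂] (φ : A₁ →+* A₂) (ψ : R₁ →+* R₂)
    (h : ∀ a, ψ (algebraMap A₁ R₁ a) = algebraMap A₂ R₂ (φ a)) (r : R₁) (w : Ω[R₁⁄A₁]) :
    kaehlerMap φ ψ h (r • w) = ψ r • kaehlerMap φ ψ h w :=
  (kaehlerMap φ ψ h).map_smulₛₗ r w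

theorem kaehlerMap_eq_self {A R : Type u} [CommRing A] [CommRing R] [Algebra A R] (φ : A →+* A)
    (ψ : R →+* R) (h : ∀ a, ψ (algebraMap A R a) = algebraMap A R (φ a)) (hψ : ∀ r, ψ r = r)
    (w : Ω[R⁄A]) : kaehlerMap φ ψ h w = w := by
  refine kaehler_induction w (map_zero _) (fun r => ?_) (fun r x hx => ?_) fun x y hx hy => ?_
  · rw [kaehlerMap_D, hψ]
  · rw [kaehlerMap_smul, hψ, hx]
  · rw [map_add, hx, hy]

theorem kaehlerMap_kaehlerMap {A₁ A₂ A₃ R₁ R₂ R₃ : Type u} [CommRing A₁] [CommRing A₂]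
    [CommRing A₃] [CommRing R₁] [CommRing R₂] [CommRing R₃] [Algebra A₁ R₁] [Algebra A₂ R₂]
    [Algebra A₃ R₃] (φ : A₁ →+* A₂) (ψ : R₁ →+* R₂)
    (h : ∀ a, ψ (algebraMap A₁ R₁ a) = algebraMap A₂ R₂ (φ a)) (φ' : A₂ →+* A₃) (ψ' : R₂ →+* R₃)
    (h' : ∀ a, ψ' (algebraMap A₂ R₂ a) = algebraMap A₃ R₃ (φ' a)) (φ'' : A₁ →+* A₃)
    (ψ'' : R₁ →+* R₃) (h'' : ∀ a, ψ'' (algebraMap A₁ R₁ a) = algebraMap A₃ R₃ (φ'' a))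
    (hψ : ∀ r, ψ' (ψ r) = ψ'' r) (w : Ω[R₁⁄A₁]) :
    kaehlerMap φ' ψ' h' (kaehlerMap φ ψ h w) = kaehlerMap φ'' ψ'' h'' w := by
  refine kaehler_induction w (by simp only [map_zero]) (fun r => ?_) (fun r x hx => ?_)
    fun x y hx hy => ?_
  · rw [kaehlerMap_D, kaehlerMap_D, kaehlerMap_D, hψ]
  · rw [kaehlerMap_smul, kaehlerMap_smul, kaehlerMap_smul, hψ, hx]
  · rw [map_add, map_add, map_add, hx, hy]

end KaehlerMaps

section QCoh

variable {A : Type u} [CommRing A] {C : PolarScheme A} {n : ℕ} {F : C.X.Modules}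

theorem resM_apply {V U : C.X.Opens} (h : V ≤ U) (s : Γ(F, U)) : resM C F h s = rF F h s := rfl

theorem isLocalization_resO (V : C.X.affineOpens) (g : Γ(C.X, V.1)) :
    letI := (resO C (C.X.affineBasicOpen_le g)).toAlgebra
    IsLocalization.Away g Γ(C.X, (C.X.affineBasicOpen g).1) :=
  V.2.isLocalization_of_eq_basicOpen g (homOfLE (C.X.basicOpen_le g)) rfl

theorem tensorOmega_res_omegaTmul {V' V : C.X.affineOpens} (h : V' ≤ V) (s : Γ(F, V.1))
    (w : Ω[Γ(C.X, V.1)⁄A]) : (tensorOmega F).res h (omegaTmul s w) = omegaTmul (rF F h s)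
      (kaehlerMap (RingHom.id A) (resO C h) (resO_algebraMap C h) w) := rfl

@[elab_as_elim]
theorem tensorOmega_induction {V : C.X.affineOpens} {p : (tensorOmega F).obj V → Prop}
    (x : (tensorOmega F).obj V) (zero : p 0) (tmul : ∀ s w, p (omegaTmul s w))
    (add : ∀ x y, p x → p y → p (x + y)) : p x :=
  TensorProduct.induction_on (motive := p) x zero tmul add

theorem isQCoh_tensorOmega (hF : IsVectorBundle n F) : (tensorOmega F).IsQCoh := by
  have away : ∀ (V : C.X.affineOpens) (g : Γ(C.X, V.1)), IsAwayMap g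
      (TensorProduct.map (resM C F (C.X.affineBasicOpen_le g)) (kaehlerMap (RingHom.id A)
        (resO C (C.X.affineBasicOpen_le g)) (resO_algebraMap C (C.X.affineBasicOpen_le g)))) :=
    fun V g => IsAwayMap.tensor (isLocalization_resO V g)
      ⟨fun s hs => hF.exists_pow_smul_eq_zero g s hs, fun y => hF.exists_extension g y⟩
      (isAwayMap_kaehlerMap _ (isLocalization_resO V g))
  refine ⟨fun h r x => ?_, fun {V} h x => ?_, fun {V V' V''} h h' x => ?_,
    fun {V} f x hx => (away V f).1 x hx, fun {V} f y => (away V f).2 y⟩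
  · exact (TensorProduct.map (resM C F h)
      (kaehlerMap (RingHom.id A) (resO C h) (resO_algebraMap C h))).map_smulₛₗ r x
  · refine tensorOmega_induction x (map_zero _) (fun s w => ?_) fun x y hx hy => ?_
    · rw [tensorOmega_res_omegaTmul, rF_self, kaehlerMap_eq_self]
      exact fun r => rs_self _ r
    · rw [map_add, hx, hy]
  · refine tensorOmega_induction x (by simp only [map_zero]) (fun s w => ?_) fun x y hx hy => ?_
    · rw [tensorOmega_res_omegaTmul, tensorOmega_res_omegaTmul, tensorOmega_res_omegaTmul, rF_rF,
        kaehlerMap_kaehlerMap]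
      exact fun r => rs_rs _ _ r
    · rw [map_add, map_add, map_add, hx, hy]

theorem AffModule.tensor_res_tmul (N : AffModule C) (M : Type u) [AddCommGroup M] [Module A M]
    {V' V : C.X.affineOpens} (h : V' ≤ V) (x : N.obj V) (m : M) :
    (N.tensor M).res h (N.tmul m V x) = N.tmul m V' (N.res h x) := rfl

@[elab_as_elim]
theorem AffModule.tensor_induction {N : AffModule C} {M : Type u} [AddCommGroup M] [Module A M]
    {V : C.X.affineOpens} {p : (N.tensor M).obj V → Prop}
    (x : (N.tensor M).obj V) (zero : p 0) (tmul : ∀ s m, p (N.tmul m V s))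
    (add : ∀ x y, p x → p y → p (x + y)) : p x :=
  TensorProduct.induction_on (motive := p) x zero tmul add

theorem AffModule.IsQCoh.tensor {N : AffModule C} (hN : N.IsQCoh) (M : Type u) [AddCommGroup M]
    [Module A M] : (N.tensor M).IsQCoh := by
  have smul : ∀ {V' V : C.X.affineOpens} (h : V' ≤ V) (r : Γ(C.X, V.1)) (x : (N.tensor M).obj V),
      (N.tensor M).res h (r • x) = resO C h r • (N.tensor M).res h x := by
    intro V' V h r x
    refine AffModule.tensor_induction x (by simp only [map_zero, smul_zero]) (fun s m => ?_)
      fun x y hx hy => ?_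
    · exact congrArg (N.tmul m V') (hN.res_smul h r s)
    · rw [smul_add, map_add, map_add, hx, hy, smul_add]
  have away : ∀ (V : C.X.affineOpens) (g : Γ(C.X, V.1)), IsAwayMap g
      ({ toFun := (N.tensor M).res (C.X.affineBasicOpen_le g), map_add' := map_add _,
         map_smul' := smul _ } : (N.tensor M).obj V →ₛₗ[resO C (C.X.affineBasicOpen_le g)]
          (N.tensor M).obj (C.X.affineBasicOpen g)) := fun V g =>
    IsAwayMap.rTensor (fun a => resO_algebraMap C _ a) (isLocalization_resO V g)
      (f := { toFun := N.res (C.X.affineBasicOpen_le g), map_add' := map_add _,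
              map_smul' := hN.res_smul _ }) ⟨hN.eq_zero g, hN.extend g⟩
      (N.res (C.X.affineBasicOpen_le g)) (fun _ => rfl) _ fun _ => rfl
  refine ⟨smul, fun {V} h x => ?_, fun {V V' V''} h h' x => ?_,
    fun {V} f x hx => (away V f).1 x hx, fun {V} f y => (away V f).2 y⟩
  · refine AffModule.tensor_induction x (map_zero _) (fun s m => ?_) fun x y hx hy => ?_
    · rw [AffModule.tensor_res_tmul, hN.res_self]
    · rw [map_add, hx, hy]
  · refine AffModule.tensor_induction x (by simp only [map_zero]) (fun s m => ?_) fun x y hx hy => ?_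
    · simp only [AffModule.tensor_res_tmul, hN.res_res]
    · rw [map_add, map_add, map_add, hx, hy]

end QCoh

/-! ### Čech classes and special covers -/

section CechComparison

variable {A : Type u} [CommRing A] {X : TopCat.{u}} {E E' : (Opens X)ᵒᵖ ⥤ ModuleCat.{u} A}

section Cocycles

universe v w

variable {ι : Type v} {U : ι → Opens X}

theorem CechZ1.res_add (c : CechZ1 U E) {i j k : ι} {V : Opens X} (hi : V ≤ U i) (hj : V ≤ U j)
    (hk : V ≤ U k) : resE E (le_inf hi hj) (c.1 i j) + resE E (le_inf hj hk) (c.1 j k) =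
      resE E (le_inf hi hk) (c.1 i k) := by
  have h1 := congrArg (resE E (le_inf (le_inf hi hj) hk))
    (congrFun (congrFun (congrFun (LinearMap.mem_ker.1 c.2) i) j) k)
  simp only [cechD1, LinearMap.coe_mk, AddHom.coe_mk, map_add, map_sub, resE_resE, Pi.zero_apply,
    map_zero] at h1
  exact sub_eq_zero.1 h1

theorem CechZ1.res_self (c : CechZ1 U E) {i : ι} {V : Opens X} (hi : V ≤ U i) :
    resE E (le_inf hi hi) (c.1 i i) = 0 := by
  have := CechZ1.res_add c hi hi hi
  rwa [add_eq_right] at this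

theorem resE_self (E : (Opens X)ᵒᵖ ⥤ ModuleCat.{u} A) {U : Opens X} (h : U ≤ U)
    (s : E.obj (op U)) : resE E h s = s := by
  change (E.map (𝟙 (op U))).hom s = s
  rw [E.map_id]
  rfl

end Cocycles

theorem resE_app (f : E ⟶ E') {V U : Opens X} (h : V ≤ U) (s : E.obj (op U)) :
    (f.app (op V)).hom (resE E h s) = resE E' h ((f.app (op U)).hom s) :=
  congrArg (fun φ => φ.hom s) (f.naturality (homOfLE h).op)

namespace PointedCover

/-- The class in `H¹` of a cocycle. -/
def cls (E : (Opens X)ᵒᵖ ⥤ ModuleCat.{u} A) (𝒰 : PointedCover X) : CechZ1 𝒰.U E →ₗ[A] H1 E :=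
  𝒰.toH1 E ∘ₗ CechZ1.toCechH1 𝒰.U E

theorem map_cls (f : E ⟶ E') (𝒰 : PointedCover X) (c : CechZ1 𝒰.U E) :
    H1.map f (𝒰.cls E c) = 𝒰.cls E' (CechZ1.map f 𝒰.U c) := H1.map_toH1 f 𝒰 c

theorem exists_cls (x : H1 E) : ∃ (𝒰 : PointedCover X) (c : CechZ1 𝒰.U E), x = 𝒰.cls E c :=
  H1.exists_rep x

open scoped Classical in
theorem cls_trans {𝒰 𝒱 : PointedCover X} (h : 𝒰 ≤ 𝒱) (c : CechZ1 𝒰.U E) :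
    𝒱.cls E (CechZ1.refine id h E c) = 𝒰.cls E c :=
  Module.DirectLimit.of_f (R := A) (G := fun 𝒰 : PointedCover X => CechH1 𝒰.U E)
    (f := PointedCover.trans E) (hij := h) (x := CechZ1.toCechH1 𝒰.U E c)

theorem cls_eq_zero {𝒰 : PointedCover X} {c : CechZ1 𝒰.U E} (s : ∀ x, E.obj (op (𝒰.U x)))
    (h : ∀ x y, c.1 x y = resE E inf_le_left (s x) - resE E inf_le_right (s y)) :
    𝒰.cls E c = 0 := by
  have h1 : CechZ1.toCechH1 𝒰.U E c = 0 :=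
    (Submodule.Quotient.mk_eq_zero _).2 ⟨s, funext fun x => funext fun y => (h x y).symm⟩
  exact (congrArg (𝒰.toH1 E) h1).trans (map_zero _)

/-- The common refinement of two covers. -/
def inf (𝒰 𝒱 : PointedCover X) : PointedCover X :=
  ⟨fun x => 𝒰.U x ⊓ 𝒱.U x, fun x => ⟨𝒰.mem x, 𝒱.mem x⟩⟩

theorem le_inf_left (𝒰 𝒱 : PointedCover X) : 𝒰 ≤ 𝒰.inf 𝒱 := fun _ => inf_le_left

theorem le_inf_right (𝒰 𝒱 : PointedCover X) : 𝒱 ≤ 𝒰.inf 𝒱 := fun _ => inf_le_right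

instance : IsDirectedOrder (PointedCover X) :=
  ⟨fun 𝒰 𝒱 => ⟨𝒰.inf 𝒱, 𝒰.le_inf_left 𝒱, 𝒰.le_inf_right 𝒱⟩⟩

open scoped Classical in
/-- A cocycle with trivial class becomes a coboundary on a refinement. -/
theorem exists_of_cls_eq_zero {𝒰 : PointedCover X} {c : CechZ1 𝒰.U E} (h : 𝒰.cls E c = 0) :
    ∃ (𝒱 : PointedCover X) (h : 𝒰 ≤ 𝒱) (s : ∀ x, E.obj (op (𝒱.U x))), ∀ x y,
      resE E (inf_le_inf (h x) (h y)) (c.1 x y) =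
        resE E inf_le_left (s x) - resE E inf_le_right (s y) := by
  haveI : DirectedSystem (fun 𝒰 : PointedCover X => CechH1 𝒰.U E)
      (fun 𝒰 𝒱 h => PointedCover.trans E 𝒰 𝒱 h) :=
    ⟨fun 𝒰 x => by
      obtain ⟨c, rfl⟩ := Submodule.mkQ_surjective _ x
      exact congrArg (CechZ1.toCechH1 𝒰.U E) (Subtype.ext (funext fun x => funext fun y =>
        resE_self E _ _)), fun 𝒲 𝒱 𝒰 h h' x => by
      obtain ⟨c, rfl⟩ := Submodule.mkQ_surjective _ x
      have h1 : CechZ1.refine id h' E (CechZ1.refine id h E c) = CechZ1.refine id (h.trans h') E c :=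
        Subtype.ext (funext fun x => funext fun y => resE_resE E _ _ _)
      exact congrArg (CechZ1.toCechH1 𝒲.U E) h1⟩
  obtain ⟨𝒱, h𝒱, h0⟩ := Module.DirectLimit.of.zero_exact (R := A)
    (G := fun 𝒰 : PointedCover X => CechH1 𝒰.U E) (f := PointedCover.trans E) h
  obtain ⟨s, hs⟩ := (Submodule.Quotient.mk_eq_zero _).1
    (h0 : CechZ1.toCechH1 𝒱.U E (CechZ1.refine id h𝒱 E c) = 0)
  exact ⟨𝒱, h𝒱, s, fun x y => (congrFun (congrFun hs x) y).symm⟩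

/-- The class of a cocycle is compatible with an arbitrary refinement. -/
theorem cls_refine {𝒰 𝒱 : PointedCover X} (σ : X → X) (h : ∀ x, 𝒱.U x ≤ 𝒰.U (σ x))
    (c : CechZ1 𝒰.U E) : 𝒱.cls E (CechZ1.refine σ h E c) = 𝒰.cls E c := by
  rw [← cls_trans (𝒰.le_inf_left 𝒱) c, ← cls_trans (𝒰.le_inf_right 𝒱), ← sub_eq_zero, ← map_sub]
  have h1 : ∀ x, (𝒰.inf 𝒱).U x ≤ 𝒰.U x := 𝒰.le_inf_left 𝒱
  have h2 : ∀ x, (𝒰.inf 𝒱).U x ≤ 𝒰.U (σ x) := fun x => (𝒰.le_inf_right 𝒱 x).trans (h x)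
  -- the two refinement maps are homotopic
  refine cls_eq_zero (fun x => resE E (le_inf (h2 x) (h1 x)) (c.1 (σ x) x)) fun x y => ?_
  change resE E _ (resE E _ (c.1 (σ x) (σ y))) - resE E _ (c.1 x y) = _
  rw [resE_resE, resE_resE, resE_resE]
  have hx : (𝒰.inf 𝒱).U x ⊓ (𝒰.inf 𝒱).U y ≤ (𝒰.inf 𝒱).U x := inf_le_left
  have hy : (𝒰.inf 𝒱).U x ⊓ (𝒰.inf 𝒱).U y ≤ (𝒰.inf 𝒱).U y := inf_le_right
  have e1 := CechZ1.res_add c (hx.trans (h2 x)) (hx.trans (h1 x)) (hy.trans (h1 y))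
  have e2 := CechZ1.res_add c (hx.trans (h2 x)) (hy.trans (h2 y)) (hy.trans (h1 y))
  exact sub_eq_sub_iff_add_eq_add.2 (e2.trans (e1.symm.trans rfl))

/-- A cover by a dense open set `U η` and neighbourhoods of the finitely many remaining points,
which meet each other within `U η` only. -/
structure IsSpecial (S : PointedCover X) (η : X) : Prop where
  le : ∀ x ∈ S.U η, S.U x ≤ S.U η
  inf_le : ∀ x y, x ≠ y → S.U x ⊓ S.U y ≤ S.U η
  finite : (S.U η : Set X)ᶜ.Finite

open scoped Classical in
/-- The index in an arbitrary cover of a member of a special cover: one set `U η` suffices for all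
of its points. -/
def index (S : PointedCover X) (η x : X) : X := if x ∈ S.U η then η else x

theorem index_of_mem {S : PointedCover X} {η x : X} (hx : x ∈ S.U η) : S.index η x = η := if_pos hx

theorem index_of_notMem {S : PointedCover X} {η x : X} (hx : x ∉ S.U η) : S.index η x = x :=
  if_neg hx

/-- The special cover `S` refines `𝒰`. -/
def Refines (S : PointedCover X) (η : X) (𝒰 : PointedCover X) : Prop :=
  ∀ x, S.U x ≤ 𝒰.U (S.index η x)

theorem Refines.trans {S 𝒰 𝒱 : PointedCover X} {η : X} (h : S.Refines η 𝒱) (h' : 𝒰 ≤ 𝒱) :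
    S.Refines η 𝒰 := fun x => (h x).trans (h' _)

variable {S : PointedCover X} {η : X}

/-- The components of a cocycle on the intersections of the members of a special refinement with
`U η`. -/
def loc {𝒰 : PointedCover X} (h : S.Refines η 𝒰) :
    CechZ1 𝒰.U E →ₗ[A] ∀ x, E.obj (op (S.U η ⊓ S.U x)) where
  toFun c x := (CechZ1.refine (S.index η) h E c).1 η x
  map_add' c c' := by rw [map_add]; rfl
  map_smul' r c := by rw [map_smul]; rfl

theorem loc_map (f : E ⟶ E') {𝒰 : PointedCover X} (h : S.Refines η 𝒰) (c : CechZ1 𝒰.U E) (x : X) :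
    loc h (CechZ1.map f 𝒰.U c) x = (f.app _).hom (loc h c x) := (resE_app f _ _).symm

open scoped Classical in
/-- Set the components at the points of `U η` to zero. -/
def hat (S : PointedCover X) (η : X) (E : (Opens X)ᵒᵖ ⥤ ModuleCat.{u} A) :
    (∀ x, E.obj (op (S.U η ⊓ S.U x))) →ₗ[A] ∀ x, E.obj (op (S.U η ⊓ S.U x)) where
  toFun u x := if x ∈ S.U η then 0 else u x
  map_add' u v := by
    funext x
    by_cases hx : x ∈ S.U η <;> simp [hx]
  map_smul' r v := by
    funext x
    by_cases hx : x ∈ S.U η <;> simp [hx]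

theorem hat_of_mem (u : ∀ x, E.obj (op (S.U η ⊓ S.U x))) {x : X} (hx : x ∈ S.U η) :
    hat S η E u x = 0 := if_pos hx

theorem hat_of_notMem (u : ∀ x, E.obj (op (S.U η ⊓ S.U x))) {x : X} (hx : x ∉ S.U η) :
    hat S η E u x = u x := if_neg hx

namespace IsSpecial

variable (hS : S.IsSpecial η)

open scoped Classical in
theorem special_aux (u : ∀ x, E.obj (op (S.U η ⊓ S.U x))) {x y : X} {V : Opens X}
    (hη : V ≤ S.U η) (hx : V ≤ S.U x) (hy : V ≤ S.U y) :
    resE E (le_inf hx hy) (if h : x = y then 0 else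
      resE E (le_inf (hS.inf_le x y h) inf_le_right) (hat S η E u y) -
        resE E (le_inf (hS.inf_le x y h) inf_le_left) (hat S η E u x)) =
      resE E (le_inf hη hy) (hat S η E u y) - resE E (le_inf hη hx) (hat S η E u x) := by
  by_cases h : x = y
  · subst h
    rw [dif_pos rfl, map_zero, sub_self]
  · rw [dif_neg h, map_sub, resE_resE, resE_resE]

open scoped Classical in
/-- The cocycle on a special cover with given components on the `U η ∩ U x`. There is no condition
on these components, since the cover has no relevant triple intersections. -/
def special : (∀ x, E.obj (op (S.U η ⊓ S.U x))) →ₗ[A] CechZ1 S.U E where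
  toFun u := ⟨fun x y => if h : x = y then 0 else
      resE E (le_inf (hS.inf_le x y h) inf_le_right) (hat S η E u y) -
        resE E (le_inf (hS.inf_le x y h) inf_le_left) (hat S η E u x), by
    rw [LinearMap.mem_ker]
    funext x y z
    have hx : S.U x ⊓ S.U y ⊓ S.U z ≤ S.U x := inf_le_left.trans inf_le_left
    have hy : S.U x ⊓ S.U y ⊓ S.U z ≤ S.U y := inf_le_left.trans inf_le_right
    have hz : S.U x ⊓ S.U y ⊓ S.U z ≤ S.U z := inf_le_right
    by_cases hη : S.U x ⊓ S.U y ⊓ S.U z ≤ S.U η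
    · have e1 := hS.special_aux u hη hx hy
      have e2 := hS.special_aux u hη hy hz
      have e3 := hS.special_aux u hη hx hz
      refine (congrArg₂ (· - ·) (congrArg₂ (· + ·) e1 e2) e3).trans ?_
      simp only [Pi.zero_apply]
      abel
    -- an intersection not contained in `U η` comes from equal indices
    · have hxy : x = y := by
        by_contra h
        exact hη (inf_le_left.trans (hS.inf_le x y h))
      have hyz : y = z := by
        by_contra h
        exact hη ((le_inf hy hz).trans (hS.inf_le y z h))
      subst hxy hyz
      simp [cechD1]⟩
  map_add' u v := by
    ext x y
    by_cases h : x = y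
    · simp [h]
    · simp only [h, map_add, Pi.add_apply, Submodule.coe_add, dif_neg, not_false_eq_true]
      abel
  map_smul' r u := by
    ext x y
    by_cases h : x = y
    · simp [h]
    · simp only [h, map_smul, Pi.smul_apply, Submodule.coe_smul, dif_neg, not_false_eq_true,
        RingHom.id_apply, smul_sub]

theorem special_self (u : ∀ x, E.obj (op (S.U η ⊓ S.U x))) (x : X) : (hS.special u).1 x x = 0 :=
  dif_pos rfl

theorem special_of_ne (u : ∀ x, E.obj (op (S.U η ⊓ S.U x))) {x y : X} (h : x ≠ y) :
    (hS.special u).1 x y = resE E (le_inf (hS.inf_le x y h) inf_le_right) (hat S η E u y) -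
        resE E (le_inf (hS.inf_le x y h) inf_le_left) (hat S η E u x) :=
  dif_neg h

theorem special_congr {u v : ∀ x, E.obj (op (S.U η ⊓ S.U x))}
    (h : ∀ x, x ∉ S.U η → u x = v x) : hS.special u = hS.special v := by
  have h1 : hat S η E u = hat S η E v := by
    funext x
    by_cases hx : x ∈ S.U η
    · rw [hat_of_mem u hx, hat_of_mem v hx]
    · rw [hat_of_notMem u hx, hat_of_notMem v hx, h x hx]
  ext x y
  by_cases hxy : x = y
  · subst hxy
    rw [special_self, special_self]
  · rw [special_of_ne _ _ hxy, special_of_ne _ _ hxy, h1]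

theorem special_map (f : E ⟶ E') (u : ∀ x, E.obj (op (S.U η ⊓ S.U x))) :
    CechZ1.map f S.U (hS.special u) = hS.special fun x => (f.app _).hom (u x) := by
  have h1 : ∀ x, (f.app _).hom (hat S η E u x) = hat S η E' (fun x => (f.app _).hom (u x)) x := by
    intro x
    by_cases hx : x ∈ S.U η
    · rw [hat_of_mem _ hx, hat_of_mem _ hx, map_zero]
    · rw [hat_of_notMem _ hx, hat_of_notMem _ hx]
  ext x y
  change (f.app _).hom ((hS.special u).1 x y) = _
  by_cases hxy : x = y
  · subst hxy
    rw [special_self, special_self, map_zero]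
  · rw [special_of_ne _ _ hxy, special_of_ne _ _ hxy, map_sub, resE_app, resE_app, h1, h1]

/-- Every class is represented by its components on a special refinement. -/
theorem cls_special_loc {𝒰 : PointedCover X} (h : S.Refines η 𝒰) (c : CechZ1 𝒰.U E) :
    S.cls E (hS.special (loc h c)) = 𝒰.cls E c := by
  rw [← cls_refine (S.index η) h c]
  congr 1
  set c' := CechZ1.refine (S.index η) h E c with hc'
  have h0 : ∀ x, x ∈ S.U η → c'.1 η x = 0 := by
    intro x hx
    have key : ∀ (i j : X) (hi : S.U η ≤ 𝒰.U i) (hj : S.U x ≤ 𝒰.U j), i = j →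
        resE E (inf_le_inf hi hj) (c.1 i j) = 0 := by
      rintro i _ hi hj rfl
      exact CechZ1.res_self c (inf_le_left.trans hi)
    exact key _ _ (h η) (h x) (by rw [index_of_mem (S.mem η), index_of_mem hx])
  have h1 : ∀ x, hat S η E (loc h c) x = c'.1 η x := by
    intro x
    by_cases hx : x ∈ S.U η
    · rw [hat_of_mem _ hx, h0 x hx]
    · rw [hat_of_notMem _ hx]
      rfl
  ext x y
  by_cases hxy : x = y
  · subst hxy
    rw [special_self]
    have := CechZ1.res_self c' (le_refl (S.U x))
    have h2 := congrArg (resE E (inf_le_left : S.U x ⊓ S.U x ≤ _)) this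
    rw [resE_resE, resE_self, map_zero] at h2
    exact h2.symm
  · rw [special_of_ne _ _ hxy, h1, h1]
    have := CechZ1.res_add c' (hS.inf_le x y hxy) inf_le_left inf_le_right
    rw [resE_self] at this
    exact sub_eq_of_eq_add' this.symm

theorem cls_special_eq_zero {u : ∀ x, E.obj (op (S.U η ⊓ S.U x))} (e : ∀ x, E.obj (op (S.U x)))
    (h : ∀ x, x ∉ S.U η → u x = resE E inf_le_left (e η) - resE E inf_le_right (e x)) :
    S.cls E (hS.special u) = 0 := by
  classical
  set e' : ∀ x, E.obj (op (S.U x)) := fun x =>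
    if hx : x ∈ S.U η then resE E (hS.le x hx) (e η) else e x with he'
  have h1 : ∀ x, hat S η E u x = resE E inf_le_left (e η) - resE E inf_le_right (e' x) := by
    intro x
    by_cases hx : x ∈ S.U η
    · rw [hat_of_mem _ hx, he']
      simp only [hx, dif_pos]
      rw [resE_resE, sub_self]
    · rw [hat_of_notMem _ hx, h x hx, he']
      simp only [hx, dif_neg, not_false_eq_true]
  refine cls_eq_zero e' fun x y => ?_
  by_cases hxy : x = y
  · subst hxy
    rw [special_self, sub_self]
  · rw [special_of_ne _ _ hxy, h1, h1, map_sub, map_sub, resE_resE, resE_resE, resE_resE, resE_resE]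
    abel

end IsSpecial

/-- A class vanishes if its components on all sufficiently fine special covers do so, up to a
coboundary. -/
theorem exists_loc_of_cls_eq_zero {𝒰 : PointedCover X} {c : CechZ1 𝒰.U E} (h : 𝒰.cls E c = 0) :
    ∃ 𝒱 : PointedCover X, 𝒰 ≤ 𝒱 ∧ ∀ (S : PointedCover X) (η : X) (_ : S.Refines η 𝒱)
      (hS' : S.Refines η 𝒰), ∃ e : ∀ x, E.obj (op (S.U x)), ∀ x,
        loc hS' c x = resE E inf_le_left (e η) - resE E inf_le_right (e x) := by
  obtain ⟨𝒱, h𝒱, s, hs⟩ := exists_of_cls_eq_zero h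
  refine ⟨𝒱, h𝒱, fun S η hS hS' => ⟨fun x => resE E (hS x) (s _), fun x => ?_⟩⟩
  have := congrArg (resE E (inf_le_inf (hS η) (hS x))) (hs (S.index η η) (S.index η x))
  rw [resE_resE, map_sub, resE_resE, resE_resE] at this
  rw [resE_resE, resE_resE]
  exact this

end PointedCover

end CechComparison

/-! ### Right exactness of the first cohomology -/

section CechTensor

variable {A : Type u} [CommRing A] {X : TopCat.{u}} {E E' : (Opens X)ᵒᵖ ⥤ ModuleCat.{u} A}
  {M : Type u} [AddCommGroup M] [Module A M]

namespace PointedCover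

variable {S : PointedCover X} {η : X}

theorem IsSpecial.mem_toFinset (hS : S.IsSpecial η) {x : X} :
    x ∈ hS.finite.toFinset ↔ x ∉ S.U η := by simp

open scoped Classical in
theorem IsSpecial.cls_special_eq_sum (hS : S.IsSpecial η)
    (u : ∀ x, E.obj (op (S.U η ⊓ S.U x))) :
    S.cls E (hS.special u) =
      ∑ z ∈ hS.finite.toFinset, S.cls E (hS.special (Pi.single z (u z))) := by
  rw [← map_sum, ← map_sum]
  congr 1
  refine hS.special_congr fun x hx => ?_
  rw [Finset.sum_apply, Finset.sum_eq_single x]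
  · rw [Pi.single_eq_same]
  · exact fun z _ hz => Pi.single_eq_of_ne' hz _
  · exact fun h => (h (hS.mem_toFinset.2 hx)).elim

open scoped Classical in
/-- The class in `H¹(E) ⊗ M` of a family of elements of the `E(U η ∩ U x) ⊗ M`. -/
def IsSpecial.tensorClass (hS : S.IsSpecial η)
    (x : ∀ z : X, E.obj (op (S.U η ⊓ S.U z)) ⊗[A] M) : H1 E ⊗[A] M :=
  ∑ z ∈ hS.finite.toFinset, LinearMap.rTensor M (S.cls E ∘ₗ hS.special ∘ₗ
    LinearMap.single A (fun z : X => E.obj (op (S.U η ⊓ S.U z))) z) (x z)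

theorem IsSpecial.tensorClass_add (hS : S.IsSpecial η)
    (x y : ∀ z : X, E.obj (op (S.U η ⊓ S.U z)) ⊗[A] M) :
    hS.tensorClass (fun z => x z + y z) = hS.tensorClass x + hS.tensorClass y := by
  simp only [tensorClass, map_add, Finset.sum_add_distrib]

theorem IsSpecial.tensorClass_neg (hS : S.IsSpecial η)
    (x : ∀ z : X, E.obj (op (S.U η ⊓ S.U z)) ⊗[A] M) :
    hS.tensorClass (fun z => - x z) = - hS.tensorClass x := by
  simp only [tensorClass, map_neg, Finset.sum_neg_distrib]

theorem IsSpecial.tensorClass_zero (hS : S.IsSpecial η) :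
    hS.tensorClass (fun z => (0 : E.obj (op (S.U η ⊓ S.U z)) ⊗[A] M)) = 0 := by
  simp only [tensorClass, map_zero, Finset.sum_const_zero]

theorem IsSpecial.tensorClass_congr (hS : S.IsSpecial η)
    {x y : ∀ z : X, E.obj (op (S.U η ⊓ S.U z)) ⊗[A] M} (h : ∀ z, z ∉ S.U η → x z = y z) :
    hS.tensorClass x = hS.tensorClass y :=
  Finset.sum_congr rfl fun z hz => by rw [h z (hS.mem_toFinset.1 hz)]

theorem IsSpecial.tensorClass_tmul (hS : S.IsSpecial η)
    (u : ∀ z : X, E.obj (op (S.U η ⊓ S.U z))) (m : M) :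
    hS.tensorClass (fun z => u z ⊗ₜ m) = S.cls E (hS.special u) ⊗ₜ m := by
  rw [cls_special_eq_sum, TensorProduct.sum_tmul]
  rfl

theorem IsSpecial.tensorClass_coboundary (hS : S.IsSpecial η)
    (f : ∀ x, E.obj (op (S.U x)) ⊗[A] M) :
    hS.tensorClass (fun z => LinearMap.rTensor M (resE E inf_le_left) (f η) -
      LinearMap.rTensor M (resE E inf_le_right) (f z)) = 0 := by
  classical
  have h1 : ∀ y : E.obj (op (S.U η)) ⊗[A] M, hS.tensorClass
      (fun z => LinearMap.rTensor M (resE E (inf_le_left : S.U η ⊓ S.U z ≤ _)) y) = 0 := by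
    intro y
    induction y using TensorProduct.induction_on with
    | zero => simp only [map_zero]; exact hS.tensorClass_zero
    | add x y hx hy => simp only [map_add]; rw [tensorClass_add, hx, hy, add_zero]
    | tmul e m =>
      simp only [LinearMap.rTensor_tmul]
      rw [tensorClass_tmul, hS.cls_special_eq_zero (fun x => if h : x = η then h ▸ e else 0),
        TensorProduct.zero_tmul]
      intro x hx
      have hne : x ≠ η := fun h => hx (h ▸ S.mem η)
      rw [dif_pos rfl, dif_neg hne, map_zero, sub_zero]
  have h2 : hS.tensorClass (fun z => - LinearMap.rTensor M
      (resE E (inf_le_right : S.U η ⊓ S.U z ≤ _)) (f z)) = 0 := by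
    rw [tensorClass_neg, neg_eq_zero]
    refine Finset.sum_eq_zero fun z hz => ?_
    rw [← LinearMap.comp_apply, ← LinearMap.rTensor_comp]
    have h3 : (S.cls E ∘ₗ hS.special ∘ₗ LinearMap.single A
        (fun z : X => E.obj (op (S.U η ⊓ S.U z))) z) ∘ₗ
        resE E (inf_le_right : S.U η ⊓ S.U z ≤ _) = 0 := by
      refine LinearMap.ext fun e => ?_
      have hne : η ≠ z := fun h => hS.mem_toFinset.1 hz (h ▸ S.mem η)
      refine hS.cls_special_eq_zero (fun x => if h : x = z then - (h ▸ e) else 0) fun x hx => ?_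
      rw [dif_neg hne, map_zero, zero_sub]
      by_cases hxz : x = z
      · subst hxz
        rw [dif_pos rfl, map_neg, neg_neg]
        exact Pi.single_eq_same (M := fun z => E.obj (op (S.U η ⊓ S.U z))) x _
      · rw [dif_neg hxz, map_zero, neg_zero]
        exact Pi.single_eq_of_ne (M := fun z => E.obj (op (S.U η ⊓ S.U z))) hxz _
    rw [h3, LinearMap.rTensor_zero]
    rfl
  have := hS.tensorClass_add (fun z => LinearMap.rTensor M (resE E inf_le_left) (f η))
    (fun z => - LinearMap.rTensor M (resE E (inf_le_right : S.U η ⊓ S.U z ≤ _)) (f z))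
  rw [h1, h2, add_zero] at this
  simpa only [sub_eq_add_neg] using this

/-- Every element of `H¹(E) ⊗ M` is represented by a tensor of cocycles on a single cover. -/
theorem exists_tensor_cls (y : H1 E ⊗[A] M) : ∃ (𝒰 : PointedCover X) (c : CechZ1 𝒰.U E ⊗[A] M),
    y = LinearMap.rTensor M (𝒰.cls E) c := by
  have trans : ∀ {𝒰 𝒱 : PointedCover X} (h : 𝒰 ≤ 𝒱) (c : CechZ1 𝒰.U E ⊗[A] M),
      LinearMap.rTensor M (𝒱.cls E) (LinearMap.rTensor M (CechZ1.refine id h E) c) =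
        LinearMap.rTensor M (𝒰.cls E) c := by
    intro 𝒰 𝒱 h c
    rw [← LinearMap.comp_apply, ← LinearMap.rTensor_comp]
    congr 2
    exact LinearMap.ext fun c => cls_trans h c
  induction y using TensorProduct.induction_on with
  | zero => exact ⟨⟨fun _ => ⊤, fun _ => trivial⟩, 0, (map_zero _).symm⟩
  | tmul x m =>
    obtain ⟨𝒰, c, rfl⟩ := exists_cls x
    exact ⟨𝒰, c ⊗ₜ m, rfl⟩
  | add x y hx hy =>
    obtain ⟨𝒰, c, rfl⟩ := hx
    obtain ⟨𝒱, d, rfl⟩ := hy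
    exact ⟨𝒰.inf 𝒱, LinearMap.rTensor M (CechZ1.refine id (le_inf_left 𝒰 𝒱) E) c +
      LinearMap.rTensor M (CechZ1.refine id (le_inf_right 𝒰 𝒱) E) d, by
        rw [map_add, trans, trans]⟩

/-- The components of a tensor of cocycles. -/
def tensorLoc {𝒰 : PointedCover X} (h : S.Refines η 𝒰) (c : CechZ1 𝒰.U E ⊗[A] M) (z : X) :
    E.obj (op (S.U η ⊓ S.U z)) ⊗[A] M :=
  LinearMap.rTensor M (LinearMap.proj z ∘ₗ loc h) c

theorem IsSpecial.tensorClass_tensorLoc (hS : S.IsSpecial η) {𝒰 : PointedCover X}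
    (h : S.Refines η 𝒰) (c : CechZ1 𝒰.U E ⊗[A] M) :
    hS.tensorClass (tensorLoc h c) = LinearMap.rTensor M (𝒰.cls E) c := by
  induction c using TensorProduct.induction_on with
  | zero =>
    rw [map_zero, ← hS.tensorClass_zero]
    exact congrArg _ (funext fun z => map_zero _)
  | add x y hx hy =>
    rw [map_add, ← hx, ← hy, ← tensorClass_add]
    exact congrArg _ (funext fun z => map_add _ _ _)
  | tmul c m =>
    rw [LinearMap.rTensor_tmul, ← hS.cls_special_loc h, ← tensorClass_tmul]
    rfl

section Comparison

variable (κ : M → (E ⟶ E')) (cmp : ∀ W : Opens X, E.obj (op W) ⊗[A] M →ₗ[A] E'.obj (op W))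
  (hcmp : ∀ W e m, cmp W (e ⊗ₜ m) = ((κ m).app (op W)).hom e)
  (K : H1 E ⊗[A] M →ₗ[A] H1 E') (hK : ∀ x m, K (x ⊗ₜ m) = H1.map (κ m) x)

include hcmp in
theorem cmp_res {V U : Opens X} (h : V ≤ U) (x : E.obj (op U) ⊗[A] M) :
    cmp V (LinearMap.rTensor M (resE E h) x) = resE E' h (cmp U x) := by
  induction x using TensorProduct.induction_on with
  | zero => simp only [map_zero]
  | add x y hx hy => simp only [map_add, hx, hy]
  | tmul e m => rw [LinearMap.rTensor_tmul, hcmp, hcmp, resE_app]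

include hcmp hK

theorem comparison_tensorClass (hS : S.IsSpecial η)
    (x : ∀ z : X, E.obj (op (S.U η ⊓ S.U z)) ⊗[A] M) :
    K (hS.tensorClass x) = S.cls E' (hS.special fun z => cmp _ (x z)) := by
  classical
  rw [hS.cls_special_eq_sum, IsSpecial.tensorClass, map_sum]
  refine Finset.sum_congr rfl fun z _ => ?_
  induction x z using TensorProduct.induction_on with
  | zero => simp only [map_zero, Pi.single_zero]
  | add x y hx hy => rw [map_add, map_add, map_add, Pi.single_add, map_add, map_add, hx, hy]
  | tmul e m =>
    rw [LinearMap.rTensor_tmul, hK, hcmp]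
    refine (map_cls (κ m) S _).trans (congrArg _ ((hS.special_map (κ m) _).trans ?_))
    refine congrArg _ (funext fun x => ?_)
    by_cases hx : x = z
    · subst hx
      rw [Pi.single_eq_same]
      exact congrArg _ (Pi.single_eq_same (M := fun z => E.obj (op (S.U η ⊓ S.U z))) x e)
    · rw [Pi.single_eq_of_ne hx]
      exact (congrArg _ (Pi.single_eq_of_ne (M := fun z => E.obj (op (S.U η ⊓ S.U z))) hx e)).trans
        (map_zero _)

theorem exists_comparison_cls {𝒰 : PointedCover X} (c : CechZ1 𝒰.U E ⊗[A] M) :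
    ∃ c' : CechZ1 𝒰.U E', K (LinearMap.rTensor M (𝒰.cls E) c) = 𝒰.cls E' c' ∧
      ∀ (S : PointedCover X) (η : X) (h : S.Refines η 𝒰) (z : X),
        loc h c' z = cmp _ (tensorLoc h c z) := by
  induction c using TensorProduct.induction_on with
  | zero => exact ⟨0, by simp only [map_zero], fun S η h z => by
      rw [tensorLoc, map_zero, map_zero, map_zero]; rfl⟩
  | add x y hx hy =>
    obtain ⟨c, hc, h⟩ := hx
    obtain ⟨c', hc', h'⟩ := hy
    refine ⟨c + c', by rw [map_add, map_add, hc, hc', map_add], fun S η hr z => ?_⟩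
    rw [map_add, tensorLoc, map_add, map_add, Pi.add_apply, h, h']
    rfl
  | tmul c m =>
    refine ⟨CechZ1.map (κ m) 𝒰.U c, by rw [LinearMap.rTensor_tmul, hK, map_cls],
      fun S η hr z => ?_⟩
    rw [loc_map, tensorLoc, LinearMap.rTensor_tmul, hcmp]
    rfl

/-- `H¹(E) ⊗ M → H¹(E ⊗ M)` is bijective when `E(W) ⊗ M → (E ⊗ M)(W)` is so for the members `W`
of arbitrarily fine special covers. -/
theorem comparison_bijective {η : X} (hsmall : ∀ 𝒰 : PointedCover X, ∃ S : PointedCover X,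
      S.IsSpecial η ∧ S.Refines η 𝒰 ∧ (∀ x, Function.Surjective (cmp (S.U x))) ∧
        ∀ x, Function.Bijective (cmp (S.U η ⊓ S.U x))) : Function.Bijective K := by
  constructor
  · refine (injective_iff_map_eq_zero _).2 fun y hy => ?_
    -- the components of the image of `y` on a special cover are differences `e η - e x`; the `e x`
    -- lift to tensors since `cmp` is surjective on the members of the cover, and the differences of
    -- the lifts are the components of `y` since `cmp` is injective on the overlaps
    obtain ⟨𝒰, c, rfl⟩ := exists_tensor_cls y
    obtain ⟨c', hc', hloc⟩ := exists_comparison_cls κ cmp hcmp K hK c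
    rw [hy] at hc'
    obtain ⟨𝒱, h𝒱, hz⟩ := exists_loc_of_cls_eq_zero hc'.symm
    obtain ⟨S, hS, hr, h1, h2⟩ := hsmall 𝒱
    obtain ⟨e, he⟩ := hz S η hr (hr.trans h𝒱)
    choose f hf using fun x => h1 x (e x)
    rw [← hS.tensorClass_tensorLoc (hr.trans h𝒱), ← hS.tensorClass_coboundary f]
    refine hS.tensorClass_congr fun z _ => (h2 z).1 ?_
    rw [← hloc, he, map_sub, cmp_res κ cmp hcmp, cmp_res κ cmp hcmp, hf, hf]
  · intro y
    -- any family of components on the overlaps is a cocycle, so they can be lifted independently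
    obtain ⟨𝒰, c, rfl⟩ := exists_cls y
    obtain ⟨S, hS, hr, -, h2⟩ := hsmall 𝒰
    choose x hx using fun z => (h2 z).2 (loc hr c z)
    refine ⟨hS.tensorClass x, ?_⟩
    rw [comparison_tensorClass κ cmp hcmp K hK, ← hS.cls_special_loc hr]
    simp only [hx]

end Comparison

/-- On a curve, special covers by the members of a basis which is closed under intersections are
cofinal. -/
theorem exists_special {X : Type u} [TopologicalSpace X] (hX : IsCurveLike X)
    (Good : Opens X → Prop)
    (hgood : ∀ (x : X) (O : Opens X), x ∈ O → ∃ V ≤ O, x ∈ V ∧ Good V) :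
    ∃ η : X, ∀ 𝒰 : PointedCover (TopCat.of X), ∃ S : PointedCover (TopCat.of X),
      S.IsSpecial η ∧ S.Refines η 𝒰 ∧ ∀ x, Good (S.U x) := by
  classical
  obtain ⟨η, h1, h2, h3⟩ := hX
  refine ⟨η, fun 𝒰 => ?_⟩
  obtain ⟨W, hW, hηW, gW⟩ := hgood η (𝒰.U η) (𝒰.mem η)
  have hfin : (W : Set X)ᶜ.Finite := h2 W W.2 hηW
  have key : ∀ x : X, ∃ V : Opens X, x ∈ V ∧ Good V ∧ (x ∈ W → V = W) ∧
      (x ∉ W → V ≤ 𝒰.U x ∧ ∀ y, y ∉ W → y ≠ x → y ∉ V) := by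
    intro x
    by_cases hx : x ∈ W
    · exact ⟨W, hx, gW, fun _ => rfl, fun h => (h hx).elim⟩
    -- outside `W`, remove the other finitely many points from a neighbourhood of `x`
    · have hfin' : ((W : Set X)ᶜ \ {x}).Finite := hfin.subset Set.sdiff_subset
      have hcl : IsClosed ((W : Set X)ᶜ \ {x}) := by
        rw [← Set.biUnion_of_singleton ((W : Set X)ᶜ \ {x})]
        exact hfin'.isClosed_biUnion fun y hy => h3 y fun h => hy.1 (h ▸ hηW)
      obtain ⟨V, hV, hxV, gV⟩ := hgood x (𝒰.U x ⊓ ⟨((W : Set X)ᶜ \ {x})ᶜ, hcl.isOpen_compl⟩)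
        ⟨𝒰.mem x, fun h => h.2 rfl⟩
      exact ⟨V, hxV, gV, fun h => (hx h).elim, fun _ => ⟨hV.trans inf_le_left,
        fun y hy hyx hyV => (hV hyV).2 ⟨hy, hyx⟩⟩⟩
  choose V hxV gV hVW hV using key
  have hη : V η = W := hVW η hηW
  refine ⟨⟨V, hxV⟩, ⟨fun x hx => ?_, fun x y hxy p hp => ?_, ?_⟩, fun x => ?_, gV⟩
  · change x ∈ V η at hx
    change V x ≤ V η
    rw [hη] at hx ⊢
    rw [hVW x hx]
  · change p ∈ V η
    change p ∈ V x ⊓ V y at hp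
    rw [hη]
    by_cases hx : x ∈ W
    · rw [← hVW x hx]; exact hp.1
    by_cases hy : y ∈ W
    · rw [← hVW y hy]; exact hp.2
    by_contra hpW
    have e1 : p = x := by
      by_contra h
      exact (hV x hx).2 p hpW h hp.1
    have e2 : p = y := by
      by_contra h
      exact (hV y hy).2 p hpW h hp.2
    exact hxy (e1.symm.trans e2)
  · change ((V η : Opens X) : Set X)ᶜ.Finite
    rw [hη]; exact hfin
  · change V x ≤ 𝒰.U (index ⟨V, hxV⟩ η x)
    by_cases hx : x ∈ V η
    · rw [index_of_mem hx, hVW x (hη ▸ hx)]; exact hW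
    · rw [index_of_notMem hx]
      exact (hV x (fun h => hx (hη.symm ▸ h))).1

end PointedCover

end CechTensor

/-! ### Sections of `ℋom(F, N(D))` -/

section Charts

variable {A : Type u} [CommRing A] {C : PolarScheme A} {n : ℕ} {F : C.X.Modules}
  {V V' V'' : C.X.affineOpens}

theorem resD_resD (h : V' ≤ V) (h' : V'' ≤ V') (a : C.D.ideal V) :
    resD C h' (resD C h a) = resD C (h'.trans h) a := Subtype.ext (rs_rs _ _ _)

theorem resD_self (h : V ≤ V) (a : C.D.ideal V) : resD C h a = a := Subtype.ext (rs_self _ _)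

theorem resD_smul (h : V' ≤ V) (r : Γ(C.X, V.1)) (a : C.D.ideal V) :
    resD C h (r • a) = resO C h r • resD C h a := (resD C h).map_smulₛₗ r a

theorem resO_self {U : C.X.Opens} (h : U ≤ U) (r : Γ(C.X, U)) : resO C h r = r := rs_self _ _

theorem IsGen.restrict {φ : C.D.ideal V} (hφ : IsGen C φ) (h : V' ≤ V) :
    IsGen C (resD C h φ) := by
  intro T hT
  rw [resD_resD]
  exact hφ T (hT.trans h)

/-- The coordinate on `𝒪(-D)` with respect to a generator. -/
def IsGen.coord {φ : C.D.ideal V} (hφ : IsGen C φ) (h : V' ≤ V) :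
    C.D.ideal V' ≃ₗ[Γ(C.X, V'.1)] Γ(C.X, V'.1) :=
  (LinearEquiv.ofBijective (LinearMap.toSpanSingleton Γ(C.X, V'.1) _ (resD C h φ)) (hφ V' h)).symm

theorem IsGen.coord_smul {φ : C.D.ideal V} (hφ : IsGen C φ) (h : V' ≤ V) (a : C.D.ideal V') :
    hφ.coord h a • resD C h φ = a :=
  (LinearEquiv.ofBijective (LinearMap.toSpanSingleton Γ(C.X, V'.1) _ (resD C h φ))
    (hφ V' h)).apply_symm_apply a

theorem IsGen.coord_self {φ : C.D.ideal V} (hφ : IsGen C φ) (h : V' ≤ V) :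
    hφ.coord h (resD C h φ) = 1 := by
  refine (hφ V' h).1 ?_
  simp only [hφ.coord_smul, one_smul]

theorem IsGen.coord_resD {φ : C.D.ideal V} (hφ : IsGen C φ) (h : V' ≤ V) (h' : V'' ≤ V')
    (a : C.D.ideal V') : hφ.coord (h'.trans h) (resD C h' a) = resO C h' (hφ.coord h a) := by
  refine (hφ V'' (h'.trans h)).1 ?_
  simp only [hφ.coord_smul]
  conv_lhs => rw [← hφ.coord_smul h a, resD_smul, resD_resD]

/-- Bilinear maps on `F × 𝒪(-D)` are determined by their values on a frame and a generator. -/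
theorem bilin_ext {U : C.X.Opens} {b : Fin n → Γ(F, U)} (hb : IsFrame F b) (hU : V'.1 ≤ U)
    {φ : C.D.ideal V} (hφ : IsGen C φ) (h : V' ≤ V) {P : Type*} [AddCommGroup P]
    [Module Γ(C.X, V'.1) P]
    {B B' : Γ(F, V'.1) →ₗ[Γ(C.X, V'.1)] (C.D.ideal V' →ₗ[Γ(C.X, V'.1)] P)}
    (hB : ∀ k, B (rF F hU (b k)) (resD C h φ) = B' (rF F hU (b k)) (resD C h φ)) : B = B' := by
  refine (hb.basis hU).ext fun k => LinearMap.ext fun a => ?_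
  rw [hb.basis_apply, ← hφ.coord_smul h a, map_smul, map_smul, hB]

/-- The bilinear map with given values on a basis and a generator. -/
def bilinOfBasis {R M I P : Type*} [CommRing R] [AddCommGroup M] [AddCommGroup I] [AddCommGroup P]
    [Module R M] [Module R I] [Module R P] (β : Module.Basis (Fin n) R M) (c : I ≃ₗ[R] R)
    (p : Fin n → P) : M →ₗ[R] I →ₗ[R] P :=
  LinearMap.mk₂ R (fun s a => ∑ k, (β.repr s k * c a) • p k)
    (fun s s' a => by simp only [map_add, Finsupp.add_apply, add_mul, add_smul,
      Finset.sum_add_distrib])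
    (fun r s a => by simp only [map_smul, Finsupp.smul_apply, smul_eq_mul, mul_assoc,
      mul_smul, Finset.smul_sum])
    (fun s a a' => by simp only [map_add, mul_add, add_smul, Finset.sum_add_distrib])
    (fun r s a => by simp only [map_smul, smul_eq_mul, mul_left_comm _ r, mul_smul r,
      Finset.smul_sum])

theorem bilinOfBasis_apply {R M I P : Type*} [CommRing R] [AddCommGroup M] [AddCommGroup I]
    [AddCommGroup P] [Module R M] [Module R I] [Module R P] (β : Module.Basis (Fin n) R M)
    (c : I ≃ₗ[R] R) (p : Fin n → P) (s : M) (a : I) :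
    bilinOfBasis β c p s a = ∑ k, (β.repr s k * c a) • p k := rfl

section HomOfFrame

variable {b : Fin n → Γ(F, V.1)} (hb : IsFrame F b) {φ : C.D.ideal V} (hφ : IsGen C φ)
  {N : AffModule C} (hN : N.IsQCoh)

/-- The section of `ℋom(F, N(D))` with given value on a frame and a generator. -/
def homOfFrame (v : Fin n → N.obj V) : homPolarSections F N V.1 :=
  ⟨fun V' => bilinOfBasis (hb.basis V'.2) (hφ.coord V'.2) fun k => N.res V'.2 (v k),
  fun V' V'' h s a => by
    rw [bilinOfBasis_apply, bilinOfBasis_apply, map_sum]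
    refine Finset.sum_congr rfl fun k _ => ?_
    rw [hN.res_smul, hN.res_res, map_mul, hφ.coord_resD V'.2 h, resM_apply]
    congr 2
    exact hb.rF_repr V'.2 h s k⟩

theorem homOfFrame_apply (v : Fin n → N.obj V) (V' : {V' : C.X.affineOpens // V'.1 ≤ V.1})
    (s : Γ(F, V'.1.1)) (a : C.D.ideal V'.1) : (homOfFrame hb hφ hN v).1 V' s a =
      ∑ k, ((hb.basis V'.2).repr s k * hφ.coord V'.2 a) • N.res V'.2 (v k) := rfl

theorem homOfFrame_apply_frame (v : Fin n → N.obj V) (k : Fin n) :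
    (homOfFrame hb hφ hN v).1 ⟨V, le_rfl⟩ (b k) φ = v k := by
  rw [homOfFrame_apply, Finset.sum_eq_single k]
  · have h1 : (hb.basis (le_refl V.1)).repr (b k) k = 1 := by
      conv_lhs => rw [← rF_self F le_rfl (b k), ← hb.basis_apply le_rfl k]
      rw [Module.Basis.repr_self, Finsupp.single_eq_same]
    have h2 : hφ.coord (le_refl V) φ = 1 :=
      (congrArg (hφ.coord le_rfl) (resD_self le_rfl φ)).symm.trans (hφ.coord_self le_rfl)
    rw [h1]
    refine (congrArg₂ (fun r x => (1 * r) • x) h2 (hN.res_self _ _)).trans ?_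
    rw [one_mul, one_smul]
  · intro l _ hl
    have h1 : (hb.basis (le_refl V.1)).repr (b k) l = 0 := by
      conv_lhs => rw [← rF_self F le_rfl (b k), ← hb.basis_apply le_rfl k]
      rw [Module.Basis.repr_self, Finsupp.single_eq_of_ne hl]
    rw [h1, zero_mul, zero_smul]
  · exact fun h => (h (Finset.mem_univ k)).elim

include hb hφ in
theorem homPolarSections_ext_frame {W : C.X.Opens} (hW : W ≤ V.1) (hV : V.1 ≤ W)
    {θ θ' : homPolarSections F N W}
    (h : ∀ k, θ.1 ⟨V, hV⟩ (b k) φ = θ'.1 ⟨V, hV⟩ (b k) φ) : θ = θ' := by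
  refine Subtype.ext (funext fun V' => ?_)
  have hle : V'.1 ≤ V := V'.2.trans hW
  refine bilin_ext hb hle hφ hle fun k => ?_
  exact (θ.2 ⟨V, hV⟩ V' hle (b k) φ).trans ((congrArg (N.res hle) (h k)).trans
    (θ'.2 ⟨V, hV⟩ V' hle (b k) φ).symm)

/-- Evaluation on a frame and a generator. -/
def evalFrame (b : Fin n → Γ(F, V.1)) (φ : C.D.ideal V) (N : AffModule C) :
    homPolarSections F N V.1 →ₗ[A] (Fin n → N.obj V) where
  toFun θ k := θ.1 ⟨V, le_rfl⟩ (b k) φ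
  map_add' _ _ := rfl
  map_smul' _ _ := rfl

include hb hφ hN in
theorem evalFrame_bijective : Function.Bijective (evalFrame b φ N) :=
  ⟨fun _ _ h => homPolarSections_ext_frame hb hφ le_rfl le_rfl (congrFun h),
    fun v => ⟨homOfFrame hb hφ hN v, funext fun k => homOfFrame_apply_frame hb hφ hN v k⟩⟩

end HomOfFrame

section Tensor

variable (F) (M : Type u) [AddCommGroup M] [Module A M]

/-- The natural map `(ℰnd(F) ⊗ ω(D))(W) ⊗ M → (ℰnd(F) ⊗ ω(D) ⊗ M)(W)`. -/
def sectionsComparison (W : C.X.Opens) :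
    homPolarSections F (tensorOmega F) W ⊗[A] M →ₗ[A]
      homPolarSections F ((tensorOmega F).tensor M) W :=
  TensorProduct.lift (LinearMap.mk₂ A (fun θ m => tensorRightSections F m W θ)
    (fun θ θ' m => map_add _ _ _) (fun r θ m => map_smul _ _ _)
    (fun θ m m' => tensorRightSections_add F m m' W θ)
    (fun r θ m => tensorRightSections_smul F r m W θ))

variable {F}

theorem sectionsComparison_bijective (hF : IsVectorBundle n F) {b : Fin n → Γ(F, V.1)}
    (hb : IsFrame F b) {φ : C.D.ideal V} (hφ : IsGen C φ) :
    Function.Bijective (sectionsComparison F M V.1) := by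
  have hN := isQCoh_tensorOmega hF
  let ev := LinearEquiv.ofBijective (evalFrame b φ (tensorOmega F))
    (evalFrame_bijective hb hφ hN)
  let e := (TensorProduct.congr ev (LinearEquiv.refl A M)) ≪≫ₗ TensorProduct.comm A _ M ≪≫ₗ
    TensorProduct.piRight A A M (fun _ : Fin n => (tensorOmega F).obj V) ≪≫ₗ
      LinearEquiv.piCongrRight fun _ => TensorProduct.comm A M _
  have h1 : evalFrame b φ ((tensorOmega F).tensor M) ∘ₗ sectionsComparison F M V.1 =
      e.toLinearMap := by
    refine TensorProduct.ext' fun θ m => funext fun k => ?_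
    simp only [e, LinearMap.comp_apply, LinearEquiv.coe_coe, LinearEquiv.trans_apply,
      TensorProduct.congr_tmul, TensorProduct.comm_tmul, TensorProduct.piRight_apply,
      LinearEquiv.piCongrRight_apply, LinearEquiv.refl_apply, TensorProduct.piRightHom_tmul]
    rfl
  refine (Function.Bijective.of_comp_iff' (evalFrame_bijective hb hφ (hN.tensor M)) _).1 ?_
  have h2 : evalFrame b φ ((tensorOmega F).tensor M) ∘ sectionsComparison F M V.1 = e :=
    congrArg DFunLike.coe h1
  rw [h2]
  exact e.bijective

end Tensor

section Glue

variable {N : AffModule C} (hN : N.IsQCoh) {W : C.X.Opens} {𝔅 : Set C.X.affineOpens}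
  (hdown : ∀ T₁ T₂ : C.X.affineOpens, T₁ ≤ T₂ → T₂ ∈ 𝔅 → T₁ ∈ 𝔅)
  (hcov : ∀ x ∈ W, ∃ T ∈ 𝔅, x ∈ T.1)

include hN hdown hcov

theorem homPolarSections_ext {θ θ' : homPolarSections F N W}
    (h : ∀ (T : C.X.affineOpens) (_ : T ∈ 𝔅) (hT : T.1 ≤ W), θ.1 ⟨T, hT⟩ = θ'.1 ⟨T, hT⟩) :
    θ = θ' := by
  refine Subtype.ext (funext fun V => LinearMap.ext fun s => LinearMap.ext fun a => ?_)
  refine hN.ext hdown (fun x hx => hcov x (V.2 hx)) fun T hT hTV => ?_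
  have hTW : T.1 ≤ W := le_trans (show T.1 ≤ V.1.1 from hTV) V.2
  exact (θ.2 V ⟨T, hTW⟩ hTV s a).symm.trans
    ((congrArg (fun f => f (resM C F hTV s) (resD C hTV a)) (h T hT hTW)).trans
      (θ'.2 V ⟨T, hTW⟩ hTV s a))

/-- Sections of `ℋom(F, N(D))` glue. -/
theorem exists_homPolarSections (θ : ∀ T : C.X.affineOpens, T ∈ 𝔅 → T.1 ≤ W →
      Γ(F, T.1) →ₗ[Γ(C.X, T.1)] (C.D.ideal T →ₗ[Γ(C.X, T.1)] N.obj T))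
    (hθ : ∀ (T₁ T₂ : C.X.affineOpens) (h : T₁ ≤ T₂) (m₁ : T₁ ∈ 𝔅) (m₂ : T₂ ∈ 𝔅) (l₁ : T₁.1 ≤ W)
      (l₂ : T₂.1 ≤ W) (s : Γ(F, T₂.1)) (a : C.D.ideal T₂),
      θ T₁ m₁ l₁ (resM C F h s) (resD C h a) = N.res h (θ T₂ m₂ l₂ s a)) :
    ∃ Θ : homPolarSections F N W, ∀ T m l, Θ.1 ⟨T, l⟩ = θ T m l := by
  have key : ∀ (V : C.X.affineOpens) (hV : V.1 ≤ W) (s : Γ(F, V.1)) (a : C.D.ideal V),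
      ∃ x : N.obj V, ∀ T m (l : T ≤ V), N.res l x =
        θ T m (le_trans (show T.1 ≤ V.1 from l) hV) (resM C F l s) (resD C l a) := by
    intro V hV s a
    refine hN.glue hdown (fun x hx => hcov x (hV hx)) _ fun T₁ T₂ h m₁ m₂ l₁ l₂ => ?_
    rw [← hθ T₁ T₂ h m₁ m₂ (le_trans (show T₁.1 ≤ V.1 from l₁) hV)
      (le_trans (show T₂.1 ≤ V.1 from l₂) hV), resD_resD, resM_apply, resM_apply,
      resM_apply, rF_rF]
  choose X hX using key
  have ext : ∀ (V : C.X.affineOpens) (hV : V.1 ≤ W) (x y : N.obj V),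
      (∀ T (_ : T ∈ 𝔅) (l : T ≤ V), N.res l x = N.res l y) → x = y := fun V hV x y h =>
    hN.ext hdown (fun p hp => hcov p (hV hp)) h
  refine ⟨⟨fun V => LinearMap.mk₂ _ (X V.1 V.2) (fun s s' a => ?_) (fun r s a => ?_)
    (fun s a a' => ?_) (fun r s a => ?_), fun V V' h s a => ?_⟩, fun T m l => ?_⟩
  · refine ext _ V.2 _ _ fun T m l => ?_
    rw [map_add, hX _ _ _ _ _ m, hX _ _ _ _ _ m, hX _ _ _ _ _ m, map_add, map_add,
      LinearMap.add_apply]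
  · refine ext _ V.2 _ _ fun T m l => ?_
    rw [hN.res_smul, hX _ _ _ _ _ m, hX _ _ _ _ _ m, (resM C F l).map_smulₛₗ, map_smul,
      LinearMap.smul_apply]
  · refine ext _ V.2 _ _ fun T m l => ?_
    rw [map_add, hX _ _ _ _ _ m, hX _ _ _ _ _ m, hX _ _ _ _ _ m, map_add, map_add]
  · refine ext _ V.2 _ _ fun T m l => ?_
    rw [hN.res_smul, hX _ _ _ _ _ m, hX _ _ _ _ _ m, resD_smul, map_smul]
  · refine ext _ V'.2 _ _ fun T m l => ?_
    change N.res l (X _ _ _ _) = N.res l (N.res h (X _ _ _ _))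
    rw [hN.res_res, hX _ _ _ _ _ m, hX _ _ _ _ _ m, resD_resD, resM_apply, resM_apply, resM_apply,
      rF_rF]
  · refine LinearMap.ext fun s => LinearMap.ext fun a => ?_
    change X T l s a = _
    refine ext _ l _ _ fun T' m' l' => ?_
    rw [hX _ _ _ _ _ m', hθ T' T l' m' m]

end Glue

end Charts

/-! ### Constructing and gluing connections -/

section Connections

variable {A : Type u} [CommRing A] {C : PolarScheme A} {n : ℕ} {F : C.X.Modules} {t : A}
  {V V' V'' : C.X.affineOpens}

theorem omegaTmul_add (s : Γ(F, V.1)) (w w' : Ω[Γ(C.X, V.1)⁄A]) :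
    omegaTmul s (w + w') = omegaTmul s w + omegaTmul s w' := TensorProduct.tmul_add s w w'

theorem omegaTmul_smul (s : Γ(F, V.1)) (r : Γ(C.X, V.1)) (w : Ω[Γ(C.X, V.1)⁄A]) :
    omegaTmul s (r • w) = r • omegaTmul s w := TensorProduct.tmul_smul r s w

theorem smul_omegaTmul (s : Γ(F, V.1)) (r : Γ(C.X, V.1)) (w : Ω[Γ(C.X, V.1)⁄A]) :
    omegaTmul (r • s) w = r • omegaTmul s w := rfl

theorem sum_omegaTmul {ι : Type*} (S : Finset ι) (s : ι → Γ(F, V.1)) (w : Ω[Γ(C.X, V.1)⁄A]) :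
    omegaTmul (∑ i ∈ S, s i) w = ∑ i ∈ S, omegaTmul (s i) w := TensorProduct.sum_tmul S s w

section DFrame

variable {U : C.X.Opens} {b : Fin n → Γ(F, U)} (hb : IsFrame F b)

/-- The connection `F → F ⊗ Ω` which vanishes on a frame. -/
def dFrame (h : V.1 ≤ U) (s : Γ(F, V.1)) : (tensorOmega F).obj V :=
  ∑ k, omegaTmul (rF F h (b k)) (KaehlerDifferential.D A _ ((hb.basis h).repr s k))

theorem dFrame_add (h : V.1 ≤ U) (s s' : Γ(F, V.1)) :
    dFrame hb h (s + s') = dFrame hb h s + dFrame hb h s' := by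
  simp only [dFrame, map_add, Finsupp.add_apply, omegaTmul_add, Finset.sum_add_distrib]

theorem dFrame_leibniz (h : V.1 ≤ U) (f : Γ(C.X, V.1)) (s : Γ(F, V.1)) :
    dFrame hb h (f • s) = f • dFrame hb h s + omegaTmul s (KaehlerDifferential.D A _ f) := by
  conv_rhs => rw [← (hb.basis h).sum_repr s]
  rw [sum_omegaTmul, dFrame, dFrame, Finset.smul_sum, ← Finset.sum_add_distrib]
  refine Finset.sum_congr rfl fun k _ => ?_
  rw [map_smul, Finsupp.smul_apply, smul_eq_mul, Derivation.leibniz, omegaTmul_add, omegaTmul_smul,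
    omegaTmul_smul, smul_omegaTmul, hb.basis_apply, (hb.basis h).sum_repr]

theorem dFrame_smul (h : V.1 ≤ U) (r : A) (s : Γ(F, V.1)) :
    dFrame hb h (r • s) = r • dFrame hb h s := by
  rw [← algebraMap_smul Γ(C.X, V.1) r s, dFrame_leibniz, Derivation.map_algebraMap,
    algebraMap_smul]
  exact add_eq_left.2 (TensorProduct.tmul_zero _ s)

theorem dFrame_res (h : V.1 ≤ U) (h' : V' ≤ V) (s : Γ(F, V.1)) :
    dFrame hb (le_trans (show V'.1 ≤ V.1 from h') h) (rF F h' s) =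
      (tensorOmega F).res h' (dFrame hb h s) := by
  rw [dFrame, dFrame, map_sum]
  refine Finset.sum_congr rfl fun k _ => ?_
  rw [tensorOmega_res_omegaTmul, kaehlerMap_D, rF_rF, hb.rF_repr h h']

end DFrame

/-- The combination of a bilinear map `θ` and an additive map `δ` in the local formula for a
connection. -/
def connMap {A R M I P : Type*} [CommRing A] [CommRing R] [Algebra A R] [AddCommGroup M]
    [AddCommGroup I] [AddCommGroup P] [Module R M] [Module R I] [Module R P] [Module A M]
    [Module A P] [IsScalarTower A R M] [IsScalarTower A R P] (θ : M →ₗ[R] I →ₗ[R] P)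
    (δ : M →ₗ[A] P) (ι : I →ₗ[R] R) (t : A) : M →ₗ[A] I →ₗ[R] P where
  toFun s := θ s + t • (LinearMap.toSpanSingleton R P (δ s) ∘ₗ ι)
  map_add' s s' := LinearMap.ext fun a => by
    simp only [map_add, LinearMap.add_apply, LinearMap.smul_apply, LinearMap.comp_apply,
      LinearMap.toSpanSingleton_apply, smul_add]
    abel
  map_smul' r s := LinearMap.ext fun a => by
    rw [← algebraMap_smul R r s, map_smul, algebraMap_smul, algebraMap_smul]
    simp only [map_smul, LinearMap.add_apply, LinearMap.smul_apply, LinearMap.comp_apply,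
      LinearMap.toSpanSingleton_apply, smul_add, RingHom.id_apply]
    rw [smul_comm _ r, smul_comm t r]

theorem connMap_apply {A R M I P : Type*} [CommRing A] [CommRing R] [Algebra A R] [AddCommGroup M]
    [AddCommGroup I] [AddCommGroup P] [Module R M] [Module R I] [Module R P] [Module A M]
    [Module A P] [IsScalarTower A R M] [IsScalarTower A R P] (θ : M →ₗ[R] I →ₗ[R] P)
    (δ : M →ₗ[A] P) (ι : I →ₗ[R] R) (t : A) (s : M) (a : I) :
    connMap θ δ ι t s a = θ s a + t • (ι a • δ s) := rfl

section ConnOfFrame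

variable {b : Fin n → Γ(F, V.1)} (hb : IsFrame F b) {φ : C.D.ideal V} (hφ : IsGen C φ)
  (hF : IsVectorBundle n F)

theorem tensorOmega_res_smul {F : C.X.Modules} (h : V' ≤ V) (r : Γ(C.X, V.1))
    (x : (tensorOmega F).obj V) :
    (tensorOmega F).res h (r • x) = resO C h r • (tensorOmega F).res h x :=
  (TensorProduct.map (resM C F h)
      (kaehlerMap (RingHom.id A) (resO C h) (resO_algebraMap C h))).map_smulₛₗ r x

/-- The `t`-connection with given values on a frame, contracted with a generator of `𝒪(-D)`. -/
def connOfFrame (t : A) (ω : Fin n → (tensorOmega F).obj V) : TConnection t F V.1 where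
  nabla V' := connMap ((homOfFrame hb hφ (isQCoh_tensorOmega hF) ω).1 V')
    { toFun := dFrame hb V'.2, map_add' := dFrame_add hb V'.2, map_smul' := dFrame_smul hb V'.2 }
    (C.D.ideal V'.1).subtype t
  leibniz V' f s a := by
    have h1 : (homOfFrame hb hφ (isQCoh_tensorOmega hF) ω).1 V' (f • s) a =
        f • (homOfFrame hb hφ (isQCoh_tensorOmega hF) ω).1 V' s a := by
      rw [map_smul]
      rfl
    have h2 : t • (a.1 • dFrame hb V'.2 (f • s)) = f • (t • (a.1 • dFrame hb V'.2 s)) +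
        t • (a.1 • omegaTmul s (KaehlerDifferential.D A _ f)) := by
      rw [dFrame_leibniz, smul_add, smul_add, smul_comm f t, smul_comm f a.1]
    exact (congrArg₂ (· + ·) h1 h2).trans
      ((add_assoc _ _ _).symm.trans (congrArg (· + _) (smul_add _ _ _).symm))
  compat V₁ V₂ h s a := by
    have h1 := (homOfFrame hb hφ (isQCoh_tensorOmega hF) ω).2 V₁ V₂ h s a
    have h2 : t • ((resD C h a).1 • dFrame hb V₂.2 (resM C F h s)) =
        (tensorOmega F).res h (t • (a.1 • dFrame hb V₁.2 s)) := by
      rw [map_smul, tensorOmega_res_smul]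
      exact congrArg (fun x => t • (resO C h a.1 • x)) (dFrame_res hb V₁.2 h s)
    exact (congrArg₂ (· + ·) h1 h2).trans (map_add _ _ _).symm

theorem connOfFrame_apply (t : A) (ω : Fin n → (tensorOmega F).obj V) (k : Fin n) :
    (connOfFrame hb hφ hF t ω).nabla ⟨V, le_rfl⟩ (b k) φ = ω k := by
  have h1 : dFrame hb (le_refl V.1) (b k) = 0 := by
    refine Finset.sum_eq_zero fun l _ => ?_
    have h2 : (hb.basis (le_refl V.1)).repr (b k) l = if k = l then 1 else 0 := by
      conv_lhs => rw [← rF_self F le_rfl (b k), ← hb.basis_apply le_rfl k]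
      rw [Module.Basis.repr_self, Finsupp.single_apply]
    rw [h2]
    have h3 : KaehlerDifferential.D A Γ(C.X, V.1) (if k = l then 1 else 0) = 0 := by
      split_ifs
      · exact Derivation.map_one_eq_zero _
      · exact map_zero _
    rw [h3]
    exact TensorProduct.tmul_zero _ _
  refine (connMap_apply _ _ _ _ _ _).trans ?_
  rw [homOfFrame_apply_frame]
  refine add_eq_left.2 ?_
  refine (congrArg (fun x => t • (φ.1 • x)) h1).trans ?_
  rw [smul_zero, smul_zero]

end ConnOfFrame

/-- The restriction of a connection to an open subset. -/
def TConnection.restrict {W W' : C.X.Opens} (nab : TConnection t F W) (h : W' ≤ W) :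
    TConnection t F W' where
  nabla V := nab.nabla ⟨V.1, V.2.trans h⟩
  leibniz V := nab.leibniz ⟨V.1, V.2.trans h⟩
  compat V V' := nab.compat ⟨V.1, V.2.trans h⟩ ⟨V'.1, V'.2.trans h⟩

/-- The difference of two connections is linear. -/
def TConnection.diff {W W' : C.X.Opens} (nab : TConnection t F W) (nab' : TConnection t F W')
    (V : C.X.affineOpens) (h : V.1 ≤ W) (h' : V.1 ≤ W') :
    Γ(F, V.1) →ₗ[Γ(C.X, V.1)] (C.D.ideal V →ₗ[Γ(C.X, V.1)] (tensorOmega F).obj V) where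
  toFun s := nab.nabla ⟨V, h⟩ s - nab'.nabla ⟨V, h'⟩ s
  map_add' s s' := by
    rw [map_add, map_add]
    abel
  map_smul' f s := by
    refine LinearMap.ext fun a => ?_
    refine (congrArg₂ (· - ·) (nab.leibniz ⟨V, h⟩ f s a) (nab'.leibniz ⟨V, h'⟩ f s a)).trans ?_
    exact (add_sub_add_right_eq_sub _ _ _).trans (smul_sub _ _ _).symm

/-- Connections glue. -/
theorem exists_tconnection (hF : IsVectorBundle n F) {W : C.X.Opens} {𝔅 : Set C.X.affineOpens}
    (hdown : ∀ T₁ T₂ : C.X.affineOpens, T₁ ≤ T₂ → T₂ ∈ 𝔅 → T₁ ∈ 𝔅)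
    (hcov : ∀ x ∈ W, ∃ T ∈ 𝔅, x ∈ T.1) (nab : ∀ T : C.X.affineOpens, T ∈ 𝔅 → TConnection t F T.1)
    (hnab : ∀ (T₁ T₂ : C.X.affineOpens) (h : T₁ ≤ T₂) (m₁ : T₁ ∈ 𝔅) (m₂ : T₂ ∈ 𝔅),
      (nab T₁ m₁).nabla ⟨T₁, le_rfl⟩ = (nab T₂ m₂).nabla ⟨T₁, h⟩) :
    ∃ N : TConnection t F W, ∀ T (m : T ∈ 𝔅) (l : T.1 ≤ W),
      N.nabla ⟨T, l⟩ = (nab T m).nabla ⟨T, le_rfl⟩ := by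
  have hN := isQCoh_tensorOmega (C := C) hF
  have key : ∀ (V : C.X.affineOpens) (_ : V.1 ≤ W) (s : Γ(F, V.1)) (a : C.D.ideal V),
      ∃ x : (tensorOmega F).obj V, ∀ T m (l : T ≤ V), (tensorOmega F).res l x =
        (nab T m).nabla ⟨T, le_rfl⟩ (resM C F l s) (resD C l a) := by
    intro V hV s a
    refine hN.glue hdown (fun x hx => hcov x (hV hx)) _ fun T₁ T₂ h m₁ m₂ l₁ l₂ => ?_
    rw [hnab T₁ T₂ h m₁ m₂, ← (nab T₂ m₂).compat ⟨T₂, le_rfl⟩ ⟨T₁, h⟩ h, resD_resD, resM_apply,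
      resM_apply, resM_apply, rF_rF]
  choose X hX using key
  have ext : ∀ (V : C.X.affineOpens) (hV : V.1 ≤ W) (x y : (tensorOmega F).obj V),
      (∀ T (_ : T ∈ 𝔅) (l : T ≤ V), (tensorOmega F).res l x = (tensorOmega F).res l y) → x = y :=
    fun V hV x y h => hN.ext hdown (fun p hp => hcov p (hV hp)) h
  let Y : ∀ (V : C.X.affineOpens) (_ : V.1 ≤ W) (_ : Γ(F, V.1)),
      C.D.ideal V →ₗ[Γ(C.X, V.1)] (tensorOmega F).obj V := fun V hV s =>
    { toFun := X V hV s
      map_add' := fun a a' => by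
        refine ext _ hV _ _ fun T m l => ?_
        rw [map_add, hX _ _ _ _ _ m, hX _ _ _ _ _ m, hX _ _ _ _ _ m, map_add, map_add]
      map_smul' := fun r a => by
        refine ext _ hV _ _ fun T m l => ?_
        rw [RingHom.id_apply, hN.res_smul, hX _ _ _ _ _ m, hX _ _ _ _ _ m, resD_smul, map_smul] }
  let Z : ∀ (V : C.X.affineOpens) (_ : V.1 ≤ W),
      Γ(F, V.1) →ₗ[A] C.D.ideal V →ₗ[Γ(C.X, V.1)] (tensorOmega F).obj V := fun V hV =>
    { toFun := Y V hV
      map_add' := fun s s' => LinearMap.ext fun a => by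
        refine ext _ hV _ _ fun T m l => ?_
        change (tensorOmega F).res l (X _ _ _ _) = (tensorOmega F).res l (X _ _ _ _ + X _ _ _ _)
        rw [map_add, hX _ _ _ _ _ m, hX _ _ _ _ _ m, hX _ _ _ _ _ m, map_add, map_add,
          LinearMap.add_apply]
      map_smul' := fun r s => LinearMap.ext fun a => by
        refine ext _ hV _ _ fun T m l => ?_
        change (tensorOmega F).res l (X _ _ _ _) = (tensorOmega F).res l (r • X _ _ _ _)
        rw [map_smul, hX _ _ _ _ _ m, hX _ _ _ _ _ m]
        exact congrArg (fun f => f (resD C l a)) (((nab T m).nabla ⟨T, le_rfl⟩ ∘ₗ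
          toLinA l (resM C F l)).map_smul r s) }
  refine ⟨⟨fun V => Z V.1 V.2, fun V f s a => ?_, fun V V' h s a => ?_⟩, fun T m l => ?_⟩
  · refine ext _ V.2 _ _ fun T m l => ?_
    change (tensorOmega F).res l (X _ _ _ _) = (tensorOmega F).res l (f • X _ _ _ _ + _)
    rw [map_add, hN.res_smul, map_smul, hN.res_smul, hX _ _ _ _ _ m, hX _ _ _ _ _ m,
      (resM C F l).map_smulₛₗ, (nab T m).leibniz, tensorOmega_res_omegaTmul, kaehlerMap_D]
    rfl
  · refine ext _ V'.2 _ _ fun T m l => ?_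
    change (tensorOmega F).res l (X _ _ _ _) = (tensorOmega F).res l ((tensorOmega F).res h
      (X _ _ _ _))
    rw [hN.res_res, hX _ _ _ _ _ m, hX _ _ _ _ _ m, resD_resD, resM_apply, resM_apply, resM_apply,
      rF_rF]
  · refine LinearMap.ext fun s => LinearMap.ext fun a => ?_
    change X T l s a = _
    refine ext _ l _ _ fun T' m' l' => ?_
    rw [hX _ _ _ _ _ m', hnab T' T l' m' m]
    exact (nab T m).compat ⟨T, le_rfl⟩ ⟨T', l'⟩ l' s a

end Connections

/-! ### Modules over a square zero extension -/

section SquareZero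

variable {A A' : Type u} [CommRing A] [CommRing A'] [Algebra A' A]

section KerRel

variable {N' N P' P : Type u} [AddCommGroup N'] [Module A' N'] [AddCommGroup N] [Module A N]
  [AddCommGroup P'] [Module A' P'] [AddCommGroup P] [Module A P]

/-- The relation `∑ iₖ xₖ ∼ ∑ p xₖ ⊗ iₖ`, for `xₖ` in `N'` and `iₖ` in the kernel `I` of `A' → A`. -/
def KerRel (p : N' →ₛₗ[algebraMap A' A] N) (δ : N') (ν : N ⊗[A] KerModule A A') : Prop :=
  ∃ w : N' ⊗[A'] RingHom.ker (algebraMap A' A), δ = mulKer N' w ∧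
    ν = TensorProduct.map p toKerModule w

variable {p : N' →ₛₗ[algebraMap A' A] N} {p₂ : P' →ₛₗ[algebraMap A' A] P}

theorem KerRel.zero : KerRel p 0 0 := ⟨0, (map_zero _).symm, (map_zero _).symm⟩

theorem KerRel.add {δ ε : N'} {ν μ : N ⊗[A] KerModule A A'} (h : KerRel p δ ν)
    (h' : KerRel p ε μ) : KerRel p (δ + ε) (ν + μ) := by
  obtain ⟨w, rfl, rfl⟩ := h
  obtain ⟨w', rfl, rfl⟩ := h'
  exact ⟨w + w', (map_add _ _ _).symm, (map_add _ _ _).symm⟩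

theorem KerRel.neg {δ : N'} {ν : N ⊗[A] KerModule A A'} (h : KerRel p δ ν) :
    KerRel p (-δ) (-ν) := by
  obtain ⟨w, rfl, rfl⟩ := h
  exact ⟨-w, (map_neg _ _).symm, (map_neg _ _).symm⟩

theorem KerRel.sub {δ ε : N'} {ν μ : N ⊗[A] KerModule A A'} (h : KerRel p δ ν)
    (h' : KerRel p ε μ) : KerRel p (δ - ε) (ν - μ) := by
  rw [sub_eq_add_neg, sub_eq_add_neg]
  exact h.add h'.neg

theorem KerRel.sum {ι : Type*} (S : Finset ι) {δ : ι → N'} {ν : ι → N ⊗[A] KerModule A A'}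
    (h : ∀ i ∈ S, KerRel p (δ i) (ν i)) : KerRel p (∑ i ∈ S, δ i) (∑ i ∈ S, ν i) := by
  classical
  induction S using Finset.induction_on with
  | empty => exact .zero
  | insert i S hi ih =>
    rw [Finset.sum_insert hi, Finset.sum_insert hi]
    exact (h i (Finset.mem_insert_self i S)).add
      (ih fun j hj => h j (Finset.mem_insert_of_mem hj))

theorem KerRel.smul_ker (x : N') (i : RingHom.ker (algebraMap A' A)) :
    KerRel p (i.1 • x) (p x ⊗ₜ toKerModule i) := ⟨x ⊗ₜ i, rfl, rfl⟩

theorem mulKer_rTensor (q' : N' →ₗ[A'] P') (w : N' ⊗[A'] RingHom.ker (algebraMap A' A)) :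
    mulKer (A := A) (A' := A') P' (LinearMap.rTensor _ q' w) = q' (mulKer N' w) := by
  induction w using TensorProduct.induction_on with
  | zero => simp only [map_zero]
  | add x y hx hy => simp only [map_add, hx, hy]
  | tmul x i => exact (map_smul q' i.1 x).symm

theorem map_toKerModule_rTensor (q' : N' →ₗ[A'] P') (q : N →ₗ[A] P) (hq : ∀ x, p₂ (q' x) = q (p x))
    (w : N' ⊗[A'] RingHom.ker (algebraMap A' A)) :
    TensorProduct.map p₂ toKerModule (LinearMap.rTensor _ q' w) =
      LinearMap.rTensor (KerModule A A') q (TensorProduct.map p toKerModule w) := by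
  induction w using TensorProduct.induction_on with
  | zero => simp only [map_zero]
  | add x y hx hy => simp only [map_add, hx, hy]
  | tmul x i => exact congrArg (· ⊗ₜ[A] toKerModule i) (hq x)

theorem KerRel.map {δ : N'} {ν : N ⊗[A] KerModule A A'} (h : KerRel p δ ν) (q' : N' →ₗ[A'] P')
    (q : N →ₗ[A] P) (hq : ∀ x, p₂ (q' x) = q (p x)) :
    KerRel p₂ (q' δ) (LinearMap.rTensor (KerModule A A') q ν) := by
  obtain ⟨w, rfl, rfl⟩ := h
  exact ⟨_, (mulKer_rTensor q' w).symm, (map_toKerModule_rTensor q' q hq w).symm⟩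

theorem mulKer_injective [Module.Flat A' N'] : Function.Injective (mulKer (A := A) (A' := A') N') := by
  have h1 : mulKer (A := A) (A' := A') N' = (TensorProduct.rid A' N').toLinearMap ∘ₗ
      LinearMap.lTensor N' (Submodule.subtype (RingHom.ker (algebraMap A' A))) :=
    TensorProduct.ext' fun x i => rfl
  rw [h1, LinearMap.coe_comp]
  exact (TensorProduct.rid A' N').injective.comp
    (Module.Flat.lTensor_preserves_injective_linearMap _ Subtype.val_injective)

theorem KerRel.eq_zero [Module.Flat A' N'] {ν : N ⊗[A] KerModule A A'} (h : KerRel p 0 ν) :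
    ν = 0 := by
  obtain ⟨w, hw, rfl⟩ := h
  rw [mulKer_injective (hw.symm.trans (map_zero _).symm), map_zero]

theorem KerRel.unique [Module.Flat A' N'] {δ : N'} {ν μ : N ⊗[A] KerModule A A'}
    (h : KerRel p δ ν) (h' : KerRel p δ μ) : ν = μ := by
  have := h.sub h'
  rw [sub_self] at this
  exact sub_eq_zero.1 this.eq_zero

theorem toKerModule_surjective (hs : Function.Surjective (algebraMap A' A)) :
    Function.Surjective (toKerModule (A := A) (A' := A')) := by
  intro x
  induction x using TensorProduct.induction_on with
  | zero => exact ⟨0, map_zero _⟩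
  | add x y hx hy =>
    obtain ⟨i, rfl⟩ := hx
    obtain ⟨j, rfl⟩ := hy
    exact ⟨i + j, map_add _ _ _⟩
  | tmul r i =>
    obtain ⟨r, rfl⟩ := hs r
    refine ⟨r • i, ?_⟩
    change (1 : A) ⊗ₜ[A'] (r • i) = _
    rw [TensorProduct.tmul_smul, TensorProduct.smul_tmul', Algebra.smul_def, mul_one]

theorem exists_kerRel_right {δ : N'} (h : δ ∈ LinearMap.range (mulKer (A := A) (A' := A') N')) :
    ∃ ν, KerRel p δ ν := by
  obtain ⟨w, rfl⟩ := h
  exact ⟨_, w, rfl, rfl⟩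

theorem exists_kerRel_left (hs : Function.Surjective (algebraMap A' A))
    (hp : Function.Surjective p) (ν : N ⊗[A] KerModule A A') : ∃ δ, KerRel p δ ν := by
  induction ν using TensorProduct.induction_on with
  | zero => exact ⟨0, .zero⟩
  | add x y hx hy =>
    obtain ⟨δ, h⟩ := hx
    obtain ⟨ε, h'⟩ := hy
    exact ⟨_, h.add h'⟩
  | tmul x i =>
    obtain ⟨x, rfl⟩ := hp x
    obtain ⟨i, rfl⟩ := toKerModule_surjective hs i
    exact ⟨_, .smul_ker x i⟩

theorem KerRel.apply_eq_zero {δ : N'} {ν : N ⊗[A] KerModule A A'} (h : KerRel p δ ν) :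
    p δ = 0 := by
  obtain ⟨w, rfl, -⟩ := h
  induction w using TensorProduct.induction_on with
  | zero => rw [map_zero, map_zero]
  | add x y hx hy => rw [map_add, map_add, hx, hy, add_zero]
  | tmul x i =>
    change p (i.1 • x) = 0
    rw [p.map_smulₛₗ, RingHom.mem_ker.1 i.2, zero_smul]

/-- If `p` is the reduction modulo `I` and `I² = 0`, then `∑ p xₖ ⊗ iₖ` determines `∑ iₖ xₖ`. -/
theorem KerRel.left_eq_zero (hsq : RingHom.ker (algebraMap A' A) ^ 2 = ⊥)
    (hp : Function.Surjective p)
    (hker : ∀ x, p x = 0 → x ∈ LinearMap.range (mulKer (A := A) (A' := A') N')) {δ : N'}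
    (h : KerRel p δ 0) : δ = 0 := by
  obtain ⟨w, rfl, hw⟩ := h
  letI : Module A' N := Module.compHom N (algebraMap A' A)
  haveI : IsScalarTower A' A N := ⟨fun a b c => by rw [Algebra.smul_def, mul_smul]; rfl⟩
  let p' : N' →ₗ[A'] N := { toFun := p, map_add' := map_add p, map_smul' := p.map_smulₛₗ }
  have h1 : ∀ w, TensorProduct.AlgebraTensorModule.cancelBaseChange A' A A N
      (RingHom.ker (algebraMap A' A)) (TensorProduct.map p toKerModule w) =
        LinearMap.rTensor _ p' w := by
    intro w
    induction w using TensorProduct.induction_on with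
    | zero => simp only [map_zero]
    | add x y hx hy => simp only [map_add, hx, hy]
    | tmul x i => exact congrArg (· ⊗ₜ[A'] i) (one_smul A (p x))
  have h2 : LinearMap.rTensor (RingHom.ker (algebraMap A' A)) p' w = 0 := by
    rw [← h1, ← hw, map_zero]
  -- `w` is a sum of tensors `x ⊗ i` with `x ∈ ker p = I N'`, whose products `i x` lie in `I² N' = 0`
  have h3 := (rTensor_exact (RingHom.ker (algebraMap A' A))
    (LinearMap.exact_subtype_ker_map p') hp w).1 h2
  obtain ⟨w, rfl⟩ := h3
  clear h2 hw h1
  induction w using TensorProduct.induction_on with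
  | zero => rw [map_zero, map_zero]
  | add x y hx hy =>
    rw [map_add, map_add, hx, hy, add_zero]
  | tmul x i =>
    change i.1 • x.1 = 0
    obtain ⟨v, hv⟩ := hker x.1 (LinearMap.mem_ker.1 x.2)
    rw [← hv]
    clear hv
    induction v using TensorProduct.induction_on with
    | zero => rw [map_zero, smul_zero]
    | add x y hx hy => rw [map_add, smul_add, hx, hy, add_zero]
    | tmul x j =>
      change i.1 • (j.1 • x) = 0
      have h4 : i.1 * j.1 ∈ RingHom.ker (algebraMap A' A) ^ 2 := by
        rw [pow_two]
        exact Ideal.mul_mem_mul i.2 j.2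
      rw [hsq, Ideal.mem_bot] at h4
      rw [smul_smul, h4, zero_smul]

end KerRel

section Kernels

variable {R' R : Type u} [CommRing R'] [CommRing R] [Algebra A' R'] [Algebra A R] {ψ : R' →+* R}

theorem mem_range_mulKer {N' : Type u} [AddCommGroup N'] [Module A' N'] [Module R' N']
    [IsScalarTower A' R' N'] {x : N'}
    (hx : x ∈ ((RingHom.ker (algebraMap A' A)).map (algebraMap A' R')) • (⊤ : Submodule R' N')) :
    x ∈ LinearMap.range (mulKer (A := A) (A' := A') N') := by
  refine Submodule.smul_induction_on hx (fun r hr m hm => ?_) fun x y hx hy => add_mem hx hy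
  clear hm
  induction hr using Submodule.span_induction generalizing m with
  | zero => rw [zero_smul]; exact zero_mem _
  | add x y _ _ hx hy => rw [add_smul]; exact add_mem (hx m) (hy m)
  | smul c x _ hx =>
    rw [smul_eq_mul, mul_comm, mul_smul]
    exact hx (c • m)
  | mem r hr =>
    obtain ⟨i, hi, rfl⟩ := hr
    exact ⟨m ⊗ₜ ⟨i, hi⟩, (algebraMap_smul R' i m).symm⟩

theorem kaehlerMap_surjective (hψA : ∀ a, ψ (algebraMap A' R' a) = algebraMap A R (algebraMap A' A a))
    (hψ : Function.Surjective ψ) : Function.Surjective (kaehlerMap (algebraMap A' A) ψ hψA) := by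
  intro w
  refine kaehler_induction w ⟨0, map_zero _⟩ (fun r => ?_) (fun r x hx => ?_) fun x y hx hy => ?_
  · obtain ⟨r, rfl⟩ := hψ r
    exact ⟨_, kaehlerMap_D _ _ _ r⟩
  · obtain ⟨r, rfl⟩ := hψ r
    obtain ⟨x, rfl⟩ := hx
    exact ⟨_, kaehlerMap_smul _ _ _ r x⟩
  · obtain ⟨x, rfl⟩ := hx
    obtain ⟨y, rfl⟩ := hy
    exact ⟨_, map_add _ x y⟩

/-- The kernel of `Ω[R'/A'] → Ω[R/A]` is `I Ω[R'/A']`, if `R = R'/IR'`. -/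
theorem mem_of_kaehlerMap_eq_zero (hs : Function.Surjective (algebraMap A' A))
    (hψA : ∀ a, ψ (algebraMap A' R' a) = algebraMap A R (algebraMap A' A a))
    (hψ : Function.Surjective ψ)
    (hker : RingHom.ker ψ = (RingHom.ker (algebraMap A' A)).map (algebraMap A' R')) {w : Ω[R'⁄A']}
    (hw : kaehlerMap (algebraMap A' A) ψ hψA w = 0) :
    w ∈ (RingHom.ker ψ) • (⊤ : Submodule R' Ω[R'⁄A']) := by
  set J := RingHom.ker ψ
  let e : R ≃+* R' ⧸ J := (RingHom.quotientKerEquivOfSurjective hψ).symm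
  let Q := Ω[R'⁄A'] ⧸ (J • (⊤ : Submodule R' Ω[R'⁄A']))
  letI : Module R Q := Module.compHom Q e.toRingHom
  have he : ∀ r, e (ψ r) = Ideal.Quotient.mk J r := fun r => by
    rw [RingEquiv.symm_apply_eq]
    rfl
  have smul_def : ∀ (r : R') (x : Ω[R'⁄A']), ψ r • (Submodule.Quotient.mk x : Q) =
      Submodule.Quotient.mk (r • x) := fun r x => by
    change e (ψ r) • (Submodule.Quotient.mk x : Q) = _
    rw [he]
    rfl
  letI : Module A Q := Module.compHom Q (algebraMap A R)
  haveI : IsScalarTower A R Q := ⟨fun a b c => by rw [Algebra.smul_def, mul_smul]; rfl⟩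
  -- the derivation `R' → Ω[R'/A'] / J` factors through `R`, which gives a left inverse of the map
  -- from this quotient to `Ω[R/A]`
  let d : R' → Q := fun r => Submodule.Quotient.mk (KaehlerDifferential.D A' R' r)
  have dadd : ∀ r s, d (r + s) = d r + d s := fun r s => by
    simp only [d, map_add, Submodule.Quotient.mk_add]
  have dmul : ∀ r s, d (r * s) = ψ r • d s + ψ s • d r := fun r s => by
    simp only [d, Derivation.leibniz, Submodule.Quotient.mk_add, smul_def]
  have dzero : ∀ r ∈ J, d r = 0 := by
    intro r hr
    rw [hker] at hr
    refine Submodule.span_induction (p := fun r _ => d r = 0) ?_ ?_ ?_ ?_ hr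
    · rintro _ ⟨i, _, rfl⟩
      simp only [d, Derivation.map_algebraMap]
      rfl
    · simp only [d, map_zero]
      rfl
    · intro x y _ _ hx hy
      rw [dadd, hx, hy, add_zero]
    · intro c x hx' hx
      have hx'' : ψ x = 0 := by
        have : x ∈ J := by rw [hker]; exact hx'
        exact this
      rw [smul_eq_mul, dmul, hx, smul_zero, hx'', zero_smul, zero_add]
  have dcongr : ∀ r s, ψ r = ψ s → d r = d s := fun r s h => by
    have h1 : r - s ∈ J := by rw [RingHom.mem_ker, map_sub, h, sub_self]
    have h2 := dadd (r - s) s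
    rw [sub_add_cancel, dzero _ h1, zero_add] at h2
    exact h2
  let σ := Function.surjInv hψ
  have hσ : ∀ r, ψ (σ r) = r := Function.surjInv_eq hψ
  let D : Derivation A R Q := Derivation.mk'
    { toFun := fun r => d (σ r)
      map_add' := fun r s => by
        rw [← dadd]
        exact dcongr _ _ (by rw [hσ, map_add, hσ, hσ])
      map_smul' := fun a r => by
        obtain ⟨a, rfl⟩ := hs a
        have h1 : d (σ (algebraMap A' A a • r)) = d (algebraMap A' R' a * σ r) :=
          dcongr _ _ (by rw [hσ, map_mul, hσ, hψA, Algebra.smul_def])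
        have h2 : d (algebraMap A' R' a) = 0 := by
          simp only [d, Derivation.map_algebraMap]
          rfl
        rw [h1, dmul, h2, smul_zero, add_zero, hψA]
        rfl }
    fun r s => by
      have h1 : d (σ (r * s)) = d (σ r * σ s) := dcongr _ _ (by rw [hσ, map_mul, hσ, hσ])
      refine h1.trans ((dmul _ _).trans ?_)
      rw [hσ, hσ]
      rfl
  let f : Ω[R'⁄A'] →ₛₗ[ψ] Q :=
    { toFun := fun x => D.liftKaehlerDifferential (kaehlerMap (algebraMap A' A) ψ hψA x)
      map_add' := fun x y => by rw [map_add, map_add]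
      map_smul' := fun r x => by rw [kaehlerMap_smul, map_smul] }
  let f' : Ω[R'⁄A'] →ₛₗ[ψ] Q :=
    { toFun := fun x => Submodule.Quotient.mk x
      map_add' := fun x y => rfl
      map_smul' := fun r x => (smul_def r x).symm }
  have hff : f = f' := kaehler_hom_ext fun r => by
    change D.liftKaehlerDifferential (kaehlerMap (algebraMap A' A) ψ hψA (KaehlerDifferential.D A' R' r)) =
      d r
    rw [kaehlerMap_D, Derivation.liftKaehlerDifferential_comp_D]
    exact dcongr _ _ (hσ _)
  have h1 : f w = 0 := by
    change D.liftKaehlerDifferential (kaehlerMap (algebraMap A' A) ψ hψA w) = 0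
    rw [hw, map_zero]
  rw [hff] at h1
  exact (Submodule.Quotient.mk_eq_zero _).1 h1

variable {M' M : Type u} [AddCommGroup M'] [Module R' M'] [AddCommGroup M] [Module R M]
  {W' W : Type u} [AddCommGroup W'] [Module R' W'] [AddCommGroup W] [Module R W] {n : ℕ}

theorem map_surjective_of_surjective (p : M' →ₛₗ[ψ] M) (q : W' →ₛₗ[ψ] W)
    (hp : Function.Surjective p) (hq : Function.Surjective q) :
    Function.Surjective (TensorProduct.map p q) := by
  intro x
  induction x using TensorProduct.induction_on with
  | zero => exact ⟨0, map_zero _⟩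
  | add x y hx hy =>
    obtain ⟨x, rfl⟩ := hx
    obtain ⟨y, rfl⟩ := hy
    exact ⟨x + y, map_add _ _ _⟩
  | tmul x y =>
    obtain ⟨x, rfl⟩ := hp x
    obtain ⟨y, rfl⟩ := hq y
    exact ⟨x ⊗ₜ y, rfl⟩

theorem mem_of_map_eq_zero (p : M' →ₛₗ[ψ] M) (q : W' →ₛₗ[ψ] W) (β' : Module.Basis (Fin n) R' M')
    (β : Module.Basis (Fin n) R M) (hβ : ∀ k, p (β' k) = β k) {J : Ideal R'}
    (hq : ∀ w, q w = 0 → w ∈ J • (⊤ : Submodule R' W')) {x : M' ⊗[R'] W'}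
    (hx : TensorProduct.map p q x = 0) : x ∈ J • (⊤ : Submodule R' (M' ⊗[R'] W')) := by
  obtain ⟨c, rfl⟩ := TensorProduct.eq_repr_basis_left β' x
  have h1 : (c.mapRange q (map_zero q)).sum (fun k w => β k ⊗ₜ[R] w) = 0 := by
    rw [← hx, Finsupp.sum_mapRange_index (fun k => TensorProduct.tmul_zero _ _), Finsupp.sum,
      Finsupp.sum, map_sum]
    exact Finset.sum_congr rfl fun k _ => by rw [TensorProduct.map_tmul, hβ]
  have h2 := TensorProduct.sum_tmul_basis_left_eq_zero β _ h1
  refine Submodule.sum_mem _ fun k _ => ?_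
  have h3 := hq (c k) (by simpa using DFunLike.congr_fun h2 k)
  refine Submodule.smul_induction_on h3 (fun r hr m _ => ?_) fun x y hx hy => ?_
  · change β' k ⊗ₜ[R'] (r • m) ∈ _
    rw [TensorProduct.tmul_smul]
    exact Submodule.smul_mem_smul hr trivial
  · change β' k ⊗ₜ[R'] (x + y) ∈ _
    rw [TensorProduct.tmul_add]
    exact add_mem hx hy

end Kernels

end SquareZero

/-! ### Frames, functions and differentials on a thickening -/

namespace PolarScheme.Hom

variable {A A' : Type u} [CommRing A] [CommRing A'] [Algebra A' A]
  {C : PolarScheme A} {C' : PolarScheme A'} (g : C.Hom C')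

theorem mapO_resO {U₁' U₂' : C'.X.Opens} {U₁ U₂ : C.X.Opens} (e₁ : U₁ ≤ g.f ⁻¹ᵁ U₁')
    (e₂ : U₂ ≤ g.f ⁻¹ᵁ U₂') (h' : U₁' ≤ U₂') (h : U₁ ≤ U₂) (r : Γ(C'.X, U₂')) :
    g.mapO e₁ (resO C' h' r) = resO C h (g.mapO e₂ r) := appLE_rs g.f e₂ e₁ h' h r

theorem mapD_resD {V₁' V₂' : C'.X.affineOpens} {V₁ V₂ : C.X.affineOpens} (e₁ : V₁.1 ≤ g.f ⁻¹ᵁ V₁'.1)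
    (e₂ : V₂.1 ≤ g.f ⁻¹ᵁ V₂'.1) (h' : V₁' ≤ V₂') (h : V₁ ≤ V₂) (a : C'.D.ideal V₂') :
    g.mapD e₁ (resD C' h' a) = resD C h (g.mapD e₂ a) :=
  Subtype.ext (g.mapO_resO e₁ e₂ h' h a.1)

section

variable {F : C.X.Modules} {L : C'.X.Modules} (α : L ⟶ (Scheme.Modules.pushforward g.f).obj F)

theorem mapM_smul {U' : C'.X.Opens} {U : C.X.Opens} (e : U ≤ g.f ⁻¹ᵁ U') (r : Γ(C'.X, U'))
    (s : Γ(L, U')) : g.mapM α e (r • s) = g.mapO e r • g.mapM α e s :=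
  (g.mapM α e).map_smulₛₗ r s

theorem mapM_resM {U₁' U₂' : C'.X.Opens} {U₁ U₂ : C.X.Opens} (e₁ : U₁ ≤ g.f ⁻¹ᵁ U₁')
    (e₂ : U₂ ≤ g.f ⁻¹ᵁ U₂') (h' : U₁' ≤ U₂') (h : U₁ ≤ U₂) (s : Γ(L, U₂')) :
    g.mapM α e₁ (resM C' L h' s) = resM C F h (g.mapM α e₂ s) := pull_rF g.f α e₂ e₁ h' h s

variable {V' : C'.X.affineOpens} {V : C.X.affineOpens} (e : V.1 ≤ g.f ⁻¹ᵁ V'.1)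

theorem mapOmega_omegaTmul (s : Γ(L, V'.1)) (w : Ω[Γ(C'.X, V'.1)⁄A']) :
    g.mapOmega α e (omegaTmul s w) = omegaTmul (g.mapM α e s)
      (kaehlerMap (algebraMap A' A) (g.mapO e) (g.mapO_algebraMap e) w) := rfl

theorem mapOmega_smul (r : Γ(C'.X, V'.1)) (x : (tensorOmega L).obj V') :
    g.mapOmega α e (r • x) = g.mapO e r • g.mapOmega α e x :=
  (TensorProduct.map (g.mapM α e)
    (kaehlerMap (algebraMap A' A) (g.mapO e) (g.mapO_algebraMap e))).map_smulₛₗ r x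

theorem mapOmega_res {V₁' : C'.X.affineOpens} {V₁ : C.X.affineOpens} (e₁ : V₁.1 ≤ g.f ⁻¹ᵁ V₁'.1)
    (h' : V₁' ≤ V') (h : V₁ ≤ V) (x : (tensorOmega L).obj V') :
    g.mapOmega α e₁ ((tensorOmega L).res h' x) = (tensorOmega F).res h (g.mapOmega α e x) := by
  refine tensorOmega_induction x (by simp only [map_zero]) (fun s w => ?_) fun x y hx hy => ?_
  · rw [tensorOmega_res_omegaTmul, mapOmega_omegaTmul, mapOmega_omegaTmul,
      tensorOmega_res_omegaTmul]
    refine congrArg₂ omegaTmul (g.mapM_resM α e₁ e h' h s) ?_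
    refine (kaehlerMap_kaehlerMap _ _ _ _ _ _ (algebraMap A' A) (g.mapO (le_trans h e)) (g.mapO_algebraMap (le_trans h e)) ?_ w).trans
      (kaehlerMap_kaehlerMap _ _ _ _ _ _ _ _ _ ?_ w).symm
    · intro r
      rw [g.mapO_resO e₁ (le_trans h e) h' (le_refl _), resO_self]
    · intro r
      rw [← g.mapO_resO (le_trans h e) e le_rfl h, resO_self]
  · rw [map_add, map_add, map_add, map_add, hx, hy]

end

/-- The inverse image of an affine open set under an affine morphism. -/
def down [IsAffineHom g.f] (V' : C'.X.affineOpens) : C.X.affineOpens :=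
  ⟨g.f ⁻¹ᵁ V'.1, V'.2.preimage g.f⟩

variable [IsAffineHom g.f]

theorem down_mono {V₁' V₂' : C'.X.affineOpens} (h : V₁' ≤ V₂') : g.down V₁' ≤ g.down V₂' :=
  g.f.preimage_mono h

theorem le_down (V' : C'.X.affineOpens) : (g.down V').1 ≤ g.f ⁻¹ᵁ V'.1 := le_rfl

end PolarScheme.Hom

section Pairs

variable {A A' : Type u} [CommRing A] [CommRing A'] [Algebra A' A]
  {C : PolarScheme A} {C' : PolarScheme A'} {g : C.Hom C'} {n : ℕ} {F : C.X.Modules}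

theorem exists_isUnit_matrix_lift {R' R : Type u} [CommRing R'] [CommRing R] (ψ : R' →+* R)
    (hψ : Function.Surjective ψ) (hker : ∀ x, ψ x = 0 → IsNilpotent x)
    {M : Matrix (Fin n) (Fin n) R} (hM : IsUnit M) :
    ∃ M' : Matrix (Fin n) (Fin n) R', IsUnit M' ∧ M'.map ψ = M := by
  choose σ hσ using hψ
  refine ⟨M.map σ, ?_, ?_⟩
  · rw [Matrix.isUnit_iff_isUnit_det] at hM ⊢
    have h1 : ψ (M.map σ).det = M.det := by
      rw [RingHom.map_det]
      congr 1
      ext i j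
      exact hσ _
    obtain ⟨c, hc⟩ := hM.exists_right_inv
    obtain ⟨d, hd⟩ : ∃ d, ψ d = c := ⟨_, hσ c⟩
    have h2 : IsNilpotent ((M.map σ).det * d - 1) :=
      hker _ (by rw [map_sub, map_mul, h1, hd, hc, map_one, sub_self])
    have h3 := h2.isUnit_add_one
    rw [sub_add_cancel] at h3
    exact isUnit_of_mul_isUnit_left h3
  · ext i j
    exact hσ _

namespace IsThickening

variable (hg : IsThickening g) [IsAffineHom g.f]

include hg

theorem mapO_surjective (V' : C'.X.affineOpens) : Function.Surjective (g.mapO (g.le_down V')) := by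
  have h := hg.app_surj V'
  rwa [Scheme.Hom.app_eq_appLE] at h

theorem ker_mapO (V' : C'.X.affineOpens) : RingHom.ker (g.mapO (g.le_down V')) =
    (RingHom.ker (algebraMap A' A)).map (algebraMap A' Γ(C'.X, V'.1)) := by
  have h := hg.ker_app V'
  rwa [Scheme.Hom.app_eq_appLE] at h

theorem isNilpotent_of_mapO_eq_zero (V' : C'.X.affineOpens) {r : Γ(C'.X, V'.1)}
    (hr : g.mapO (g.le_down V') r = 0) : IsNilpotent r := by
  have h1 : r ∈ RingHom.ker (g.mapO (g.le_down V')) := hr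
  rw [hg.ker_mapO V'] at h1
  have h2 := Ideal.pow_mem_pow h1 2
  rw [← Ideal.map_pow, hg.sq, Ideal.map_bot, Ideal.mem_bot] at h2
  exact ⟨2, h2⟩

theorem isUnit_of_isUnit_mapO (V' : C'.X.affineOpens) {M : Matrix (Fin n) (Fin n) Γ(C.X, (g.down V').1)}
    (hM : IsUnit M) : ∃ M' : Matrix (Fin n) (Fin n) Γ(C'.X, V'.1), IsUnit M' ∧
      M'.map (g.mapO (g.le_down V')) = M :=
  exists_isUnit_matrix_lift _ (hg.mapO_surjective V')
    (fun _ h => hg.isNilpotent_of_mapO_eq_zero V' h) hM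

variable (L : BundleLift g n F) {V' : C'.X.affineOpens} {b : Fin n → Γ(L.bundle, V'.1)}
  (hb : IsFrame L.bundle b)


include hb

omit hg in
theorem _root_.LogConn.BundleLift.isFrame_down : IsFrame F fun k => g.mapM L.toPush (g.le_down V') (b k) := L.isFrame hb

/-- A frame of `F` lifts to a frame of a lift of `F`. -/
theorem exists_isFrame {c : Fin n → Γ(F, (g.down V').1)} (hc : IsFrame F c) :
    ∃ b : Fin n → Γ(L.bundle, V'.1), IsFrame L.bundle b ∧
      ∀ k, g.mapM L.toPush (g.le_down V') (b k) = c k := by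
  obtain ⟨M, hM, hMc⟩ := (L.isFrame_down hb).exists_matrix hc
  obtain ⟨M', hM', rfl⟩ := hg.isUnit_of_isUnit_mapO V' hM
  refine ⟨_, hb.change hM', fun k => ?_⟩
  rw [hMc, map_sum]
  exact Finset.sum_congr rfl fun l _ => g.mapM_smul L.toPush _ _ _

theorem mapM_surjective : Function.Surjective (g.mapM L.toPush (g.le_down V')) := by
  intro s
  obtain ⟨r, hr⟩ := (L.isFrame_down hb (g.down V').1 le_rfl).2 s
  choose r' hr' using fun k => hg.mapO_surjective V' (r k)
  refine ⟨∑ k, r' k • b k, hr ▸ ?_⟩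
  rw [map_sum]
  refine Finset.sum_congr rfl fun k _ => ?_
  rw [g.mapM_smul, hr']
  exact congrArg (r k • ·) (rF_self F _ _).symm

theorem mem_of_mapM_eq_zero {s : Γ(L.bundle, V'.1)} (hs : g.mapM L.toPush (g.le_down V') s = 0) :
    s ∈ RingHom.ker (g.mapO (g.le_down V')) • (⊤ : Submodule Γ(C'.X, V'.1) Γ(L.bundle, V'.1)) := by
  have h1 : ∑ k, g.mapO (g.le_down V') ((hb.basis le_rfl).repr s k) •
      rF F le_rfl (g.mapM L.toPush (g.le_down V') (b k)) = 0 := by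
    rw [← hs]
    conv_rhs => rw [← (hb.basis le_rfl).sum_repr s]
    rw [map_sum]
    refine Finset.sum_congr rfl fun k _ => ?_
    rw [g.mapM_smul, hb.basis_apply, rF_self, rF_self]
  have h2 := (L.isFrame_down hb (g.down V').1 le_rfl).1 (a₁ := fun k =>
    g.mapO (g.le_down V') ((hb.basis le_rfl).repr s k)) (a₂ := 0)
    (h1.trans (by simp only [Pi.zero_apply, zero_smul, Finset.sum_const_zero]))
  rw [← (hb.basis le_rfl).sum_repr s]
  exact Submodule.sum_mem _ fun k _ => Submodule.smul_mem_smul (congrFun h2 k) trivial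

theorem mapOmega_surjective : Function.Surjective (g.mapOmega L.toPush (g.le_down V')) :=
  map_surjective_of_surjective _ _ (hg.mapM_surjective L hb)
    (kaehlerMap_surjective (g.mapO_algebraMap (g.le_down V')) (hg.mapO_surjective V'))

theorem mem_range_mulKer_of_mapOmega_eq_zero {x : (tensorOmega L.bundle).obj V'}
    (hx : g.mapOmega L.toPush (g.le_down V') x = 0) :
    x ∈ LinearMap.range (mulKer (A := A) (A' := A') ((tensorOmega L.bundle).obj V')) := by
  refine mem_range_mulKer (R' := Γ(C'.X, V'.1)) ?_
  rw [← hg.ker_mapO V']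
  refine mem_of_map_eq_zero (g.mapM L.toPush (g.le_down V')) _ (hb.basis le_rfl)
    ((L.isFrame_down hb).basis le_rfl) (fun k => ?_)
    (fun w hw => mem_of_kaehlerMap_eq_zero hg.surj (g.mapO_algebraMap (g.le_down V'))
      (hg.mapO_surjective V') (hg.ker_mapO V') hw) hx
  rw [hb.basis_apply, rF_self, IsFrame.basis_apply, rF_self]

theorem flat_tensorOmega : Module.Flat A' ((tensorOmega L.bundle).obj V') := by
  have h1 := hg.flat V'
  have h2 := hg.flat_kaehler V'
  have h3 : Module.Free Γ(C'.X, V'.1) Γ(L.bundle, V'.1) := .of_basis (hb.basis le_rfl)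
  have h4 : Module.Flat Γ(C'.X, V'.1) ((tensorOmega L.bundle).obj V') :=
    inferInstanceAs (Module.Flat Γ(C'.X, V'.1) (Γ(L.bundle, V'.1) ⊗[Γ(C'.X, V'.1)] Ω[Γ(C'.X, V'.1)⁄A']))
  exact Module.Flat.trans A' Γ(C'.X, V'.1) _

end IsThickening

end Pairs

/-! ### Differences of connections along homomorphisms -/

section BilinearRel

variable {A A' : Type u} [CommRing A] [CommRing A'] [Algebra A' A]
  {R' R : Type u} [CommRing R'] [CommRing R] [Algebra A' R'] [Algebra A R] {ψ : R' →+* R}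
  {N' N : Type u} [AddCommGroup N'] [Module A' N'] [Module R' N'] [IsScalarTower A' R' N']
  [AddCommGroup N] [Module A N] [Module R N] [IsScalarTower A R N]
  {p : N' →ₛₗ[algebraMap A' A] N} {n : ℕ}

theorem KerRel.smul (hp : ∀ (r : R') x, p (r • x) = ψ r • p x) {δ : N'}
    {ν : N ⊗[A] KerModule A A'} (h : KerRel p δ ν) (r : R') : KerRel p (r • δ) (ψ r • ν) :=
  h.map (Algebra.lsmul A' A' N' r) (Algebra.lsmul A A N (ψ r)) (hp r)

/-- Two bilinear maps are related if their values on a basis and a generator are. -/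
theorem KerRel.bilin (hp : ∀ (r : R') x, p (r • x) = ψ r • p x)
    {S' S I' I : Type u} [AddCommGroup S'] [Module R' S'] [AddCommGroup S] [Module R S]
    [AddCommGroup I'] [Module R' I'] [AddCommGroup I] [Module R I]
    (pS : S' →ₛₗ[ψ] S) (pI : I' →ₛₗ[ψ] I) (Δ : S' →ₗ[R'] I' →ₗ[R'] N')
    (θ : S →ₗ[R] I →ₗ[R] N ⊗[A] KerModule A A') (β : Module.Basis (Fin n) R' S') {φ : I'}
    (hφ : ∀ a, ∃ r : R', r • φ = a)
    (h : ∀ k, KerRel p (Δ (β k) φ) (θ (pS (β k)) (pI φ))) (s : S') (a : I') :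
    KerRel p (Δ s a) (θ (pS s) (pI a)) := by
  obtain ⟨r, rfl⟩ := hφ a
  rw [← β.sum_repr s, map_sum, map_sum, map_sum, LinearMap.sum_apply, LinearMap.sum_apply]
  refine KerRel.sum _ fun k _ => ?_
  rw [pS.map_smulₛₗ, pI.map_smulₛₗ, map_smul, map_smul, map_smul, map_smul, LinearMap.smul_apply,
    LinearMap.smul_apply]
  exact ((h k).smul hp _).smul hp _

end BilinearRel

section FrameMap

variable {X : Scheme.{u}} {F G : X.Modules} {n : ℕ} {U V W : X.Opens} {b : Fin n → Γ(F, U)}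

/-- The linear map which carries a frame to given sections. -/
def IsFrame.map (hb : IsFrame F b) (c : Fin n → Γ(G, U)) (h : V ≤ U) :
    Γ(F, V) →ₗ[Γ(X, V)] Γ(G, V) :=
  (hb.basis h).constr Γ(X, V) fun k => rF G h (c k)

theorem IsFrame.map_frame (hb : IsFrame F b) (c : Fin n → Γ(G, U)) (h : V ≤ U) (k : Fin n) :
    hb.map c h (rF F h (b k)) = rF G h (c k) := by
  rw [← hb.basis_apply, IsFrame.map, Module.Basis.constr_basis]

theorem IsFrame.basis_self (hb : IsFrame F b) (k : Fin n) : hb.basis le_rfl k = b k :=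
  (hb.basis_apply le_rfl k).trans (rF_self F _ _)

theorem IsFrame.map_frame_self (hb : IsFrame F b) (c : Fin n → Γ(G, U)) (k : Fin n) :
    hb.map c le_rfl (b k) = c k := by
  have h := hb.map_frame c le_rfl k
  rwa [rF_self, rF_self] at h

theorem IsFrame.map_rF (hb : IsFrame F b) (c : Fin n → Γ(G, U)) (h : V ≤ U) (h' : W ≤ V)
    (s : Γ(F, V)) : hb.map c (h'.trans h) (rF F h' s) = rF G h' (hb.map c h s) := by
  rw [← (hb.basis h).sum_repr s]
  simp only [map_sum, map_smul, rF_smul, IsFrame.basis_apply, rF_rF, IsFrame.map_frame]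

end FrameMap

section HomDiff

variable {A : Type u} [CommRing A] {C : PolarScheme A} {n : ℕ} {F G H : C.X.Modules} {t : A}
  {V V' : C.X.affineOpens}

/-- The map `ψ ⊗ 1` from `(F ⊗ Ω)(V)` to `(G ⊗ Ω)(V)`. -/
def homOmega (ψ : Γ(F, V.1) →ₗ[Γ(C.X, V.1)] Γ(G, V.1)) :
    (tensorOmega F).obj V →ₗ[Γ(C.X, V.1)] (tensorOmega G).obj V :=
  LinearMap.rTensor Ω[Γ(C.X, V.1)⁄A] ψ

theorem homOmega_omegaTmul (ψ : Γ(F, V.1) →ₗ[Γ(C.X, V.1)] Γ(G, V.1)) (s : Γ(F, V.1))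
    (w : Ω[Γ(C.X, V.1)⁄A]) : homOmega ψ (omegaTmul s w) = omegaTmul (ψ s) w := rfl

theorem homOmega_add (ψ ψ' : Γ(F, V.1) →ₗ[Γ(C.X, V.1)] Γ(G, V.1)) (x : (tensorOmega F).obj V) :
    homOmega (ψ + ψ') x = homOmega ψ x + homOmega ψ' x :=
  LinearMap.congr_fun (LinearMap.rTensor_add _ ψ ψ') x

theorem homOmega_smul (r : A) (ψ : Γ(F, V.1) →ₗ[Γ(C.X, V.1)] Γ(G, V.1))
    (x : (tensorOmega F).obj V) : homOmega (r • ψ) x = r • homOmega ψ x := by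
  refine tensorOmega_induction x (by simp only [map_zero, smul_zero]) (fun s w => ?_)
    fun x y hx hy => ?_
  · rw [homOmega_omegaTmul, homOmega_omegaTmul, LinearMap.smul_apply,
      ← algebraMap_smul Γ(C.X, V.1) r, smul_omegaTmul, algebraMap_smul]
  · rw [map_add, map_add, smul_add, hx, hy]

theorem homOmega_id (x : (tensorOmega F).obj V) : homOmega LinearMap.id x = x :=
  LinearMap.congr_fun (LinearMap.rTensor_id _ _) x

theorem homOmega_res (h : V' ≤ V) (ψ : Γ(F, V.1) →ₗ[Γ(C.X, V.1)] Γ(G, V.1))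
    (ψ' : Γ(F, V'.1) →ₗ[Γ(C.X, V'.1)] Γ(G, V'.1))
    (hψ : ∀ s, ψ' (resM C F h s) = resM C G h (ψ s)) (x : (tensorOmega F).obj V) :
    homOmega ψ' ((tensorOmega F).res h x) = (tensorOmega G).res h (homOmega ψ x) := by
  refine tensorOmega_induction x (by simp only [map_zero]) (fun s w => ?_) fun x y hx hy => ?_
  · rw [tensorOmega_res_omegaTmul, homOmega_omegaTmul, homOmega_omegaTmul,
      tensorOmega_res_omegaTmul]
    exact congrArg (omegaTmul · _) (hψ s)
  · simp only [map_add, hx, hy]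

variable {W₁ W₂ : C.X.Opens} (nab₁ : TConnection t F W₁) (nab₂ : TConnection t G W₂)

/-- The map `ψ ↦ (ψ ⊗ 1) ∇₁ s - ∇₂ ψ s`, contracted with a section `a` of `𝒪(-D)`. -/
def homDiffEval (V : C.X.affineOpens) (h₁ : V.1 ≤ W₁) (h₂ : V.1 ≤ W₂) (s : Γ(F, V.1))
    (a : C.D.ideal V) :
    (Γ(F, V.1) →ₗ[Γ(C.X, V.1)] Γ(G, V.1)) →ₗ[A] (tensorOmega G).obj V where
  toFun ψ := homOmega ψ (nab₁.nabla ⟨V, h₁⟩ s a) - nab₂.nabla ⟨V, h₂⟩ (ψ s) a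
  map_add' ψ ψ' := by
    rw [homOmega_add, LinearMap.add_apply, map_add, LinearMap.add_apply]
    abel
  map_smul' r ψ := by
    rw [homOmega_smul, LinearMap.smul_apply, map_smul, LinearMap.smul_apply, RingHom.id_apply,
      smul_sub]

theorem homDiffEval_apply (h₁ : V.1 ≤ W₁) (h₂ : V.1 ≤ W₂) (s : Γ(F, V.1)) (a : C.D.ideal V)
    (ψ : Γ(F, V.1) →ₗ[Γ(C.X, V.1)] Γ(G, V.1)) : homDiffEval nab₁ nab₂ V h₁ h₂ s a ψ =
      homOmega ψ (nab₁.nabla ⟨V, h₁⟩ s a) - nab₂.nabla ⟨V, h₂⟩ (ψ s) a := rfl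

theorem homDiffEval_smul (h₁ : V.1 ≤ W₁) (h₂ : V.1 ≤ W₂) (f : Γ(C.X, V.1)) (s : Γ(F, V.1))
    (a : C.D.ideal V) (ψ : Γ(F, V.1) →ₗ[Γ(C.X, V.1)] Γ(G, V.1)) :
    homDiffEval nab₁ nab₂ V h₁ h₂ (f • s) a ψ = f • homDiffEval nab₁ nab₂ V h₁ h₂ s a ψ := by
  rw [homDiffEval_apply, homDiffEval_apply, nab₁.leibniz, map_smul, nab₂.leibniz, map_add, map_smul,
    ← algebraMap_smul Γ(C.X, V.1) t, ← algebraMap_smul Γ(C.X, V.1) t, map_smul, map_smul,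
    homOmega_omegaTmul, add_sub_add_right_eq_sub, smul_sub]

/-- The bilinear map `(s, a) ↦ a ((ψ ⊗ 1) ∇₁ s - ∇₂ ψ s)`. -/
def homDiff (V : C.X.affineOpens) (h₁ : V.1 ≤ W₁) (h₂ : V.1 ≤ W₂)
    (ψ : Γ(F, V.1) →ₗ[Γ(C.X, V.1)] Γ(G, V.1)) :
    Γ(F, V.1) →ₗ[Γ(C.X, V.1)] (C.D.ideal V →ₗ[Γ(C.X, V.1)] (tensorOmega G).obj V) :=
  LinearMap.mk₂ _ (fun s a => homDiffEval nab₁ nab₂ V h₁ h₂ s a ψ)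
    (fun s s' a => by
      simp only [homDiffEval_apply, map_add, LinearMap.add_apply]
      abel)
    (fun f s a => homDiffEval_smul nab₁ nab₂ h₁ h₂ f s a ψ)
    (fun s a a' => by
      simp only [homDiffEval_apply, map_add]
      abel)
    (fun f s a => by
      simp only [homDiffEval_apply, map_smul, smul_sub])

theorem homDiff_apply (h₁ : V.1 ≤ W₁) (h₂ : V.1 ≤ W₂) (s : Γ(F, V.1)) (a : C.D.ideal V)
    (ψ : Γ(F, V.1) →ₗ[Γ(C.X, V.1)] Γ(G, V.1)) : homDiff nab₁ nab₂ V h₁ h₂ ψ s a =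
      homOmega ψ (nab₁.nabla ⟨V, h₁⟩ s a) - nab₂.nabla ⟨V, h₂⟩ (ψ s) a := rfl

theorem homDiff_res (h₁ : V.1 ≤ W₁) (h₂ : V.1 ≤ W₂) (h₁' : V'.1 ≤ W₁) (h₂' : V'.1 ≤ W₂)
    (h : V' ≤ V) {ψ : Γ(F, V.1) →ₗ[Γ(C.X, V.1)] Γ(G, V.1)}
    {ψ' : Γ(F, V'.1) →ₗ[Γ(C.X, V'.1)] Γ(G, V'.1)}
    (hψ : ∀ s, ψ' (resM C F h s) = resM C G h (ψ s)) (s : Γ(F, V.1)) (a : C.D.ideal V) :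
    homDiff nab₁ nab₂ V' h₁' h₂' ψ' (resM C F h s) (resD C h a) =
      (tensorOmega G).res h (homDiff nab₁ nab₂ V h₁ h₂ ψ s a) := by
  rw [homDiff_apply, homDiff_apply, map_sub, hψ, nab₁.compat ⟨V, h₁⟩ ⟨V', h₁'⟩ h,
    nab₂.compat ⟨V, h₂⟩ ⟨V', h₂'⟩ h, homOmega_res h ψ ψ' hψ]

/-- The differences along a compatible family of linear maps, as a section of `ℋom(F, (G ⊗ Ω)(D))`. -/
def homDiffSection {W : C.X.Opens} (h₁ : W ≤ W₁) (h₂ : W ≤ W₂)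
    (ψ : ∀ V : {V : C.X.affineOpens // V.1 ≤ W}, Γ(F, V.1.1) →ₗ[Γ(C.X, V.1.1)] Γ(G, V.1.1))
    (hψ : ∀ (V V' : {V : C.X.affineOpens // V.1 ≤ W}) (h : V'.1 ≤ V.1) (s : Γ(F, V.1.1)),
      ψ V' (resM C F h s) = resM C G h (ψ V s)) : homPolarSections F (tensorOmega G) W :=
  ⟨fun V => homDiff nab₁ nab₂ V.1 (V.2.trans h₁) (V.2.trans h₂) (ψ V), fun V V' h s a =>
    homDiff_res nab₁ nab₂ _ _ _ _ h (hψ V V' h) s a⟩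

theorem commutatorAt_apply (nab : TConnection t F ⊤) (θ : Γ(F, V.1) →ₗ[Γ(C.X, V.1)] Γ(F, V.1))
    (s : Γ(F, V.1)) (a : C.D.ideal V) : nab.commutatorAt V θ s a =
      -homDiffEval nab nab V le_top le_top s a θ := (neg_sub _ _).symm

end HomDiff

/-! ### Reduction of differences between connections -/

section Reduction

variable {A A' : Type u} [CommRing A] [CommRing A'] [Algebra A' A]
  {C : PolarScheme A} {C' : PolarScheme A'} {g : C.Hom C'} [IsAffineHom g.f] {n : ℕ}
  {F : C.X.Modules} {L L₁ L₂ : BundleLift g n F} {V' V₁' : C'.X.affineOpens}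

/-- Reduction of homomorphisms between two lifts of `F` to endomorphisms of `F`. -/
def reduceHom (L₂ : BundleLift g n F) {b : Fin n → Γ(L₁.bundle, V'.1)}
    (hb : IsFrame L₁.bundle b) :
    (Γ(L₁.bundle, V'.1) →ₗ[Γ(C'.X, V'.1)] Γ(L₂.bundle, V'.1)) →ₛₗ[algebraMap A' A]
      (Γ(F, (g.down V').1) →ₗ[Γ(C.X, (g.down V').1)] Γ(F, (g.down V').1)) where
  toFun H := ((L₁.isFrame_down hb).basis le_rfl).constr Γ(C.X, (g.down V').1) fun k =>
    g.mapM L₂.toPush (g.le_down V') (H (b k))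
  map_add' H H' := ((L₁.isFrame_down hb).basis le_rfl).ext fun k => by
    simp only [LinearMap.add_apply, Module.Basis.constr_basis, map_add]
  map_smul' r H := ((L₁.isFrame_down hb).basis le_rfl).ext fun k => by
    simp only [LinearMap.smul_apply, Module.Basis.constr_basis]
    rw [← algebraMap_smul Γ(C'.X, V'.1) r, g.mapM_smul, g.mapO_algebraMap, algebraMap_smul]

theorem reduceHom_mapM {b : Fin n → Γ(L₁.bundle, V'.1)} (hb : IsFrame L₁.bundle b)
    (H : Γ(L₁.bundle, V'.1) →ₗ[Γ(C'.X, V'.1)] Γ(L₂.bundle, V'.1)) (s : Γ(L₁.bundle, V'.1)) :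
    reduceHom L₂ hb H (g.mapM L₁.toPush (g.le_down V') s) =
      g.mapM L₂.toPush (g.le_down V') (H s) := by
  have h1 : ∀ k, reduceHom L₂ hb H (g.mapM L₁.toPush (g.le_down V') (b k)) =
      g.mapM L₂.toPush (g.le_down V') (H (b k)) := fun k => by
    have h2 : g.mapM L₁.toPush (g.le_down V') (b k) = (L₁.isFrame_down hb).basis le_rfl k :=
      ((L₁.isFrame_down hb).basis_self k).symm
    rw [h2]
    exact Module.Basis.constr_basis _ Γ(C.X, (g.down V').1) _ _
  rw [← (hb.basis le_rfl).sum_repr s]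
  simp only [map_sum, map_smul, g.mapM_smul, hb.basis_self, h1]

theorem mapOmega_homOmega {ψ : Γ(L₁.bundle, V'.1) →ₗ[Γ(C'.X, V'.1)] Γ(L₂.bundle, V'.1)}
    {θ : Γ(F, (g.down V').1) →ₗ[Γ(C.X, (g.down V').1)] Γ(F, (g.down V').1)}
    (h : ∀ s, θ (g.mapM L₁.toPush (g.le_down V') s) = g.mapM L₂.toPush (g.le_down V') (ψ s))
    (x : (tensorOmega L₁.bundle).obj V') :
    g.mapOmega L₂.toPush (g.le_down V') (homOmega ψ x) =
      homOmega θ (g.mapOmega L₁.toPush (g.le_down V') x) := by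
  refine tensorOmega_induction x (by simp only [map_zero]) (fun s w => ?_) fun x y hx hy => ?_
  · rw [homOmega_omegaTmul, g.mapOmega_omegaTmul, g.mapOmega_omegaTmul, homOmega_omegaTmul, h]
  · simp only [map_add, hx, hy]

variable {t : A} {t' : A'} {nab : TConnection t F ⊤} {W₁' W₂' : C'.X.Opens}
  {nab₁ : TConnection t' L₁.bundle W₁'} {nab₂ : TConnection t' L₂.bundle W₂'}

theorem mapOmega_homDiffEval (hn₁ : L₁.IsConnectionLift nab₁ nab)
    (hn₂ : L₂.IsConnectionLift nab₂ nab) (h₁ : V'.1 ≤ W₁') (h₂ : V'.1 ≤ W₂')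
    {ψ : Γ(L₁.bundle, V'.1) →ₗ[Γ(C'.X, V'.1)] Γ(L₂.bundle, V'.1)}
    {θ : Γ(F, (g.down V').1) →ₗ[Γ(C.X, (g.down V').1)] Γ(F, (g.down V').1)}
    (h : ∀ s, θ (g.mapM L₁.toPush (g.le_down V') s) = g.mapM L₂.toPush (g.le_down V') (ψ s))
    (s : Γ(L₁.bundle, V'.1)) (a : C'.D.ideal V') :
    g.mapOmega L₂.toPush (g.le_down V') (homDiffEval nab₁ nab₂ V' h₁ h₂ s a ψ) =
      homDiffEval nab nab (g.down V') le_top le_top (g.mapM L₁.toPush (g.le_down V') s)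
        (g.mapD (g.le_down V') a) θ := by
  rw [homDiffEval_apply, homDiffEval_apply, map_sub, mapOmega_homOmega h, h,
    ← hn₁ ⟨V', h₁⟩ (g.down V') (g.le_down V'), ← hn₂ ⟨V', h₂⟩ (g.down V') (g.le_down V')]

/-- If `ψ₁` and `ψ₂` differ by `∑ iⱼ Hⱼ`, then the differences between `∇₁` and `∇₂` along `ψ₁` and
along `ψ₂` differ by the commutators of `∇` with the reductions of the `Hⱼ`. -/
theorem KerRel.homDiffEval (hn₁ : L₁.IsConnectionLift nab₁ nab)
    (hn₂ : L₂.IsConnectionLift nab₂ nab) (h₁ : V'.1 ≤ W₁') (h₂ : V'.1 ≤ W₂')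
    {b : Fin n → Γ(L₁.bundle, V'.1)} (hb : IsFrame L₁.bundle b)
    {H : Γ(L₁.bundle, V'.1) →ₗ[Γ(C'.X, V'.1)] Γ(L₂.bundle, V'.1)}
    {u : (Γ(F, (g.down V').1) →ₗ[Γ(C.X, (g.down V').1)] Γ(F, (g.down V').1)) ⊗[A] KerModule A A'}
    (hu : KerRel (reduceHom L₂ hb) H u) (s : Γ(L₁.bundle, V'.1)) (a : C'.D.ideal V') :
    KerRel (g.mapOmega L₂.toPush (g.le_down V')) (LogConn.homDiffEval nab₁ nab₂ V' h₁ h₂ s a H)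
      (LinearMap.rTensor (KerModule A A') (LogConn.homDiffEval nab nab (g.down V') le_top le_top
        (g.mapM L₁.toPush (g.le_down V') s) (g.mapD (g.le_down V') a)) u) :=
  hu.map _ _ fun H => mapOmega_homDiffEval hn₁ hn₂ h₁ h₂ (reduceHom_mapM hb H) s a

namespace IsThickening

variable (hg : IsThickening g)

include hg

theorem exists_kerRel_reduceHom {b : Fin n → Γ(L₁.bundle, V'.1)} (hb : IsFrame L₁.bundle b)
    {c : Fin n → Γ(L₂.bundle, V'.1)} (hc : IsFrame L₂.bundle c)
    {H : Γ(L₁.bundle, V'.1) →ₗ[Γ(C'.X, V'.1)] Γ(L₂.bundle, V'.1)}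
    (hH : ∀ s, g.mapM L₂.toPush (g.le_down V') (H s) = 0) :
    ∃ u, KerRel (reduceHom L₂ hb) H u := by
  refine exists_kerRel_right (mem_range_mulKer (R' := Γ(C'.X, V'.1)) ?_)
  rw [← hg.ker_mapO V']
  let β := hb.basis (le_refl V'.1)
  have h1 : H = ∑ k, (β.coord k).smulRight (H (β k)) := β.ext fun l => by
    rw [LinearMap.sum_apply, Finset.sum_eq_single l]
    · simp
    · intro k _ hk
      simp [Finsupp.single_eq_of_ne hk]
    · exact fun h => (h (Finset.mem_univ l)).elim
  rw [h1]
  refine Submodule.sum_mem _ fun k _ => ?_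
  refine Submodule.smul_induction_on (hg.mem_of_mapM_eq_zero L₂ hc (hH (β k)))
    (fun r hr m _ => ?_) fun x y hx hy => ?_
  · have h2 : (β.coord k).smulRight (r • m) = r • (β.coord k).smulRight m :=
      LinearMap.ext fun s => smul_comm _ _ _
    rw [h2]
    exact Submodule.smul_mem_smul hr trivial
  · have h2 : (β.coord k).smulRight (x + y) = (β.coord k).smulRight x + (β.coord k).smulRight y :=
      LinearMap.ext fun s => smul_add _ _ _
    rw [h2]
    exact add_mem hx hy

theorem exists_kerRel_reduceHom_left {b : Fin n → Γ(L₁.bundle, V'.1)} (hb : IsFrame L₁.bundle b)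
    {c : Fin n → Γ(L₂.bundle, V'.1)} (hc : IsFrame L₂.bundle c)
    (u : (Γ(F, (g.down V').1) →ₗ[Γ(C.X, (g.down V').1)] Γ(F, (g.down V').1)) ⊗[A] KerModule A A') :
    ∃ H, KerRel (reduceHom L₂ hb) H u := by
  refine exists_kerRel_left hg.surj (fun θ => ?_) u
  choose v hv using fun k => hg.mapM_surjective L₂ hc (θ (g.mapM L₁.toPush (g.le_down V') (b k)))
  refine ⟨hb.map v le_rfl, ((L₁.isFrame_down hb).basis le_rfl).ext fun k => ?_⟩
  rw [IsFrame.basis_self]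
  refine (reduceHom_mapM hb _ (b k)).trans ?_
  rw [hb.map_frame_self, hv]

variable {φ : C'.D.ideal V'} (hφ : IsGen C' φ)

omit hg in
include hφ in
theorem exists_smul_resD (h : V₁' ≤ V') (a : C'.D.ideal V₁') :
    ∃ r : Γ(C'.X, V₁'.1), r • resD C' h φ = a := (hφ V₁' h).2 a

/-- A section of `ℋom(L₁, (L₂ ⊗ Ω)(D))` over a small open set which vanishes modulo `I` is a section
of `ℰnd(F) ⊗ ω(D) ⊗ I`. -/
theorem exists_kerRel_section (hF : IsVectorBundle n F) (hφ : IsGen C' φ)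
    (hφ' : IsGen C (U := g.down V') (g.mapD (g.le_down V') φ))
    {b : Fin n → Γ(L₁.bundle, V'.1)} (hb : IsFrame L₁.bundle b)
    {c : Fin n → Γ(L₂.bundle, V'.1)} (hc : IsFrame L₂.bundle c)
    (Δ : homPolarSections L₁.bundle (tensorOmega L₂.bundle) V'.1)
    (hΔ : ∀ k, g.mapOmega L₂.toPush (g.le_down V') (Δ.1 ⟨V', le_rfl⟩ (b k) φ) = 0) :
    ∃ e : homPolarSections F ((tensorOmega F).tensor (KerModule A A')) (g.down V').1,
      ∀ (V₁' : C'.X.affineOpens) (h : V₁' ≤ V') (s : Γ(L₁.bundle, V₁'.1)) (a : C'.D.ideal V₁'),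
        KerRel (g.mapOmega L₂.toPush (g.le_down V₁')) (Δ.1 ⟨V₁', h⟩ s a)
          (e.1 ⟨g.down V₁', g.down_mono h⟩ (g.mapM L₁.toPush (g.le_down V₁') s)
            (g.mapD (g.le_down V₁') a)) := by
  choose ν hν using fun k => exists_kerRel_right (p := g.mapOmega L₂.toPush (g.le_down V'))
    (hg.mem_range_mulKer_of_mapOmega_eq_zero L₂ hc (hΔ k))
  refine ⟨homOfFrame (V := g.down V') (L₁.isFrame_down hb) hφ' ((isQCoh_tensorOmega hF).tensor _) ν,
    fun V₁' h s a => ?_⟩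
  refine KerRel.bilin (fun r x => g.mapOmega_smul L₂.toPush (g.le_down V₁') r x)
    (g.mapM L₁.toPush (g.le_down V₁')) (g.mapD (g.le_down V₁')) _ _ (hb.basis h)
    (exists_smul_resD hφ h) (fun k => ?_) s a
  have h3 := (hν k).map ((tensorOmega L₂.bundle).res h) ((tensorOmega F).res (g.down_mono h))
    (fun x => g.mapOmega_res L₂.toPush (g.le_down V') (g.le_down V₁') h (g.down_mono h) x)
  rw [hb.basis_apply]
  have h4 := Δ.2 ⟨V', le_rfl⟩ ⟨V₁', h⟩ h (b k) φ
  have h5 := (homOfFrame (V := g.down V') (L₁.isFrame_down hb) hφ'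
    ((isQCoh_tensorOmega hF).tensor _) ν).2 ⟨g.down V', le_rfl⟩
      ⟨g.down V₁', g.down_mono h⟩ (g.down_mono h) (g.mapM L₁.toPush (g.le_down V') (b k))
      (g.mapD (g.le_down V') φ)
  rw [← g.mapM_resM L₁.toPush (g.le_down V₁') (g.le_down V') h (g.down_mono h),
    ← g.mapD_resD (g.le_down V₁') (g.le_down V') h (g.down_mono h)] at h5
  have h6 := homOfFrame_apply_frame (V := g.down V') (L₁.isFrame_down hb) hφ'
    ((isQCoh_tensorOmega hF).tensor (KerModule A A')) ν k
  exact (iff_of_eq (congrArg₂ (KerRel (g.mapOmega L₂.toPush (g.le_down V₁'))) h4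
    (h5.trans (congrArg _ h6)))).2 h3

omit hg in
theorem mapM_map {b : Fin n → Γ(L₁.bundle, V'.1)} (hb : IsFrame L₁.bundle b)
    {c : Fin n → Γ(L₂.bundle, V'.1)}
    (hbc : ∀ k, g.mapM L₂.toPush (g.le_down V') (c k) = g.mapM L₁.toPush (g.le_down V') (b k))
    (h : V₁' ≤ V') (s : Γ(L₁.bundle, V₁'.1)) :
    g.mapM L₂.toPush (g.le_down V₁') (hb.map c h s) = g.mapM L₁.toPush (g.le_down V₁') s := by
  have h1 : ∀ k, g.mapM L₂.toPush (g.le_down V₁') (rF _ h (c k)) =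
      g.mapM L₁.toPush (g.le_down V₁') (rF _ h (b k)) := fun k =>
    (g.mapM_resM L₂.toPush (g.le_down V₁') (g.le_down V') h (g.down_mono h) (c k)).trans
      ((congrArg _ (hbc k)).trans
        (g.mapM_resM L₁.toPush (g.le_down V₁') (g.le_down V') h (g.down_mono h) (b k)).symm)
  rw [← (hb.basis h).sum_repr s]
  simp only [map_sum, map_smul, g.mapM_smul, hb.basis_apply, hb.map_frame, h1]

/-- The difference between two lifts of `∇`, on two lifts of `F`, along an identification of the
latter over an open set: it is a section of `ℰnd(F) ⊗ ω(D) ⊗ I`. -/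
theorem exists_kerRel_homDiff (hF : IsVectorBundle n F) (hφ : IsGen C' φ)
    (hφ' : IsGen C (U := g.down V') (g.mapD (g.le_down V') φ))
    (hn₁ : L₁.IsConnectionLift nab₁ nab) (hn₂ : L₂.IsConnectionLift nab₂ nab) (h₁ : V'.1 ≤ W₁')
    (h₂ : V'.1 ≤ W₂') {b : Fin n → Γ(L₁.bundle, V'.1)} (hb : IsFrame L₁.bundle b)
    {c : Fin n → Γ(L₂.bundle, V'.1)} (hc : IsFrame L₂.bundle c)
    (hbc : ∀ k, g.mapM L₂.toPush (g.le_down V') (c k) = g.mapM L₁.toPush (g.le_down V') (b k)) :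
    ∃ e : homPolarSections F ((tensorOmega F).tensor (KerModule A A')) (g.down V').1,
      ∀ (V₁' : C'.X.affineOpens) (h : V₁' ≤ V') (s : Γ(L₁.bundle, V₁'.1)) (a : C'.D.ideal V₁'),
        KerRel (g.mapOmega L₂.toPush (g.le_down V₁'))
          (homDiff nab₁ nab₂ V₁' (le_trans (show V₁'.1 ≤ V'.1 from h) h₁)
            (le_trans (show V₁'.1 ≤ V'.1 from h) h₂) (hb.map c h) s a)
          (e.1 ⟨g.down V₁', g.down_mono h⟩ (g.mapM L₁.toPush (g.le_down V₁') s)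
            (g.mapD (g.le_down V₁') a)) := by
  refine hg.exists_kerRel_section hF hφ hφ' hb hc (homDiffSection nab₁ nab₂ h₁ h₂
    (fun V => hb.map c V.2) fun V₁ V₂ h s => hb.map_rF c V₁.2 h s) fun k => ?_
  refine (mapOmega_homDiffEval hn₁ hn₂ h₁ h₂ (θ := LinearMap.id)
    (fun s => (mapM_map hb hbc le_rfl s).symm) (b k) φ).trans ?_
  rw [homDiffEval_apply, homOmega_id, LinearMap.id_apply, sub_self]

end IsThickening

/-- Comparison of the differences between local lifts of `∇` on two lifts of `F`, on the overlap of
two open sets on which the lifts of `F` are identified: if the two identifications differ by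
`∑ iⱼ Hⱼ`, the commutators of `∇` with the reductions of the `Hⱼ` appear. -/
theorem KerRel.change {W₃' W₄' : C'.X.Opens} {nab₃ : TConnection t' L₁.bundle W₃'}
    {nab₄ : TConnection t' L₂.bundle W₄'}
    (hn₁ : L₁.IsConnectionLift nab₁ nab) (hn₂ : L₂.IsConnectionLift nab₂ nab)
    (h₁ : V'.1 ≤ W₁') (h₂ : V'.1 ≤ W₂') (h₃ : V'.1 ≤ W₃') (h₄ : V'.1 ≤ W₄')
    {b : Fin n → Γ(L₁.bundle, V'.1)} (hb : IsFrame L₁.bundle b)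
    {ψ ψ' : Γ(L₁.bundle, V'.1) →ₗ[Γ(C'.X, V'.1)] Γ(L₂.bundle, V'.1)}
    (hψ' : ∀ s, g.mapM L₂.toPush (g.le_down V') (ψ' s) = g.mapM L₁.toPush (g.le_down V') s)
    {u : (Γ(F, (g.down V').1) →ₗ[Γ(C.X, (g.down V').1)] Γ(F, (g.down V').1)) ⊗[A] KerModule A A'}
    (hu : KerRel (reduceHom L₂ hb) (ψ - ψ') u) (s : Γ(L₁.bundle, V'.1)) (a : C'.D.ideal V')
    {c e e' : (tensorOmega F).obj (g.down V') ⊗[A] KerModule A A'}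
    (hc : KerRel (g.mapOmega L₁.toPush (g.le_down V'))
      (nab₁.nabla ⟨V', h₁⟩ s a - nab₃.nabla ⟨V', h₃⟩ s a) c)
    (he : KerRel (g.mapOmega L₂.toPush (g.le_down V')) (homDiff nab₁ nab₂ V' h₁ h₂ ψ s a) e)
    (he' : KerRel (g.mapOmega L₂.toPush (g.le_down V')) (homDiff nab₃ nab₄ V' h₃ h₄ ψ' s a) e') :
    KerRel (g.mapOmega L₂.toPush (g.le_down V'))
      (nab₂.nabla ⟨V', h₂⟩ (ψ' s) a - nab₄.nabla ⟨V', h₄⟩ (ψ' s) a)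
      (c - e + e' + LinearMap.rTensor (KerModule A A') (LogConn.homDiffEval nab nab (g.down V')
        le_top le_top (g.mapM L₁.toPush (g.le_down V') s) (g.mapD (g.le_down V') a)) u) := by
  have h5 := KerRel.homDiffEval hn₁ hn₂ h₁ h₂ hb hu s a
  have h6 : KerRel (g.mapOmega L₂.toPush (g.le_down V'))
      (homOmega ψ' (nab₁.nabla ⟨V', h₁⟩ s a - nab₃.nabla ⟨V', h₃⟩ s a)) c := by
    have := hc.map (p₂ := g.mapOmega L₂.toPush (g.le_down V')) ((homOmega ψ').restrictScalars A')
      LinearMap.id fun x => (mapOmega_homOmega (θ := LinearMap.id) (fun s => (hψ' s).symm) x).trans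
        (homOmega_id _)
    rwa [LinearMap.rTensor_id] at this
  refine iff_of_eq ?_ |>.1 (((h6.sub he).add he').add h5)
  congr 1
  simp only [homDiff_apply, homDiffEval_apply, map_sub, LinearMap.sub_apply]
  abel

end Reduction

/-! ### Sections of `ℰnd(L) ⊗ ω(D)` vanishing modulo `I` -/

section SectionRel

variable {A A' : Type u} [CommRing A] [CommRing A'] [Algebra A' A]
  {C : PolarScheme A} {C' : PolarScheme A'} {g : C.Hom C'} [IsAffineHom g.f] {n : ℕ}
  {F : C.X.Modules} {L : BundleLift g n F}

/-- Restriction of sections of `ℋom(F, N(D))`. -/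
def homPolarRes {F : C.X.Modules} {N : AffModule C} {W W₁ : C.X.Opens} (h : W₁ ≤ W)
    (θ : homPolarSections F N W) : homPolarSections F N W₁ :=
  ⟨fun V => θ.1 ⟨V.1, V.2.trans h⟩, fun V V' => θ.2 ⟨V.1, V.2.trans h⟩ ⟨V'.1, V'.2.trans h⟩⟩

/-- The difference of two connections, as a section of `ℰnd(F) ⊗ ω(D)`. -/
def TConnection.diffSection {F : C.X.Modules} {t : A} {W W₁ W₂ : C.X.Opens}
    (nab₁ : TConnection t F W₁) (nab₂ : TConnection t F W₂) (h₁ : W ≤ W₁) (h₂ : W ≤ W₂) :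
    homPolarSections F (tensorOmega F) W :=
  ⟨fun V => nab₁.diff nab₂ V.1 (V.2.trans h₁) (V.2.trans h₂), fun V V' h s a =>
    (congrArg₂ (· - ·) (nab₁.compat ⟨V.1, V.2.trans h₁⟩ ⟨V'.1, V'.2.trans h₁⟩ h s a)
      (nab₂.compat ⟨V.1, V.2.trans h₂⟩ ⟨V'.1, V'.2.trans h₂⟩ h s a)).trans
        (map_sub ((tensorOmega F).res h) _ _).symm⟩

/-- A section `Δ` of `ℰnd(L) ⊗ ω(D)` with values in `I · (ℰnd(L) ⊗ ω(D))` corresponds to the section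
`θ` of `ℰnd(F) ⊗ ω(D) ⊗ I`. -/
def SectionRel (L : BundleLift g n F) {W' : C'.X.Opens}
    (Δ : homPolarSections L.bundle (tensorOmega L.bundle) W')
    (θ : homPolarSections F ((tensorOmega F).tensor (KerModule A A')) (g.f ⁻¹ᵁ W')) : Prop :=
  ∀ (V' : C'.X.affineOpens) (h : V'.1 ≤ W') (s : Γ(L.bundle, V'.1)) (a : C'.D.ideal V'),
    KerRel (g.mapOmega L.toPush (g.le_down V')) (Δ.1 ⟨V', h⟩ s a)
      (θ.1 ⟨g.down V', g.f.preimage_mono h⟩ (g.mapM L.toPush (g.le_down V') s)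
        (g.mapD (g.le_down V') a))

theorem SectionRel.apply {W' : C'.X.Opens}
    {Δ : homPolarSections L.bundle (tensorOmega L.bundle) W'}
    {θ : homPolarSections F ((tensorOmega F).tensor (KerModule A A')) (g.f ⁻¹ᵁ W')}
    (H : SectionRel L Δ θ) (V' : C'.X.affineOpens) (h : V'.1 ≤ W') (V : C.X.affineOpens)
    (e : V.1 ≤ g.f ⁻¹ᵁ V'.1) (s : Γ(L.bundle, V'.1)) (a : C'.D.ideal V') :
    KerRel (g.mapOmega L.toPush e) (Δ.1 ⟨V', h⟩ s a)
      (θ.1 ⟨V, e.trans (g.f.preimage_mono h)⟩ (g.mapM L.toPush e s) (g.mapD e a)) := by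
  have e' : V ≤ g.down V' := e
  have h1 := (H V' h s a).map (p₂ := g.mapOmega L.toPush e) LinearMap.id ((tensorOmega F).res e')
    fun x => (congrArg (g.mapOmega L.toPush e) ((isQCoh_tensorOmega L.isVectorBundle).res_self
      (le_refl V') x).symm).trans (g.mapOmega_res L.toPush (g.le_down V') e le_rfl e' x)
  have es : g.mapM L.toPush e s = resM C F e' (g.mapM L.toPush (g.le_down V') s) := by
    rw [← g.mapM_resM L.toPush e (g.le_down V') le_rfl e', resM_apply, rF_self]
  have ea : g.mapD e a = resD C e' (g.mapD (g.le_down V') a) := by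
    rw [← g.mapD_resD e (g.le_down V') le_rfl e', resD_self]
  rw [es, ea, θ.2 ⟨g.down V', g.f.preimage_mono h⟩ ⟨V, e.trans (g.f.preimage_mono h)⟩ e']
  exact h1

theorem SectionRel.restrict {W' W₁' : C'.X.Opens}
    {Δ : homPolarSections L.bundle (tensorOmega L.bundle) W'}
    {θ : homPolarSections F ((tensorOmega F).tensor (KerModule A A')) (g.f ⁻¹ᵁ W')}
    (H : SectionRel L Δ θ) (h : W₁' ≤ W') :
    SectionRel L (homPolarRes h Δ) (homPolarRes (g.f.preimage_mono h) θ) :=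
  fun V' hV' s a => H V' (hV'.trans h) s a

/-- An affine open set over which the ideal of the divisor is generated by one section, compatibly
with the restriction to `C`. -/
def HasGen (g : C.Hom C') [IsAffineHom g.f] (V' : C'.X.affineOpens) : Prop :=
  ∃ φ : C'.D.ideal V', IsGen C' φ ∧ IsGen C (U := g.down V') (g.mapD (g.le_down V') φ)

theorem HasGen.mono {V' V₁' : C'.X.affineOpens} (h : HasGen g V') (hV : V₁' ≤ V') :
    HasGen g V₁' := by
  obtain ⟨φ, hφ, hφ'⟩ := h
  refine ⟨resD C' hV φ, hφ.restrict hV, ?_⟩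
  rw [g.mapD_resD (g.le_down V₁') (g.le_down V') hV (g.down_mono hV)]
  exact hφ'.restrict (g.down_mono hV)

/-- An affine open set over which `L` and the ideal of the divisor are trivial. -/
def IsSmall (L : BundleLift g n F) (V' : C'.X.affineOpens) : Prop :=
  (∃ b : Fin n → Γ(L.bundle, V'.1), IsFrame L.bundle b) ∧ HasGen g V'

theorem IsSmall.mono {V' V₁' : C'.X.affineOpens} (h : IsSmall L V') (hV : V₁' ≤ V') :
    IsSmall L V₁' :=
  ⟨h.1.imp' _ fun _ hb => hb.restrict hV, h.2.mono hV⟩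

namespace IsThickening

variable (hg : IsThickening g)

include hg

theorem le_of_preimage_le {U' V' : C'.X.Opens} (h : g.f ⁻¹ᵁ U' ≤ g.f ⁻¹ᵁ V') : U' ≤ V' := by
  intro x hx
  obtain ⟨y, rfl⟩ := hg.homeo.surjective x
  exact h hx

theorem exists_hasGen {x : C'.X} {U' : C'.X.Opens} (hx : x ∈ U') :
    ∃ V' : C'.X.affineOpens, V'.1 ≤ U' ∧ x ∈ V'.1 ∧ HasGen g V' := by
  obtain ⟨T', hxT, φ, hφ, hφ'⟩ := hg.gen x
  obtain ⟨_, ⟨V', hV', rfl⟩, hxV, hVU⟩ := C'.X.isBasis_affineOpens.exists_subset_of_mem_open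
    (show x ∈ (U' ⊓ T'.1 : C'.X.Opens) from ⟨hx, hxT⟩) (U' ⊓ T'.1).2
  exact ⟨⟨V', hV'⟩, hVU.trans inf_le_left, hxV,
    HasGen.mono (V' := T') ⟨φ, hφ, hφ'⟩ (hVU.trans inf_le_right)⟩

theorem exists_isSmall (L : BundleLift g n F) {x : C'.X} {U' : C'.X.Opens} (hx : x ∈ U') :
    ∃ V' : C'.X.affineOpens, V'.1 ≤ U' ∧ x ∈ V'.1 ∧ IsSmall L V' := by
  obtain ⟨T, hxT, b, hb⟩ := L.isVectorBundle x
  obtain ⟨V', hV, hxV, h⟩ := hg.exists_hasGen (show x ∈ U' ⊓ T from ⟨hx, hxT⟩)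
  exact ⟨V', hV.trans inf_le_left, hxV, ⟨_, hb.restrict (hV.trans inf_le_right)⟩, h⟩

omit hg in
/-- A section over `W` is determined by its values on a frame, with respect to any affine open set
contained in `W` and containing `T`. -/
theorem eq_on_of_frame {N : AffModule C} {W₁ W₂ : C.X.Opens} {θ₁ : homPolarSections F N W₁}
    {θ₂ : homPolarSections F N W₂} {V' : C'.X.affineOpens} (hV : IsSmall L V')
    (h₁ : g.f ⁻¹ᵁ V'.1 ≤ W₁) (h₂ : g.f ⁻¹ᵁ V'.1 ≤ W₂)
    (h : ∀ (s : Γ(L.bundle, V'.1)) (a : C'.D.ideal V'),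
      θ₁.1 ⟨g.down V', h₁⟩ (g.mapM L.toPush (g.le_down V') s) (g.mapD (g.le_down V') a) =
        θ₂.1 ⟨g.down V', h₂⟩ (g.mapM L.toPush (g.le_down V') s) (g.mapD (g.le_down V') a))
    (T : C.X.affineOpens) (hT : T.1 ≤ g.f ⁻¹ᵁ V'.1) :
    θ₁.1 ⟨T, hT.trans h₁⟩ = θ₂.1 ⟨T, hT.trans h₂⟩ := by
  obtain ⟨⟨b, hb⟩, φ, hφ, hφ'⟩ := hV
  have h3 : homPolarRes (W₁ := (g.down V').1) h₁ θ₁ = homPolarRes h₂ θ₂ :=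
    homPolarSections_ext_frame (V := g.down V') (L.isFrame_down hb) hφ' le_rfl le_rfl
      fun k => h (b k) φ
  exact congrArg (fun θ : homPolarSections F N (g.down V').1 => θ.1 ⟨T, hT⟩) h3

theorem sectionRel_unique_on {W₁' W₂' : C'.X.Opens}
    {Δ₁ : homPolarSections L.bundle (tensorOmega L.bundle) W₁'}
    {Δ₂ : homPolarSections L.bundle (tensorOmega L.bundle) W₂'}
    {θ₁ : homPolarSections F ((tensorOmega F).tensor (KerModule A A')) (g.f ⁻¹ᵁ W₁')}
    {θ₂ : homPolarSections F ((tensorOmega F).tensor (KerModule A A')) (g.f ⁻¹ᵁ W₂')}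
    (H₁ : SectionRel L Δ₁ θ₁) (H₂ : SectionRel L Δ₂ θ₂) {V' : C'.X.affineOpens} (hV : IsSmall L V')
    (h₁ : V'.1 ≤ W₁') (h₂ : V'.1 ≤ W₂') (h : Δ₁.1 ⟨V', h₁⟩ = Δ₂.1 ⟨V', h₂⟩)
    (T : C.X.affineOpens) (hT : T.1 ≤ g.f ⁻¹ᵁ V'.1) :
    θ₁.1 ⟨T, hT.trans (g.f.preimage_mono h₁)⟩ = θ₂.1 ⟨T, hT.trans (g.f.preimage_mono h₂)⟩ := by
  refine eq_on_of_frame hV (g.f.preimage_mono h₁) (g.f.preimage_mono h₂) (fun s a => ?_) T hT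
  obtain ⟨b, hb⟩ := hV.1
  haveI := hg.flat_tensorOmega L hb
  have h3 := H₂ V' h₂ s a
  rw [← h] at h3
  exact (H₁ V' h₁ s a).unique h3

/-- The affine open sets of `C` which lie over a small open set. -/
theorem small_cover (L : BundleLift g n F) (W' : C'.X.Opens) {x : C.X} (hx : x ∈ g.f ⁻¹ᵁ W') :
    ∃ T ∈ {T : C.X.affineOpens | ∃ V' : C'.X.affineOpens, IsSmall L V' ∧ V'.1 ≤ W' ∧
      T.1 ≤ g.f ⁻¹ᵁ V'.1}, x ∈ T.1 := by
  obtain ⟨V', hV, hxV, h⟩ := hg.exists_isSmall L (show g.f x ∈ W' from hx)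
  exact ⟨g.down V', ⟨V', h, hV, le_rfl⟩, hxV⟩

omit hg [IsAffineHom g.f] in
theorem small_down {P : C'.X.affineOpens → Prop} (T₁ T₂ : C.X.affineOpens) (h : T₁ ≤ T₂)
    (h₂ : T₂ ∈ {T : C.X.affineOpens | ∃ V' : C'.X.affineOpens, P V' ∧ T.1 ≤ g.f ⁻¹ᵁ V'.1}) :
    T₁ ∈ {T : C.X.affineOpens | ∃ V' : C'.X.affineOpens, P V' ∧ T.1 ≤ g.f ⁻¹ᵁ V'.1} := by
  obtain ⟨V', hV, h'⟩ := h₂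
  exact ⟨V', hV, le_trans (show T₁.1 ≤ T₂.1 from h) h'⟩

theorem sectionRel_unique (hF : IsVectorBundle n F) {W' : C'.X.Opens}
    {Δ : homPolarSections L.bundle (tensorOmega L.bundle) W'}
    {θ₁ θ₂ : homPolarSections F ((tensorOmega F).tensor (KerModule A A')) (g.f ⁻¹ᵁ W')}
    (H₁ : SectionRel L Δ θ₁) (H₂ : SectionRel L Δ θ₂) : θ₁ = θ₂ := by
  refine homPolarSections_ext ((isQCoh_tensorOmega hF).tensor _)
    (𝔅 := {T : C.X.affineOpens | ∃ V' : C'.X.affineOpens, (IsSmall L V' ∧ V'.1 ≤ W') ∧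
      T.1 ≤ g.f ⁻¹ᵁ V'.1}) small_down (fun x hx => ?_) ?_
  · simpa only [and_assoc] using hg.small_cover L W' hx
  · rintro T ⟨V', ⟨hV, hVW⟩, hT⟩ _
    exact hg.sectionRel_unique_on H₁ H₂ hV hVW hVW rfl T hT

/-- The relation between sections can be checked on small open sets. -/
theorem sectionRel_of_small (hF : IsVectorBundle n F) {W' : C'.X.Opens}
    {Δ : homPolarSections L.bundle (tensorOmega L.bundle) W'}
    {θ : homPolarSections F ((tensorOmega F).tensor (KerModule A A')) (g.f ⁻¹ᵁ W')}
    (H : ∀ (V' : C'.X.affineOpens) (_ : IsSmall L V') (h : V'.1 ≤ W') (s : Γ(L.bundle, V'.1))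
      (a : C'.D.ideal V'), KerRel (g.mapOmega L.toPush (g.le_down V')) (Δ.1 ⟨V', h⟩ s a)
        (θ.1 ⟨g.down V', g.f.preimage_mono h⟩ (g.mapM L.toPush (g.le_down V') s)
          (g.mapD (g.le_down V') a))) : SectionRel L Δ θ := by
  intro V' hVW s a
  have hN' := isQCoh_tensorOmega (C := C') L.isVectorBundle
  have hNI := hN'.tensor (RingHom.ker (algebraMap A' A))
  have hNM := (isQCoh_tensorOmega hF).tensor (KerModule A A')
  have hcov : ∀ x ∈ V'.1, ∃ T ∈ {T : C'.X.affineOpens | IsSmall L T}, x ∈ T.1 := fun x hx => by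
    obtain ⟨T, -, hxT, hT⟩ := hg.exists_isSmall L hx
    exact ⟨T, hT, hxT⟩
  have hdown : ∀ T₁ T₂ : C'.X.affineOpens, T₁ ≤ T₂ → T₂ ∈ {T : C'.X.affineOpens | IsSmall L T} →
      T₁ ∈ {T : C'.X.affineOpens | IsSmall L T} := fun T₁ T₂ h hT => hT.mono h
  choose w hw hw' using fun (T' : C'.X.affineOpens) (hT : IsSmall L T') (l : T' ≤ V') =>
    H T' hT (le_trans (show T'.1 ≤ V'.1 from l) hVW) (resM C' L.bundle l s) (resD C' l a)
  have hΔ : ∀ (T' : C'.X.affineOpens) (l : T' ≤ V'),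
      Δ.1 ⟨T', le_trans (show T'.1 ≤ V'.1 from l) hVW⟩ (resM C' L.bundle l s) (resD C' l a) =
        (tensorOmega L.bundle).res l (Δ.1 ⟨V', hVW⟩ s a) := fun T' l =>
    Δ.2 ⟨V', hVW⟩ ⟨T', le_trans (show T'.1 ≤ V'.1 from l) hVW⟩ l s a
  -- the tensors in `(L ⊗ Ω) ⊗ I` which witness the relation are unique by flatness, so they glue
  obtain ⟨W, hW⟩ := hNI.glue hdown hcov w fun T₁ T₂ h m₁ m₂ l₁ l₂ => by
    obtain ⟨b, hb⟩ := (show IsSmall L T₁ from m₁).1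
    haveI := hg.flat_tensorOmega L hb
    refine mulKer_injective (A := A) (A' := A') ?_
    refine (mulKer_rTensor ((tensorOmega L.bundle).res h) (w T₂ m₂ l₂)).trans ?_
    rw [← hw T₂ m₂ l₂, ← hw T₁ m₁ l₁, hΔ T₂ l₂, hΔ T₁ l₁, hN'.res_res]
  refine ⟨W, ?_, ?_⟩
  · refine hN'.ext hdown hcov fun T m l => ?_
    rw [← hΔ T l, hw T m l, ← hW T m l]
    exact mulKer_rTensor ((tensorOmega L.bundle).res l) W
  · refine hNM.ext (𝔅 := {T : C.X.affineOpens | ∃ T' : C'.X.affineOpens, (IsSmall L T' ∧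
      T' ≤ V') ∧ T.1 ≤ g.f ⁻¹ᵁ T'.1}) small_down (fun x hx => ?_) ?_
    · obtain ⟨T', hT', hxT, hT⟩ := hg.exists_isSmall L (show g.f x ∈ V'.1 from hx)
      exact ⟨g.down T', ⟨T', ⟨hT, hT'⟩, le_rfl⟩, hxT⟩
    · rintro T ⟨T', ⟨m, l⟩, hTT'⟩ hT
      have hT'' : T ≤ g.down T' := hTT'
      have h1 := map_toKerModule_rTensor (p := g.mapOmega L.toPush (g.le_down V'))
        (p₂ := g.mapOmega L.toPush (g.le_down T')) ((tensorOmega L.bundle).res l)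
        ((tensorOmega F).res (g.down_mono l))
        (fun x => g.mapOmega_res L.toPush (g.le_down V') (g.le_down T') l (g.down_mono l) x) W
      have h2 := (congrArg (TensorProduct.map (g.mapOmega L.toPush (g.le_down T')) toKerModule)
        (hW T' m l)).symm.trans h1
      have h3 := θ.2 ⟨g.down V', g.f.preimage_mono hVW⟩ ⟨g.down T', g.f.preimage_mono
        (le_trans (show T'.1 ≤ V'.1 from l) hVW)⟩ (g.down_mono l)
        (g.mapM L.toPush (g.le_down V') s) (g.mapD (g.le_down V') a)
      rw [← g.mapM_resM L.toPush (g.le_down T') (g.le_down V') l (g.down_mono l),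
        ← g.mapD_resD (g.le_down T') (g.le_down V') l (g.down_mono l)] at h3
      have h4 := h3.symm.trans ((hw' T' m l).trans h2)
      have h5 := congrArg (((tensorOmega F).tensor (KerModule A A')).res hT'') h4
      rw [hNM.res_res] at h5
      refine h5.trans ?_
      exact hNM.res_res (g.down_mono l) hT'' _

/-- A section of `ℰnd(L) ⊗ ω(D)` which vanishes modulo `I` corresponds to a section of
`ℰnd(F) ⊗ ω(D) ⊗ I`. -/
theorem exists_sectionRel (hF : IsVectorBundle n F) {W' : C'.X.Opens}
    (Δ : homPolarSections L.bundle (tensorOmega L.bundle) W')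
    (hΔ : ∀ (V' : C'.X.affineOpens) (h : V'.1 ≤ W') (s : Γ(L.bundle, V'.1)) (a : C'.D.ideal V'),
      g.mapOmega L.toPush (g.le_down V') (Δ.1 ⟨V', h⟩ s a) = 0) :
    ∃ θ : homPolarSections F ((tensorOmega F).tensor (KerModule A A')) (g.f ⁻¹ᵁ W'),
      SectionRel L Δ θ := by
  have local_exists : ∀ (T' : C'.X.affineOpens) (_ : IsSmall L T' ∧ T'.1 ≤ W'),
      ∃ e : homPolarSections F ((tensorOmega F).tensor (KerModule A A')) (g.f ⁻¹ᵁ T'.1),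
        ∀ h : T'.1 ≤ W', SectionRel L (homPolarRes h Δ) e := by
    rintro T' ⟨⟨⟨b, hb⟩, φ, hφ, hφ'⟩, h⟩
    obtain ⟨e, he⟩ := hg.exists_kerRel_section hF hφ hφ' hb hb (homPolarRes h Δ)
      fun k => hΔ T' h (b k) φ
    exact ⟨e, fun _ => he⟩
  -- the local sections agree on overlaps, being determined by `Δ`
  choose e he using local_exists
  have hdown := small_down (g := g) (P := fun V' => IsSmall L V' ∧ V'.1 ≤ W')
  obtain ⟨Θ, hΘ⟩ := exists_homPolarSections (F := F) ((isQCoh_tensorOmega hF).tensor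
    (KerModule A A')) (W := g.f ⁻¹ᵁ W') hdown
    (fun x hx => by simpa only [and_assoc] using hg.small_cover L W' hx)
    (fun T m _ => (e m.choose m.choose_spec.1).1 ⟨T, m.choose_spec.2⟩)
    fun T₁ T₂ h m₁ m₂ l₁ l₂ s a => by
      have h12 : T₁.1 ≤ g.f ⁻¹ᵁ (m₁.choose.1 ⊓ m₂.choose.1) :=
        le_inf m₁.choose_spec.2 (le_trans (show T₁.1 ≤ T₂.1 from h) m₂.choose_spec.2)
      have h1 := hg.sectionRel_unique_on (he m₁.choose m₁.choose_spec.1 m₁.choose_spec.1.2)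
        (he m₂.choose m₂.choose_spec.1 m₂.choose_spec.1.2)
        (V' := ⟨m₁.choose.1 ⊓ m₂.choose.1, hg.inf _ _⟩)
        (m₁.choose_spec.1.1.mono (show m₁.choose.1 ⊓ m₂.choose.1 ≤ m₁.choose.1 from inf_le_left))
        inf_le_left inf_le_right rfl T₁ h12
      refine (congrArg (fun f => f (resM C F h s) (resD C h a)) h1).trans ?_
      exact (e m₂.choose m₂.choose_spec.1).2 ⟨T₂, m₂.choose_spec.2⟩ ⟨T₁, _⟩ h s a
  refine ⟨Θ, hg.sectionRel_of_small hF fun V' hV h s a => ?_⟩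
  have m : g.down V' ∈ {T : C.X.affineOpens | ∃ V' : C'.X.affineOpens, (IsSmall L V' ∧ V'.1 ≤ W') ∧
      T.1 ≤ g.f ⁻¹ᵁ V'.1} := ⟨V', ⟨hV, h⟩, le_rfl⟩
  have h1 := he m.choose m.choose_spec.1 m.choose_spec.1.2 V'
    (hg.le_of_preimage_le m.choose_spec.2) s a
  rw [hΘ (g.down V') m (g.f.preimage_mono h)]
  exact h1

end IsThickening

end SectionRel

/-! ### The commutator with coefficients, and the comparison isomorphism -/

section Obstructions

variable {A A' : Type u} [CommRing A] [CommRing A'] [Algebra A' A]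
  {C : PolarScheme A} {C' : PolarScheme A'} {g : C.Hom C'} {n : ℕ}
  {F : C.X.Modules}

section Commutators

variable (M : Type u) [AddCommGroup M] [Module A M] {t : A} (nab : TConnection t F ⊤)

/-- Evaluation of sections of `ℰnd(F)` on an affine open set. -/
def endEval {W : C.X.Opens} (V : {V : C.X.affineOpens // V.1 ≤ W}) :
    endSections F W →ₗ[A] (Γ(F, V.1.1) →ₗ[Γ(C.X, V.1.1)] Γ(F, V.1.1)) where
  toFun θ := θ.1 V
  map_add' _ _ := rfl
  map_smul' _ _ := rfl

theorem endEval_surjective {V : C.X.affineOpens} {b : Fin n → Γ(F, V.1)} (hb : IsFrame F b) :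
    Function.Surjective (endEval (F := F) ⟨V, le_refl V.1⟩) := by
  intro θ
  refine ⟨⟨fun V₁ => hb.map (fun k => θ (b k)) V₁.2, fun V₁ V₂ h s => hb.map_rF _ V₁.2 h s⟩, ?_⟩
  exact (hb.basis le_rfl).ext fun k => by
    rw [hb.basis_self]
    exact hb.map_frame_self _ k

/-- The commutator `ℰnd(F) ⊗ M → ℰnd(F) ⊗ ω(D) ⊗ M` on sections over `W`. -/
def tensorCommutator (W : C.X.Opens) :
    endSections F W ⊗[A] M →ₗ[A] homPolarSections F ((tensorOmega F).tensor M) W :=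
  sectionsComparison F M W ∘ₗ LinearMap.rTensor M (nab.commutatorSections W)

variable {M}

theorem tensorCommutator_apply {W : C.X.Opens} (u : endSections F W ⊗[A] M)
    (V : {V : C.X.affineOpens // V.1 ≤ W}) (s : Γ(F, V.1.1)) (a : C.D.ideal V.1) :
    (tensorCommutator M nab W u).1 V s a = -LinearMap.rTensor M
      (homDiffEval nab nab V.1 le_top le_top s a) (LinearMap.rTensor M (endEval V) u) := by
  induction u using TensorProduct.induction_on with
  | zero => simp only [map_zero, neg_zero]; rfl
  | add x y hx hy =>
    simp only [map_add, neg_add]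
    exact congrArg₂ (· + ·) hx hy
  | tmul θ m =>
    refine (congrArg (fun x => x ⊗ₜ[A] m) (commutatorAt_apply nab (θ.1 V) s a)).trans ?_
    exact TensorProduct.neg_tmul _ _

theorem tensorRight_tensorCommutator (m : M) (W : C.X.Opens) (θ : endSections F W) :
    tensorCommutator M nab W (θ ⊗ₜ m) =
      ((nab.commutator ≫ tensorRight F m).app (op W)).hom θ := rfl

/-- The map `H¹(ℰnd(F)) ⊗ M → H¹(ℰnd(F) ⊗ ω(D) ⊗ M)` induced by the commutator. -/
def H1.tensorCommutator : H1 (endPresheaf F) ⊗[A] M →ₗ[A] H1 (endOmegaTensor F M) :=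
  H1.tensorComparison F M ∘ₗ LinearMap.rTensor M (H1.map nab.commutator)

theorem H1.tensorCommutator_tmul (x : H1 (endPresheaf F)) (m : M) :
    H1.tensorCommutator nab (x ⊗ₜ m) = H1.map (nab.commutator ≫ tensorRight F m) x := by
  obtain ⟨𝒰, c, rfl⟩ := H1.exists_rep x
  refine (?_ : H1.map (tensorRight F m) (H1.map nab.commutator
    (𝒰.toH1 _ (CechZ1.toCechH1 𝒰.U _ c))) = _)
  rw [H1.map_toH1, H1.map_toH1, H1.map_toH1]
  rfl

end Commutators

section Special

variable [IsAffineHom g.f] (hg : IsThickening g)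

/-- The open cover of `C` given by affine open sets of `C'`. -/
def PolarScheme.Hom.cover (g : C.Hom C') (T : C.X → C'.X.affineOpens)
    (hT : ∀ x, x ∈ g.f ⁻¹ᵁ (T x).1) : PointedCover (TopCat.of C.X) :=
  ⟨fun x => g.f ⁻¹ᵁ (T x).1, hT⟩

include hg

omit [IsAffineHom g.f] in
theorem IsThickening.exists_special (hX : IsCurveLike C.X) (Good : C'.X.affineOpens → Prop)
    (hgood : ∀ (x : C'.X) (U' : C'.X.Opens), x ∈ U' → ∃ V' : C'.X.affineOpens,
      V'.1 ≤ U' ∧ x ∈ V'.1 ∧ Good V') :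
    ∃ η : C.X, ∀ 𝒰 : PointedCover (TopCat.of C.X), ∃ (T : C.X → C'.X.affineOpens)
      (hT : ∀ x, x ∈ g.f ⁻¹ᵁ (T x).1), (g.cover T hT).IsSpecial η ∧ (g.cover T hT).Refines η 𝒰 ∧
        ∀ x, Good (T x) := by
  obtain ⟨η, h⟩ := PointedCover.exists_special hX
    (fun V => ∃ V' : C'.X.affineOpens, V = g.f ⁻¹ᵁ V'.1 ∧ Good V') (fun x O hx => by
      obtain ⟨U', hU', hO⟩ := hg.homeo.isInducing.isOpen_iff.1 O.2
      have hx' : g.f x ∈ (⟨U', hU'⟩ : C'.X.Opens) := by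
        have : x ∈ g.f ⁻¹' U' := hO ▸ hx
        exact this
      obtain ⟨V', hV, hxV, h⟩ := hgood (g.f x) ⟨U', hU'⟩ hx'
      refine ⟨g.f ⁻¹ᵁ V'.1, fun y hy => ?_, hxV, V', rfl, h⟩
      have : y ∈ g.f ⁻¹' U' := hV hy
      rw [hO] at this
      exact this)
  refine ⟨η, fun 𝒰 => ?_⟩
  obtain ⟨⟨U, hU⟩, hS, hr, hG⟩ := h 𝒰
  choose T hT hGT using hG
  obtain rfl : U = fun x => g.f ⁻¹ᵁ (T x).1 := funext hT
  exact ⟨T, hU, hS, hr, hGT⟩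

theorem IsThickening.exists_frame_hasGen (hF : IsVectorBundle n F) (x : C'.X) (U' : C'.X.Opens)
    (hx : x ∈ U') : ∃ V' : C'.X.affineOpens, V'.1 ≤ U' ∧ x ∈ V'.1 ∧ HasGen g V' ∧
      ∃ b : Fin n → Γ(F, (g.down V').1), IsFrame F b := by
  obtain ⟨y, rfl⟩ := hg.homeo.surjective x
  obtain ⟨U, hyU, b, hb⟩ := hF y
  obtain ⟨O, hO, hOU⟩ := hg.homeo.isInducing.isOpen_iff.1 U.2
  have hy : g.f y ∈ (U' ⊓ ⟨O, hO⟩ : C'.X.Opens) := ⟨hx, by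
    have : y ∈ g.f ⁻¹' O := hOU ▸ hyU
    exact this⟩
  obtain ⟨V', hV, hyV, h⟩ := hg.exists_hasGen hy
  have hVU : (g.down V').1 ≤ U := fun p hp => by
    have : p ∈ g.f ⁻¹' O := (hV hp).2
    rw [hOU] at this
    exact this
  exact ⟨V', hV.trans inf_le_left, hyV, h, _, hb.restrict hVU⟩

/-- `H¹(ℰnd(F) ⊗ ω(D)) ⊗ M ≅ H¹(ℰnd(F) ⊗ ω(D) ⊗ M)`: on a curve the functor `H¹` of quasi-coherent
sheaves is right exact. -/
theorem tensorComparison_bijective (hX : IsCurveLike C.X) (hF : IsVectorBundle n F)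
    (M : Type u) [AddCommGroup M] [Module A M] :
    Function.Bijective (H1.tensorComparison F M) := by
  obtain ⟨η, hη⟩ := hg.exists_special hX (fun V' => HasGen g V' ∧
    ∃ b : Fin n → Γ(F, (g.down V').1), IsFrame F b) (hg.exists_frame_hasGen hF)
  refine PointedCover.comparison_bijective (fun m : M => tensorRight F m)
    (fun W => sectionsComparison F M W) (fun _ _ _ => rfl) _ (fun _ _ => rfl) (η := η) fun 𝒰 => ?_
  obtain ⟨T, hT, hS, hr, hG⟩ := hη 𝒰
  refine ⟨_, hS, hr, fun x => ?_, fun x => ?_⟩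
  · obtain ⟨⟨φ, -, hφ⟩, b, hb⟩ := hG x
    exact (sectionsComparison_bijective M (V := g.down (T x)) hF hb hφ).2
  · obtain ⟨hφ, b, hb⟩ := hG η
    have hle : (⟨(T η).1 ⊓ (T x).1, hg.inf _ _⟩ : C'.X.affineOpens) ≤ T η :=
      show (T η).1 ⊓ (T x).1 ≤ (T η).1 from inf_le_left
    obtain ⟨φ, -, hφ⟩ := hφ.mono hle
    exact sectionsComparison_bijective M (V := g.down ⟨(T η).1 ⊓ (T x).1, hg.inf _ _⟩) hF
      (hb.restrict (g.down_mono hle)) hφ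

end Special

end Obstructions

/-! ### Difference cocycles -/

section DifferenceCocycles

variable {A A' : Type u} [CommRing A] [CommRing A'] [Algebra A' A]
  {C : PolarScheme A} {C' : PolarScheme A'} {g : C.Hom C'} [IsAffineHom g.f] {n : ℕ}
  {F : C.X.Modules} {L L₁ L₂ : BundleLift g n F}

section

variable {W' : C'.X.Opens} {Δ Δ₁ Δ₂ : homPolarSections L.bundle (tensorOmega L.bundle) W'}
  {θ θ₁ θ₂ : homPolarSections F ((tensorOmega F).tensor (KerModule A A')) (g.f ⁻¹ᵁ W')}

theorem SectionRel.zero : SectionRel L (0 : homPolarSections L.bundle (tensorOmega L.bundle) W')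
    (0 : homPolarSections F ((tensorOmega F).tensor (KerModule A A')) (g.f ⁻¹ᵁ W')) :=
  fun _ _ _ _ => KerRel.zero

theorem SectionRel.add (h₁ : SectionRel L Δ₁ θ₁) (h₂ : SectionRel L Δ₂ θ₂) :
    SectionRel L (Δ₁ + Δ₂) (θ₁ + θ₂) :=
  fun V' h s a => (h₁ V' h s a).add (h₂ V' h s a)

theorem SectionRel.sub (h₁ : SectionRel L Δ₁ θ₁) (h₂ : SectionRel L Δ₂ θ₂) :
    SectionRel L (Δ₁ - Δ₂) (θ₁ - θ₂) :=
  fun V' h s a => (h₁ V' h s a).sub (h₂ V' h s a)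

end

variable {t : A} {t' : A'} {nab : TConnection t F ⊤}

theorem BundleLift.IsConnectionLift.restrict {W' W₁' : C'.X.Opens}
    {nab' : TConnection t' L.bundle W'} (hn : L.IsConnectionLift nab' nab) (h : W₁' ≤ W') :
    L.IsConnectionLift (nab'.restrict h) nab :=
  fun V' V e s a => hn ⟨V'.1, V'.2.trans h⟩ V e s a

theorem BundleLift.IsConnectionLift.mapOmega_diffSection {W' W₁' W₂' : C'.X.Opens}
    {nab₁ : TConnection t' L.bundle W₁'} {nab₂ : TConnection t' L.bundle W₂'}
    (hn₁ : L.IsConnectionLift nab₁ nab) (hn₂ : L.IsConnectionLift nab₂ nab)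
    (h₁ : W' ≤ W₁') (h₂ : W' ≤ W₂') (V' : C'.X.affineOpens) (h : V'.1 ≤ W')
    (s : Γ(L.bundle, V'.1)) (a : C'.D.ideal V') :
    g.mapOmega L.toPush (g.le_down V') ((nab₁.diffSection nab₂ h₁ h₂).1 ⟨V', h⟩ s a) = 0 :=
  (map_sub (g.mapOmega L.toPush (g.le_down V')) _ _).trans (sub_eq_zero.2
    ((hn₁ ⟨V', h.trans h₁⟩ (g.down V') (g.le_down V') s a).symm.trans
      (hn₂ ⟨V', h.trans h₂⟩ (g.down V') (g.le_down V') s a)))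

/-- The cocycle formed by the differences between local lifts of `∇`. -/
theorem ObstructionData.isDifferenceCocycle_iff (d : ObstructionData g n nab t')
    (c : CechZ1 (fun i => g.f ⁻¹ᵁ (d.cover i).1) (endOmegaTensor F (KerModule A A'))) :
    d.IsDifferenceCocycle c ↔ ∀ i j, SectionRel d.lift
      ((d.conn i).diffSection (d.conn j) (W := (d.cover i).1 ⊓ (d.cover j).1) inf_le_left
        inf_le_right) (c.1 i j) :=
  ⟨fun h i j V' hV s a => h i j V' (hV.trans inf_le_left) (hV.trans inf_le_right) (g.down V')
    (g.le_down V') s a, fun h i j V' hi hj V e s a => (h i j).apply V' (le_inf hi hj) V e s a⟩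

variable (hg : IsThickening g) (hF : IsVectorBundle n F)

include hg hF

theorem IsThickening.exists_isDifferenceCocycle (d : ObstructionData g n nab t') :
    ∃ c, d.IsDifferenceCocycle c := by
  choose c hc using fun i j : Fin d.m => hg.exists_sectionRel hF
    ((d.conn i).diffSection (d.conn j) (W := (d.cover i).1 ⊓ (d.cover j).1) inf_le_left
      inf_le_right)
    ((d.isConnectionLift i).mapOmega_diffSection (d.isConnectionLift j) _ _)
  refine ⟨⟨c, LinearMap.mem_ker.2 (funext fun i => funext fun j => funext fun k => ?_)⟩,
    (d.isDifferenceCocycle_iff _).2 hc⟩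
  have hij : (d.cover i).1 ⊓ (d.cover j).1 ⊓ (d.cover k).1 ≤ (d.cover i).1 ⊓ (d.cover j).1 :=
    inf_le_left
  have hjk : (d.cover i).1 ⊓ (d.cover j).1 ⊓ (d.cover k).1 ≤ (d.cover j).1 ⊓ (d.cover k).1 :=
    le_inf (inf_le_left.trans inf_le_right) inf_le_right
  have hik : (d.cover i).1 ⊓ (d.cover j).1 ⊓ (d.cover k).1 ≤ (d.cover i).1 ⊓ (d.cover k).1 :=
    le_inf (inf_le_left.trans inf_le_left) inf_le_right
  -- `(∇ᵢ - ∇ⱼ) + (∇ⱼ - ∇ₖ) - (∇ᵢ - ∇ₖ) = 0`, and the corresponding section is unique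
  have h1 := (((hc i j).restrict hij).add ((hc j k).restrict hjk)).sub ((hc i k).restrict hik)
  refine hg.sectionRel_unique hF (L := d.lift) (W' := (d.cover i).1 ⊓ (d.cover j).1 ⊓
    (d.cover k).1) (?_ : SectionRel d.lift 0 _) .zero
  refine (iff_of_eq (congrArg (fun Δ => SectionRel d.lift Δ _) ?_)).1 h1
  refine Subtype.ext (funext fun V => LinearMap.ext fun s => LinearMap.ext fun a => ?_)
  exact sub_eq_zero.2 (sub_add_sub_cancel _ _ _)

/-- The differences between local lifts of `∇` on two lifts of `F`, on the overlap of two open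
sets on which the lifts of `F` are identified. -/
theorem IsThickening.sectionRel_change {T₀ T₁ V' : C'.X.affineOpens} (hV₀ : V' ≤ T₀) (hV₁ : V' ≤ T₁)
    (hV : HasGen g V')
    {nab₁ : TConnection t' L₁.bundle T₀.1} {nab₂ : TConnection t' L₂.bundle T₀.1}
    {nab₃ : TConnection t' L₁.bundle T₁.1} {nab₄ : TConnection t' L₂.bundle T₁.1}
    (hn₁ : L₁.IsConnectionLift nab₁ nab) (hn₂ : L₂.IsConnectionLift nab₂ nab)
    {b₀ : Fin n → Γ(L₁.bundle, T₀.1)} (hb₀ : IsFrame L₁.bundle b₀) {c₀ : Fin n → Γ(L₂.bundle, T₀.1)}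
    {b₁ : Fin n → Γ(L₁.bundle, T₁.1)} (hb₁ : IsFrame L₁.bundle b₁) {c₁ : Fin n → Γ(L₂.bundle, T₁.1)}
    (hc₁ : IsFrame L₂.bundle c₁)
    (hbc : ∀ k, g.mapM L₂.toPush (g.le_down T₁) (c₁ k) = g.mapM L₁.toPush (g.le_down T₁) (b₁ k))
    {e₀ : homPolarSections F ((tensorOmega F).tensor (KerModule A A')) (g.down T₀).1}
    (he₀ : ∀ (V₁' : C'.X.affineOpens) (h : V₁' ≤ T₀) (s : Γ(L₁.bundle, V₁'.1)) (a : C'.D.ideal V₁'),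
      KerRel (g.mapOmega L₂.toPush (g.le_down V₁')) (homDiff nab₁ nab₂ V₁' h h (hb₀.map c₀ h) s a)
        (e₀.1 ⟨g.down V₁', g.down_mono h⟩ (g.mapM L₁.toPush (g.le_down V₁') s)
          (g.mapD (g.le_down V₁') a)))
    {e₁ : homPolarSections F ((tensorOmega F).tensor (KerModule A A')) (g.down T₁).1}
    (he₁ : ∀ (V₁' : C'.X.affineOpens) (h : V₁' ≤ T₁) (s : Γ(L₁.bundle, V₁'.1)) (a : C'.D.ideal V₁'),
      KerRel (g.mapOmega L₂.toPush (g.le_down V₁')) (homDiff nab₃ nab₄ V₁' h h (hb₁.map c₁ h) s a)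
        (e₁.1 ⟨g.down V₁', g.down_mono h⟩ (g.mapM L₁.toPush (g.le_down V₁') s)
          (g.mapD (g.le_down V₁') a)))
    {b : Fin n → Γ(L₁.bundle, V'.1)} (hb : IsFrame L₁.bundle b)
    {u : endSections F (g.f ⁻¹ᵁ V'.1) ⊗[A] KerModule A A'}
    (hu : KerRel (reduceHom L₂ hb) (hb₀.map c₀ hV₀ - hb₁.map c₁ hV₁)
      (LinearMap.rTensor _ (endEval (F := F) ⟨g.down V', le_refl (g.down V').1⟩) u))
    {θ₁ θ₂ : homPolarSections F ((tensorOmega F).tensor (KerModule A A')) (g.f ⁻¹ᵁ V'.1)}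
    (h₁ : SectionRel L₁ (nab₁.diffSection nab₃ (W := V'.1) hV₀ hV₁) θ₁)
    (h₂ : SectionRel L₂ (nab₂.diffSection nab₄ (W := V'.1) hV₀ hV₁) θ₂) :
    θ₂ = θ₁ - homPolarRes (g.f.preimage_mono hV₀) e₀ + homPolarRes (g.f.preimage_mono hV₁) e₁ -
      tensorCommutator (KerModule A A') nab (g.f ⁻¹ᵁ V'.1) u := by
  obtain ⟨φ, hφ, hφ'⟩ := hV
  have hle : V'.1 ≤ T₁.1 := hV₁
  refine homPolarSections_ext_frame (V := g.down V') (L₁.isFrame_down hb) hφ' le_rfl le_rfl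
    fun k => ?_
  haveI := hg.flat_tensorOmega L₂ (hc₁.restrict hle)
  have h3 := KerRel.change hn₁ hn₂ hV₀ hV₀ hV₁ hV₁ hb (fun s => mapM_map hb₁ hbc hV₁ s) hu (b k) φ
    (h₁ V' le_rfl (b k) φ) (he₀ V' hV₀ (b k) φ) (he₁ V' hV₁ (b k) φ)
  have h4 := h₂ V' le_rfl (hb₁.map c₁ hV₁ (b k)) φ
  rw [mapM_map hb₁ hbc hV₁] at h4
  refine (h4.unique h3).trans ?_
  have h5 := tensorCommutator_apply nab u ⟨g.down V', le_refl (g.down V').1⟩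
    (g.mapM L₁.toPush (g.le_down V') (b k)) (g.mapD (g.le_down V') φ)
  refine Eq.trans ?_ (congrArg (fun x => _ - x) h5).symm
  exact (sub_neg_eq_add _ _).symm

end DifferenceCocycles

/-! ### Independence of the choices -/

section PointedCover

universe v

variable {A : Type u} [CommRing A] {X : TopCat.{u}} {ι : Type v} {U : ι → Opens X}
  (E : (Opens X)ᵒᵖ ⥤ ModuleCat.{u} A) (c : CechZ1 U E)

theorem CechH1.toH1_toCechH1 (hU : ∀ x : X, ∃ i, x ∈ U i) :
    CechH1.toH1 hU E (CechZ1.toCechH1 U E c) =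
      PointedCover.cls E ⟨fun x => U (hU x).choose, fun x => (hU x).choose_spec⟩
        (CechZ1.refine (fun x : X => (hU x).choose) (fun _ => le_rfl) E c) := rfl

theorem PointedCover.loc_refine {S 𝒰 : PointedCover X} {η : X} (h : S.Refines η 𝒰) (τ : X → ι)
    (hτ : ∀ x, 𝒰.U x ≤ U (τ x)) (z : X) :
    PointedCover.loc h (CechZ1.refine τ hτ E c) z =
      resE E (inf_le_inf ((h η).trans (hτ _)) ((h z).trans (hτ _)))
        (c.1 (τ (S.index η η)) (τ (S.index η z))) :=
  resE_resE E _ _ _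

end PointedCover

section Independence

variable {A A' : Type u} [CommRing A] [CommRing A'] [Algebra A' A]
  {C : PolarScheme A} {C' : PolarScheme A'} {g : C.Hom C'} {n : ℕ}
  {F : C.X.Modules} {t : A} {t' : A'} {nab : TConnection t F ⊤}

/-- The cover of `C` indexed by its points attached to a choice of obstruction data. -/
def ObstructionData.pointedCover (d : ObstructionData g n nab t') :
    PointedCover (TopCat.of C.X) :=
  ⟨fun x => g.f ⁻¹ᵁ (d.cover (d.covers x).choose).1, fun x => (d.covers x).choose_spec⟩

/-- A cocycle on the cover of the obstruction data, as a cocycle on the cover indexed by points. -/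
abbrev ObstructionData.pointedCocycle (d : ObstructionData g n nab t')
    (c : CechZ1 (fun i => g.f ⁻¹ᵁ (d.cover i).1) (endOmegaTensor F (KerModule A A'))) :
    CechZ1 d.pointedCover.U (endOmegaTensor F (KerModule A A')) :=
  CechZ1.refine (fun x : C.X => (d.covers x).choose) (fun _ => le_rfl) _ c

theorem ObstructionData.toH1_eq_cls (d : ObstructionData g n nab t')
    (c : CechZ1 (fun i => g.f ⁻¹ᵁ (d.cover i).1) (endOmegaTensor F (KerModule A A'))) :
    CechH1.toH1 d.covers _ (CechZ1.toCechH1 _ _ c) =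
      d.pointedCover.cls _ (d.pointedCocycle c) :=
  CechH1.toH1_toCechH1 _ c d.covers

theorem rTensor_mkQ_eq_zero_iff {R M N P : Type*} [CommRing R] [AddCommGroup M] [AddCommGroup N]
    [AddCommGroup P] [Module R M] [Module R N] [Module R P] (f : M →ₗ[R] N) (z : N ⊗[R] P) :
    LinearMap.rTensor P (LinearMap.range f).mkQ z = 0 ↔ ∃ y, LinearMap.rTensor P f y = z :=
  rTensor_exact P (f := f) (g := (LinearMap.range f).mkQ)
    (LinearMap.exact_iff.2 (Submodule.ker_mkQ _)) (Submodule.mkQ_surjective _) z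

variable [IsAffineHom g.f]

section Cover

variable (hg : IsThickening g) {T : C.X → C'.X.affineOpens} {hT : ∀ x, x ∈ g.f ⁻¹ᵁ (T x).1} {η : C.X}

include hg

/-- The member of the cover of the obstruction data which contains a member of a special
refinement. -/
theorem ObstructionData.le_cover (d : ObstructionData g n nab t')
    (hr : (g.cover T hT).Refines η d.pointedCover) (x : C.X) :
    (T x).1 ≤ (d.cover (d.covers ((g.cover T hT).index η x)).choose).1 :=
  hg.le_of_preimage_le (hr x)

/-- The local lift of `∇` over a member of a special refinement. -/
def ObstructionData.localConn (d : ObstructionData g n nab t')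
    (hr : (g.cover T hT).Refines η d.pointedCover) (x : C.X) :
    TConnection t' d.lift.bundle (T x).1 :=
  (d.conn (d.covers ((g.cover T hT).index η x)).choose).restrict (d.le_cover hg hr x)

theorem ObstructionData.isConnectionLift_localConn (d : ObstructionData g n nab t')
    (hr : (g.cover T hT).Refines η d.pointedCover) (x : C.X) :
    d.lift.IsConnectionLift (d.localConn hg hr x) nab :=
  (d.isConnectionLift _).restrict _

theorem ObstructionData.sectionRel_loc (d : ObstructionData g n nab t')
    {c : CechZ1 (fun i => g.f ⁻¹ᵁ (d.cover i).1) (endOmegaTensor F (KerModule A A'))}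
    (hc : d.IsDifferenceCocycle c) (hr : (g.cover T hT).Refines η d.pointedCover) (z : C.X) :
    SectionRel d.lift ((d.localConn hg hr η).diffSection (d.localConn hg hr z)
      (W := (T η).1 ⊓ (T z).1) inf_le_left inf_le_right)
      (PointedCover.loc hr (d.pointedCocycle c) z) := by
  intro V' hV s a
  have h := ((d.isDifferenceCocycle_iff c).1 hc
    (d.covers ((g.cover T hT).index η η)).choose (d.covers ((g.cover T hT).index η z)).choose) V'
      (hV.trans (inf_le_inf (d.le_cover hg hr η) (d.le_cover hg hr z))) s a
  have e := congrArg (fun θ : homPolarSections F ((tensorOmega F).tensor (KerModule A A'))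
    (g.f ⁻¹ᵁ ((T η).1 ⊓ (T z).1)) => θ.1 ⟨g.down V', g.f.preimage_mono hV⟩
      (g.mapM d.lift.toPush (g.le_down V') s) (g.mapD (g.le_down V') a))
    (PointedCover.loc_refine _ c hr (fun x : C.X => (d.covers x).choose) (fun _ => le_rfl) z)
  exact (iff_of_eq (congrArg (KerRel (g.mapOmega d.lift.toPush (g.le_down V')) _) e)).2 h

end Cover

variable (hg : IsThickening g) (hX : IsCurveLike C.X) (hF : IsVectorBundle n F)

include hg hX hF

set_option maxHeartbeats 800000 in
/-- The obstruction class does not depend on the lift of `F`, nor on the local lifts of `∇`. -/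
theorem IsThickening.represents_unique (d₁ d₂ : ObstructionData g n nab t')
    {ob₁ ob₂ : nab.ObsModule ⊗[A] KerModule A A'} (h₁ : d₁.Represents ob₁)
    (h₂ : d₂.Represents ob₂) : ob₁ = ob₂ := by
  obtain ⟨c₁, hc₁, z₁, hz₁, rfl⟩ := h₁
  obtain ⟨c₂, hc₂, z₂, hz₂, rfl⟩ := h₂
  obtain ⟨η, hη⟩ := hg.exists_special hX (fun V' => IsSmall d₁.lift V' ∧ IsSmall d₂.lift V')
    fun x U' hx => by
      obtain ⟨V', hV, hxV, h⟩ := hg.exists_isSmall d₁.lift hx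
      obtain ⟨V'', hV', hxV', h'⟩ := hg.exists_isSmall d₂.lift hxV
      exact ⟨V'', hV'.trans hV, hxV', h.mono hV', h'⟩
  obtain ⟨T, hT, hS, hr, hG⟩ := hη (d₁.pointedCover.inf d₂.pointedCover)
  have hr₁ := hr.trans (d₁.pointedCover.le_inf_left d₂.pointedCover)
  have hr₂ := hr.trans (d₁.pointedCover.le_inf_right d₂.pointedCover)
  choose b hb using fun x => (hG x).1.1
  choose b' hb' hbb' using fun x => hg.exists_isFrame d₂.lift
    (hG x).2.1.choose_spec (d₁.lift.isFrame_down (hb x))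
  have hgen := fun x => (hG x).1.2
  -- `e x` is the difference of the local lifts along the identification `b x ↦ b' x` of the bundles
  have he : ∀ x, ∃ e : homPolarSections F ((tensorOmega F).tensor (KerModule A A'))
      (g.down (T x)).1, ∀ (V₁' : C'.X.affineOpens) (h : V₁' ≤ T x) (s : Γ(d₁.lift.bundle, V₁'.1))
        (a : C'.D.ideal V₁'), KerRel (g.mapOmega d₂.lift.toPush (g.le_down V₁'))
          (homDiff (d₁.localConn hg hr₁ x) (d₂.localConn hg hr₂ x) V₁' h h ((hb x).map (b' x) h) s a)
          (e.1 ⟨g.down V₁', g.down_mono h⟩ (g.mapM d₁.lift.toPush (g.le_down V₁') s)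
            (g.mapD (g.le_down V₁') a)) := fun x => by
    obtain ⟨φ, hφ, hφ'⟩ := hgen x
    exact hg.exists_kerRel_homDiff hF hφ hφ' (d₁.isConnectionLift_localConn hg hr₁ x)
      (d₂.isConnectionLift_localConn hg hr₂ x) le_rfl le_rfl (hb x) (hb' x) (hbb' x)
  choose e he using he
  let V : C.X → C'.X.affineOpens := fun z => ⟨(T η).1 ⊓ (T z).1, hg.inf _ _⟩
  have hV₀ : ∀ z, V z ≤ T η := fun z => show (T η).1 ⊓ (T z).1 ≤ (T η).1 from inf_le_left
  have hV₁ : ∀ z, V z ≤ T z := fun z => show (T η).1 ⊓ (T z).1 ≤ (T z).1 from inf_le_right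
  -- `u z` is the difference of the identifications over `T η` and `T z`
  have hu : ∀ z, ∃ u : endSections F (g.f ⁻¹ᵁ (V z).1) ⊗[A] KerModule A A',
      KerRel (reduceHom d₂.lift ((hb η).restrict (show (V z).1 ≤ (T η).1 from hV₀ z)))
        ((hb η).map (b' η) (hV₀ z) - (hb z).map (b' z) (hV₁ z)) (LinearMap.rTensor _
          (endEval (F := F) ⟨g.down (V z), le_refl (g.down (V z)).1⟩) u) := fun z => by
    obtain ⟨u', hu'⟩ := hg.exists_kerRel_reduceHom (L₂ := d₂.lift)
      ((hb η).restrict (show (V z).1 ≤ (T η).1 from hV₀ z))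
      ((hb' η).restrict (show (V z).1 ≤ (T η).1 from hV₀ z))
      (H := (hb η).map (b' η) (hV₀ z) - (hb z).map (b' z) (hV₁ z)) fun s => by
        rw [LinearMap.sub_apply, map_sub, IsThickening.mapM_map (hb η) (hbb' η) (hV₀ z),
          IsThickening.mapM_map (hb z) (hbb' z) (hV₁ z), sub_self]
    obtain ⟨u, rfl⟩ := LinearMap.rTensor_surjective (KerModule A A') (endEval_surjective
      (V := g.down (V z)) ((d₁.lift.isFrame_down (hb η)).restrict (g.down_mono (hV₀ z)))) u'
    exact ⟨u, hu'⟩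
  choose u hu using hu
  have key := fun z => hg.sectionRel_change hF (hV₀ z) (hV₁ z) ((hgen η).mono (hV₀ z))
    (d₁.isConnectionLift_localConn hg hr₁ η) (d₂.isConnectionLift_localConn hg hr₂ η)
    (hb η) (hb z) (hb' z) (hbb' z) (he η) (he z) _ (hu z)
    (d₁.sectionRel_loc hg hc₁ hr₁ z) (d₂.sectionRel_loc hg hc₂ hr₂ z)
  let w : ∀ z : TopCat.of C.X, (endOmegaTensor F (KerModule A A')).obj
    (op ((g.cover T hT).U η ⊓ (g.cover T hT).U z)) := fun z =>
      tensorCommutator (KerModule A A') nab (g.f ⁻¹ᵁ (V z).1) (u z)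
  -- by `key`, the components `c₁ - c₂ - [∇, u]` are the coboundary of `e`
  have h0 := hS.cls_special_eq_zero (E := endOmegaTensor F (KerModule A A'))
    (u := PointedCover.loc hr₁ (d₁.pointedCocycle c₁) - PointedCover.loc hr₂ (d₂.pointedCocycle c₂)
      - w) e fun z _ => by
    refine (congrArg (fun x => PointedCover.loc hr₁ (d₁.pointedCocycle c₁) z - x - _)
      (key z)).trans ?_
    have aux : ∀ {G : Type u} [AddCommGroup G] (a b c d : G), a - (a - b + c - d) - d = b - c := by
      intros
      abel
    exact aux _ _ _ _
  rw [map_sub, map_sub, map_sub, map_sub, hS.cls_special_loc, hS.cls_special_loc,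
    ← d₁.toH1_eq_cls, ← d₂.toH1_eq_cls, ← hz₁, ← hz₂] at h0
  -- hence `z₁ - z₂` is in the image of `H¹(φ) ⊗ 1`, by injectivity of the comparison map
  have h1 := PointedCover.comparison_tensorClass (fun m : KerModule A A' => nab.commutator ≫ tensorRight F m)
    (tensorCommutator (KerModule A A') nab) (fun W θ m => tensorRight_tensorCommutator nab m W θ)
    (H1.tensorCommutator nab) (fun x m => H1.tensorCommutator_tmul nab x m) hS u
  have h2 : H1.tensorComparison F (KerModule A A') (z₁ - z₂) = H1.tensorComparison F
      (KerModule A A') (LinearMap.rTensor _ (H1.map nab.commutator) (hS.tensorClass u)) := by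
    rw [map_sub]
    exact (sub_eq_zero.1 h0).trans h1.symm
  have h3 := (tensorComparison_bijective hg hX hF (KerModule A A')).1 h2
  rw [← sub_eq_zero, ← map_sub]
  exact (rTensor_mkQ_eq_zero_iff _ _).2 ⟨_, h3.symm⟩

end Independence

/-! ### Lifting bundles by lifting transition matrices -/

section Gluing

variable {A A' : Type u} [CommRing A] [CommRing A'] [Algebra A' A]
  {C : PolarScheme A} {C' : PolarScheme A'} {g : C.Hom C'} {n : ℕ} {F : C.X.Modules}
  [IsAffineHom g.f] (hg : IsThickening g)
  {T : C.X → C'.X.affineOpens} {hT : ∀ x, x ∈ g.f ⁻¹ᵁ (T x).1} {η : C.X}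

include hg

/-- A lift of a bundle is obtained by lifting transition matrices on a special cover. The lifted
matrices need not satisfy any cocycle condition. -/
theorem IsThickening.exists_bundleLift (hS : (g.cover T hT).IsSpecial η)
    {c : ∀ x, Fin n → Γ(F, (g.down (T x)).1)} (hc : ∀ x, IsFrame F (c x))
    (G : ∀ z, Matrix (Fin n) (Fin n) Γ(C'.X, (T η).1 ⊓ (T z).1)) (hG : ∀ z, IsUnit (G z))
    (h₀ : ∀ z, g.f ⁻¹ᵁ ((T η).1 ⊓ (T z).1) ≤ (g.down (T η)).1)
    (h₁ : ∀ z, g.f ⁻¹ᵁ ((T η).1 ⊓ (T z).1) ≤ (g.down (T z)).1)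
    (hGc : ∀ z k, rF F (h₁ z) (c z k) =
      ∑ l, g.mapO (le_refl (g.f ⁻¹ᵁ ((T η).1 ⊓ (T z).1))) (G z l k) • rF F (h₀ z) (c η l)) :
    ∃ (L : BundleLift g n F) (b : ∀ x, Fin n → Γ(L.bundle, (T x).1)),
      (∀ x, IsFrame L.bundle (b x)) ∧
      (∀ x k, g.mapM L.toPush (g.le_down (T x)) (b x k) = c x k) ∧
      ∀ z, z ∉ g.f ⁻¹ᵁ (T η).1 → ∀ k, rF L.bundle (inf_le_right : (T η).1 ⊓ (T z).1 ≤ _) (b z k) =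
        ∑ l, G z l k • rF L.bundle (inf_le_left : (T η).1 ⊓ (T z).1 ≤ _) (b η l) := by
  let ι : Type u := {z : C.X // z ∉ g.f ⁻¹ᵁ (T η).1}
  let Δ : GluingData C'.X n ι := ⟨(T η).1, fun z => (T z.1).1, fun z => G z.1⟩
  have hW : ∀ z z' : ι, z ≠ z' → Δ.W z ⊓ Δ.W z' ≤ Δ.W0 := fun z z' h =>
    hg.le_of_preimage_le (hS.inf_le z.1 z'.1 fun h' => h (Subtype.ext h'))
  obtain ⟨b₀, b, hb₀, hb, hbG⟩ := Δ.exists_frames (fun z => hG z.1) hW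
  let P : C'.X.Modules := (Scheme.Modules.pushforward g.f).obj F
  have hcov : ∀ y : C.X, y ∈ g.f ⁻¹ᵁ Δ.W0 ∨ ∃ z : ι, y ∈ g.f ⁻¹ᵁ (Δ.W z) := fun y => by
    by_cases hy : y ∈ g.f ⁻¹ᵁ (T η).1
    · exact .inl hy
    · exact .inr ⟨⟨y, hy⟩, hT y⟩
  let U : Option ι → C'.X.Opens := fun i => i.elim Δ.W0 Δ.W
  let B : ∀ i, Fin n → Γ(Δ.sheaf, U i) := fun i => match i with
    | none => b₀
    | some z => b z
  have hB : ∀ i, IsFrame Δ.sheaf (B i) := fun i => match i with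
    | none => hb₀
    | some z => hb z
  let c₀ : Fin n → Γ(P, Δ.W0) := c η
  let c₁ : ∀ z, Fin n → Γ(P, Δ.W z) := fun z => c z.1
  let c' : ∀ i, Fin n → Γ(P, U i) := fun i => match i with
    | none => c₀
    | some z => c₁ z
  have hGc' : ∀ (z : ι) k, rF P (inf_le_right : Δ.W0 ⊓ Δ.W z ≤ _) (c₁ z k) =
      ∑ l, Δ.G z l k • rF P (inf_le_left : Δ.W0 ⊓ Δ.W z ≤ _) (c₀ l) := fun z k => by
    refine (hGc z.1 k).trans (Finset.sum_congr rfl fun l _ => ?_)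
    refine congrArg (fun r : Γ(C.X, g.f ⁻¹ᵁ ((T η).1 ⊓ (T z.1).1)) => r • rF F (h₀ z.1) (c η l))
      (?_ : _ = (g.f.app ((T η).1 ⊓ (T z.1).1)).hom (G z.1 l k))
    exact congrArg (fun φ => φ.hom (G z.1 l k)) (Scheme.Hom.app_eq_appLE g.f).symm
  -- the map from the glued bundle to the direct image of `F` given by the frame `c η` over `W₀` sends
  -- the other frames to the corresponding frames of `F`
  have hβ₁ : ∀ (z : ι) {V : C'.X.Opens} (h : V ≤ Δ.W0) (hz : V ≤ Δ.W z) (k : Fin n),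
      hb₀.map c₀ h (rF Δ.sheaf hz (b z k)) = rF P hz (c₁ z k) := by
    intro z V h hz k
    have hV : V ≤ Δ.W0 ⊓ Δ.W z := le_inf h hz
    have e1 := congrArg (rF Δ.sheaf hV) (hbG z k)
    have e2 := congrArg (rF P hV) (hGc' z k)
    rw [rF_rF, map_sum] at e1 e2
    refine (congrArg _ e1).trans (Eq.trans ?_ e2.symm)
    rw [map_sum]
    refine Finset.sum_congr rfl fun l _ => ?_
    rw [rF_smul, rF_smul, map_smul, rF_rF, rF_rF, hb₀.map_frame]
  have hβ : ∀ (i : Option ι) {V : C'.X.Opens} (h : V ≤ Δ.W0) (hi : V ≤ U i) (k : Fin n),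
      hb₀.map c₀ h (rF Δ.sheaf hi (B i k)) = rF P hi (c' i k) := by
    rintro (_ | z) V h hi k
    · exact hb₀.map_frame c₀ h k
    · exact hβ₁ z h hi k
  obtain ⟨α, hα⟩ := exists_hom_of_frames (F := Δ.sheaf) (G := P) U (fun x => by
    obtain ⟨y, rfl⟩ := hg.homeo.surjective x
    obtain h | ⟨z, h⟩ := hcov y
    · exact ⟨none, h⟩
    · exact ⟨some z, h⟩) B hB c' fun i j M h k => by
      by_cases hij : i = j
      · subst hij
        have e := congrArg ((hB i).map (c' i) (inf_le_right : U i ⊓ U i ≤ _)) (h k)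
        rw [(hB i).map_frame, map_sum] at e
        refine e.trans (Finset.sum_congr rfl fun l _ => ?_)
        rw [map_smul]
        exact congrArg _ ((hB i).map_frame (c' i) inf_le_left l)
      · have hV : U i ⊓ U j ≤ Δ.W0 := by
          obtain _ | z := i
          · exact inf_le_left
          obtain _ | z' := j
          · exact inf_le_right
          exact hW z z' fun h => hij (congrArg some h)
        have e := congrArg (hb₀.map c₀ hV) (h k)
        rw [hβ j hV inf_le_right, map_sum] at e
        refine e.trans (Finset.sum_congr rfl fun l _ => ?_)
        rw [map_smul, hβ i hV inf_le_left]
  have hα' : ∀ x : C.X, ∃ (U' : C'.X.Opens) (_ : x ∈ g.f ⁻¹ᵁ U') (b : Fin n → Γ(Δ.sheaf, U')),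
      IsFrame Δ.sheaf b ∧ IsFrame F fun k => pull g.f α (le_refl (g.f ⁻¹ᵁ U')) (b k) := fun y => by
    have h2 : ∀ i, (fun k => pull g.f α (le_refl (g.f ⁻¹ᵁ U i)) (B i k)) = c' i := fun i =>
      funext fun k => (pull_app g.f α (B i k)).trans (hα i k)
    obtain h | ⟨z, h⟩ := hcov y
    · exact ⟨U none, h, B none, hB none, (h2 none).symm ▸ hc η⟩
    · exact ⟨U (some z), h, B (some z), hB (some z), (h2 (some z)).symm ▸ hc z.1⟩
  have hL : IsVectorBundle n Δ.sheaf := fun x => by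
    obtain ⟨y, rfl⟩ := hg.homeo.surjective x
    obtain ⟨U', hU, b, hb, -⟩ := hα' y
    exact ⟨U', hU, b, hb⟩
  let L : BundleLift g n F := BundleLift.ofHom Δ.sheaf hL α hα'
  have hpush : L.toPush = α := BundleLift.ofHom_toPush Δ.sheaf hL α hα'
  have hpull : ∀ i k, pull g.f L.toPush (le_refl (g.f ⁻¹ᵁ U i)) (B i k) = c' i k := fun i k => by
    rw [hpush]
    exact (pull_app g.f α (B i k)).trans (hα i k)
  -- frames over all the members of the cover, those contained in `T η` being arbitrary lifts
  have hx : ∀ x, ∃ bx : Fin n → Γ(L.bundle, (T x).1), IsFrame L.bundle bx ∧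
      (∀ k, g.mapM L.toPush (g.le_down (T x)) (bx k) = c x k) ∧
      (∀ h : x ∉ g.f ⁻¹ᵁ (T η).1, bx = b ⟨x, h⟩) ∧ ∀ h : x = η, bx = h ▸ b₀ := fun x => by
    by_cases h : x ∈ g.f ⁻¹ᵁ (T η).1
    · by_cases h' : x = η
      · subst h'
        exact ⟨b₀, hb₀, hpull none, fun h' => absurd h h', fun _ => rfl⟩
      · have hle : (T x).1 ≤ (T η).1 := hg.le_of_preimage_le (hS.le x h)
        obtain ⟨bx, h1, h2⟩ := hg.exists_isFrame L (V' := T x)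
          (IsFrame.restrict (F := L.bundle) hb₀ hle) (hc x)
        exact ⟨bx, h1, h2, fun h' => absurd h h', fun h'' => absurd h'' h'⟩
    · refine ⟨b ⟨x, h⟩, hb ⟨x, h⟩, hpull (some ⟨x, h⟩), fun _ => rfl, fun h' => ?_⟩
      subst h'
      exact absurd (hT x) h
  choose bx h1 h2 h3 h4 using hx
  refine ⟨L, bx, h1, h2, fun z hz k => ?_⟩
  rw [h3 z hz, h4 η rfl]
  exact hbG ⟨z, hz⟩ k

end Gluing

/-! ### Existence of bundle lifts, local lifts and classes -/

section Existence

variable {A A' : Type u} [CommRing A] [CommRing A'] [Algebra A' A]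
  {C : PolarScheme A} {C' : PolarScheme A'} {g : C.Hom C'} {n : ℕ} {F : C.X.Modules}

section LiftLeibniz

variable {L : BundleLift g n F} {t : A} {t' : A'} {nab : TConnection t F ⊤}

/-- The failure of a connection to lift `∇` is linear, hence can be tested on a frame. -/
theorem BundleLift.lift_of_frame (ht : algebraMap A' A t' = t) {W' : C'.X.Opens}
    {nab' : TConnection t' L.bundle W'} {V' : C'.X.affineOpens} (hV : V'.1 ≤ W')
    {V : C.X.affineOpens} (e : V.1 ≤ g.f ⁻¹ᵁ V'.1) {U' : C'.X.Opens}
    {b : Fin n → Γ(L.bundle, U')} (hb : IsFrame L.bundle b) (hU : V'.1 ≤ U') {φ : C'.D.ideal V'}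
    (hφ : ∀ a, ∃ r : Γ(C'.X, V'.1), r • φ = a)
    (h : ∀ k, nab.nabla ⟨V, le_top⟩ (g.mapM L.toPush e (rF L.bundle hU (b k))) (g.mapD e φ) =
      g.mapOmega L.toPush e (nab'.nabla ⟨V', hV⟩ (rF L.bundle hU (b k)) φ))
    (s : Γ(L.bundle, V'.1)) (a : C'.D.ideal V') :
    nab.nabla ⟨V, le_top⟩ (g.mapM L.toPush e s) (g.mapD e a) =
      g.mapOmega L.toPush e (nab'.nabla ⟨V', hV⟩ s a) := by
  have hs : ∀ s, nab.nabla ⟨V, le_top⟩ (g.mapM L.toPush e s) (g.mapD e φ) =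
      g.mapOmega L.toPush e (nab'.nabla ⟨V', hV⟩ s φ) := by
    intro s
    rw [← (hb.basis hU).sum_repr s]
    generalize (hb.basis hU).repr s = f
    have key : ∀ S : Finset (Fin n), nab.nabla ⟨V, le_top⟩
        (g.mapM L.toPush e (∑ k ∈ S, f k • hb.basis hU k)) (g.mapD e φ) =
          g.mapOmega L.toPush e (nab'.nabla ⟨V', hV⟩ (∑ k ∈ S, f k • hb.basis hU k) φ) := by
      intro S
      classical
      induction S using Finset.induction_on with
      | empty => simp only [Finset.sum_empty, map_zero, LinearMap.zero_apply]
      | insert k S hk ih =>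
        rw [Finset.sum_insert hk, map_add, map_add, map_add, LinearMap.add_apply,
          LinearMap.add_apply, map_add, ih]
        congr 1
        rw [g.mapM_smul, hb.basis_apply, nab.leibniz, nab'.leibniz, h k, map_add,
          g.mapOmega_smul, map_smulₛₗ, ht, g.mapOmega_smul, g.mapOmega_omegaTmul, kaehlerMap_D]
        rfl
    exact key Finset.univ
  obtain ⟨r, rfl⟩ := hφ a
  rw [map_smulₛₗ, map_smul, map_smul, hs, g.mapOmega_smul]

end LiftLeibniz

variable [IsAffineHom g.f] (hg : IsThickening g)

include hg

omit hg in
theorem BundleLift.isConnectionLift_connOfFrame {t : A} {t' : A'} {nab : TConnection t F ⊤}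
    (ht : algebraMap A' A t' = t) {L : BundleLift g n F} {V' : C'.X.affineOpens}
    {b : Fin n → Γ(L.bundle, V'.1)} (hb : IsFrame L.bundle b) {φ : C'.D.ideal V'}
    (hφ : IsGen C' φ) {ω : Fin n → (tensorOmega L.bundle).obj V'}
    (hω : ∀ k, g.mapOmega L.toPush (g.le_down V') (ω k) = nab.nabla ⟨g.down V', le_top⟩
      (g.mapM L.toPush (g.le_down V') (b k)) (g.mapD (g.le_down V') φ)) :
    L.IsConnectionLift (connOfFrame hb hφ L.isVectorBundle t' ω) nab := by
  intro V₁' V e s a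
  have hV : V₁'.1 ≤ V' := V₁'.2
  have e' : V ≤ g.down V' := e.trans (g.f.preimage_mono V₁'.2)
  refine L.lift_of_frame ht V₁'.2 e hb V₁'.2 (IsThickening.exists_smul_resD hφ hV) (fun k => ?_) s a
  have h1 := (connOfFrame hb hφ L.isVectorBundle t' ω).compat ⟨V', le_rfl⟩ V₁' hV (b k) φ
  rw [connOfFrame_apply] at h1
  have h2 := nab.compat ⟨g.down V', le_top⟩ ⟨V, le_top⟩ e'
    (g.mapM L.toPush (g.le_down V') (b k)) (g.mapD (g.le_down V') φ)
  rw [← hω, ← g.mapM_resM L.toPush e (g.le_down V') hV e',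
    ← g.mapD_resD e (g.le_down V') hV e'] at h2
  exact h2.trans ((g.mapOmega_res L.toPush (g.le_down V') e hV e' (ω k)).symm.trans
    (congrArg (g.mapOmega L.toPush e) h1).symm)

theorem IsThickening.exists_localLift {t : A} {t' : A'} (nab : TConnection t F ⊤)
    (ht : algebraMap A' A t' = t) {L : BundleLift g n F} {V' : C'.X.affineOpens}
    (hV : IsSmall L V') : ∃ nab' : TConnection t' L.bundle V'.1, L.IsConnectionLift nab' nab := by
  obtain ⟨⟨b, hb⟩, φ, hφ, hφ'⟩ := hV
  choose ω hω using fun k => hg.mapOmega_surjective L hb (nab.nabla ⟨g.down V', le_top⟩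
    (g.mapM L.toPush (g.le_down V') (b k)) (g.mapD (g.le_down V') φ))
  exact ⟨_, BundleLift.isConnectionLift_connOfFrame ht hb hφ hω⟩

variable (hX : IsCurveLike C.X)

include hX

theorem IsThickening.exists_cover (Good : C'.X.affineOpens → Prop)
    (hgood : ∀ (x : C'.X) (U' : C'.X.Opens), x ∈ U' → ∃ V' : C'.X.affineOpens,
      V'.1 ≤ U' ∧ x ∈ V'.1 ∧ Good V') :
    ∃ (m : ℕ) (cover : Fin m → C'.X.affineOpens), (∀ x : C.X, ∃ i, x ∈ g.f ⁻¹ᵁ (cover i).1) ∧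
      ∀ i, Good (cover i) := by
  classical
  obtain ⟨η, hη⟩ := hg.exists_special hX Good hgood
  obtain ⟨T, hT, hS, -, hG⟩ := hη ⟨fun _ => ⊤, fun _ => trivial⟩
  let S : Finset C.X := insert η hS.finite.toFinset
  refine ⟨S.card, fun i => T (S.equivFin.symm i).1, fun x => ?_, fun i => hG _⟩
  by_cases hx : x ∈ g.f ⁻¹ᵁ (T η).1
  · refine ⟨S.equivFin ⟨η, Finset.mem_insert_self _ _⟩, ?_⟩
    beta_reduce
    rw [Equiv.symm_apply_apply]
    exact hx
  · refine ⟨S.equivFin ⟨x, Finset.mem_insert_of_mem (hS.finite.mem_toFinset.2 hx)⟩, ?_⟩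
    beta_reduce
    rw [Equiv.symm_apply_apply]
    exact hT x

theorem IsThickening.exists_cover_isSmall (L : BundleLift g n F) :
    ∃ (m : ℕ) (cover : Fin m → C'.X.affineOpens), (∀ x : C.X, ∃ i, x ∈ g.f ⁻¹ᵁ (cover i).1) ∧
      ∀ i, IsSmall L (cover i) :=
  hg.exists_cover hX _ fun _ _ hx => hg.exists_isSmall L hx

variable (hF : IsVectorBundle n F)

include hF

/-- On a curve there is no obstruction to lifting a vector bundle. -/
theorem IsThickening.nonempty_bundleLift : Nonempty (BundleLift g n F) := by
  obtain ⟨η, hη⟩ := hg.exists_special hX (fun V' => HasGen g V' ∧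
    ∃ b : Fin n → Γ(F, (g.down V').1), IsFrame F b) (hg.exists_frame_hasGen hF)
  obtain ⟨T, hT, hS, -, hG⟩ := hη ⟨fun _ => ⊤, fun _ => trivial⟩
  choose c hc using fun x => (hG x).2
  let V : C.X → C'.X.affineOpens := fun z => ⟨(T η).1 ⊓ (T z).1, hg.inf _ _⟩
  have h₀ : ∀ z, (g.down (V z)).1 ≤ (g.down (T η)).1 := fun z => g.f.preimage_mono inf_le_left
  have h₁ : ∀ z, (g.down (V z)).1 ≤ (g.down (T z)).1 := fun z => g.f.preimage_mono inf_le_right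
  have hM : ∀ z, ∃ M : Matrix (Fin n) (Fin n) Γ(C'.X, (V z).1), IsUnit M ∧
      ∀ k, rF F (h₁ z) (c z k) = ∑ l, g.mapO (g.le_down (V z)) (M l k) • rF F (h₀ z) (c η l) := by
    intro z
    obtain ⟨M, hM, h⟩ := ((hc η).restrict (h₀ z)).exists_matrix ((hc z).restrict (h₁ z))
    obtain ⟨M', hM', rfl⟩ := hg.isUnit_of_isUnit_mapO (V z) hM
    exact ⟨M', hM', h⟩
  choose M hM hMc using hM
  obtain ⟨L, -⟩ := hg.exists_bundleLift hS hc M hM h₀ h₁ hMc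
  exact ⟨L⟩

theorem IsThickening.nonempty_obstructionData {t : A} {t' : A'} (nab : TConnection t F ⊤)
    (ht : algebraMap A' A t' = t) : Nonempty (ObstructionData g n nab t') := by
  obtain ⟨L⟩ := hg.nonempty_bundleLift hX hF
  obtain ⟨m, cover, hcover, hsmall⟩ := hg.exists_cover_isSmall hX L
  choose conn hconn using fun i => hg.exists_localLift nab ht (hsmall i)
  exact ⟨⟨L, m, cover, hcover, fun i => ⟨_, L.isFrame_down (hsmall i).1.choose_spec⟩, conn, hconn⟩⟩

omit hF in
/-- The obstruction vanishes if there is a lift, computed by means of its restrictions. -/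
theorem IsThickening.exists_represents_zero {t : A} {t' : A'} {nab : TConnection t F ⊤}
    (h : nab.HasLift g n t') : ∃ d : ObstructionData g n nab t', d.Represents 0 := by
  obtain ⟨L, nab', hn⟩ := h
  obtain ⟨m, cover, hcover, hsmall⟩ := hg.exists_cover_isSmall hX L
  refine ⟨⟨L, m, cover, hcover, fun i => ⟨_, L.isFrame_down (hsmall i).1.choose_spec⟩,
    fun i => nab'.restrict le_top, fun i => hn.restrict le_top⟩, 0,
    (ObstructionData.isDifferenceCocycle_iff _ _).2 fun i j V' hV s a => ?_, 0, ?_, map_zero _⟩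
  · refine (iff_of_eq (congrArg₂ (KerRel (g.mapOmega L.toPush (g.le_down V'))) ?_ ?_)).2 KerRel.zero
    · exact sub_self _
    · rfl
  · rw [map_zero, map_zero, map_zero]

/-- Every choice of local lifts defines an obstruction class. -/
theorem IsThickening.exists_represents {t : A} {t' : A'} {nab : TConnection t F ⊤}
    (d : ObstructionData g n nab t') : ∃ ob, d.Represents ob := by
  obtain ⟨c, hc⟩ := hg.exists_isDifferenceCocycle hF d
  obtain ⟨z, hz⟩ := (tensorComparison_bijective hg hX hF (KerModule A A')).2
    (CechH1.toH1 d.covers _ (CechZ1.toCechH1 _ _ c))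
  exact ⟨_, c, hc, z, hz, rfl⟩

end Existence

/-! ### Prescribing the difference of two local lifts -/

section Converse

variable {A A' : Type u} [CommRing A] [CommRing A'] [Algebra A' A]
  {C : PolarScheme A} {C' : PolarScheme A'} {g : C.Hom C'} {n : ℕ} {F : C.X.Modules}
  [IsAffineHom g.f] {t : A} {t' : A'} {nab : TConnection t F ⊤} {L L₁ L₂ : BundleLift g n F}

/-- That a connection lifts `∇` is a local property. -/
theorem BundleLift.isConnectionLift_of_local (hF : IsVectorBundle n F) {W' : C'.X.Opens}
    {nab' : TConnection t' L.bundle W'} {𝔅 : Set C'.X.affineOpens}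
    (hdown : ∀ T₁ T₂ : C'.X.affineOpens, T₁ ≤ T₂ → T₂ ∈ 𝔅 → T₁ ∈ 𝔅)
    (hcov : ∀ x ∈ W', ∃ T ∈ 𝔅, x ∈ T.1)
    (h : ∀ (T : C'.X.affineOpens) (_ : T ∈ 𝔅) (l : T.1 ≤ W') (s : Γ(L.bundle, T.1))
      (a : C'.D.ideal T), nab.nabla ⟨g.down T, le_top⟩ (g.mapM L.toPush (g.le_down T) s)
        (g.mapD (g.le_down T) a) = g.mapOmega L.toPush (g.le_down T) (nab'.nabla ⟨T, l⟩ s a)) :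
    L.IsConnectionLift nab' nab := by
  intro V' V e s a
  refine (isQCoh_tensorOmega hF).ext (𝔅 := {T : C.X.affineOpens | ∃ T' : C'.X.affineOpens,
    (T' ∈ 𝔅 ∧ T' ≤ V'.1) ∧ T.1 ≤ g.f ⁻¹ᵁ T'.1}) IsThickening.small_down (fun x hx => ?_) ?_
  · have hxV : g.f x ∈ V'.1.1 := e hx
    obtain ⟨T₀, hT₀, hxT⟩ := hcov (g.f x) (V'.2 hxV)
    obtain ⟨_, ⟨T', hT', rfl⟩, hxT', hT'V⟩ := C'.X.isBasis_affineOpens.exists_subset_of_mem_open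
      (show g.f x ∈ (V'.1.1 ⊓ T₀.1 : C'.X.Opens) from ⟨hxV, hxT⟩) (V'.1.1 ⊓ T₀.1).2
    exact ⟨g.down ⟨T', hT'⟩, ⟨⟨T', hT'⟩, ⟨hdown _ T₀ (fun y hy => (hT'V hy).2) hT₀,
      fun y hy => (hT'V hy).1⟩, le_rfl⟩, hxT'⟩
  · rintro T ⟨T', ⟨hT', hTV⟩, hTT'⟩ hT
    have hle : T ≤ g.down T' := hTT'
    have hW : T'.1 ≤ W' := le_trans (show T'.1 ≤ V'.1.1 from hTV) V'.2
    have h1 := nab.compat ⟨V, le_top⟩ ⟨T, le_top⟩ hT (g.mapM L.toPush e s) (g.mapD e a)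
    have h2 := nab.compat ⟨g.down T', le_top⟩ ⟨T, le_top⟩ hle
      (g.mapM L.toPush (g.le_down T') (resM C' L.bundle hTV s))
      (g.mapD (g.le_down T') (resD C' hTV a))
    rw [h T' hT' hW] at h2
    rw [← g.mapM_resM L.toPush hTT' (g.le_down T') le_rfl hle,
      ← g.mapD_resD hTT' (g.le_down T') le_rfl hle, resD_self, resM_apply (le_refl T'.1), rF_self,
      g.mapM_resM L.toPush hTT' e hTV hT, g.mapD_resD hTT' e hTV hT] at h2
    refine h1.symm.trans (h2.trans ?_)
    have h3 := nab'.compat V' ⟨T', hW⟩ hTV s a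
    refine (congrArg (fun x => (tensorOmega F).res hle (g.mapOmega L.toPush (g.le_down T') x))
      h3).trans ?_
    refine (g.mapOmega_res L.toPush (g.le_down T') hTT' le_rfl hle _).symm.trans ?_
    refine (congrArg (g.mapOmega L.toPush hTT')
      ((isQCoh_tensorOmega L.isVectorBundle).res_self (le_refl T') _)).trans ?_
    exact g.mapOmega_res L.toPush e hTT' hTV hT _

variable (hg : IsThickening g)

include hg

/-- Connections on a lift of `F` whose difference corresponds to zero are equal. -/
theorem IsThickening.nabla_eq_of_sectionRel {W' W₁' W₂' : C'.X.Opens}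
    {nab₁ : TConnection t' L.bundle W₁'} {nab₂ : TConnection t' L.bundle W₂'} (h₁ : W' ≤ W₁')
    (h₂ : W' ≤ W₂') (h : SectionRel L (nab₁.diffSection nab₂ h₁ h₂) 0) {V' : C'.X.affineOpens}
    (hV : V'.1 ≤ W') (hV' : IsSmall L V') :
    nab₁.nabla ⟨V', hV.trans h₁⟩ = nab₂.nabla ⟨V', hV.trans h₂⟩ := by
  obtain ⟨b, hb⟩ := hV'.1
  refine LinearMap.ext fun s => LinearMap.ext fun a => sub_eq_zero.1 ?_
  exact (h V' hV s a).left_eq_zero hg.sq (hg.mapOmega_surjective L hb)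
    fun x hx => hg.mem_range_mulKer_of_mapOmega_eq_zero L hb hx

/-- A local lift of `∇` on one lift of `F`, and its prescribed difference with a local lift of `∇`
on another one. -/
theorem IsThickening.exists_localLift_homDiff (hF : IsVectorBundle n F)
    (ht : algebraMap A' A t' = t) {V' : C'.X.affineOpens} (hV : HasGen g V')
    {nab₁ : TConnection t' L₁.bundle V'.1} (hn₁ : L₁.IsConnectionLift nab₁ nab)
    {b : Fin n → Γ(L₁.bundle, V'.1)} (hb : IsFrame L₁.bundle b)
    {c : Fin n → Γ(L₂.bundle, V'.1)} (hc : IsFrame L₂.bundle c)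
    (hbc : ∀ k, g.mapM L₂.toPush (g.le_down V') (c k) = g.mapM L₁.toPush (g.le_down V') (b k))
    (e : homPolarSections F ((tensorOmega F).tensor (KerModule A A')) (g.down V').1) :
    ∃ nab₂ : TConnection t' L₂.bundle V'.1, L₂.IsConnectionLift nab₂ nab ∧
      ∀ (V₁' : C'.X.affineOpens) (h : V₁' ≤ V') (s : Γ(L₁.bundle, V₁'.1)) (a : C'.D.ideal V₁'),
        KerRel (g.mapOmega L₂.toPush (g.le_down V₁')) (homDiff nab₁ nab₂ V₁' h h (hb.map c h) s a)
          (e.1 ⟨g.down V₁', g.down_mono h⟩ (g.mapM L₁.toPush (g.le_down V₁') s)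
            (g.mapD (g.le_down V₁') a)) := by
  obtain ⟨φ, hφ, hφ'⟩ := hV
  have hsurj := hg.mapOmega_surjective L₂ hc
  choose δ hδ using fun k => exists_kerRel_left (A := A) (A' := A') hg.surj hsurj
    (e.1 ⟨g.down V', le_rfl⟩ (g.mapM L₁.toPush (g.le_down V') (b k)) (g.mapD (g.le_down V') φ))
  -- transport `∇₁` to `L₂`, and subtract a representative of `e`
  let ω : Fin n → (tensorOmega L₂.bundle).obj V' := fun k =>
    homOmega (hb.map c le_rfl) (nab₁.nabla ⟨V', le_rfl⟩ (b k) φ) - δ k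
  have hω : ∀ k, g.mapOmega L₂.toPush (g.le_down V') (ω k) = nab.nabla ⟨g.down V', le_top⟩
      (g.mapM L₂.toPush (g.le_down V') (c k)) (g.mapD (g.le_down V') φ) := fun k => by
    refine (map_sub (g.mapOmega L₂.toPush (g.le_down V')) _ _).trans ?_
    rw [(hδ k).apply_eq_zero, sub_zero, hbc,
      hn₁ ⟨V', le_rfl⟩ (g.down V') (g.le_down V') (b k) φ]
    refine (mapOmega_homOmega (θ := LinearMap.id)
      (fun s => (IsThickening.mapM_map hb hbc le_rfl s).symm) _).trans ?_
    exact homOmega_id _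
  have hn₂ := BundleLift.isConnectionLift_connOfFrame (t' := t') ht hc hφ hω
  refine ⟨connOfFrame hc hφ L₂.isVectorBundle t' ω, hn₂, ?_⟩
  obtain ⟨e', he'⟩ := hg.exists_kerRel_homDiff hF hφ hφ' hn₁ hn₂ le_rfl le_rfl hb hc hbc
  suffices h : e' = e by
    subst h
    exact he'
  refine homPolarSections_ext_frame (V := g.down V') (L₁.isFrame_down hb) hφ' le_rfl le_rfl
    fun k => ?_
  haveI := hg.flat_tensorOmega L₂ hc
  have h1 : homDiff nab₁ (connOfFrame hc hφ L₂.isVectorBundle t' ω) V' le_rfl le_rfl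
      (hb.map c le_rfl) (b k) φ = δ k := by
    rw [homDiff_apply, hb.map_frame_self, connOfFrame_apply]
    exact sub_sub_cancel _ _
  have h2 := he' V' le_rfl (b k) φ
  rw [h1] at h2
  exact h2.unique (hδ k)

/-- Matrices which are invertible modulo `I` are invertible. -/
theorem IsThickening.isUnit_matrix {V' : C'.X.affineOpens}
    {M : Matrix (Fin n) (Fin n) Γ(C'.X, V'.1)} (hM : IsUnit (M.map (g.mapO (g.le_down V')))) :
    IsUnit M := by
  rw [Matrix.isUnit_iff_isUnit_det] at hM ⊢
  rw [← RingHom.mapMatrix_apply, ← RingHom.map_det] at hM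
  obtain ⟨r', hr'⟩ := hM.exists_right_inv
  obtain ⟨r, rfl⟩ := hg.mapO_surjective V' r'
  rw [← map_mul] at hr'
  have h1 : IsNilpotent (M.det * r - 1) := hg.isNilpotent_of_mapO_eq_zero V' (by
    rw [map_sub, hr', map_one, sub_self])
  have h2 := h1.isUnit_add_one
  rw [sub_add_cancel] at h2
  exact isUnit_of_mul_isUnit_left h2

/-- The matrix of `1 - H` with respect to two frames, where `H` vanishes modulo `I`. -/
theorem IsThickening.exists_matrix_sub {V' : C'.X.affineOpens} {b c : Fin n → Γ(L.bundle, V'.1)}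
    (hb : IsFrame L.bundle b) (hc : IsFrame L.bundle c)
    (H : Γ(L.bundle, V'.1) →ₗ[Γ(C'.X, V'.1)] Γ(L.bundle, V'.1))
    (hH : ∀ s, g.mapM L.toPush (g.le_down V') (H s) = 0) :
    ∃ M : Matrix (Fin n) (Fin n) Γ(C'.X, V'.1), IsUnit M ∧
      (∀ k, c k - H (c k) = ∑ l, M l k • b l) ∧
      ∀ k, g.mapM L.toPush (g.le_down V') (c k) =
        ∑ l, g.mapO (g.le_down V') (M l k) • g.mapM L.toPush (g.le_down V') (b l) := by
  let M : Matrix (Fin n) (Fin n) Γ(C'.X, V'.1) := fun l k =>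
    (hb.basis le_rfl).repr (c k - H (c k)) l
  have hM : ∀ k, c k - H (c k) = ∑ l, M l k • b l := fun k => by
    have h := (hb.basis le_rfl).sum_repr (c k - H (c k))
    simp only [hb.basis_self] at h
    exact h.symm
  have hM' : ∀ k, g.mapM L.toPush (g.le_down V') (c k) =
      ∑ l, g.mapO (g.le_down V') (M l k) • g.mapM L.toPush (g.le_down V') (b l) := fun k => by
    have h := congrArg (g.mapM L.toPush (g.le_down V')) (hM k)
    rw [map_sub, hH, sub_zero, map_sum] at h
    simpa only [g.mapM_smul] using h
  refine ⟨M, hg.isUnit_matrix ?_, hM, hM'⟩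
  obtain ⟨M', hM'', h⟩ := (L.isFrame_down hb).exists_matrix (L.isFrame_down hc)
  convert hM''
  ext l k
  have h1 := (hM' k).symm.trans (h k)
  have h2 := congrArg (fun x => ((L.isFrame_down hb).basis le_rfl).repr x l) h1
  have h3 : ∀ a : Fin n → Γ(C.X, (g.down V').1), ((L.isFrame_down hb).basis le_rfl).repr
      (∑ l, a l • g.mapM L.toPush (g.le_down V') (b l)) l = a l := fun a => by
    have h4 := ((L.isFrame_down hb).basis le_rfl).repr_sum_self a
    simp only [IsFrame.basis_self] at h4
    exact congrFun h4 l
  exact (h3 _).symm.trans (h2.trans (h3 _))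

end Converse

/-! ### Vanishing of the obstruction implies the existence of a lift -/

theorem PointedCover.loc_refine_id {A : Type u} [CommRing A] {X : TopCat.{u}}
    {E : (Opens X)ᵒᵖ ⥤ ModuleCat.{u} A} {S 𝒰 𝒱 : PointedCover X} {η : X} (h : S.Refines η 𝒱)
    (h' : 𝒰 ≤ 𝒱) (c : CechZ1 𝒰.U E) (z : X) :
    PointedCover.loc h (CechZ1.refine id h' E c) z = PointedCover.loc (h.trans h') c z :=
  resE_resE E _ _ _

section Converse

variable {A A' : Type u} [CommRing A] [CommRing A'] [Algebra A' A]
  {C : PolarScheme A} {C' : PolarScheme A'} {g : C.Hom C'} {n : ℕ} {F : C.X.Modules}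
  [IsAffineHom g.f] {t : A} {t' : A'} {nab : TConnection t F ⊤}

section Glue

variable (hg : IsThickening g) {T : C.X → C'.X.affineOpens} {hT : ∀ x, x ∈ g.f ⁻¹ᵁ (T x).1} {η : C.X}
  (hS : (g.cover T hT).IsSpecial η) (hF : IsVectorBundle n F)

include hg hS hF

/-- Local lifts of `∇` over the members of a special cover which agree on the overlaps with the
dense member can be glued. -/
theorem IsThickening.hasLift_of_local {L : BundleLift g n F} (hL : ∀ x, IsSmall L (T x))
    (nab' : ∀ x, TConnection t' L.bundle (T x).1) (hn : ∀ x, L.IsConnectionLift (nab' x) nab)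
    (h0 : ∀ z, z ∉ g.f ⁻¹ᵁ (T η).1 → SectionRel L ((nab' η).diffSection (nab' z)
      (W := (T η).1 ⊓ (T z).1) inf_le_left inf_le_right) 0) : nab.HasLift g n t' := by
  have hη : ∀ z, z ∉ g.f ⁻¹ᵁ (T η).1 → ∀ (V' : C'.X.affineOpens) (h₁ : V' ≤ T η) (h₂ : V' ≤ T z),
      (nab' η).nabla ⟨V', h₁⟩ = (nab' z).nabla ⟨V', h₂⟩ := fun z hz V' h₁ h₂ =>
    hg.nabla_eq_of_sectionRel inf_le_left inf_le_right (h0 z hz) (le_inf h₁ h₂) ((hL η).mono h₁)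
  -- two members of the cover other than `T η` meet within `T η`
  let J : Type u := {x : C.X // x = η ∨ x ∉ g.f ⁻¹ᵁ (T η).1}
  have agree : ∀ (i j : J) (V' : C'.X.affineOpens) (h₁ : V' ≤ T i.1) (h₂ : V' ≤ T j.1),
      (nab' i.1).nabla ⟨V', h₁⟩ = (nab' j.1).nabla ⟨V', h₂⟩ := by
    rintro ⟨i, hi⟩ ⟨j, hj⟩ V' h₁ h₂
    by_cases hij : i = j
    · subst hij
      rfl
    have hV : V' ≤ T η := fun x hx =>
      hg.le_of_preimage_le (U' := (T i).1 ⊓ (T j).1) (hS.inf_le i j hij) ⟨h₁ hx, h₂ hx⟩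
    have key : ∀ (k : C.X) (_ : k = η ∨ k ∉ g.f ⁻¹ᵁ (T η).1) (h : V' ≤ T k),
        (nab' η).nabla ⟨V', hV⟩ = (nab' k).nabla ⟨V', h⟩ := by
      rintro k (rfl | hk) h
      · rfl
      · exact hη k hk V' hV h
    exact (key i hi h₁).symm.trans (key j hj h₂)
  let 𝔅 : Set C'.X.affineOpens := {V' | ∃ i : J, V' ≤ T i.1}
  have hdown : ∀ T₁ T₂ : C'.X.affineOpens, T₁ ≤ T₂ → T₂ ∈ 𝔅 → T₁ ∈ 𝔅 := fun T₁ T₂ h h₂ =>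
    h₂.imp fun i hi => le_trans h hi
  have hcov : ∀ x ∈ (⊤ : C'.X.Opens), ∃ V' ∈ 𝔅, x ∈ V'.1 := fun x _ => by
    obtain ⟨y, rfl⟩ := hg.homeo.surjective x
    by_cases hy : y ∈ g.f ⁻¹ᵁ (T η).1
    · exact ⟨T η, ⟨⟨η, .inl rfl⟩, le_rfl⟩, hy⟩
    · exact ⟨T y, ⟨⟨y, .inr hy⟩, le_rfl⟩, hT y⟩
  obtain ⟨N, hN⟩ := exists_tconnection L.isVectorBundle hdown hcov
    (fun V' m => (nab' m.choose.1).restrict m.choose_spec)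
    fun T₁ T₂ h m₁ m₂ => agree m₁.choose m₂.choose T₁ m₁.choose_spec (h.trans m₂.choose_spec)
  refine ⟨L, N, BundleLift.isConnectionLift_of_local hF hdown hcov fun V' m l s a => ?_⟩
  rw [hN V' m l]
  exact hn m.choose.1 ⟨V', m.choose_spec⟩ (g.down V') (g.le_down V') s a

omit hF in
/-- Modification of the transition functions of a lift of `F` on a special cover by arbitrary
sections `u` of `ℰnd(F) ⊗ I`. -/
theorem IsThickening.exists_modification {L₁ : BundleLift g n F}
    {b : ∀ x, Fin n → Γ(L₁.bundle, (T x).1)} (hb : ∀ x, IsFrame L₁.bundle (b x))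
    (V : C.X → C'.X.affineOpens) (hV : ∀ z, (V z).1 = (T η).1 ⊓ (T z).1)
    (hV₀ : ∀ z, V z ≤ T η) (hV₁ : ∀ z, V z ≤ T z)
    (u : ∀ z, endSections F (g.f ⁻¹ᵁ (V z).1) ⊗[A] KerModule A A') :
    ∃ (L₂ : BundleLift g n F) (c : ∀ x, Fin n → Γ(L₂.bundle, (T x).1)),
      (∀ x, IsFrame L₂.bundle (c x)) ∧
      (∀ x k, g.mapM L₂.toPush (g.le_down (T x)) (c x k) =
        g.mapM L₁.toPush (g.le_down (T x)) (b x k)) ∧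
      ∀ z, z ∉ g.f ⁻¹ᵁ (T η).1 → KerRel
        (reduceHom L₂ ((hb η).restrict (show (V z).1 ≤ (T η).1 from hV₀ z)))
        ((hb η).map (c η) (hV₀ z) - (hb z).map (c z) (hV₁ z)) (LinearMap.rTensor _
          (endEval (F := F) ⟨g.down (V z), le_refl (g.down (V z)).1⟩) (u z)) := by
  obtain rfl : V = fun z => ⟨(T η).1 ⊓ (T z).1, hg.inf _ _⟩ :=
    funext fun z => Subtype.ext (hV z)
  let V : C.X → C'.X.affineOpens := fun z => ⟨(T η).1 ⊓ (T z).1, hg.inf _ _⟩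
  have l₀ : ∀ z, (V z).1 ≤ (T η).1 := hV₀
  have l₁ : ∀ z, (V z).1 ≤ (T z).1 := hV₁
  choose H hH using fun z => hg.exists_kerRel_reduceHom_left (L₂ := L₁) ((hb η).restrict (l₀ z))
    ((hb η).restrict (l₀ z)) (LinearMap.rTensor _
      (endEval (F := F) ⟨g.down (V z), le_refl (g.down (V z)).1⟩) (u z))
  have hH0 : ∀ z s, g.mapM L₁.toPush (g.le_down (V z)) (H z s) = 0 := fun z s => by
    rw [← reduceHom_mapM ((hb η).restrict (l₀ z)), (hH z).apply_eq_zero, LinearMap.zero_apply]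
  -- the new transition matrices express `b z - H z (b z)`, instead of `b z`, in terms of `b η`
  choose M hM hM₁ hM₂ using fun z => hg.exists_matrix_sub ((hb η).restrict (l₀ z))
    ((hb z).restrict (l₁ z)) (H z) (hH0 z)
  obtain ⟨L₂, c, hc, hbc, hcM⟩ := hg.exists_bundleLift hS
    (c := fun x k => g.mapM L₁.toPush (g.le_down (T x)) (b x k)) (fun x => L₁.isFrame_down (hb x))
    M hM (fun z => g.down_mono (hV₀ z)) (fun z => g.down_mono (hV₁ z)) fun z k => by
      have h1 := hM₂ z k
      have h2 : ∀ x (h : V z ≤ T x) k, g.mapM L₁.toPush (g.le_down (V z)) (rF L₁.bundle h (b x k)) =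
          rF F (g.down_mono h) (g.mapM L₁.toPush (g.le_down (T x)) (b x k)) := fun x h k =>
        g.mapM_resM L₁.toPush (g.le_down (V z)) (g.le_down (T x)) h (g.down_mono h) (b x k)
      refine (h2 z (hV₁ z) k).symm.trans (h1.trans (Finset.sum_congr rfl fun l _ => ?_))
      exact congrArg _ (h2 η (hV₀ z) l)
  refine ⟨L₂, c, hc, hbc, fun z hz => ?_⟩
  -- the two identifications of `L₁` with `L₂` over `V z` differ by the first one composed with `H`
  have h1 : (hb η).map (c η) (l₀ z) - (hb z).map (c z) (l₁ z) =
      (hb η).map (c η) (l₀ z) ∘ₗ H z := by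
    refine ((hb z).basis (l₁ z)).ext fun k => ?_
    rw [(hb z).basis_apply, LinearMap.sub_apply, LinearMap.comp_apply, (hb z).map_frame,
      sub_eq_iff_eq_add, ← sub_eq_iff_eq_add', ← map_sub, hM₁ z k, map_sum]
    refine Eq.trans (Finset.sum_congr rfl fun l _ => ?_) (hcM z hz k).symm
    rw [map_smul, (hb η).map_frame]
  rw [h1]
  have h2 := (hH z).map (p₂ := reduceHom L₂ ((hb η).restrict (l₀ z)))
    { toFun := fun H' => (hb η).map (c η) (l₀ z) ∘ₗ H'
      map_add' := fun _ _ => LinearMap.comp_add _ _ _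
      map_smul' := fun r H' => LinearMap.ext fun s => by
        change (hb η).map (c η) (l₀ z) (r • H' s) = r • (hb η).map (c η) (l₀ z) (H' s)
        rw [← algebraMap_smul Γ(C'.X, (V z).1) r, map_smul, algebraMap_smul] } LinearMap.id
    fun H' => by
      refine ((L₁.isFrame_down ((hb η).restrict (l₀ z))).basis le_rfl).ext fun k => ?_
      rw [IsFrame.basis_self]
      refine (reduceHom_mapM ((hb η).restrict (l₀ z)) _ _).trans ?_
      refine Eq.trans ?_ (reduceHom_mapM ((hb η).restrict (l₀ z)) H' _).symm
      exact IsThickening.mapM_map (hb η) (hbc η) (hV₀ z) _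
  rw [LinearMap.rTensor_id] at h2
  exact h2

end Glue

variable (hg : IsThickening g) (hX : IsCurveLike C.X) (hF : IsVectorBundle n F)

include hg hX hF

set_option maxHeartbeats 800000 in
/-- If the obstruction vanishes, the lift of `F` can be modified in such a way that the local lifts
of `∇` become compatible. -/
theorem IsThickening.hasLift_of_represents_zero (ht : algebraMap A' A t' = t)
    {d : ObstructionData g n nab t'} (h : d.Represents 0) : nab.HasLift g n t' := by
  obtain ⟨c, hc, z, hz, h0⟩ := h
  -- the class of the difference cocycle is the image of a class `y` in `H¹(ℰnd(F)) ⊗ I`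
  obtain ⟨y, rfl⟩ := (rTensor_mkQ_eq_zero_iff _ _).1 h0
  obtain ⟨𝒱, cc, rfl⟩ := PointedCover.exists_tensor_cls y
  obtain ⟨c', hc', hloc⟩ := PointedCover.exists_comparison_cls
    (fun m : KerModule A A' => nab.commutator ≫ tensorRight F m)
    (tensorCommutator (KerModule A A') nab) (fun W θ m => tensorRight_tensorCommutator nab m W θ)
    (H1.tensorCommutator nab) (fun x m => H1.tensorCommutator_tmul nab x m) cc
  rw [d.toH1_eq_cls] at hz
  have hle₁ := d.pointedCover.le_inf_left 𝒱
  have hle₂ := d.pointedCover.le_inf_right 𝒱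
  -- the components of the difference cocycle are `[∇, u] + e η - e z`, for components `u` of `y`
  have hcls : (d.pointedCover.inf 𝒱).cls _ (CechZ1.refine id hle₁ _ (d.pointedCocycle c) -
      CechZ1.refine id hle₂ _ c') = 0 := by
    rw [map_sub, PointedCover.cls_trans, PointedCover.cls_trans, ← hz, ← hc']
    exact sub_self _
  obtain ⟨𝒲, hle, he⟩ := PointedCover.exists_loc_of_cls_eq_zero hcls
  obtain ⟨η, hη⟩ := hg.exists_special hX (IsSmall d.lift) fun x U' hx => hg.exists_isSmall d.lift hx
  obtain ⟨T, hT, hS, hr, hG⟩ := hη 𝒲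
  obtain ⟨e, he⟩ := he _ η hr (hr.trans hle)
  have hr₁ := (hr.trans hle).trans hle₁
  have hr₂ := (hr.trans hle).trans hle₂
  let w : ∀ z : TopCat.of C.X, (endOmegaTensor F (KerModule A A')).obj
    (op ((g.cover T hT).U η ⊓ (g.cover T hT).U z)) := fun z =>
      tensorCommutator (KerModule A A') nab _ (PointedCover.tensorLoc hr₂ cc z)
  have he' : ∀ z : C.X, PointedCover.loc hr₁ (d.pointedCocycle c) z - w z =
      resE (endOmegaTensor F (KerModule A A')) inf_le_left (e η) -
        resE (endOmegaTensor F (KerModule A A')) inf_le_right (e z) := fun z => by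
    refine Eq.trans ?_ (he z)
    rw [map_sub]
    refine congrArg₂ (· - ·) (PointedCover.loc_refine_id _ hle₁ _ z).symm ?_
    exact (hloc _ η hr₂ z).symm.trans (PointedCover.loc_refine_id _ hle₂ c' z).symm
  choose b hb using fun x => (hG x).1
  let V : C.X → C'.X.affineOpens := fun z => ⟨(T η).1 ⊓ (T z).1, hg.inf _ _⟩
  have hV₀ : ∀ z, V z ≤ T η := fun z => show (T η).1 ⊓ (T z).1 ≤ (T η).1 from inf_le_left
  have hV₁ : ∀ z, V z ≤ T z := fun z => show (T η).1 ⊓ (T z).1 ≤ (T z).1 from inf_le_right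
  -- modify the bundle by `u` and the local connections by `e`: both terms cancel
  obtain ⟨L₂, b', hb', hbb', hu⟩ := hg.exists_modification hS hb V (fun _ => rfl) hV₀ hV₁
    fun z => PointedCover.tensorLoc hr₂ cc z
  choose nab₂ hn₂ he₂ using fun x => hg.exists_localLift_homDiff hF ht (hG x).2
    (d.isConnectionLift_localConn hg hr₁ x) (hb x) (hb' x) (hbb' x) (e x)
  refine hg.hasLift_of_local hS hF (L := L₂) (fun x => ⟨⟨_, hb' x⟩, (hG x).2⟩) nab₂ hn₂
    fun z hz => ?_
  obtain ⟨θ, hθ⟩ := hg.exists_sectionRel hF ((nab₂ η).diffSection (nab₂ z)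
    (W := (T η).1 ⊓ (T z).1) inf_le_left inf_le_right) ((hn₂ η).mapOmega_diffSection (hn₂ z) _ _)
  have key := hg.sectionRel_change hF (hV₀ z) (hV₁ z) ((hG η).2.mono (hV₀ z))
    (d.isConnectionLift_localConn hg hr₁ η) (hn₂ η) (hb η) (hb z) (hb' z) (hbb' z) (he₂ η) (he₂ z)
    _ (hu z hz) (d.sectionRel_loc hg hc hr₁ z) hθ
  have hθ0 : θ = 0 := by
    refine key.trans ?_
    have aux : ∀ {G : Type u} [AddCommGroup G] (a b c d : G), a - d = b - c → a - b + c - d = 0 := by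
      intro G _ a b c d h
      rw [sub_eq_iff_eq_add.1 h]
      abel
    exact aux _ _ _ _ (he' z)
  rw [← hθ0]
  exact hθ

end Converse

/-! ### The obstruction theory of a thickening of a curve -/

section ObstructionTheory

variable {A A' : Type u} [CommRing A] [CommRing A'] [Algebra A' A]
  {C : PolarScheme A} {C' : PolarScheme A'} {g : C.Hom C'} {n : ℕ} {F : C.X.Modules}

/-- The obstruction theory of logarithmic connections along a thickening of a curve. -/
theorem IsThickening.exists_obstruction (hg : IsThickening g) (hX : IsCurveLike C.X)
    (hF : IsVectorBundle n F) {t : A} {t' : A'} (ht : algebraMap A' A t' = t)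
    (nab : TConnection t F ⊤) :
    ∃ ob : nab.ObsModule ⊗[A] KerModule A A',
      Nonempty (ObstructionData g n nab t') ∧
      (∀ (d : ObstructionData g n nab t') (ob' : nab.ObsModule ⊗[A] KerModule A A'),
        d.Represents ob' ↔ ob' = ob) ∧
      (ob = 0 ↔ nab.HasLift g n t') ∧ (Subsingleton nab.ObsModule → nab.HasLift g n t') := by
  haveI := hg.affine
  obtain ⟨d₀⟩ := hg.nonempty_obstructionData hX hF nab ht
  obtain ⟨ob, h₀⟩ := hg.exists_represents hX hF d₀
  have hlift : ob = 0 ↔ nab.HasLift g n t' := by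
    refine ⟨fun h => ?_, fun h => ?_⟩
    · subst h
      exact hg.hasLift_of_represents_zero hX hF ht h₀
    · obtain ⟨d, hd⟩ := hg.exists_represents_zero hX h
      exact hg.represents_unique hX hF d₀ d h₀ hd
  refine ⟨ob, ⟨d₀⟩, fun d ob' => ⟨fun h => hg.represents_unique hX hF d d₀ h h₀, ?_⟩, hlift,
    fun hQ => hlift.1 ?_⟩
  · rintro rfl
    obtain ⟨ob'', h⟩ := hg.exists_represents hX hF d
    rwa [← hg.represents_unique hX hF d d₀ h h₀]
  · refine TensorProduct.induction_on (motive := fun x => x = 0) ob rfl (fun x y => ?_)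
      fun x y hx hy => ?_
    · rw [Subsingleton.elim x 0, TensorProduct.zero_tmul]
    · rw [hx, hy, add_zero]

end ObstructionTheory

end LogConn

end

theorem proposition4p2 {B C : Scheme.{u}} [IsNoetherian B] (π : C ⟶ B)
    [SmoothOfRelativeDimension 1 π] [IsProper π] [GeometricallyIntegral π]
    (D : C.IdealSheafData) (hD : LogConn.IsRelativeCartier π D)
    [GeometricallyReduced (D.subschemeι ≫ π)]
    (A' A : Type u) [CommRing A'] [IsLocalRing A'] [IsArtinianRing A']
    [CommRing A] [IsLocalRing A] [IsArtinianRing A] [Algebra A' A]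
    (hsurj : Function.Surjective (algebraMap A' A))
    (hsq : RingHom.ker (algebraMap A' A) ^ 2 = ⊥)
    (b : Spec (.of A') ⟶ B) (t' : A') (n : ℕ)
    (F : (LogConn.baseChange π D
      (Spec.map (CommRingCat.ofHom (algebraMap A' A)) ≫ b)).X.Modules)
    (hF : LogConn.IsVectorBundle n F)
    (nab : LogConn.TConnection (algebraMap A' A t') F ⊤) :
    ∃ ob : nab.ObsModule ⊗[A] LogConn.KerModule A A',
      Nonempty (LogConn.ObstructionData (LogConn.baseChangeHom π D b) n nab t') ∧
      (∀ (d : LogConn.ObstructionData (LogConn.baseChangeHom π D b) n nab t')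
        (ob' : nab.ObsModule ⊗[A] LogConn.KerModule A A'), d.Represents ob' ↔ ob' = ob) ∧
      (ob = 0 ↔ nab.HasLift (LogConn.baseChangeHom π D b) n t') ∧
      (Subsingleton nab.ObsModule → nab.HasLift (LogConn.baseChangeHom π D b) n t') := by
  have : Smooth π := SmoothOfRelativeDimension.smooth 1 π
  exact (LogConn.isThickening_baseChangeHom π D b hsurj hsq hD).exists_obstruction
    (LogConn.isCurveLike_baseChange π D _) hF rfl nab
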